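/- Let $K$ be a number field of degree $d$ with discriminant $\Delta_K$ and ring of integers $\mathcal{O}_K$. Let $\mathcal{O}_K$ be given by the multiplication table of an integral basis $\omega_1=1,\omega_2,\dots,\omega_d$ that is LLL-reduced (with factor $3/4$) for the form $T_2(x,y)=\sum_{\sigma:K\to\mathbb{C}}\sigma(x)\overline{\sigma(y)}$. A non-zero fractional ideal $\mathfrak{a}$ of $K$ is represented by its denominator $k$, the minimal positive integer with $k\mathfrak{a}\subseteq\mathcal{O}_K$, together with the matrix in Hermite normal form whose rows are the coordinates with respect to $\omega_1,\dots,\omega_d$ of a $\mathbb{Z}$-basis of $k\mathfrak{a}$. Its size is $S(\mathfrak{a})=\log_2 k+d^2\log_2\mathcal{N}(k\mathfrak{a})$. Running times are bit costs, where for integers of at most $h$ bits an addition or subtraction costs $h$, a multiplication or division costs $\mathcal{M}(h)=O(h\log h\log\log h)$, and the Euclidean algorithm (the gcd and its Bézout coefficients) costs $O(\mathcal{M}(h)\log h)$. Let $\omega\in[2,3]$ be the exponent of the complexity of matrix multiplication, and write $\tilde{O}(X)$ for a bound $C\,X\,\log(2+X)^{c}$ with absolute constants $C$ and $c$. Let $\mathfrak{a}$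 and $\mathfrak{b}$ be non-zero fractional ideals of $K$ and let $B$ be a real number such that $S(\mathfrak{a}),S(\mathfrak{b})\le B$. There are algorithms, the same for all number fields, that compute from the representations of $\mathfrak{a}$ and $\mathfrak{b}$: 1. the representation of $\mathfrak{a}+\mathfrak{b}$ in time $\tilde{O}(d^{\omega+1}B)$, provided that $B\ge 1$; 2. the representation of $\mathfrak{a}\mathfrak{b}$ in time $\tilde{O}\left(d^3\left(d^4+d^2\log|\Delta_K|+B\right)\right)$; 3. the representation of $\mathfrak{a}^{-1}$ in time $\tilde{O}\left(d^{2\omega}\left(d^4+d^2\log|\Delta_K|+B\right)\right)$. -/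

import Mathlib

open NumberField nonZeroDivisors

universe u

noncomputable section

/-! ### The exponent of matrix multiplication -/

/-- One arithmetic operation of a straight-line program over `ℚ`; operands are positions in the
list of the values known so far. -/
inductive ArithOp
  | const (q : ℚ)
  | add (i j : ℕ)
  | sub (i j : ℕ)
  | mul (i j : ℕ)

/-- The value of an operation, given the list `v` of the values known so far. -/
def ArithOp.eval (v : List ℚ) : ArithOp → ℚ
  | .const q => q
  | .add i j => v.getD i 0 + v.getD j 0
  | .sub i j => v.getD i 0 - v.getD j 0
  | .mul i j => v.getD i 0 * v.getD j 0

/-- Run a straight-line program: each operation appends its value to the list. -/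
def runStraightLine (P : List ArithOp) (v : List ℚ) : List ℚ :=
  P.foldl (fun w I => w ++ [I.eval w]) v

/-- The entries of a matrix, row by row. -/
def matrixEntries {R : Type*} {m n : ℕ} (A : Matrix (Fin m) (Fin n) R) : List R :=
  (List.finRange m).flatMap fun i => (List.finRange n).map fun j => A i j

/-- The straight-line program `P` multiplies `n × n` matrices: the value at the position `pos i j`
is the `(i, j)` entry of the product. -/
def MultipliesMatrices (n : ℕ) (P : List ArithOp) : Prop :=
  ∃ pos : Fin n → Fin n → ℕ, ∀ (A A' : Matrix (Fin n) (Fin n) ℚ) (i j : Fin n),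
    (runStraightLine P (matrixEntries A ++ matrixEntries A')).getD (pos i j) 0 = (A * A') i j

/-- The exponent of the complexity of matrix multiplication: the infimum of the real numbers `τ`
such that `n × n` matrices can be multiplied with `O(n ^ τ)` arithmetic operations. -/
def matMulExponent : ℝ :=
  sInf {τ : ℝ | ∃ C : ℝ, ∀ n : ℕ, 1 ≤ n →
    ∃ P : List ArithOp, MultipliesMatrices n P ∧ (P.length : ℝ) ≤ C * (n : ℝ) ^ τ}

/-! ### Integer random access machines with bit costs -/

namespace RAM

/-- The instructions. Registers hold integers and are numbered by natural numbers; `r, s, t` are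
numbers of registers. The input is a read-only list with random access, the output a list that is
written from left to right. -/
inductive Instr
  /-- `M[r] := z` -/
  | const (r : ℕ) (z : ℤ)
  /-- `M[r] := M[s] + M[t]` -/
  | add (r s t : ℕ)
  /-- `M[r] := M[s] - M[t]` -/
  | sub (r s t : ℕ)
  /-- `M[r] := M[s] * M[t]` -/
  | mul (r s t : ℕ)
  /-- `M[r] :=` the quotient of the division of `M[s]` by `M[t]` with remainder -/
  | div (r s t : ℕ)
  /-- `M[r] :=` the remainder of that division -/
  | mod (r s t : ℕ)
  /-- `M[r] := gcd (M[s], M[t])` -/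
  | gcd (r s t : ℕ)
  /-- `M[r] :=` the coefficient of `M[s]` in the Bézout relation of the Euclidean algorithm -/
  | bezoutLeft (r s t : ℕ)
  /-- `M[r] :=` the coefficient of `M[t]` in that relation -/
  | bezoutRight (r s t : ℕ)
  /-- `M[r] := M[M[s]]` -/
  | load (r s : ℕ)
  /-- `M[M[r]] := M[s]` -/
  | store (r s : ℕ)
  /-- `M[r] :=` the entry of the input at the position `M[s]` (from 0; `0` beyond its end) -/
  | read (r s : ℕ)
  /-- append `M[r]` to the output -/
  | write (r : ℕ)
  /-- go to the instruction number `l` if `M[r] ≤ 0`, else continue -/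
  | jump (r l : ℕ)

/-- A program is a finite list of instructions; it stops when it leaves the list. -/
abbrev Program := List Instr

/-- The bit size of an integer, sign included. -/
def bits (x : ℤ) : ℕ := x.natAbs.size + 1

/-- The larger one of the bit sizes of two integers. -/
def bits₂ (x y : ℤ) : ℕ := max (bits x) (bits y)

/-- `⌊log₂ h⌋ + 1` -/
def lg (h : ℕ) : ℕ := Nat.log 2 h + 1

/-- The bit cost `h log h log log h` of a multiplication of integers of bit size `h`. -/
def mulCost (h : ℕ) : ℕ := h * lg h * lg (lg h)

/-- The state of a machine: program counter, registers, output so far, cost so far. -/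
structure Config where
  pc : ℕ
  mem : ℕ → ℤ
  out : List ℤ
  time : ℕ

/-- At the start all registers are `0`. -/
def start : Config := ⟨0, fun _ => 0, [], 0⟩

/-- Put `z` into the register `r`, charge `cost`, go on with the next instruction. -/
def Config.assign (c : Config) (r : ℕ) (z : ℤ) (cost : ℕ) : Config :=
  ⟨c.pc + 1, Function.update c.mem r z, c.out, c.time + cost⟩

/-- The effect and the bit cost of an instruction. On operands of bit size at most `h`, additions
and subtractions cost `h`, multiplications and divisions `mulCost h`, and the Euclidean algorithm
`lg h * mulCost h`; moving a value costs its bit size and that of its address. -/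
def Instr.exec (inp : List ℤ) (c : Config) : Instr → Config
  | .const r z => c.assign r z (bits z)
  | .add r s t => c.assign r (c.mem s + c.mem t) (bits₂ (c.mem s) (c.mem t))
  | .sub r s t => c.assign r (c.mem s - c.mem t) (bits₂ (c.mem s) (c.mem t))
  | .mul r s t => c.assign r (c.mem s * c.mem t) (mulCost (bits₂ (c.mem s) (c.mem t)))
  | .div r s t => c.assign r (c.mem s / c.mem t) (mulCost (bits₂ (c.mem s) (c.mem t)))
  | .mod r s t => c.assign r (c.mem s % c.mem t) (mulCost (bits₂ (c.mem s) (c.mem t)))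
  | .gcd r s t => c.assign r (Int.gcd (c.mem s) (c.mem t))
      (lg (bits₂ (c.mem s) (c.mem t)) * mulCost (bits₂ (c.mem s) (c.mem t)))
  | .bezoutLeft r s t => c.assign r (Int.gcdA (c.mem s) (c.mem t))
      (lg (bits₂ (c.mem s) (c.mem t)) * mulCost (bits₂ (c.mem s) (c.mem t)))
  | .bezoutRight r s t => c.assign r (Int.gcdB (c.mem s) (c.mem t))
      (lg (bits₂ (c.mem s) (c.mem t)) * mulCost (bits₂ (c.mem s) (c.mem t)))
  | .load r s => c.assign r (c.mem (c.mem s).toNat)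
      (bits (c.mem s) + bits (c.mem (c.mem s).toNat))
  | .store r s => c.assign (c.mem r).toNat (c.mem s) (bits (c.mem r) + bits (c.mem s))
  | .read r s => c.assign r (inp.getD (c.mem s).toNat 0)
      (bits (c.mem s) + bits (inp.getD (c.mem s).toNat 0))
  | .write r => ⟨c.pc + 1, c.mem, c.out ++ [c.mem r], c.time + bits (c.mem r)⟩
  | .jump r l => ⟨if c.mem r ≤ 0 then l else c.pc + 1, c.mem, c.out, c.time + bits (c.mem r)⟩

/-- One step of a program; nothing happens any more once the program has stopped. -/
def step (P : Program) (inp : List ℤ) (c : Config) : Config :=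
  match P[c.pc]? with
  | none => c
  | some I => I.exec inp c

/-- On the input `inp`, the program stops with the output `out`, at a total bit cost of at
most `T`. -/
def ComputesWithin (P : Program) (inp out : List ℤ) (T : ℝ) : Prop :=
  ∃ n : ℕ, P[((step P inp)^[n] start).pc]? = none ∧ ((step P inp)^[n] start).out = out ∧
    (((step P inp)^[n] start).time : ℝ) ≤ T

end RAM

/-- The function `X (log X) ^ c` (with `2 + X` in the logarithm, so that this is also meaningful for
small `X`). A quantity is `Õ(X)` if it is at most `C * softO c X` for constants `C` and `c`. -/
def softO (c : ℕ) (X : ℝ) : ℝ := X * Real.logb 2 (2 + X) ^ c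

/-! ### Integral bases and fractional ideals -/

section Ideals

variable {K : Type*} [Field K] [NumberField K]

/-- The image of `x` under all complex embeddings. The Euclidean norm of this vector is the
`T₂`-norm of `x`. -/
def embVec (x : K) : EuclideanSpace ℂ (K →+* ℂ) := WithLp.toLp 2 fun σ => σ x

/-- The Gram-Schmidt vectors of an integral basis, for the form `T₂`. -/
def basisGS {d : ℕ} (ω : Module.Basis (Fin d) ℤ (𝓞 K)) : Fin d → EuclideanSpace ℂ (K →+* ℂ) :=
  InnerProductSpace.gramSchmidt ℂ fun i => embVec (ω i : K)

/-- The Gram-Schmidt coefficients `μ i j`. They are real numbers, since `T₂` is real on `K`. -/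
def basisMu {d : ℕ} (ω : Module.Basis (Fin d) ℤ (𝓞 K)) (i j : Fin d) : ℂ :=
  inner ℂ (basisGS ω j) (embVec (ω i : K)) / (‖basisGS ω j‖ ^ 2 : ℝ)

/-- The integral basis is LLL-reduced for the form `T₂`: it is size-reduced and satisfies the
Lovász conditions with the factor `3 / 4`. -/
def IsLLLReduced {d : ℕ} (ω : Module.Basis (Fin d) ℤ (𝓞 K)) : Prop :=
  (∀ i j : Fin d, j < i → ‖basisMu ω i j‖ ≤ 1 / 2) ∧
  ∀ i j : Fin d, (j : ℕ) + 1 = i →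
    3 / 4 * ‖basisGS ω j‖ ^ 2 ≤ ‖basisGS ω i + basisMu ω i j • basisGS ω j‖ ^ 2

/-- The positive integers `k` such that `k 𝔞` is integral. -/
def denominators (𝔞 : FractionalIdeal (𝓞 K)⁰ K) : Set ℕ :=
  {k | 0 < k ∧ ∀ x ∈ 𝔞, ∃ y : 𝓞 K, (k : K) * x = (y : K)}

/-- The denominator of a fractional ideal: the minimal positive integer `k` such that `k 𝔞` is
integral. -/
def idealDen (𝔞 : FractionalIdeal (𝓞 K)⁰ K) : ℕ := sInf (denominators 𝔞)

/-- The integral ideal `k 𝔞`, where `k` is the denominator of `𝔞`. -/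
def idealNum (𝔞 : FractionalIdeal (𝓞 K)⁰ K) : Ideal (𝓞 K) :=
  ((FractionalIdeal.spanSingleton (𝓞 K)⁰ (idealDen 𝔞 : K) * 𝔞 :
    FractionalIdeal (𝓞 K)⁰ K) : Submodule (𝓞 K) K).comap (Algebra.linearMap (𝓞 K) K)

/-- The size `log₂ k + d² log₂ (N (k 𝔞))` of a fractional ideal with denominator `k`. -/
def idealSize (𝔞 : FractionalIdeal (𝓞 K)⁰ K) : ℝ :=
  Real.logb 2 (idealDen 𝔞) +
    (Module.finrank ℚ K : ℝ) ^ 2 * Real.logb 2 (Ideal.absNorm (idealNum 𝔞))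

/-- Hermite normal form of a nonsingular integral matrix, for lattices generated by rows: lower
triangular, with positive diagonal, and the entries below a diagonal entry are reduced modulo it. -/
def IsHNF {d : ℕ} (M : Matrix (Fin d) (Fin d) ℤ) : Prop :=
  (∀ i j, i < j → M i j = 0) ∧ (∀ i, 0 < M i i) ∧ ∀ i j, j < i → 0 ≤ M i j ∧ M i j < M j j

/-- `(k, M)` is the HNF representation of `𝔞` with respect to the integral basis `ω`: `k` is the
denominator of `𝔞`, the matrix `M` is in Hermite normal form, and its rows are the coordinates with
respect to `ω` of a `ℤ`-basis of `k 𝔞`. -/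
def IsHNFRep {d : ℕ} (ω : Module.Basis (Fin d) ℤ (𝓞 K)) (𝔞 : FractionalIdeal (𝓞 K)⁰ K)
    (k : ℕ) (M : Matrix (Fin d) (Fin d) ℤ) : Prop :=
  IsLeast (denominators 𝔞) k ∧ IsHNF M ∧
    (𝔞 : Submodule (𝓞 K) K).restrictScalars ℤ =
      Submodule.span ℤ (Set.range fun i => (k : K)⁻¹ * ∑ j, (M i j : K) * (ω j : K))

/-- The data by which the field is given: the degree and the multiplication table of the basis,
that is the coordinates of the products `ω i * ω j`. -/
def encodeField {d : ℕ} (ω : Module.Basis (Fin d) ℤ (𝓞 K)) : List ℤ :=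
  (d : ℤ) :: (List.finRange d).flatMap fun i => (List.finRange d).flatMap fun j =>
    (List.finRange d).map fun l => ω.repr (ω i * ω j) l

/-- The list of integers that represents the pair `(k, M)`. -/
def encodeIdeal {d : ℕ} (k : ℕ) (M : Matrix (Fin d) (Fin d) ℤ) : List ℤ :=
  (k : ℤ) :: matrixEntries M

end Ideals

end

/-! ### The exponent of matrix multiplication is at least two -/

section MatrixMultiplication

/-! Schoolbook arithmetic is enough. The only fact needed about the exponent of matrix
multiplication is `two_le_matMulExponent`: it gives `d ^ 3 ≤ d ^ (matMulExponent + 1)` and `d ^ 4 ≤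
d ^ (2 * matMulExponent)`, and classical elimination stays within these powers.

The common core is a Hermite normal form modulo an integer. If a lattice in `w` coordinates contains
all multiples of `g`, every entry may be reduced modulo `g` during the elimination. So `n`
generators are brought to normal form with `O((n + w) * w ^ 2)` operations on integers of `O(log g)`
bits (`spec_normalize`). For an ideal represented by `(k, M)`, the determinant of `M` is the norm of
`k 𝔞` (`IsHNFRep.absNorm_eq`), and its multiples of the basis lie in `k 𝔞` (`det_mul_mem`), so it
yields the moduli. The weight `d ^ 2` in the size leaves it at most `B / d ^ 2` bits
(`IsHNFRep.logb_det_le`). The denominators may have `B` bits, but they take part in only `O(d ^ 2)`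
operations. The cost estimates keep these two sizes of numbers apart throughout.

Sum: the rows of both matrices, scaled to a common denominator, are `2 d` generators, and `O(d ^ 3)`
operations suffice. Product: the `d ^ 2` products of rows are generators modulo the product of the
determinants. Computing their coordinates takes `O(d ^ 5)` operations, which dominates. Inverse:
with `a = det M`, an element of `𝔞⁻¹` has the form `(k / a) x` with `x` integral, and the condition
on `x` is that `x` times each row of `M` vanishes modulo `a`. This kernel is read off from a normal
form: the generators are the identity matrix followed by `d ^ 2` columns with the coordinates of the
products, and the lattice vectors that vanish in the additional columns are the solutions. There are
`d + d ^ 2` columns, hence `O(d ^ 6)` operations.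

Products and inverses also need a short multiplication table. For a reduced basis starting with `1`,
the Gram-Schmidt lengths are bounded from below by the Lovász condition and from above because the
product of their squares is the absolute discriminant. Size reduction then bounds vectors by lengths
and coordinates by vectors, which gives table entries of `O(d ^ 2 + log |Δ|)` bits
(`IsLLLReduced.abs_repr_mul_le_two_rpow`).

The programs are written in a small language with variables, four arrays and counted loops, and are
verified by a logic that tracks result and cost together. `Cmd.sim` transfers both to the random
access machine. Bounding every number in a phase by `Z` makes its cost the number of operations
times `unitCost Z`, which is quasilinear in the bit size of `Z`. -/

theorem runStraightLine_append (P Q : List ArithOp) (v : List ℚ) :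
    runStraightLine (P ++ Q) v = runStraightLine Q (runStraightLine P v) :=
  List.foldl_append

theorem runStraightLine_length (P : List ArithOp) (v : List ℚ) :
    (runStraightLine P v).length = v.length + P.length := by
  induction P generalizing v with
  | nil => rfl
  | cons I P ih =>
    change (runStraightLine P (v ++ [I.eval v])).length = _
    rw [ih]; simp; omega

theorem runStraightLine_getD_of_lt (P : List ArithOp) (v : List ℚ) {i : ℕ} (hi : i < v.length) :
    (runStraightLine P v).getD i 0 = v.getD i 0 := by
  induction P generalizing v with
  | nil => rfl
  | cons I P ih =>
    change (runStraightLine P (v ++ [I.eval v])).getD i 0 = _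
    rw [ih _ (by simp; omega), List.getD_append _ _ _ _ hi]

theorem matrixEntries_length {R : Type*} {m n : ℕ} (A : Matrix (Fin m) (Fin n) R) :
    (matrixEntries A).length = m * n := by
  simp [matrixEntries]

/-- The trailing list `l` makes this usable for a block that is followed by further data, as in the
inputs of the programs. -/
theorem flatMap_finRange_getD {R : Type*} (m n : ℕ) (f : Fin m → List R)
    (hf : ∀ i, (f i).length = n) (z : R) (i : Fin m) {j : ℕ} (hj : j < n) (l : List R) :
    ((List.finRange m).flatMap f ++ l).getD (i * n + j) z = (f i).getD j z := by
  induction m with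
  | zero => exact i.elim0
  | succ m ih =>
    rw [List.finRange_succ, List.flatMap_cons, List.append_assoc, List.flatMap_map]
    refine Fin.cases ?_ (fun i => ?_) i
    · simp only [Fin.val_zero, zero_mul, zero_add]
      rw [List.getD_append _ _ _ _ (by rw [hf]; exact hj)]
    · rw [List.getD_append_right _ _ _ _ (by rw [hf, Fin.val_succ]; nlinarith), hf]
      have := ih (fun i => f i.succ) (fun i => hf _) i
      rw [← this]
      congr 1
      rw [Fin.val_succ]
      have : ((i : ℕ) + 1) * n = i * n + n := by ring
      omega

theorem matrixEntries_getD {R : Type*} {m n : ℕ} (A : Matrix (Fin m) (Fin n) R) (z : R)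
    (i : Fin m) (j : Fin n) (l : List R) :
    (matrixEntries A ++ l).getD (i * n + j) z = A i j := by
  rw [matrixEntries, flatMap_finRange_getD m n _ (by simp) z i j.2]
  simp [List.getD_eq_getElem?_getD]

/-- The entries of the matrix product are the results of distinct operations. -/
theorem MultipliesMatrices.sq_le_length {n : ℕ} {P : List ArithOp}
    (h : MultipliesMatrices n P) : n ^ 2 ≤ P.length := by
  obtain ⟨pos, h⟩ := h
  rcases Nat.eq_zero_or_pos n with rfl | hn
  · simp
  let J : ℚ → Matrix (Fin n) (Fin n) ℚ := fun c => Matrix.of fun _ _ => c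
  have hJ : ∀ c i j, (J c * J c) i j = n * c ^ 2 := fun c i j => by
    simp [J, Matrix.mul_apply, sq]
  -- A position among the inputs cannot serve. If all inputs equal `c`, the value there is `c`, but
  -- the product has the entry `n * c ^ 2`. The cases `c = 1` and `c = 2` contradict each other.
  have hlow : ∀ i j, n * n + n * n ≤ pos i j := by
    intro i j
    by_contra hlt
    have hval : ∀ c, (runStraightLine P (matrixEntries (J c) ++ matrixEntries (J c))).getD
        (pos i j) 0 = c := by
      intro c
      have hlen : pos i j < (matrixEntries (J c) ++ matrixEntries (J c)).length := by
        rw [List.length_append, matrixEntries_length]; omega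
      rw [runStraightLine_getD_of_lt _ _ hlen, List.getD_eq_getElem _ _ hlen]
      have : ∀ x ∈ matrixEntries (J c) ++ matrixEntries (J c), x = c := by
        simp [matrixEntries, J]
      exact this _ (List.getElem_mem _)
    have h1 := (hval 1).symm.trans (h (J 1) (J 1) i j)
    have h2 := (hval 2).symm.trans (h (J 2) (J 2) i j)
    rw [hJ] at h1 h2
    linarith
  -- Beyond the end of the list the default value is `0`, whereas the all-ones matrices have a
  -- product with the entries `n > 0`.
  have hhigh : ∀ i j, pos i j < n * n + n * n + P.length := by
    intro i j
    by_contra hlt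
    have h1 := h (J 1) (J 1) i j
    rw [hJ, List.getD_eq_default _ _ (by
      rw [runStraightLine_length, List.length_append, matrixEntries_length]; omega)] at h1
    have : (0 : ℚ) < n := by exact_mod_cast hn
    linarith
  -- A matrix unit times the identity has different entries at `(i, j)` and at any other place, so
  -- two entries cannot share a position.
  have hinj : Function.Injective fun p : Fin n × Fin n => pos p.1 p.2 := by
    rintro ⟨i, j⟩ ⟨i', j'⟩ hp
    have h1 := h (Matrix.of fun a b => if a = i ∧ b = j then 1 else 0) 1 i j
    have h2 := h (Matrix.of fun a b => if a = i ∧ b = j then 1 else 0) 1 i' j'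
    simp only at hp
    rw [← hp, h1] at h2
    simp only [mul_one, Matrix.of_apply, and_self, if_true] at h2
    by_contra hne
    rw [if_neg (by rintro ⟨rfl, rfl⟩; exact hne rfl)] at h2
    exact one_ne_zero h2
  have := Finset.card_le_card_of_injOn (s := (Finset.univ : Finset (Fin n × Fin n)))
    (t := Finset.Ico (n * n + n * n) (n * n + n * n + P.length)) (fun p => pos p.1 p.2)
    (fun p _ => Finset.mem_coe.2 (Finset.mem_Ico.2 ⟨hlow _ _, hhigh _ _⟩)) hinj.injOn
  simp only [Finset.card_univ, Fintype.card_prod, Fintype.card_fin, Nat.card_Ico] at this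
  rw [sq]; omega

/-- A straight-line program for a sum of products of inputs. -/
theorem exists_straightLine_sum (a b : ℕ → ℕ) (n m : ℕ) :
    ∃ P : List ArithOp, P.length = 2 * n + 1 ∧ ∀ v : List ℚ, v.length = m →
      (∀ t < n, a t < m) → (∀ t < n, b t < m) →
      (runStraightLine P v).getD (m + 2 * n) 0 =
        ∑ t ∈ Finset.range n, v.getD (a t) 0 * v.getD (b t) 0 := by
  induction n with
  | zero =>
    refine ⟨[.const 0], rfl, fun v hv _ _ => ?_⟩
    subst hv
    simp [runStraightLine, ArithOp.eval]
  | succ n ih =>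
    obtain ⟨P, hP, h⟩ := ih
    refine ⟨P ++ [.mul (a n) (b n), .add (m + 2 * n) (m + 2 * n + 1)], by simp [hP]; omega,
      fun v hv ha hb => ?_⟩
    have hlen : (runStraightLine P v).length = m + 2 * n + 1 := by
      rw [runStraightLine_length, hv, hP]; omega
    rw [runStraightLine_append, Finset.sum_range_succ, ← h v hv (fun t ht => ha t (by omega))
      (fun t ht => hb t (by omega)),
      ← runStraightLine_getD_of_lt P v (i := a n) (by have := ha n (by omega); omega),
      ← runStraightLine_getD_of_lt P v (i := b n) (by have := hb n (by omega); omega)]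
    generalize runStraightLine P v = w at *
    simp only [runStraightLine, List.foldl_cons, List.foldl_nil, ArithOp.eval]
    rw [List.getD_append_right _ _ _ _ (by simp; omega)]
    rw [List.getD_append _ _ _ _ (by omega), List.getD_append_right _ _ _ (m + 2 * n + 1) (by omega)]
    simp [hlen, show m + 2 * (n + 1) - (m + 2 * n + 1 + 1) = 0 by omega]

/-- The schoolbook method. It is needed because the infimum of an empty set of reals is `0`, so some
admissible exponent has to be exhibited before a lower bound makes sense. -/
theorem exists_multipliesMatrices (n : ℕ) :
    ∃ P : List ArithOp, MultipliesMatrices n P ∧ P.length = n ^ 2 * (2 * n + 1) := by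
  have key : ∀ L : List (Fin n × Fin n), ∃ P : List ArithOp, P.length = L.length * (2 * n + 1) ∧
      ∃ pos : Fin n × Fin n → ℕ, ∀ p ∈ L, pos p < 2 * (n * n) + P.length ∧
        ∀ A A' : Matrix (Fin n) (Fin n) ℚ,
        (runStraightLine P (matrixEntries A ++ matrixEntries A')).getD (pos p) 0 =
          (A * A') p.1 p.2 := by
    intro L
    induction L with
    | nil => exact ⟨[], by simp, fun _ => 0, by simp⟩
    | cons p L ih =>
      obtain ⟨P, hP, pos, h⟩ := ih
      obtain ⟨Q, hQ, hq⟩ := exists_straightLine_sum (fun t => p.1 * n + t)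
        (fun t => n * n + (t * n + p.2)) n (2 * (n * n) + P.length)
      refine ⟨P ++ Q, by simp [hP, hQ]; ring,
        Function.update pos p (2 * (n * n) + P.length + 2 * n), fun q hmem => ?_⟩
      have hlen : ∀ A A' : Matrix (Fin n) (Fin n) ℚ, (runStraightLine P (matrixEntries A ++
          matrixEntries A')).length = 2 * (n * n) + P.length := fun A A' => by
        rw [runStraightLine_length, List.length_append, matrixEntries_length,
          matrixEntries_length]; ring
      by_cases hqp : q = p
      · subst hqp
        rw [Function.update_self]
        refine ⟨by simp [hQ]; omega, fun A A' => ?_⟩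
        have hb1 : ∀ t < n, q.1 * n + t < n * n := fun t ht => by
          have := q.1.2; nlinarith
        have hb2 : ∀ t < n, t * n + (q.2 : ℕ) < n * n := fun t ht => by
          have := q.2.2; nlinarith
        rw [runStraightLine_append, hq _ (hlen A A')
          (fun t ht => by have := hb1 t ht; omega) (fun t ht => by have := hb2 t ht; omega),
          Matrix.mul_apply, Finset.sum_range]
        refine Finset.sum_congr rfl fun t _ => ?_
        rw [runStraightLine_getD_of_lt _ _ (by
            have := hb1 t t.2
            rw [List.length_append, matrixEntries_length, matrixEntries_length]; omega),
          runStraightLine_getD_of_lt _ _ (by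
            have := hb2 t t.2
            rw [List.length_append, matrixEntries_length, matrixEntries_length]; omega),
          matrixEntries_getD, List.getD_append_right _ _ _ _ (by
            rw [matrixEntries_length]; omega), matrixEntries_length, Nat.add_sub_cancel_left]
        have := matrixEntries_getD A' 0 t q.2 []
        rw [List.append_nil] at this
        rw [this]
      · rw [Function.update_of_ne hqp]
        have hL : q ∈ L := (List.mem_cons.1 hmem).resolve_left hqp
        refine ⟨by have := (h q hL).1; simp; omega, fun A A' => ?_⟩
        rw [runStraightLine_append, runStraightLine_getD_of_lt _ _ (by
          rw [hlen]; exact (h q hL).1), (h q hL).2]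
  obtain ⟨P, hP, pos, h⟩ := key (Finset.univ : Finset (Fin n × Fin n)).toList
  refine ⟨P, ⟨fun i j => pos (i, j), fun A A' i j => (h (i, j) (by simp)).2 A A'⟩, ?_⟩
  rw [hP, Finset.length_toList, Finset.card_univ, Fintype.card_prod, Fintype.card_fin, sq]

/-- Each of the `n ^ 2` entries of a product needs an operation of its own, so no exponent below `2`
is admissible. The schoolbook exponent `3` shows that the set of exponents is nonempty. -/
theorem two_le_matMulExponent : 2 ≤ matMulExponent := by
  unfold matMulExponent
  refine le_csInf ⟨3, 3, fun n hn => ?_⟩ ?_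
  · obtain ⟨P, hP, hl⟩ := exists_multipliesMatrices n
    refine ⟨P, hP, ?_⟩
    have h1 : (1 : ℝ) ≤ n := by exact_mod_cast hn
    have h3 : (n : ℝ) ^ (3 : ℝ) = (n : ℝ) ^ 3 := by exact_mod_cast Real.rpow_natCast (n : ℝ) 3
    rw [hl, h3]
    push_cast
    nlinarith [pow_pos (by linarith : (0 : ℝ) < n) 2]
  · rintro τ ⟨C, hC⟩
    by_contra! hτ
    -- If `τ < 2`, then `n ^ (2 - τ)` exceeds any constant `C`, against `n ^ 2 ≤ C * n ^ τ`.
    have hlim := tendsto_rpow_atTop (show 0 < 2 - τ by linarith)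
    have := (hlim.comp tendsto_natCast_atTop_atTop).eventually_gt_atTop C
    obtain ⟨n, hn1, hn⟩ := (this.and (Filter.eventually_ge_atTop 1)).exists
    obtain ⟨P, hP, hl⟩ := hC n hn
    have hn0 : (0 : ℝ) < n := by exact_mod_cast hn
    have h1 : ((n : ℝ)) ^ 2 ≤ C * (n : ℝ) ^ τ :=
      le_trans (by exact_mod_cast hP.sq_le_length) hl
    have h2 : (n : ℝ) ^ 2 = (n : ℝ) ^ (2 - τ) * (n : ℝ) ^ τ := by
      rw [← Real.rpow_add hn0, sub_add_cancel]
      exact_mod_cast (Real.rpow_natCast (n : ℝ) 2).symm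
    rw [h2] at h1
    have h3 := le_of_mul_le_mul_right h1 (Real.rpow_pos_of_pos hn0 τ)
    exact absurd hn1 (not_lt.2 h3)

end MatrixMultiplication

/-! ### Reduced integral bases have small multiplication tables -/

section GramSchmidt

open InnerProductSpace

variable {E : Type*} [NormedAddCommGroup E] [InnerProductSpace ℂ E] {d : ℕ}

theorem inner_gramSchmidt_self (v : Fin d → E) (i : Fin d) :
    inner ℂ (gramSchmidt ℂ v i) (v i) = (‖gramSchmidt ℂ v i‖ ^ 2 : ℂ) := by
  conv_lhs => rw [gramSchmidt_def'' ℂ v i]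
  rw [inner_add_right, inner_self_eq_norm_sq_to_K, inner_sum, Finset.sum_eq_zero, add_zero]
  · rfl
  · intro j hj
    rw [inner_smul_right, gramSchmidt_orthogonal ℂ v (Finset.mem_Iio.1 hj).ne', mul_zero]

/-- A family of `d` vectors in dimension `d` spans a parallelepiped with the volume
`∏ ‖gramSchmidt v i‖`. -/
theorem norm_det_eq_prod_gramSchmidt [FiniteDimensional ℂ E] (e : OrthonormalBasis (Fin d) ℂ E)
    (v : Fin d → E) : ‖e.toBasis.det v‖ = ∏ i, ‖gramSchmidt ℂ v i‖ := by
  have h : Module.finrank ℂ E = Fintype.card (Fin d) := Module.finrank_eq_card_basis e.toBasis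
  have h1 := (e.toBasis.det).eq_smul_basis_det (gramSchmidtOrthonormalBasis h v).toBasis
  rw [h1, AlternatingMap.smul_apply, norm_smul, OrthonormalBasis.coe_toBasis,
    e.det_to_matrix_orthonormalBasis, one_mul, gramSchmidtOrthonormalBasis_det, norm_prod]
  refine Finset.prod_congr rfl fun i _ => ?_
  by_cases h0 : gramSchmidt ℂ v i = 0
  · rw [inner_gramSchmidtOrthonormalBasis_eq_zero h (by simp [gramSchmidtNormed, h0]), h0]
    simp
  · have h2 : (‖gramSchmidt ℂ v i‖ : ℂ) ≠ 0 := by simpa using h0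
    rw [gramSchmidtOrthonormalBasis_apply h (by simpa [gramSchmidtNormed] using h0),
      gramSchmidtNormed, inner_smul_left, inner_gramSchmidt_self]
    simp only [norm_mul, map_inv₀, norm_inv, norm_pow, RCLike.norm_conj]
    simp
    field_simp

theorem norm_gramSchmidt_add_smul_sq (v : Fin d → E) {i j : Fin d} (hij : i ≠ j) (c : ℂ) :
    ‖gramSchmidt ℂ v i + c • gramSchmidt ℂ v j‖ ^ 2 =
      ‖gramSchmidt ℂ v i‖ ^ 2 + ‖c‖ ^ 2 * ‖gramSchmidt ℂ v j‖ ^ 2 := by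
  have h3 : inner ℂ (gramSchmidt ℂ v i) (c • gramSchmidt ℂ v j) = 0 := by
    rw [inner_smul_right, gramSchmidt_orthogonal ℂ _ hij, mul_zero]
  have h4 := norm_add_sq_eq_norm_sq_add_norm_sq_of_inner_eq_zero _ _ h3
  rwa [← sq, ← sq, ← sq, norm_smul, mul_pow] at h4

/-- A vector is not much longer than the longest Gram-Schmidt vector, if it is size-reduced. -/
theorem norm_le_of_gramSchmidt (v : Fin d → E) {R : ℝ} (hR : ∀ j, ‖gramSchmidt ℂ v j‖ ≤ R)
    (i : Fin d) (hμ : ∀ j < i,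
      ‖inner ℂ (gramSchmidt ℂ v j) (v i) / (‖gramSchmidt ℂ v j‖ ^ 2 : ℝ)‖ ≤ 1 / 2) :
    ‖v i‖ ≤ d * R := by
  have hR0 : 0 ≤ R := (norm_nonneg _).trans (hR i)
  rw [gramSchmidt_def'' ℂ v i]
  refine (norm_add_le _ _).trans ((add_le_add (hR i) (norm_sum_le_of_le _ fun j hj => ?_)).trans
    (b := R + ∑ j ∈ Finset.Iio i, R) ?_)
  · rw [norm_smul]
    have h1 := hμ j (Finset.mem_Iio.1 hj)
    rw [Complex.ofReal_pow] at h1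
    calc _ ≤ 1 / 2 * R := mul_le_mul h1 (hR j) (norm_nonneg _) (by norm_num)
      _ ≤ R := by linarith
  · rw [Finset.sum_const, Fin.card_Iio, nsmul_eq_mul]
    have : ((i : ℕ) : ℝ) + 1 ≤ d := by exact_mod_cast i.2
    nlinarith

/-- Take the inner product of the combination with the `l`-th Gram-Schmidt vector. The terms before
`l` vanish, the term `l` contributes `c l`, and the later ones contribute `c m` times a Gram-Schmidt
coefficient of absolute value at most `1 / 2`. Cauchy-Schwarz bounds the total. -/
theorem norm_coord_le_of_gramSchmidt (v : Fin d → E) (c : Fin d → ℂ) (l : Fin d)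
    (hl : gramSchmidt ℂ v l ≠ 0) (hμ : ∀ m > l,
      ‖inner ℂ (gramSchmidt ℂ v l) (v m) / (‖gramSchmidt ℂ v l‖ ^ 2 : ℝ)‖ ≤ 1 / 2) :
    ‖c l‖ ≤ ‖∑ m, c m • v m‖ / ‖gramSchmidt ℂ v l‖ + 1 / 2 * ∑ m ∈ Finset.Ioi l, ‖c m‖ := by
  set b := gramSchmidt ℂ v l with hb
  have hb0 : 0 < ‖b‖ := norm_pos_iff.2 hl
  have hbC : (‖b‖ : ℂ) ≠ 0 := by exact_mod_cast hb0.ne'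
  have h1 : inner ℂ b (∑ m, c m • v m) / (‖b‖ ^ 2 : ℝ) =
      c l + ∑ m ∈ Finset.Ioi l, c m * (inner ℂ b (v m) / (‖b‖ ^ 2 : ℝ)) := by
    have h2 : ∀ m, inner ℂ b (c m • v m) / ((‖b‖ ^ 2 : ℝ) : ℂ) =
        if m = l then c l else if m ∈ Finset.Ioi l then
          c m * (inner ℂ b (v m) / (‖b‖ ^ 2 : ℝ)) else 0 := by
      intro m
      rw [inner_smul_right]
      rcases lt_trichotomy m l with hm | rfl | hm
      · rw [if_neg hm.ne, if_neg (by simpa using hm.le), gramSchmidt_inv_triangular ℂ v hm]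
        simp
      · rw [if_pos rfl, inner_gramSchmidt_self]
        push_cast
        rw [mul_div_assoc, div_self (pow_ne_zero 2 hbC), mul_one]
      · rw [if_neg hm.ne', if_pos (Finset.mem_Ioi.2 hm), mul_div_assoc]
    rw [inner_sum, Finset.sum_div, Finset.sum_congr rfl fun m _ => h2 m,
      ← Finset.add_sum_erase _ _ (Finset.mem_univ l), if_pos rfl]
    congr 1
    rw [Finset.sum_congr rfl fun m hm => if_neg (Finset.ne_of_mem_erase hm), ← Finset.sum_filter]
    refine Finset.sum_congr ?_ fun _ _ => rfl
    ext m
    simp only [Finset.mem_filter, Finset.mem_erase, Finset.mem_univ, Finset.mem_Ioi]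
    exact ⟨fun h => h.2, fun h => ⟨⟨h.ne', trivial⟩, h⟩⟩
  have h3 : c l = inner ℂ b (∑ m, c m • v m) / (‖b‖ ^ 2 : ℝ) -
      ∑ m ∈ Finset.Ioi l, c m * (inner ℂ b (v m) / (‖b‖ ^ 2 : ℝ)) := by
    rw [h1]; ring
  rw [h3]
  refine (norm_sub_le _ _).trans (add_le_add ?_ ?_)
  · rw [norm_div, Complex.norm_real, norm_pow, norm_norm, div_le_div_iff₀ (by positivity) hb0]
    have := norm_inner_le_norm (𝕜 := ℂ) b (∑ m, c m • v m)
    nlinarith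
  · rw [Finset.mul_sum]
    refine norm_sum_le_of_le _ fun m hm => ?_
    rw [norm_mul, mul_comm]
    exact mul_le_mul_of_nonneg_right (hμ m (Finset.mem_Ioi.1 hm)) (norm_nonneg _)

end GramSchmidt

/-- The bound on the coordinates of a vector from back substitution. -/
theorem abs_le_of_back_substitution {d : ℕ} {W : ℝ} (hW : 0 ≤ W) (y : ℕ → ℝ) (hy : ∀ l, 0 ≤ y l)
    (h : ∀ l < d, y l ≤ W + 1 / 2 * ∑ m ∈ Finset.Ico (l + 1) d, y m) {l : ℕ} (hl : l < d) :
    y l ≤ W * 4 ^ d := by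
  -- Sum of the last `t` terms. One more term adds at most `W` plus half of the sum so far, so the
  -- factor `4` per term is generous.
  have key : ∀ t ≤ d, ∑ m ∈ Finset.Ico (d - t) d, y m ≤ W * (4 ^ t - 1) := by
    intro t
    induction t with
    | zero => simp
    | succ t ih =>
      intro ht
      have h1 := ih (by omega)
      have h2 := h (d - (t + 1)) (by omega)
      rw [Finset.sum_eq_sum_Ico_succ_bot (by omega)]
      rw [show d - (t + 1) + 1 = d - t by omega] at *
      have h4 : (1 : ℝ) ≤ 4 ^ t := one_le_pow₀ (by norm_num)
      rw [pow_succ]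
      nlinarith
  have h1 := key (d - l) (by omega)
  rw [Nat.sub_sub_self hl.le] at h1
  have h2 : y l ≤ ∑ m ∈ Finset.Ico l d, y m :=
    Finset.single_le_sum (fun m _ => hy m) (Finset.mem_Ico.2 ⟨le_rfl, hl⟩)
  have h3 : (4 : ℝ) ^ (d - l) ≤ 4 ^ d := pow_le_pow_right₀ (by norm_num) (Nat.sub_le _ _)
  nlinarith

/-- A bound for the factors of a product of which no factor is less than half of the preceding
one. -/
theorem le_prod_mul_two_pow {d : ℕ} (a : ℕ → ℝ) (h0 : 1 ≤ a 0)
    (h : ∀ i, i + 1 < d → a i ≤ 2 * a (i + 1)) :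
    (∀ i < d, 1 ≤ 2 ^ d * a i) ∧
      ∀ i < d, a i ≤ (∏ j ∈ Finset.range d, a j) * 2 ^ (d * d) := by
  have h1 : ∀ i < d, 1 ≤ 2 ^ i * a i := by
    intro i
    induction i with
    | zero => intro _; simpa using h0
    | succ i ih =>
      intro hi
      have := ih (by omega)
      have h2 := h i hi
      have h3 : (0 : ℝ) < 2 ^ i := by positivity
      rw [pow_succ]
      nlinarith
  have hpos : ∀ i < d, 0 < a i := fun i hi =>
    pos_of_mul_pos_right (zero_lt_one.trans_le (h1 i hi)) (by positivity)
  have h2 : ∀ i < d, 1 ≤ 2 ^ d * a i := fun i hi => (h1 i hi).trans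
    (mul_le_mul_of_nonneg_right (pow_le_pow_right₀ (by norm_num) hi.le) (hpos i hi).le)
  refine ⟨h2, fun i hi => ?_⟩
  -- Each of the other factors is at least `2 ^ (-d)`, so one factor can exceed the whole product by
  -- at most `2 ^ (d * (d - 1))`.
  have h3 : 1 ≤ ∏ j ∈ (Finset.range d).erase i, 2 ^ d * a j := by
    have := Finset.prod_le_prod (s := (Finset.range d).erase i) (f := fun _ => (1 : ℝ))
      (g := fun j => 2 ^ d * a j) (fun _ _ => zero_le_one)
      fun j hj => h2 j (Finset.mem_range.1 (Finset.mem_of_mem_erase hj))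
    simpa using this
  rw [Finset.prod_mul_distrib, Finset.prod_const, Finset.card_erase_of_mem
    (Finset.mem_range.2 hi), Finset.card_range, ← pow_mul] at h3
  rw [← Finset.mul_prod_erase _ _ (Finset.mem_range.2 hi)]
  have h4 : (0 : ℝ) ≤ ∏ j ∈ (Finset.range d).erase i, a j := Finset.prod_nonneg fun j hj =>
    (hpos j (Finset.mem_range.1 (Finset.mem_of_mem_erase hj))).le
  have h5 : (2 : ℝ) ^ (d * (d - 1)) ≤ 2 ^ (d * d) :=
    pow_le_pow_right₀ (by norm_num) (Nat.mul_le_mul_left _ (Nat.sub_le _ _))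
  have h6 := hpos i hi
  calc a i ≤ a i * (2 ^ (d * (d - 1)) * ∏ j ∈ (Finset.range d).erase i, a j) :=
        le_mul_of_one_le_right h6.le h3
    _ ≤ a i * (2 ^ (d * d) * ∏ j ∈ (Finset.range d).erase i, a j) := by gcongr
    _ = _ := by ring

section Reduced

variable {K : Type*} [Field K] [NumberField K] {d : ℕ} {ω : Module.Basis (Fin d) ℤ (𝓞 K)}

theorem norm_embVec_sq (x : K) : ‖embVec x‖ ^ 2 = ∑ σ : K →+* ℂ, ‖σ x‖ ^ 2 :=
  EuclideanSpace.norm_sq_eq _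

theorem norm_embVec_mul_le (x y : K) : ‖embVec (x * y)‖ ≤ ‖embVec x‖ * ‖embVec y‖ := by
  refine le_of_sq_le_sq ?_ (by positivity)
  rw [mul_pow, norm_embVec_sq, norm_embVec_sq, norm_embVec_sq, Finset.sum_mul]
  refine Finset.sum_le_sum fun σ _ => ?_
  rw [map_mul, norm_mul, mul_pow]
  gcongr
  exact Finset.single_le_sum (f := fun σ : K →+* ℂ => ‖σ y‖ ^ 2) (fun _ _ => by positivity)
    (Finset.mem_univ σ)

theorem embVec_sum (c : Fin d → ℤ) (x : Fin d → K) :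
    embVec (∑ i, (c i : K) * x i) = ∑ i, (c i : ℂ) • embVec (x i) := by
  ext σ
  simp [embVec]

/-- The product of the lengths is the absolute value of the determinant of the matrix of embeddings
of the basis, and the square of that determinant is the discriminant. -/
theorem prod_norm_basisGS (hd : Module.finrank ℚ K = d) (ω : Module.Basis (Fin d) ℤ (𝓞 K)) :
    ∏ i, ‖basisGS ω i‖ ^ 2 = |(discr K : ℝ)| := by
  have hcard : Fintype.card (Fin d) = Fintype.card (K →ₐ[ℚ] ℂ) := by
    rw [AlgHom.card, hd, Fintype.card_fin]
  let e : Fin d ≃ (K →ₐ[ℚ] ℂ) := Fintype.equivOfCardEq hcard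
  let e' : Fin d ≃ (K →+* ℂ) := e.trans (RingHom.equivRatAlgHom K ℂ).symm
  let o : OrthonormalBasis (Fin d) ℂ (EuclideanSpace ℂ (K →+* ℂ)) :=
    (EuclideanSpace.basisFun (K →+* ℂ) ℂ).reindex e'.symm
  let v : Fin d → EuclideanSpace ℂ (K →+* ℂ) := fun i => embVec (ω i : K)
  have h1 := norm_det_eq_prod_gramSchmidt o v
  have h2 : o.toBasis.det v =
      (Algebra.embeddingsMatrixReindex ℚ ℂ (fun i => (ω i : K)) e).det := by
    rw [Module.Basis.det_apply, ← Matrix.det_transpose]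
    congr 1
  have h3 := Algebra.discr_eq_det_embeddingsMatrixReindex_pow_two ℚ ℂ (fun i => (ω i : K)) e
  have h4 : Algebra.discr ℚ (fun i => (ω i : K)) = (discr K : ℚ) := by
    rw [← discr_eq_discr K ω]
    have : Algebra.discr ℚ (ω.localizationLocalization ℚ ℤ⁰ K) = _ :=
      Algebra.discr_localizationLocalization ℤ ℤ⁰ K ω
    rw [show (algebraMap ℤ ℚ) (Algebra.discr ℤ ω) = ((Algebra.discr ℤ ω : ℤ) : ℚ) from rfl] at this
    rw [← this]
    congr 1
    funext i
    rw [Module.Basis.localizationLocalization_apply]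
  rw [h4, ← h2] at h3
  have h5 := congrArg norm h3
  rw [norm_pow, h1] at h5
  rw [Finset.prod_pow]
  unfold basisGS
  rw [← h5]
  simp

/-- The first vector is its own Gram-Schmidt vector, and `1` has absolute value `1` under each of
the `d` embeddings. This anchors the chain of lower bounds for the other lengths. -/
theorem norm_basisGS_zero_sq (hd : Module.finrank ℚ K = d) (hω : ∀ i : Fin d, (i : ℕ) = 0 → ω i = 1)
    (i : Fin d) (hi : (i : ℕ) = 0) : ‖basisGS ω i‖ ^ 2 = d := by
  have h1 : basisGS ω i = embVec (1 : K) := by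
    unfold basisGS
    rw [InnerProductSpace.gramSchmidt_def, Finset.sum_eq_zero, sub_zero, hω i hi]
    · simp
    · intro j hj
      have : j < i := Finset.mem_Iio.1 hj
      have : (j : ℕ) < i := this
      omega
  rw [h1, norm_embVec_sq]
  simp [← hd, Embeddings.card]

/-- The Lovász factor `3 / 4` loses at most `1 / 4` to the squared Gram-Schmidt coefficient, which
leaves `1 / 2`. -/
theorem IsLLLReduced.norm_sq_le (h : IsLLLReduced ω) (i j : Fin d) (hij : (j : ℕ) + 1 = i) :
    ‖basisGS ω j‖ ^ 2 ≤ 2 * ‖basisGS ω i‖ ^ 2 := by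
  have hji : j < i := by rw [Fin.lt_def]; omega
  have h1 := h.1 i j hji
  have h2 := h.2 i j hij
  have h4 : ‖basisGS ω i + basisMu ω i j • basisGS ω j‖ ^ 2 =
      ‖basisGS ω i‖ ^ 2 + ‖basisMu ω i j‖ ^ 2 * ‖basisGS ω j‖ ^ 2 :=
    norm_gramSchmidt_add_smul_sq _ hji.ne' _
  rw [h4] at h2
  have h5 : ‖basisMu ω i j‖ ^ 2 ≤ 1 / 4 := by nlinarith [norm_nonneg (basisMu ω i j)]
  nlinarith [sq_nonneg ‖basisGS ω j‖]

/-- The lengths of the Gram-Schmidt vectors of a reduced basis. -/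
theorem IsLLLReduced.norm_basisGS (h : IsLLLReduced ω) (hd : Module.finrank ℚ K = d)
    (hω : ∀ i : Fin d, (i : ℕ) = 0 → ω i = 1) (i : Fin d) :
    1 ≤ 2 ^ d * ‖basisGS ω i‖ ^ 2 ∧ ‖basisGS ω i‖ ^ 2 ≤ |(discr K : ℝ)| * 2 ^ (d * d) := by
  let a : ℕ → ℝ := fun t => if ht : t < d then ‖basisGS ω ⟨t, ht⟩‖ ^ 2 else 0
  have ha : ∀ i : Fin d, a i = ‖basisGS ω i‖ ^ 2 := fun i => by simp [a]
  have hprod : ∏ j ∈ Finset.range d, a j = |(discr K : ℝ)| := by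
    rw [Finset.prod_range, ← prod_norm_basisGS hd ω]
    exact Finset.prod_congr rfl fun i _ => ha i
  have h0 : 1 ≤ a 0 := by
    have hd0 : 0 < d := i.pos
    rw [show a 0 = a (⟨0, hd0⟩ : Fin d) from rfl, ha, norm_basisGS_zero_sq hd hω _ rfl]
    exact_mod_cast hd0
  have := le_prod_mul_two_pow (d := d) a h0 fun t ht => by
    have := h.norm_sq_le ⟨t + 1, ht⟩ ⟨t, by omega⟩ rfl
    rwa [← ha, ← ha] at this
  rw [hprod] at this
  rw [← ha]
  exact ⟨this.1 i i.2, this.2 i i.2⟩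

theorem one_le_abs_discr : (1 : ℝ) ≤ |(discr K : ℝ)| := by
  exact_mod_cast Int.one_le_abs (discr_ne_zero K)

/-- The multiplication table of a reduced basis. -/
theorem IsLLLReduced.abs_repr_mul_le (h : IsLLLReduced ω) (hd : Module.finrank ℚ K = d)
    (hω : ∀ i : Fin d, (i : ℕ) = 0 → ω i = 1) (i j l : Fin d) :
    |((ω.repr (ω i * ω j) l : ℤ) : ℝ)| ≤
      (d * (|(discr K : ℝ)| * 2 ^ (d * d))) ^ 2 * 2 ^ d * 4 ^ d := by
  set R : ℝ := |(discr K : ℝ)| * 2 ^ (d * d)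
  have hR : 1 ≤ R := one_le_mul_of_one_le_of_one_le one_le_abs_discr
    (one_le_pow₀ (by norm_num))
  -- The bound at hand is for the square. As `R ≥ 1`, a length above `R` would have a square above
  -- `R`. The lower bound below is unsquared in the same way.
  have hR' : ∀ j, ‖basisGS ω j‖ ≤ R := fun j => by
    have := (h.norm_basisGS hd hω j).2
    by_contra! hlt
    nlinarith
  have hgs : ∀ j, 1 ≤ 2 ^ d * ‖basisGS ω j‖ := fun j => by
    have := (h.norm_basisGS hd hω j).1
    have h2 : (1 : ℝ) ≤ 2 ^ d := one_le_pow₀ (by norm_num)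
    by_contra! hlt
    have h3 := norm_nonneg (basisGS ω j)
    nlinarith
  have hv : ∀ i, ‖embVec (ω i : K)‖ ≤ d * R := fun i =>
    norm_le_of_gramSchmidt (fun i => embVec (ω i : K)) hR' i fun j hj => h.1 i j hj
  set w := embVec ((ω i * ω j : 𝓞 K) : K)
  have hw : ‖w‖ ≤ (d * R) ^ 2 := by
    have h1 := norm_embVec_mul_le (ω i : K) (ω j : K)
    have h2 := hv i
    have h3 := hv j
    have h4 := norm_nonneg (embVec (ω i : K))
    have e : w = embVec ((ω i : K) * (ω j : K)) := by simp [w]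
    rw [e, sq]
    exact h1.trans (mul_le_mul h2 h3 (norm_nonneg _) (h4.trans h2))
  let c : Fin d → ℂ := fun m => ((ω.repr (ω i * ω j) m : ℤ) : ℂ)
  have hwc : w = ∑ m, c m • embVec (ω m : K) := by
    rw [← embVec_sum]
    have := congrArg (algebraMap (𝓞 K) K) (ω.sum_repr (ω i * ω j))
    rw [← RingOfIntegers.coe_eq_algebraMap, ← RingOfIntegers.coe_eq_algebraMap] at this
    simp only [w, ← this]
    simp [map_sum]
  -- The division by the Gram-Schmidt length is replaced by the factor `2 ^ d`. Back substitution
  -- then applies with `W = ‖w‖ * 2 ^ d`.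
  have hc : ∀ l, ‖c l‖ ≤ ‖w‖ * 2 ^ d + 1 / 2 * ∑ m ∈ Finset.Ioi l, ‖c m‖ := by
    intro l
    have h0 : 0 < ‖basisGS ω l‖ :=
      pos_of_mul_pos_right (zero_lt_one.trans_le (hgs l)) (by positivity)
    refine (norm_coord_le_of_gramSchmidt (fun i => embVec (ω i : K)) c l
      (norm_pos_iff.1 h0) fun m hm => h.1 m l hm).trans (add_le_add_left ?_ _)
    rw [← hwc]
    change ‖w‖ / ‖basisGS ω l‖ ≤ _
    rw [div_le_iff₀ h0]
    have := mul_le_mul_of_nonneg_left (hgs l) (norm_nonneg w)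
    linarith
  let y : ℕ → ℝ := fun t => if ht : t < d then ‖c ⟨t, ht⟩‖ else 0
  have hyf : ∀ l : Fin d, y l = ‖c l‖ := fun l => by simp [y]
  have hsum : ∀ l : Fin d, ∑ m ∈ Finset.Ico ((l : ℕ) + 1) d, y m =
      ∑ m ∈ Finset.Ioi l, ‖c m‖ := by
    intro l
    symm
    refine Finset.sum_bij (fun (m : Fin d) _ => (m : ℕ)) (fun m hm => ?_) (fun a _ b _ hab => Fin.ext hab)
      (fun t ht => ?_) (fun m _ => (hyf m).symm)
    · have : (l : ℕ) < (m : ℕ) := Fin.lt_def.1 (Finset.mem_Ioi.1 hm)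
      exact Finset.mem_Ico.2 ⟨this, m.2⟩
    · obtain ⟨h1, h2⟩ := Finset.mem_Ico.1 ht
      exact ⟨⟨t, h2⟩, Finset.mem_Ioi.2 (Fin.lt_def.2 h1), rfl⟩
  have := abs_le_of_back_substitution (d := d) (W := ‖w‖ * 2 ^ d) (by positivity) y
    (fun t => by dsimp only [y]; split_ifs <;> positivity)
    (fun t ht => by
      have := hc ⟨t, ht⟩
      rwa [← hsum, ← hyf] at this) l.2
  rw [hyf] at this
  have hcl : ‖c l‖ = |((ω.repr (ω i * ω j) l : ℤ) : ℝ)| := Complex.norm_intCast _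
  rw [← hcl]
  refine this.trans ?_
  gcongr

/-- The entries of the multiplication table have `O(d ^ 2 + log |Δ|)` bits. -/
theorem IsLLLReduced.abs_repr_mul_le_two_rpow (h : IsLLLReduced ω) (hd : Module.finrank ℚ K = d)
    (hω : ∀ i : Fin d, (i : ℕ) = 0 → ω i = 1) (i j l : Fin d) :
    |((ω.repr (ω i * ω j) l : ℤ) : ℝ)| ≤
      2 ^ (7 * (d : ℝ) ^ 2 + 2 * Real.logb 2 |(discr K : ℝ)|) := by
  refine (h.abs_repr_mul_le hd hω i j l).trans ?_
  have hD : (0 : ℝ) < |(discr K : ℝ)| := zero_lt_one.trans_le one_le_abs_discr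
  have h1 : (d : ℝ) ≤ 2 ^ d := by exact_mod_cast Nat.lt_two_pow_self.le
  have h2 : (2 : ℝ) ^ (2 * Real.logb 2 |(discr K : ℝ)|) = |(discr K : ℝ)| ^ 2 := by
    rw [mul_comm, Real.rpow_mul (by norm_num), Real.rpow_logb (by norm_num) (by norm_num) hD]
    exact_mod_cast Real.rpow_natCast |(discr K : ℝ)| 2
  have h3 : (2 : ℝ) ^ (7 * (d : ℝ) ^ 2) = 2 ^ (7 * d ^ 2) := by
    exact_mod_cast Real.rpow_natCast (2 : ℝ) (7 * d ^ 2)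
  have hd0 := i.pos
  rw [Real.rpow_add (by norm_num), h2, h3]
  -- With `d ≤ 2 ^ d`, the exponent of `2` is `2 d + 2 d ^ 2 + d + 2 d`, which is at most `7 d ^ 2`.
  calc _ ≤ (2 ^ d * (|(discr K : ℝ)| * 2 ^ (d * d))) ^ 2 * 2 ^ d * 4 ^ d := by gcongr
    _ = 2 ^ (5 * d + 2 * (d * d)) * |(discr K : ℝ)| ^ 2 := by
      rw [show (4 : ℝ) ^ d = 2 ^ (2 * d) by rw [pow_mul]; norm_num]
      ring
    _ ≤ 2 ^ (7 * d ^ 2) * |(discr K : ℝ)| ^ 2 := by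
      gcongr
      · norm_num
      · nlinarith

end Reduced

namespace RAM

/-! ### Costs -/

theorem one_le_lg (h : ℕ) : 1 ≤ lg h := by simp [lg]

theorem lg_mono {a b : ℕ} (h : a ≤ b) : lg a ≤ lg b :=
  Nat.succ_le_succ (Nat.log_mono_right h)

theorem mulCost_mono {a b : ℕ} (h : a ≤ b) : mulCost a ≤ mulCost b := by
  unfold mulCost
  exact Nat.mul_le_mul (Nat.mul_le_mul h (lg_mono h)) (lg_mono (lg_mono h))

theorem le_mulCost (h : ℕ) : h ≤ mulCost h := by
  unfold mulCost
  calc h = h * 1 * 1 := by ring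
    _ ≤ _ := Nat.mul_le_mul (Nat.mul_le_mul_left _ (one_le_lg _)) (one_le_lg _)

theorem bits_mono {x y : ℤ} (h : |x| ≤ y) : bits x ≤ bits y := by
  unfold bits
  have : x.natAbs ≤ y.natAbs := by rw [Int.abs_eq_natAbs] at h; omega
  exact Nat.succ_le_succ (Nat.size_le_size this)

/-- An upper bound for the cost of an instruction whose operands are `O(Z)`. -/
def unitCost (Z : ℤ) : ℕ :=
  -- The bound `32 * Z + 32` leaves room for the addresses `16 * i + 8 + a` of array entries with `i
  -- ≤ Z`. The factor `2` is for memory accesses, which pay for an address and a value. The gcd cost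
  -- dominates all other instructions.
  2 * (lg (bits (32 * Z + 32)) * mulCost (bits (32 * Z + 32)))

theorem lg_mul_mulCost_le_unitCost {Z : ℤ} {h : ℕ} (hh : h ≤ bits (32 * Z + 32)) :
    lg h * mulCost h ≤ unitCost Z := by
  unfold unitCost
  have := Nat.mul_le_mul (lg_mono hh) (mulCost_mono hh)
  omega

theorem mulCost_le_unitCost {Z : ℤ} {h : ℕ} (hh : h ≤ bits (32 * Z + 32)) :
    mulCost h ≤ unitCost Z :=
  (Nat.le_mul_of_pos_left _ (one_le_lg h)).trans (lg_mul_mulCost_le_unitCost hh)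

theorem le_unitCost {Z : ℤ} {h : ℕ} (hh : h ≤ bits (32 * Z + 32)) : h ≤ unitCost Z :=
  (le_mulCost h).trans (mulCost_le_unitCost hh)

theorem add_le_unitCost {Z : ℤ} {h k : ℕ} (hh : h ≤ bits (32 * Z + 32))
    (hk : k ≤ bits (32 * Z + 32)) : h + k ≤ unitCost Z := by
  unfold unitCost
  have h1 := le_mulCost (bits (32 * Z + 32))
  have h2 := Nat.le_mul_of_pos_left (mulCost (bits (32 * Z + 32)))
    (one_le_lg (bits (32 * Z + 32)))
  omega

theorem bits₂_le {x y w : ℤ} (hx : |x| ≤ w) (hy : |y| ≤ w) : bits₂ x y ≤ bits w :=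
  max_le (bits_mono hx) (bits_mono hy)

/-! ### A structured language -/

/-- Binary operations on integers that the machine has as instructions. -/
inductive BinOp
  | add | sub | mul | div | mod | gcd | bezoutLeft | bezoutRight

/-- The value of a binary operation. -/
def BinOp.eval : BinOp → ℤ → ℤ → ℤ
  | .add, x, y => x + y
  | .sub, x, y => x - y
  | .mul, x, y => x * y
  | .div, x, y => x / y
  | .mod, x, y => x % y
  | .gcd, x, y => Int.gcd x y
  | .bezoutLeft, x, y => Int.gcdA x y
  | .bezoutRight, x, y => Int.gcdB x y

/-- The machine instruction for a binary operation. -/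
def BinOp.instr : BinOp → ℕ → ℕ → ℕ → Instr
  | .add => .add
  | .sub => .sub
  | .mul => .mul
  | .div => .div
  | .mod => .mod
  | .gcd => .gcd
  | .bezoutLeft => .bezoutLeft
  | .bezoutRight => .bezoutRight

theorem BinOp.exec_instr (o : BinOp) (inp : List ℤ) (c : Config) (r s t : ℕ) {Z : ℤ}
    (hs : |c.mem s| ≤ 32 * Z + 32) (ht : |c.mem t| ≤ 32 * Z + 32) :
    ∃ k ≤ unitCost Z,
      (o.instr r s t).exec inp c = c.assign r (o.eval (c.mem s) (c.mem t)) k := by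
  have h := bits₂_le hs ht
  cases o
  case add => exact ⟨_, le_unitCost h, rfl⟩
  case sub => exact ⟨_, le_unitCost h, rfl⟩
  case mul => exact ⟨_, mulCost_le_unitCost h, rfl⟩
  case div => exact ⟨_, mulCost_le_unitCost h, rfl⟩
  case mod => exact ⟨_, mulCost_le_unitCost h, rfl⟩
  case gcd => exact ⟨_, lg_mul_mulCost_le_unitCost h, rfl⟩
  case bezoutLeft => exact ⟨_, lg_mul_mulCost_le_unitCost h, rfl⟩
  case bezoutRight => exact ⟨_, lg_mul_mulCost_le_unitCost h, rfl⟩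

/-- Expressions over integer variables, four integer arrays, and the input. -/
inductive Expr
  | const (z : ℤ)
  | var (x : ℕ)
  | arr (a : Fin 4) (e : Expr)
  | inp (e : Expr)
  | bin (o : BinOp) (e f : Expr)

/-- Commands. The loop `loop x e b` runs `b` with `x = 0, …, n - 1`, where `n` is the value
of `e` at the beginning. -/
inductive Cmd
  | assign (x : ℕ) (e : Expr)
  | store (a : Fin 4) (e f : Expr)
  | write (e : Expr)
  | seq (b c : Cmd)
  | loop (x : ℕ) (e : Expr) (b : Cmd)

/-- The values of the variables and arrays, and the output so far. -/
structure Store where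
  var : ℕ → ℤ
  arr : Fin 4 → ℕ → ℤ
  out : List ℤ

/-- Change the value of a variable. -/
def Store.setVar (s : Store) (x : ℕ) (z : ℤ) : Store := ⟨Function.update s.var x z, s.arr, s.out⟩

/-- Change an entry of an array. -/
def Store.setArr (s : Store) (a : Fin 4) (i : ℕ) (z : ℤ) : Store :=
  ⟨s.var, Function.update s.arr a (Function.update (s.arr a) i z), s.out⟩

section
variable (inp : List ℤ)

/-- The value of an expression. -/
def Expr.eval (s : Store) : Expr → ℤ
  | .const z => z
  | .var x => s.var x
  | .arr a e => s.arr a (e.eval s).toNat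
  | .inp e => inp.getD (e.eval s).toNat 0
  | .bin o e f => o.eval (e.eval s) (f.eval s)

/-- All values occurring in the evaluation have absolute value at most `Z`, and array indices are
nonnegative. -/
def Expr.Fits (Z : ℤ) (s : Store) : Expr → Prop
  | .const z => |z| ≤ Z
  | .var x => |s.var x| ≤ Z
  | .arr a e => e.Fits Z s ∧ 0 ≤ e.eval inp s ∧ |s.arr a (e.eval inp s).toNat| ≤ Z
  | .inp e => e.Fits Z s ∧ |inp.getD (e.eval inp s).toNat 0| ≤ Z
  | .bin o e f => e.Fits Z s ∧ f.Fits Z s ∧ |o.eval (e.eval inp s) (f.eval inp s)| ≤ Z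

/-- The number of machine instructions of an expression. -/
def Expr.size : Expr → ℕ
  | .const _ => 1
  | .var _ => 2
  | .arr _ e => e.size + 5
  | .inp e => e.size + 1
  | .bin _ e f => e.size + f.size + 1

theorem Expr.Fits.abs_eval_le {Z : ℤ} {s : Store} {e : Expr} (h : e.Fits inp Z s) :
    |e.eval inp s| ≤ Z := by
  cases e
  case const => exact h
  case var => exact h
  case arr => exact h.2.2
  case inp => exact h.2
  case bin => exact h.2.2

/-- Apply `f 0, …, f (n - 1)` one after the other. -/
def iter {α : Type*} (f : ℕ → α → α) (s : α) : ℕ → α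
  | 0 => s
  | n + 1 => f n (iter f s n)

/-- The store after a command. -/
def Cmd.eval : Cmd → Store → Store
  | .assign x e, s => s.setVar x (e.eval inp s)
  | .store a e f, s => s.setArr a (e.eval inp s).toNat (f.eval inp s)
  | .write e, s => ⟨s.var, s.arr, s.out ++ [e.eval inp s]⟩
  | .seq b c, s => c.eval (b.eval s)
  | .loop x e b, s => iter (fun i s' => b.eval (s'.setVar x i)) s (e.eval inp s).toNat

/-- The command uses array indices properly, and its cost is at most `T`. -/
def Cmd.Safe : Cmd → Store → ℕ → Prop
  | .assign _ e, s, T => ∃ Z, e.Fits inp Z s ∧ (e.size + 2) * unitCost Z ≤ T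
  | .store _ e f, s, T => ∃ Z, e.Fits inp Z s ∧ 0 ≤ e.eval inp s ∧ f.Fits inp Z s ∧
      (e.size + f.size + 5) * unitCost Z ≤ T
  | .write e, s, T => ∃ Z, e.Fits inp Z s ∧ (e.size + 1) * unitCost Z ≤ T
  | .seq b c, s, T => ∃ T₁ T₂, b.Safe s T₁ ∧ c.Safe (b.eval inp s) T₂ ∧ T₁ + T₂ ≤ T
  | .loop x e b, s, T => ∃ Z U, e.Fits inp Z s ∧
      (∀ i < (e.eval inp s).toNat,
        b.Safe ((iter (fun i s' => b.eval inp (s'.setVar x i)) s i).setVar x i) U) ∧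
      -- A pass has eight instructions besides the body: four for the test and for setting `x`, four
      -- for the increment and the jump back. The initialization and the last test account for the
      -- other three.
      (e.size + 3) * unitCost Z + (e.eval inp s).toNat * (U + 8 * unitCost Z) ≤ T

/-! ### Compilation -/

/-- The register of a temporary value. -/
def temp (t : ℕ) : ℕ := 16 * t + 1

/-- Code that computes the value of an expression into `temp t`, using only `temp u` for
`u ≥ t`. -/
def Expr.compile : Expr → ℕ → List Instr
  | .const z, t => [.const (temp t) z]
  -- The machine has no instruction for copying between fixed registers; adding zero does the job,
  -- here and for assignments.
  | .var x, t => [.const (temp t) 0, .add (temp t) (16 * x) (temp t)]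
  | .arr a e, t => e.compile t ++ [.const (temp (t + 1)) 16, .mul (temp t) (temp t) (temp (t + 1)),
      .const (temp (t + 1)) (8 + (a : ℕ)), .add (temp t) (temp t) (temp (t + 1)),
      .load (temp t) (temp t)]
  | .inp e, t => e.compile t ++ [.read (temp t) (temp t)]
  | .bin o e f, t => e.compile t ++ (f.compile (t + 1) ++
      [o.instr (temp t) (temp t) (temp (t + 1))])

theorem Expr.length_compile (e : Expr) (t : ℕ) : (e.compile t).length = e.size := by
  induction e generalizing t <;> simp_all [Expr.compile, Expr.size, Nat.add_assoc]

/-- Code of a command that starts at the position `p` of the program, using only `temp u` for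
`u ≥ t`. -/
def Cmd.compile : Cmd → (t p : ℕ) → List Instr
  | .assign x e, t, _ => e.compile t ++
      [.const (temp (t + 1)) 0, .add (16 * x) (temp t) (temp (t + 1))]
  | .store a e f, t, _ => e.compile t ++ (f.compile (t + 1) ++
      [.const (temp (t + 2)) 16, .mul (temp t) (temp t) (temp (t + 2)),
      .const (temp (t + 2)) (8 + (a : ℕ)), .add (temp t) (temp t) (temp (t + 2)),
      .store (temp t) (temp (t + 1))])
  | .write e, t, _ => e.compile t ++ [.write (temp t)]
  | .seq b c, t, p => b.compile t p ++ c.compile t (p + (b.compile t p).length)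
  -- The bound is kept in `temp t` and the counter in `temp (t + 1)`, out of reach of the body,
  -- which uses temporaries from `t + 2` on; so the number of passes is fixed even if the body
  -- changes `x`. The jump back is unconditional because its register has just been set to `0`.
  | .loop x e b, t, p =>
      let h := p + e.size + 1
      let code := b.compile (t + 2) (h + 4)
      e.compile t ++ (.const (temp (t + 1)) 0 ::
        .sub (temp (t + 2)) (temp t) (temp (t + 1)) ::
        .jump (temp (t + 2)) (h + 4 + code.length + 4) ::
        .const (temp (t + 2)) 0 ::
        .add (16 * x) (temp (t + 1)) (temp (t + 2)) :: (code ++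
        [.const (temp (t + 2)) 1, .add (temp (t + 1)) (temp (t + 1)) (temp (t + 2)),
        .const (temp (t + 2)) 0, .jump (temp (t + 2)) h]))

/-- The segment `code` stands at the position `p` of the program `P`. -/
def At (P : Program) (p : ℕ) (code : List Instr) : Prop :=
  ∃ A B, P = A ++ code ++ B ∧ A.length = p

theorem At.left {P : Program} {p : ℕ} {a b : List Instr} (h : At P p (a ++ b)) : At P p a := by
  obtain ⟨A, B, rfl, hA⟩ := h
  exact ⟨A, b ++ B, by simp, hA⟩

theorem At.right {P : Program} {p : ℕ} {a b : List Instr} (h : At P p (a ++ b)) :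
    At P (p + a.length) b := by
  obtain ⟨A, B, rfl, hA⟩ := h
  exact ⟨A ++ a, B, by simp, by simp [hA]⟩

theorem At.head {P : Program} {p : ℕ} {I : Instr} {b : List Instr} (h : At P p (I :: b)) :
    P[p]? = some I := by
  obtain ⟨A, B, rfl, rfl⟩ := h
  simp

theorem At.tail {P : Program} {p : ℕ} {I : Instr} {b : List Instr} (h : At P p (I :: b)) :
    At P (p + 1) b := At.right (a := [I]) h

/-- The machine gets from `c` to `c'`. -/
def Reach (P : Program) (c c' : Config) : Prop := ∃ n : ℕ, (step P inp)^[n] c = c'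

variable {inp}

theorem Reach.refl {P : Program} (c : Config) : Reach inp P c c := ⟨0, rfl⟩

theorem Reach.trans {P : Program} {a b c : Config} (h : Reach inp P a b) (h' : Reach inp P b c) :
    Reach inp P a c := by
  obtain ⟨n, rfl⟩ := h
  obtain ⟨m, rfl⟩ := h'
  exact ⟨m + n, Function.iterate_add_apply _ _ _ _⟩

theorem Reach.step {P : Program} {c : Config} {I : Instr} (h : P[c.pc]? = some I) :
    Reach inp P c (I.exec inp c) := ⟨1, by simp [RAM.step, h]⟩

theorem Reach.tail {P : Program} {a b : Config} {I : Instr} (h : Reach inp P a b)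
    (h' : P[b.pc]? = some I) : Reach inp P a (I.exec inp b) := h.trans (Reach.step h')

/-- The configuration represents the store. -/
structure Rep (s : Store) (c : Config) : Prop where
  -- Registers are divided by residues modulo `16`: `0` for variables, `8` to `11` for the arrays,
  -- `1` for temporaries. The three kinds never collide, and all arrays are unbounded.
  var : ∀ x, c.mem (16 * x) = s.var x
  arr : ∀ (a : Fin 4) i, c.mem (16 * i + 8 + a) = s.arr a i
  out : c.out = s.out

theorem temp_ne_var (t x : ℕ) : 16 * x ≠ temp t := by unfold temp; omega

theorem temp_ne_arr (t i : ℕ) (a : Fin 4) : 16 * i + 8 + (a : ℕ) ≠ temp t := by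
  unfold temp; omega

theorem temp_inj {t u : ℕ} : temp t = temp u ↔ t = u := by unfold temp; omega

theorem Rep.congr {s : Store} {c c' : Config} {t : ℕ} (h : Rep s c)
    (hm : ∀ r, (∀ u ≥ t, r ≠ temp u) → c'.mem r = c.mem r) (ho : c'.out = c.out) : Rep s c' :=
  ⟨fun x => (hm _ fun u _ => temp_ne_var u x).trans (h.var x),
    fun a i => (hm _ fun u _ => temp_ne_arr u i a).trans (h.arr a i), ho.trans h.out⟩

end

end RAM

/-! ### Correctness and cost of the compiled code -/

namespace RAM

variable {inp : List ℤ}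

theorem BinOp.step_instr (o : BinOp) {P : Program} {a c : Config} (h : Reach inp P a c)
    {r s t : ℕ} (hI : P[c.pc]? = some (o.instr r s t)) {Z : ℤ}
    (hs : |c.mem s| ≤ 32 * Z + 32) (ht : |c.mem t| ≤ 32 * Z + 32) :
    ∃ k ≤ unitCost Z, Reach inp P a (c.assign r (o.eval (c.mem s) (c.mem t)) k) := by
  obtain ⟨k, hk, e⟩ := o.exec_instr inp c r s t hs ht
  exact ⟨k, hk, e ▸ h.tail hI⟩

theorem step_const {P : Program} {a c : Config} (h : Reach inp P a c)
    {r : ℕ} {z : ℤ} (hI : P[c.pc]? = some (.const r z)) {Z : ℤ} (hz : |z| ≤ 32 * Z + 32) :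
    ∃ k ≤ unitCost Z, Reach inp P a (c.assign r z k) :=
  ⟨_, le_unitCost (bits_mono hz), h.tail hI⟩

/-- Induction on the expression. The second operand of a binary operation is evaluated with
temporaries from `t + 1` on, so the first one survives in `temp t`. Every instruction has operands
of size `O(Z)` and costs at most `unitCost Z`, hence the time is the code length times that. -/
theorem Expr.sim {P : Program} {s : Store} {Z : ℤ} (e : Expr) :
    ∀ (t : ℕ) (c : Config), At P c.pc (e.compile t) → Rep s c → e.Fits inp Z s →
    ∃ c', Reach inp P c c' ∧ c'.pc = c.pc + e.size ∧ c'.out = c.out ∧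
      c'.mem (temp t) = e.eval inp s ∧ (∀ r, (∀ u ≥ t, r ≠ temp u) → c'.mem r = c.mem r) ∧
      c'.time ≤ c.time + e.size * unitCost Z := by
  induction e with
  | const z =>
    intro t c hP hc hf
    have hf' : |z| ≤ Z := hf
    obtain ⟨k, hk, hr⟩ := step_const (Z := Z) (Reach.refl (inp := inp) c) hP.head
      (by linarith [abs_nonneg z])
    refine ⟨_, hr, rfl, rfl, ?_, fun r hr => ?_, ?_⟩
    · simp [Config.assign, Expr.eval]
    · simp [Config.assign, hr t le_rfl]
    · simpa [Config.assign, Expr.size] using hk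
  | var x =>
    intro t c hP hc hf
    have hf' : |s.var x| ≤ Z := hf
    have hZ := (abs_nonneg _).trans hf'
    obtain ⟨k, hk, hr⟩ := step_const (Z := Z) (Reach.refl (inp := inp) c) hP.head
      (by simp; linarith)
    obtain ⟨k', hk', hr⟩ := BinOp.add.step_instr (Z := Z) hr hP.tail.head
      (by simp only [Config.assign, ne_eq, temp_ne_var, not_false_eq_true,
            Function.update_of_ne, hc.var]; linarith) (by simp [Config.assign]; linarith)
    refine ⟨_, hr, rfl, rfl, ?_, fun r hr => ?_, ?_⟩
    · simp [Config.assign, Expr.eval, BinOp.eval, temp_ne_var, hc.var]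
    · simp [Config.assign, hr t le_rfl]
    · simp only [Config.assign, Expr.size]; omega
  | arr a e ih =>
    intro t c hP hc hf
    obtain ⟨c', h, hpc, ho, hv, hm, ht⟩ := ih t c hP.left hc hf.1
    have hZ := hf.1.abs_eval_le
    have hZ0 := (abs_nonneg _).trans hZ
    have hP' := hP.right
    rw [Expr.length_compile, ← hpc] at hP'
    have ha : (a : ℕ) < 4 := a.2
    obtain ⟨k1, hk1, h⟩ := step_const (Z := Z) h hP'.head (by simp; linarith)
    obtain ⟨k2, hk2, h⟩ := BinOp.mul.step_instr (Z := Z) h hP'.tail.head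
      (by simp [Config.assign, temp_inj, hv]; linarith) (by simp [Config.assign]; linarith)
    obtain ⟨k3, hk3, h⟩ := step_const (Z := Z) h hP'.tail.tail.head
      (by rw [abs_of_nonneg (by positivity)]; linarith [(Nat.cast_lt (α := ℤ)).2 ha])
    have hidx : |e.eval inp s * 16| ≤ 16 * Z := by rw [abs_mul]; simp; linarith
    obtain ⟨k4, hk4, h⟩ := BinOp.add.step_instr (Z := Z) h hP'.tail.tail.tail.head
      (by simp [Config.assign, temp_inj, hv, BinOp.eval]; linarith)
      (by simp only [Config.assign, Function.update_self]
          rw [abs_of_nonneg (by positivity)]; linarith [(Nat.cast_lt (α := ℤ)).2 ha])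
    have h := h.tail hP'.tail.tail.tail.tail.head
    have hsum : e.eval inp s * 16 + (8 + ((a : ℕ) : ℤ)) =
        ((16 * (e.eval inp s).toNat + 8 + (a : ℕ) : ℕ) : ℤ) := by
      have := hf.2.1; push_cast; rw [Int.toNat_of_nonneg this]; ring
    have hmem : c'.mem (16 * (e.eval inp s).toNat + 8 + (a : ℕ)) =
        s.arr a (e.eval inp s).toNat := by
      rw [hm _ fun u _ => temp_ne_arr u _ a, hc.arr]
    refine ⟨_, h, ?_, ?_, ?_, fun r hr => ?_, ?_⟩
    · simp [Config.assign, Instr.exec, hpc, Expr.size]; ring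
    · simp [Config.assign, Instr.exec, ho]
    · simp only [Config.assign, Instr.exec, Expr.eval, BinOp.eval, Function.update_self, temp_inj,
        ne_eq, Nat.left_eq_add, one_ne_zero, not_false_eq_true,
        Function.update_of_ne, hv]
      rw [hsum, Int.toNat_natCast]
      simp [temp_ne_arr, hmem]
    · simp [Config.assign, Instr.exec, hr t le_rfl, hr (t + 1) (by omega), hm r hr]
    · have hb : bits (e.eval inp s * 16 + (8 + ((a : ℕ) : ℤ))) +
          bits (s.arr a (e.eval inp s).toNat) ≤ unitCost Z := by
        refine add_le_unitCost (bits_mono ?_) (bits_mono (by linarith [hf.2.2]))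
        calc _ ≤ |e.eval inp s * 16| + |8 + ((a : ℕ) : ℤ)| := abs_add_le _ _
          _ ≤ 16 * Z + 12 := by
            rw [abs_of_nonneg (a := 8 + ((a : ℕ) : ℤ)) (by positivity)]
            linarith [(Nat.cast_lt (α := ℤ)).2 ha]
          _ ≤ _ := by linarith
      simp only [Config.assign, Instr.exec, BinOp.eval, Function.update_self, temp_inj,
        ne_eq, Nat.left_eq_add, one_ne_zero, not_false_eq_true,
        Function.update_of_ne, hv, Expr.size]
      rw [hsum, Int.toNat_natCast]
      simp only [ne_eq, temp_ne_arr, not_false_eq_true, Function.update_of_ne, hmem]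
      rw [hsum] at hb
      nlinarith
  | inp e ih =>
    intro t c hP hc hf
    obtain ⟨c', h, hpc, ho, hv, hm, ht⟩ := ih t c hP.left hc hf.1
    have hZ := hf.1.abs_eval_le
    have hZ0 := (abs_nonneg _).trans hZ
    have hP' := hP.right
    rw [Expr.length_compile, ← hpc] at hP'
    have h := h.tail hP'.head
    refine ⟨_, h, ?_, ?_, ?_, fun r hr => ?_, ?_⟩
    · simp [Config.assign, Instr.exec, hpc, Expr.size]; ring
    · simp [Config.assign, Instr.exec, ho]
    · simp [Config.assign, Instr.exec, Expr.eval, hv]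
    · simp [Config.assign, Instr.exec, hr t le_rfl, hm r hr]
    · have hb : bits (e.eval inp s) + bits (inp.getD (e.eval inp s).toNat 0) ≤ unitCost Z :=
        add_le_unitCost (bits_mono (by linarith)) (bits_mono (by linarith [hf.2]))
      simp only [Config.assign, Instr.exec, hv, Expr.size]
      nlinarith
  | bin o e f ihe ihf =>
    intro t c hP hc hf
    obtain ⟨c₁, h₁, hpc₁, ho₁, hv₁, hm₁, ht₁⟩ := ihe t c hP.left hc hf.1
    have hP' := hP.right
    rw [Expr.length_compile, ← hpc₁] at hP'
    obtain ⟨c₂, h₂, hpc₂, ho₂, hv₂, hm₂, ht₂⟩ :=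
      ihf (t + 1) c₁ hP'.left (hc.congr hm₁ ho₁) hf.2.1
    have hP'' := hP'.right
    rw [Expr.length_compile, ← hpc₂] at hP''
    have hv₁' : c₂.mem (temp t) = e.eval inp s := by
      rw [hm₂ _ fun u hu => by simp [temp_inj]; omega, hv₁]
    have hZ := hf.1.abs_eval_le
    have hZ' := hf.2.1.abs_eval_le
    have hZ0 := (abs_nonneg _).trans hZ
    obtain ⟨k, hk, h⟩ := o.step_instr (Z := Z) (h₁.trans h₂) hP''.head
      (by rw [hv₁']; linarith) (by rw [hv₂]; linarith)
    refine ⟨_, h, ?_, ?_, ?_, fun r hr => ?_, ?_⟩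
    · simp [Config.assign, hpc₁, hpc₂, Expr.size]; ring
    · simp [Config.assign, ho₁, ho₂]
    · simp [Config.assign, Expr.eval, hv₁', hv₂]
    · simp [Config.assign, hr t le_rfl, hm₂ r fun u hu => hr u (by omega), hm₁ r hr]
    · simp only [Config.assign, Expr.size]
      nlinarith

end RAM

namespace RAM

variable {inp : List ℤ}

theorem Rep.setVar {s : Store} {c c' : Config} (h : Rep s c) {x : ℕ} {z : ℤ}
    (hm : ∀ r, (∀ u, r ≠ temp u) → c'.mem r = Function.update c.mem (16 * x) z r)
    (ho : c'.out = c.out) : Rep (s.setVar x z) c' := by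
  refine ⟨fun y => ?_, fun a i => ?_, ho.trans h.out⟩
  · rw [hm _ fun u => temp_ne_var u y]
    by_cases hy : y = x
    · simp [Store.setVar, hy]
    · simp [Store.setVar, hy, h.var]
  · rw [hm _ fun u => temp_ne_arr u i a, Function.update_of_ne (by omega), h.arr]
    rfl

theorem Rep.setArr {s : Store} {c c' : Config} (h : Rep s c) {a : Fin 4} {i : ℕ} {z : ℤ}
    (hm : ∀ r, (∀ u, r ≠ temp u) → c'.mem r = Function.update c.mem (16 * i + 8 + a) z r)
    (ho : c'.out = c.out) : Rep (s.setArr a i z) c' := by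
  refine ⟨fun y => ?_, fun b j => ?_, ho.trans h.out⟩
  · rw [hm _ fun u => temp_ne_var u y, Function.update_of_ne (by omega), h.var]
    rfl
  · rw [hm _ fun u => temp_ne_arr u j b]
    by_cases hb : b = a
    · subst hb
      by_cases hj : j = i
      · simp [Store.setArr, hj]
      · rw [Function.update_of_ne (by omega), h.arr]
        simp [Store.setArr, hj]
    · have : (b : ℕ) ≠ a := fun h => hb (Fin.ext h)
      rw [Function.update_of_ne (by omega), h.arr]
      simp [Store.setArr, hb]

/-- The hypothesis `hb` is the induction hypothesis of `Cmd.sim` for the body, placed right after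
the four instructions of the loop head. By induction on `i`, the machine is back at the head after
`i` passes, with the counter `i` and the bound untouched. -/
theorem Cmd.sim_loop {P : Program} {s : Store} {Z : ℤ} {x : ℕ} {b : Cmd} {t p n U : ℕ}
    {c : Config} (hP : At P p ((.sub (temp (t + 2)) (temp t) (temp (t + 1)) ::
        .jump (temp (t + 2)) (p + 4 + (b.compile (t + 2) (p + 4)).length + 4) ::
        .const (temp (t + 2)) 0 ::
        .add (16 * x) (temp (t + 1)) (temp (t + 2)) :: (b.compile (t + 2) (p + 4) ++
        [.const (temp (t + 2)) 1, .add (temp (t + 1)) (temp (t + 1)) (temp (t + 2)),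
        .const (temp (t + 2)) 0, .jump (temp (t + 2)) p]))))
    (hb : ∀ (s' : Store) (c' : Config), b.Safe inp s' U → c'.pc = p + 4 → Rep s' c' →
      ∃ c'', Reach inp P c' c'' ∧ c''.pc = p + 4 + (b.compile (t + 2) (p + 4)).length ∧
        Rep (b.eval inp s') c'' ∧ (∀ u < t + 2, c''.mem (temp u) = c'.mem (temp u)) ∧
        c''.time ≤ c'.time + U)
    (hn : (n : ℤ) ≤ Z)
    (hs : ∀ i < n, b.Safe inp
      ((iter (fun i s' => b.eval inp (s'.setVar x i)) s i).setVar x i) U)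
    (hpc : c.pc = p) (hc : Rep s c) (hcn : (c.mem (temp t)).toNat = n)
    (hcz : |c.mem (temp t)| ≤ Z)
    (hci : c.mem (temp (t + 1)) = 0) :
    ∃ c', Reach inp P c c' ∧ c'.pc = p + 4 + (b.compile (t + 2) (p + 4)).length + 4 ∧
      Rep (iter (fun i s' => b.eval inp (s'.setVar x i)) s n) c' ∧
      (∀ u < t, c'.mem (temp u) = c.mem (temp u)) ∧
      c'.time ≤ c.time + (n * (U + 8 * unitCost Z) + 2 * unitCost Z) := by
  have hZ : 0 ≤ Z := (Int.natCast_nonneg n).trans hn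
  set f := fun (i : ℕ) (s' : Store) => b.eval inp (s'.setVar x i) with hf
  set m := c.mem (temp t) with hm
  have hmZ : m ≤ Z := (le_abs_self m).trans hcz
  have hmZ' : -Z ≤ m := (abs_le.1 hcz).1
  have key : ∀ i ≤ n, ∃ c', Reach inp P c c' ∧ c'.pc = p ∧ Rep (iter f s i) c' ∧
      (∀ u ≤ t, c'.mem (temp u) = c.mem (temp u)) ∧ c'.mem (temp (t + 1)) = i ∧
      c'.time ≤ c.time + i * (U + 8 * unitCost Z) := by
    intro i
    induction i with
    | zero => exact fun _ => ⟨c, Reach.refl c, hpc, hc, fun _ _ => rfl, by simpa, by simp⟩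
    | succ i ih =>
      intro hi
      obtain ⟨c₁, h, hpc₁, hc₁, hm₁, hi₁, ht₁⟩ := ih (by omega)
      have hiZ : (i : ℤ) ≤ Z := by have : (i : ℤ) ≤ n := by exact_mod_cast (by omega)
                                   linarith
      have him : (i : ℤ) < m := by omega
      have hmt : c₁.mem (temp t) = m := hm₁ t le_rfl
      rw [← hpc₁] at hP
      obtain ⟨k1, hk1, h⟩ := BinOp.sub.step_instr (Z := Z) h hP.head
        (by rw [hmt]; linarith)
        (by rw [hi₁, abs_of_nonneg (by positivity)]; linarith)
      have h := h.tail hP.tail.head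
      simp only [Instr.exec, Config.assign, Function.update_self, BinOp.eval, hmt, hi₁,
        if_neg (show ¬ m - (i : ℤ) ≤ 0 by omega)] at h
      have hk2 : bits (m - (i : ℤ)) ≤ unitCost Z := le_unitCost (bits_mono (by
        rw [abs_of_nonneg (by omega)]; linarith))
      obtain ⟨k3, hk3, h⟩ := step_const (Z := Z) h hP.tail.tail.head (by simp; linarith)
      obtain ⟨k4, hk4, h⟩ := BinOp.add.step_instr (Z := Z) h hP.tail.tail.tail.head
        (by simp [Config.assign, temp_inj, hi₁]; linarith)
        (by simp [Config.assign]; linarith)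
      simp only [Config.assign, Function.update_self, BinOp.eval] at h
      generalize hd : Config.mk _ _ _ _ = d at h
      obtain ⟨c₂, h₂, hpc₂, hc₂, hm₂, ht₂⟩ := hb ((iter f s i).setVar x i) d (hs i (by omega))
        (by simp [← hd, hpc₁]) (hc₁.setVar (z := (i : ℤ)) (x := x)
          (fun r hr => by
            rw [← hd]
            simp only [Function.update_apply, hr, if_false, temp_inj]
            simp [hi₁]) (by simp [← hd]))
      subst hd
      have h := h.trans h₂
      have hP' := hP.tail.tail.tail.tail.right
      rw [hpc₁] at hP'
      have e4 : p + 1 + 1 + 1 + 1 + (b.compile (t + 2) (p + 4)).length = c₂.pc := by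
        rw [hpc₂]
      rw [e4] at hP'
      have hi₂ : c₂.mem (temp (t + 1)) = i := by
        rw [hm₂ _ (by omega)]
        simp [temp_inj, (temp_ne_var _ _).symm, hi₁]
      obtain ⟨k5, hk5, h⟩ := step_const (Z := Z) h hP'.head (by simp; linarith)
      obtain ⟨k6, hk6, h⟩ := BinOp.add.step_instr (Z := Z) h hP'.tail.head
        (by simp [Config.assign, temp_inj, hi₂]; linarith)
        (by simp [Config.assign]; linarith)
      obtain ⟨k7, hk7, h⟩ := step_const (Z := Z) h hP'.tail.tail.head (by simp; linarith)
      have h := h.tail hP'.tail.tail.tail.head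
      simp only [Instr.exec, Config.assign, Function.update_self, BinOp.eval, le_refl,
        if_true] at h
      have hk8 : bits 0 ≤ unitCost Z := le_unitCost (bits_mono (by simp; linarith))
      refine ⟨_, h, rfl, ?_, fun u hu => ?_, ?_, ?_⟩
      · refine hc₂.congr (t := 0) (fun r hr => ?_) rfl
        simp [Function.update_apply, hr]
      · have h1 : u ≠ t + 1 := by omega
        have h2 : u ≠ t + 2 := by omega
        simp only [Function.update_apply, temp_inj, h1, h2, if_false]
        rw [hm₂ u (by omega)]
        simp only [Function.update_apply, temp_inj, h2, if_false, (temp_ne_var _ _).symm]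
        exact hm₁ u hu
      · simp [temp_inj, hi₂]
      · simp only at ht₂ ⊢
        rw [add_one_mul]
        omega
  obtain ⟨c₁, h, hpc₁, hc₁, hm₁, hi₁, ht₁⟩ := key n le_rfl
  have hmt : c₁.mem (temp t) = m := hm₁ t le_rfl
  rw [← hpc₁] at hP
  obtain ⟨k1, hk1, h⟩ := BinOp.sub.step_instr (Z := Z) h hP.head
    (by rw [hmt]; linarith)
    (by rw [hi₁, abs_of_nonneg (by positivity)]; linarith)
  have h := h.tail hP.tail.head
  simp only [Instr.exec, Config.assign, Function.update_self, BinOp.eval, hmt, hi₁,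
    if_pos (show m - (n : ℤ) ≤ 0 by omega)] at h
  have hk2 : bits (m - (n : ℤ)) ≤ unitCost Z := le_unitCost (bits_mono (by
    rw [abs_le]; constructor <;> linarith))
  refine ⟨_, h, ?_, ?_, fun u hu => ?_, ?_⟩
  · simp [hpc₁]
  · refine hc₁.congr (t := 0) (fun r hr => ?_) rfl
    simp [hr]
  · have h2 : u ≠ t + 2 := by omega
    simp only [Function.update_apply, temp_inj, h2, if_false]
    exact hm₁ u hu.le
  · simp only
    omega

/-- Induction on the command. Preservation of the temporaries below `t` is part of the claim,
because an enclosing loop keeps its bound and counter there. -/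
theorem Cmd.sim {P : Program} (b : Cmd) :
    ∀ (t : ℕ) (s : Store) (T : ℕ) (c : Config), At P c.pc (b.compile t c.pc) → Rep s c →
    b.Safe inp s T →
    ∃ c', Reach inp P c c' ∧ c'.pc = c.pc + (b.compile t c.pc).length ∧
      Rep (b.eval inp s) c' ∧ (∀ u < t, c'.mem (temp u) = c.mem (temp u)) ∧
      c'.time ≤ c.time + T := by
  induction b with
  | assign x e =>
    intro t s T c hP hc ⟨Z, hf, hT⟩
    obtain ⟨c', h, hpc, ho, hv, hm, ht⟩ := e.sim t c hP.left hc hf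
    have hZ := hf.abs_eval_le
    have hZ0 := (abs_nonneg _).trans hZ
    have hP' := hP.right
    rw [Expr.length_compile, ← hpc] at hP'
    obtain ⟨k1, hk1, h⟩ := step_const (Z := Z) h hP'.head (by simp; linarith)
    obtain ⟨k2, hk2, h⟩ := BinOp.add.step_instr (Z := Z) h hP'.tail.head
      (by simp [Config.assign, temp_inj, hv]; linarith) (by simp [Config.assign]; linarith)
    refine ⟨_, h, ?_, ?_, fun u hu => ?_, ?_⟩
    · simp [Config.assign, hpc, Cmd.compile, Expr.length_compile]; ring
    · refine hc.setVar (fun r hr => ?_) (by simp [Config.assign, ho])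
      have := hm r fun u _ => hr u
      simp only [Config.assign, BinOp.eval, Function.update_apply, hr, if_false, temp_inj,
        Nat.left_eq_add, one_ne_zero, if_true, hv, add_zero, this]
    · simp only [Config.assign, Function.update_apply, (temp_ne_var _ _).symm, if_false, temp_inj]
      rw [if_neg (by omega), hm _ fun v hv => by rw [ne_eq, temp_inj]; omega]
    · simp only [Config.assign]
      nlinarith
  | store a e f =>
    intro t s T c hP hc ⟨Z, hf, hpos, hf', hT⟩
    obtain ⟨c₁, h₁, hpc₁, ho₁, hv₁, hm₁, ht₁⟩ := e.sim t c hP.left hc hf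
    have hP' := hP.right
    rw [Expr.length_compile, ← hpc₁] at hP'
    obtain ⟨c₂, h₂, hpc₂, ho₂, hv₂, hm₂, ht₂⟩ :=
      f.sim (t + 1) c₁ hP'.left (hc.congr hm₁ ho₁) hf'
    have hP' := hP'.right
    rw [Expr.length_compile, ← hpc₂] at hP'
    have hv₁' : c₂.mem (temp t) = e.eval inp s := by
      rw [hm₂ _ fun u hu => by rw [ne_eq, temp_inj]; omega, hv₁]
    have hZ := hf.abs_eval_le
    have hZ' := hf'.abs_eval_le
    have hZ0 := (abs_nonneg _).trans hZ
    have ha : (a : ℕ) < 4 := a.2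
    have h := h₁.trans h₂
    obtain ⟨k1, hk1, h⟩ := step_const (Z := Z) h hP'.head (by simp; linarith)
    obtain ⟨k2, hk2, h⟩ := BinOp.mul.step_instr (Z := Z) h hP'.tail.head
      (by simp [Config.assign, temp_inj, hv₁']; linarith) (by simp [Config.assign]; linarith)
    obtain ⟨k3, hk3, h⟩ := step_const (Z := Z) h hP'.tail.tail.head
      (by rw [abs_of_nonneg (by positivity)]; linarith [(Nat.cast_lt (α := ℤ)).2 ha])
    have hidx : |e.eval inp s * 16| ≤ 16 * Z := by rw [abs_mul]; simp; linarith
    obtain ⟨k4, hk4, h⟩ := BinOp.add.step_instr (Z := Z) h hP'.tail.tail.tail.head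
      (by simp [Config.assign, temp_inj, hv₁', BinOp.eval]; linarith)
      (by simp only [Config.assign, Function.update_self]
          rw [abs_of_nonneg (by positivity)]; linarith [(Nat.cast_lt (α := ℤ)).2 ha])
    have h := h.tail hP'.tail.tail.tail.tail.head
    have hsum : e.eval inp s * 16 + (8 + ((a : ℕ) : ℤ)) =
        ((16 * (e.eval inp s).toNat + 8 + (a : ℕ) : ℕ) : ℤ) := by
      push_cast; rw [Int.toNat_of_nonneg hpos]; ring
    have hb : bits (e.eval inp s * 16 + (8 + ((a : ℕ) : ℤ))) +
        bits (f.eval inp s) ≤ unitCost Z := by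
      refine add_le_unitCost (bits_mono ?_) (bits_mono (by linarith))
      calc _ ≤ |e.eval inp s * 16| + |8 + ((a : ℕ) : ℤ)| := abs_add_le _ _
        _ ≤ 16 * Z + 12 := by
          rw [abs_of_nonneg (a := 8 + ((a : ℕ) : ℤ)) (by positivity)]
          linarith [(Nat.cast_lt (α := ℤ)).2 ha]
        _ ≤ _ := by linarith
    simp only [Config.assign, Instr.exec, BinOp.eval, Function.update_self, temp_inj, ne_eq,
      Nat.left_eq_add, Nat.add_left_cancel_iff, OfNat.one_ne_ofNat, OfNat.ofNat_ne_zero,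
      not_false_eq_true, Function.update_of_ne, hv₁', hv₂,
      show ¬ t + 1 = t by omega] at h
    rw [hsum] at hb h
    rw [Int.toNat_natCast] at h
    refine ⟨_, h, ?_, ?_, fun u hu => ?_, ?_⟩
    · simp [hpc₁, hpc₂, Cmd.compile, Expr.length_compile]; ring
    · refine hc.setArr (fun r hr => ?_) (by simp [ho₁, ho₂])
      have h1 := hm₁ r fun u _ => hr u
      have h2 := hm₂ r fun u _ => hr u
      simp only [Function.update_apply, hr, if_false, h1, h2]
    · simp only [Function.update_apply, (temp_ne_arr _ _ _).symm, if_false, temp_inj]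
      rw [if_neg (by omega), if_neg (by omega), if_neg (by omega), if_neg (by omega),
        hm₂ _ fun v hv => by rw [ne_eq, temp_inj]; omega,
        hm₁ _ fun v hv => by rw [ne_eq, temp_inj]; omega]
    · simp only
      nlinarith
  | write e =>
    intro t s T c hP hc ⟨Z, hf, hT⟩
    obtain ⟨c', h, hpc, ho, hv, hm, ht⟩ := e.sim t c hP.left hc hf
    have hZ := hf.abs_eval_le
    have hP' := hP.right
    rw [Expr.length_compile, ← hpc] at hP'
    have h := h.tail hP'.head
    have hb : bits (e.eval inp s) ≤ unitCost Z :=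
      le_unitCost (bits_mono (by linarith [(abs_nonneg _).trans hZ]))
    have hr := hc.congr hm ho
    refine ⟨_, h, ?_, ⟨hr.var, hr.arr, ?_⟩, fun u hu => ?_, ?_⟩
    · simp [Instr.exec, hpc, Cmd.compile, Expr.length_compile]; ring
    · simp [Instr.exec, hr.out, hv, Cmd.eval]
    · exact hm _ fun v hv => by rw [ne_eq, temp_inj]; omega
    · simp only [Instr.exec, hv]
      nlinarith
  | seq b d ihb ihd =>
    intro t s T c hP hc ⟨T₁, T₂, hb, hd, hT⟩
    obtain ⟨c₁, h₁, hpc₁, hc₁, hm₁, ht₁⟩ := ihb t s T₁ c hP.left hc hb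
    have hP' := hP.right
    rw [← hpc₁] at hP'
    obtain ⟨c₂, h₂, hpc₂, hc₂, hm₂, ht₂⟩ := ihd t _ T₂ c₁ hP' hc₁ hd
    refine ⟨c₂, h₁.trans h₂, ?_, hc₂, fun u hu => (hm₂ u hu).trans (hm₁ u hu), by omega⟩
    simp only [Cmd.compile, List.length_append]
    rw [hpc₂, ← hpc₁]; omega
  | loop x e b ih =>
    intro t s T c hP hc ⟨Z, U, hf, hs, hT⟩
    obtain ⟨c', h, hpc, ho, hv, hm, ht⟩ := e.sim t c hP.left hc hf
    have hZ := hf.abs_eval_le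
    have hZ0 := (abs_nonneg _).trans hZ
    have hP' := hP.right
    rw [Expr.length_compile, ← hpc] at hP'
    obtain ⟨k1, hk1, h⟩ := step_const (Z := Z) h hP'.head (by simp; linarith)
    obtain ⟨c₁, h₁, hpc₁, hc₁, hm₁, ht₁⟩ := Cmd.sim_loop (inp := inp) (s := s) (Z := Z) (x := x)
      (b := b) (t := t) (p := c'.pc + 1) (n := (e.eval inp s).toNat) (U := U)
      (c := c'.assign (temp (t + 1)) 0 k1) hP'.tail
      (by
        intro s' d hd hdpc hrep
        have := ih (t + 2) s' U d (by
          rw [hdpc]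
          exact hP'.tail.tail.tail.tail.tail.left) hrep hd
        rw [hdpc] at this
        exact this)
      (by have := le_abs_self (e.eval inp s); omega)
      hs rfl
      ((hc.congr hm ho).congr (t := 0) (fun r hr => by simp [Config.assign, hr]) rfl)
      (by simp [Config.assign, temp_inj, hv]) (by simp [Config.assign, temp_inj, hv, hZ])
      (by simp [Config.assign])
    refine ⟨c₁, h.trans h₁, ?_, hc₁, fun u hu => ?_, ?_⟩
    · rw [hpc₁]
      simp [Cmd.compile, Expr.length_compile, hpc]; ring
    · rw [hm₁ u hu]
      simp only [Config.assign, Function.update_apply, temp_inj]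
      rw [if_neg (by omega), hm _ fun v hv => by rw [ne_eq, temp_inj]; omega]
    · simp only [Config.assign] at ht₁
      nlinarith

/-- The store at the start. -/
def Store.init : Store := ⟨fun _ => 0, fun _ _ => 0, []⟩

/-- This is the only bridge back to the machine: from here on, it suffices to reason about the
semantics and the cost bound of commands. -/
theorem Cmd.computesWithin (b : Cmd) {T : ℕ} {X : ℝ} (h : b.Safe inp Store.init T)
    (hX : (T : ℝ) ≤ X) :
    ComputesWithin (b.compile 0 0) inp (b.eval inp Store.init).out X := by
  obtain ⟨c, ⟨n, hn⟩, hpc, hc, -, ht⟩ := b.sim (inp := inp) (P := b.compile 0 0) 0 Store.init T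
    start ⟨[], [], by simp [start]⟩ ⟨fun _ => rfl, fun _ _ => rfl, rfl⟩ h
  refine ⟨n, ?_, ?_, ?_⟩ <;> rw [hn]
  · rw [hpc]; simp [start]
  · exact hc.out
  · exact le_trans (by exact_mod_cast (by simpa [start] using ht)) hX

end RAM

/-! ### Size of the Bézout coefficients -/

/-- Consecutive cofactors have opposite signs, so `|s' - q * s| = |s'| + q * |s|`. Therefore `|s| *
r' + |s'| * r` is unchanged by a step of the Euclidean algorithm, and it bounds the next cofactor as
long as the remainder is positive. The same argument serves both cofactor sequences. -/
theorem Nat.abs_xgcdAux_le (Y : ℤ) (r : ℕ) : ∀ (s t : ℤ) (r' : ℕ) (s' t' : ℤ),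
    (|s| ≤ Y ∧ |s'| ≤ Y ∧ s * s' ≤ 0 ∧ |s| * r' + |s'| * r ≤ Y →
      |(Nat.xgcdAux r s t r' s' t').2.1| ≤ Y) ∧
    (|t| ≤ Y ∧ |t'| ≤ Y ∧ t * t' ≤ 0 ∧ |t| * r' + |t'| * r ≤ Y →
      |(Nat.xgcdAux r s t r' s' t').2.2| ≤ Y) := by
  have key : ∀ (r r' : ℕ) (s s' : ℤ), 0 < r →
      |s| ≤ Y ∧ |s'| ≤ Y ∧ s * s' ≤ 0 ∧ |s| * r' + |s'| * r ≤ Y →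
      |s' - r' / r * s| ≤ Y ∧ |s| ≤ Y ∧ (s' - r' / r * s) * s ≤ 0 ∧
        |s' - r' / r * s| * r + |s| * (r' % r : ℕ) ≤ Y := by
    rintro r r' s s' hr ⟨h1, h2, h3, h4⟩
    have hq : (0 : ℤ) ≤ r' / r := by positivity
    have hdiv : (r : ℤ) * (r' / r) + (r' % r : ℕ) = r' := by
      push_cast; exact Int.mul_ediv_add_emod _ _
    generalize (r' / r : ℤ) = q at *
    have hs : |s' - q * s| = |s'| + q * |s| := by
      rcases le_total 0 s with h | h
      · rw [abs_of_nonneg h]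
        rcases h.eq_or_lt with rfl | h
        · simp
        · have : s' ≤ 0 := by nlinarith
          rw [abs_of_nonpos this, abs_of_nonpos (by nlinarith)]; ring
      · rw [abs_of_nonpos h]
        rcases h.eq_or_lt with rfl | h
        · simp
        · have : 0 ≤ s' := by nlinarith
          rw [abs_of_nonneg this, abs_of_nonneg (by nlinarith)]; ring
    have hr' : (1 : ℤ) ≤ r := by exact_mod_cast hr
    have hm : (0 : ℤ) ≤ (r' % r : ℕ) := by positivity
    have h5 : |s' - q * s| * r + |s| * (r' % r : ℕ) ≤ Y := by
      rw [hs]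
      calc _ = |s| * (r * q + (r' % r : ℕ)) + |s'| * r := by ring
        _ ≤ Y := by rw [hdiv]; exact h4
    refine ⟨?_, h1, by nlinarith [mul_nonneg hq (mul_self_nonneg s)], h5⟩
    have := mul_nonneg (abs_nonneg s) hm
    nlinarith [abs_nonneg (s' - q * s)]
  induction r using Nat.strong_induction_on with
  | _ r ih =>
    intro s t r' s' t'
    rcases r.eq_zero_or_pos with rfl | hr
    · rw [Nat.xgcd_zero_left]
      exact ⟨fun h => h.2.1, fun h => h.2.1⟩
    · rw [Nat.xgcdAux_rec hr]
      have := ih _ (Nat.mod_lt r' hr) (s' - r' / r * s) (t' - r' / r * t) r s t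
      exact ⟨fun h => this.1 (key r r' s s' hr h), fun h => this.2 (key r r' t t' hr h)⟩

theorem Int.abs_gcdA_le {a b : ℤ} (ha : 0 ≤ a) (hb : 0 ≤ b) : |Int.gcdA a b| ≤ b + 1 := by
  lift a to ℕ using ha
  lift b to ℕ using hb
  -- At the start the invariant has the value `b`. The `+ 1` is needed for `b = 0`, where the
  -- initial cofactor is `1`.
  exact (Nat.abs_xgcdAux_le (b + 1) a 1 0 b 0 1).1
    ⟨by simp, by simp; positivity, by simp, by simp⟩

theorem Int.abs_gcdB_le {a b : ℤ} (ha : 0 ≤ a) (hb : 0 ≤ b) : |Int.gcdB a b| ≤ a + 1 := by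
  lift a to ℕ using ha
  lift b to ℕ using hb
  exact (Nat.abs_xgcdAux_le (a + 1) a 1 0 b 0 1).2
    ⟨by simp; positivity, by simp, by simp, by simp⟩

/-! ### Lattices of integer vectors -/

namespace RowLattice

/-- The `i`-th row of a matrix with `w` columns whose entries are stored row by row. -/
def rowVec (A : ℕ → ℤ) (w i : ℕ) : ℕ → ℤ := fun t => if t < w then A (i * w + t) else 0

/-- The vectors that are divisible by `g` and supported on the coordinates below `j`. -/
def modLat (g : ℤ) (j : ℕ) : Submodule ℤ (ℕ → ℤ) where
  carrier := {x | (∀ t, g ∣ x t) ∧ ∀ t, j ≤ t → x t = 0}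
  zero_mem' := by simp
  add_mem' := fun {x y} hx hy => ⟨fun t => dvd_add (hx.1 t) (hy.1 t),
    fun t ht => by simp [hx.2 t ht, hy.2 t ht]⟩
  smul_mem' := fun c x hx => ⟨fun t => by simpa using (hx.1 t).mul_left c,
    fun t ht => by simp [hx.2 t ht]⟩

/-- The lattice generated by `n` rows and the multiples of `g` below the coordinate `j`. -/
def genLat (V : ℕ → ℤ) (w n : ℕ) (g : ℤ) (j : ℕ) : Submodule ℤ (ℕ → ℤ) :=
  Submodule.span ℤ {x | ∃ i < n, rowVec V w i = x} ⊔ modLat g j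

theorem genLat_le {V : ℕ → ℤ} {w n : ℕ} {g : ℤ} {j : ℕ} {N : Submodule ℤ (ℕ → ℤ)} :
    genLat V w n g j ≤ N ↔ (∀ i < n, rowVec V w i ∈ N) ∧ modLat g j ≤ N := by
  rw [genLat, sup_le_iff, Submodule.span_le]
  refine and_congr_left fun _ => ⟨fun h i hi => h ⟨i, hi, rfl⟩, ?_⟩
  rintro h _ ⟨i, hi, rfl⟩
  exact h i hi

theorem rowVec_mem_genLat {V : ℕ → ℤ} {w n : ℕ} {g : ℤ} {j i : ℕ} (hi : i < n) :
    rowVec V w i ∈ genLat V w n g j := (genLat_le.1 le_rfl).1 i hi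

theorem modLat_le_genLat {V : ℕ → ℤ} {w n : ℕ} {g : ℤ} {j : ℕ} :
    modLat g j ≤ genLat V w n g j := (genLat_le.1 le_rfl).2

theorem modLat_mono {g : ℤ} {i j : ℕ} (h : i ≤ j) : modLat g i ≤ modLat g j :=
  fun _ hx => ⟨hx.1, fun t ht => hx.2 t (h.trans ht)⟩

theorem pivot_le {P : ℕ → ℤ} {V : ℕ → ℤ} {w n : ℕ} {g : ℤ} {j : ℕ}
    {N : Submodule ℤ (ℕ → ℤ)} :
    Submodule.span ℤ {P} ⊔ genLat V w n g j ≤ N ↔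
      P ∈ N ∧ (∀ i < n, rowVec V w i ∈ N) ∧ modLat g j ≤ N := by
  rw [sup_le_iff, genLat_le, Submodule.span_singleton_le_iff_mem]

/-- The lattice does not change in an elimination step with the pivot row `P` and the `i`-th
generator. -/
theorem bezout_step {P P' V V' : ℕ → ℤ} {w n i c : ℕ} {g : ℤ} (hi : i < n)
    (hV : ∀ j < n, j ≠ i → rowVec V' w j = rowVec V w j)
    {u v p q : ℤ} (hdet : u * p + v * q = 1)
    (hP' : P' - (u • P + v • rowVec V w i) ∈ modLat g c)
    (hW' : rowVec V' w i - (p • rowVec V w i - q • P) ∈ modLat g c) :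
    Submodule.span ℤ {P'} ⊔ genLat V' w n g c = Submodule.span ℤ {P} ⊔ genLat V w n g c := by
  set W := rowVec V w i with hW
  set W' := rowVec V' w i with hW'd
  apply le_antisymm
  · rw [pivot_le]
    set N := Submodule.span ℤ {P} ⊔ genLat V w n g c
    obtain ⟨hP, hr, hm⟩ := (pivot_le (N := N)).1 le_rfl
    refine ⟨?_, fun j hj => ?_, hm⟩
    · have := N.add_mem (hm hP') (N.add_mem (N.smul_mem u hP) (N.smul_mem v (hr i hi)))
      simpa [hW] using this
    · by_cases hji : j = i
      · subst hji
        have := N.add_mem (hm hW') (N.sub_mem (N.smul_mem p (hr j hi)) (N.smul_mem q hP))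
        simpa [hW, hW'd] using this
      · rw [hV j hj hji]; exact hr j hj
  · rw [pivot_le]
    set N := Submodule.span ℤ {P'} ⊔ genLat V' w n g c
    obtain ⟨hP, hr, hm⟩ := (pivot_le (N := N)).1 le_rfl
    -- The step is unimodular up to multiples of `g`: the matrix with the rows `(u, v)` and `(-q,
    -- p)` has determinant `u * p + v * q = 1`, and its inverse recovers `P` and the old row from
    -- the new ones.
    have e1 : P = (p • P' - v • W') - (p • (P' - (u • P + v • W)) -
        v • (W' - (p • W - q • P))) := by
      have : P = (u * p + v * q) • P := by rw [hdet, one_smul]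
      ext t
      have := congrFun this t
      simp only [Pi.sub_apply, Pi.add_apply, Pi.smul_apply, smul_eq_mul] at this ⊢
      linarith
    have e2 : W = (q • P' + u • W') - (q • (P' - (u • P + v • W)) +
        u • (W' - (p • W - q • P))) := by
      have : W = (u * p + v * q) • W := by rw [hdet, one_smul]
      ext t
      have := congrFun this t
      simp only [Pi.sub_apply, Pi.add_apply, Pi.smul_apply, smul_eq_mul] at this ⊢
      linarith
    refine ⟨?_, fun j hj => ?_, hm⟩
    · rw [e1]
      exact N.sub_mem (N.sub_mem (N.smul_mem p hP) (N.smul_mem v (hr i hi)))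
        (N.sub_mem (N.smul_mem p (hm hP')) (N.smul_mem v (hm hW')))
    · by_cases hji : j = i
      · subst hji
        rw [← hW, e2]
        exact N.sub_mem (N.add_mem (N.smul_mem q hP) (N.smul_mem u (hr j hi)))
          (N.add_mem (N.smul_mem q (hm hP')) (N.smul_mem u (hm hW')))
      · rw [← hV j hj hji]; exact hr j hj

/-- The multiples of `g` in the coordinate `c` are traded for an explicit pivot row. So the
elimination starts with a nonzero pivot whatever the generators are, and the pivot can only shrink
to divisors of `g`. Afterwards the coordinate `c` must be treated exactly and only those below `c`
modulo `g`. -/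
theorem pivot_init {V : ℕ → ℤ} {w n c : ℕ} {g : ℤ} :
    Submodule.span ℤ {Pi.single c g} ⊔ genLat V w n g c = genLat V w n g (c + 1) := by
  apply le_antisymm
  · rw [pivot_le]
    refine ⟨modLat_le_genLat ⟨fun t => ?_, fun t ht => ?_⟩, fun i hi => rowVec_mem_genLat hi,
      (modLat_mono (Nat.le_succ c)).trans modLat_le_genLat⟩
    · by_cases h : t = c
      · subst h; simp
      · simp [h]
    · simp [show t ≠ c by omega]
  · rw [genLat_le]
    set N := Submodule.span ℤ {Pi.single c g} ⊔ genLat V w n g c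
    obtain ⟨hP, hr, hm⟩ := (pivot_le (N := N)).1 le_rfl
    refine ⟨hr, fun x hx => ?_⟩
    obtain ⟨k, hk⟩ := hx.1 c
    have : x - k • Pi.single c g ∈ modLat g c := by
      refine ⟨fun t => ?_, fun t ht => ?_⟩
      · refine dvd_sub (hx.1 t) ?_
        by_cases h : t = c
        · subst h; simp
        · simp [h]
      · rcases ht.eq_or_lt with rfl | ht
        · simp [hk, mul_comm]
        · simp [hx.2 t ht, show t ≠ c by omega]
    have := N.add_mem (hm this) (N.smul_mem k hP)
    simpa using this

theorem genLat_zero_of_le {V : ℕ → ℤ} {w n c j : ℕ} {g : ℤ} (hj : j ≤ c)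
    (h : ∀ i < n, ∀ t, c ≤ t → rowVec V w i t = 0) {x : ℕ → ℤ} (hx : x ∈ genLat V w n g j)
    {t : ℕ} (ht : c ≤ t) : x t = 0 := by
  let N : Submodule ℤ (ℕ → ℤ) := LinearMap.ker (LinearMap.proj (R := ℤ) (φ := fun _ => ℤ) t)
  have : genLat V w n g j ≤ N :=
    genLat_le.2 ⟨fun i hi => h i hi t ht, fun y hy => hy.2 t (hj.trans ht)⟩
  exact this hx

/-- After all generators have been cleared in the coordinate `c`. -/
theorem pivot_final {P V : ℕ → ℤ} {w n c : ℕ} {g : ℤ} (hP : 0 < P c)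
    (hV : ∀ i < n, ∀ t, c ≤ t → rowVec V w i t = 0) :
    (∀ x ∈ Submodule.span ℤ {P} ⊔ genLat V w n g c, P c ∣ x c) ∧
    ∀ x, (x ∈ Submodule.span ℤ {P} ⊔ genLat V w n g c ∧ ∀ t, c ≤ t → x t = 0) ↔
      x ∈ genLat V w n g c := by
  refine ⟨fun x hx => ?_, fun x => ⟨fun ⟨hx, h0⟩ => ?_, fun hx =>
    ⟨Submodule.mem_sup_right hx, fun t ht => genLat_zero_of_le le_rfl hV hx ht⟩⟩⟩
  · obtain ⟨y, hy, z, hz, rfl⟩ := Submodule.mem_sup.1 hx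
    obtain ⟨k, rfl⟩ := Submodule.mem_span_singleton.1 hy
    simp [genLat_zero_of_le le_rfl hV hz le_rfl]
  · obtain ⟨y, hy, z, hz, rfl⟩ := Submodule.mem_sup.1 hx
    obtain ⟨k, rfl⟩ := Submodule.mem_span_singleton.1 hy
    have := h0 c le_rfl
    simp only [Pi.add_apply, Pi.smul_apply, smul_eq_mul,
      genLat_zero_of_le le_rfl hV hz le_rfl, add_zero, mul_eq_zero, hP.ne', or_false] at this
    simpa [this] using hz

/-- The `i`-th row of `R` is a possible `i`-th row of a triangular basis of `Λ`. -/
structure IsPivotRow (Λ : Submodule ℤ (ℕ → ℤ)) (R : ℕ → ℤ) (w i : ℕ) : Prop where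
  mem : rowVec R w i ∈ Λ
  upper : ∀ t, i < t → t < w → R (i * w + t) = 0
  pos : 0 < R (i * w + i)
  dvd : ∀ x ∈ Λ, (∀ t, i < t → x t = 0) → R (i * w + i) ∣ x i

theorem IsPivotRow.congr {Λ : Submodule ℤ (ℕ → ℤ)} {R R' : ℕ → ℤ} {w i : ℕ} (hi : i < w)
    (h : IsPivotRow Λ R w i) (he : ∀ t < w, R' (i * w + t) = R (i * w + t)) :
    IsPivotRow Λ R' w i := by
  have : rowVec R' w i = rowVec R w i := by
    ext t; unfold rowVec; split_ifs with ht
    · exact he t ht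
    · rfl
  exact ⟨this ▸ h.mem, fun t h1 h2 => (he t h2).trans (h.upper t h1 h2), he i hi ▸ h.pos,
    he i hi ▸ h.dvd⟩

theorem IsPivotRow.of_sub_mem {Λ : Submodule ℤ (ℕ → ℤ)} {R R' : ℕ → ℤ} {w i : ℕ} (hi : i < w)
    (h : IsPivotRow Λ R w i) (he : ∀ t, i ≤ t → t < w → R' (i * w + t) = R (i * w + t))
    (hm : rowVec R' w i - rowVec R w i ∈ Λ) : IsPivotRow Λ R' w i := by
  refine ⟨?_, fun t h1 h2 => (he t h1.le h2).trans (h.upper t h1 h2), he i le_rfl hi ▸ h.pos,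
    he i le_rfl hi ▸ h.dvd⟩
  simpa using Λ.add_mem hm h.mem

/-- A vector with last nonzero coordinate `i` has there a multiple of the `i`-th diagonal entry;
subtracting that multiple of the row and descending exhausts the vector. Allowing `d < w` is what
makes triangularization compute kernels: the first `d` rows span the lattice vectors that vanish
from the coordinate `d` on. -/
theorem mem_span_rows {Λ : Submodule ℤ (ℕ → ℤ)} {R : ℕ → ℤ} {w d : ℕ} (hd : d ≤ w)
    (h : ∀ i < d, IsPivotRow Λ R w i) (x : ℕ → ℤ) :
    (x ∈ Λ ∧ ∀ t, d ≤ t → x t = 0) ↔ x ∈ Submodule.span ℤ {x | ∃ i < d, rowVec R w i = x} := by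
  constructor
  · rintro ⟨hx, h0⟩
    induction d generalizing x with
    | zero => rw [show x = 0 from funext fun t => h0 t t.zero_le]; exact zero_mem _
    | succ d ih =>
      obtain ⟨k, hk⟩ := (h d (by omega)).dvd x hx fun t ht => h0 t ht
      have h1 := ih (by omega) (fun i hi => h i (by omega)) (x - k • rowVec R w d)
        (Λ.sub_mem hx (Λ.smul_mem _ (h d (by omega)).mem)) (fun t ht => by
          rcases ht.eq_or_lt with rfl | ht
          · simp [rowVec, show d < w by omega, hk, mul_comm]
          · simp only [Pi.sub_apply, h0 t ht, Pi.smul_apply, rowVec, smul_eq_mul, zero_sub,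
              neg_eq_zero, mul_eq_zero]
            right
            split_ifs with h2
            · exact (h d (by omega)).upper t ht h2
            · rfl)
      have h2 : {x | ∃ i < d, rowVec R w i = x} ⊆ {x | ∃ i < d + 1, rowVec R w i = x} := by
        rintro _ ⟨i, hi, rfl⟩; exact ⟨i, by omega, rfl⟩
      have := Submodule.add_mem _ (Submodule.span_mono h2 h1)
        (Submodule.smul_mem _ k (Submodule.subset_span ⟨d, by omega, rfl⟩))
      simpa using this
  · intro hx
    induction hx using Submodule.span_induction with
    | mem x hx =>
      obtain ⟨i, hi, rfl⟩ := hx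
      refine ⟨(h i hi).mem, fun t ht => ?_⟩
      unfold rowVec
      split_ifs with h2
      · exact (h i hi).upper t (by omega) h2
      · rfl
    | zero => exact ⟨zero_mem _, fun _ _ => rfl⟩
    | add x y _ _ hx hy => exact ⟨add_mem hx.1 hy.1, fun t ht => by simp [hx.2 t ht, hy.2 t ht]⟩
    | smul a x _ hx => exact ⟨Λ.smul_mem a hx.1, fun t ht => by simp [hx.2 t ht]⟩

end RowLattice

namespace RAM

/-! ### A program logic -/

/-- The absolute value of `x` is at most `Z`. -/
def Small (Z x : ℤ) : Prop := |x| ≤ Z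

theorem small_of_nonneg {Z x : ℤ} (h : 0 ≤ x) (h' : x ≤ Z) : Small Z x := by
  unfold Small; rwa [abs_of_nonneg h]

theorem Small.mono {Z Y x : ℤ} (h : Small Y x) (hZ : Y ≤ Z) : Small Z x := le_trans h hZ

theorem Small.mul {A B x y : ℤ} (hx : Small A x) (hy : Small B y) : Small (A * B) (x * y) := by
  unfold Small at *
  rw [abs_mul]
  exact mul_le_mul hx hy (abs_nonneg _) ((abs_nonneg _).trans hx)

theorem Small.add {A B x y : ℤ} (hx : Small A x) (hy : Small B y) : Small (A + B) (x + y) :=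
  (abs_add_le x y).trans (add_le_add hx hy)

theorem Small.sub {A B x y : ℤ} (hx : Small A x) (hy : Small B y) : Small (A + B) (x - y) :=
  (abs_sub x y).trans (add_le_add hx hy)

theorem small_emod {Z g : ℤ} (x : ℤ) (hg : 0 < g) (h : g ≤ Z) : Small Z (x % g) :=
  small_of_nonneg (Int.emod_nonneg _ hg.ne') ((Int.emod_lt_of_pos _ hg).le.trans h)

instance : Add Expr := ⟨.bin .add⟩
instance : Sub Expr := ⟨.bin .sub⟩
instance : Mul Expr := ⟨.bin .mul⟩
instance : Div Expr := ⟨.bin .div⟩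
instance : Mod Expr := ⟨.bin .mod⟩
instance (n : ℕ) : OfNat Expr n := ⟨.const n⟩

section
variable (inp : List ℤ) (Z : ℤ) (s : Store) (e f : Expr)

namespace Expr

@[simp] theorem eval_zero : eval inp s (0 : Expr) = 0 := rfl
@[simp] theorem eval_one : eval inp s (1 : Expr) = 1 := rfl
@[simp] theorem eval_var (x : ℕ) : eval inp s (.var x) = s.var x := rfl
@[simp] theorem eval_arr (a : Fin 4) :
    eval inp s (.arr a e) = s.arr a (e.eval inp s).toNat := rfl
@[simp] theorem eval_inp : eval inp s (.inp e) = inp.getD (e.eval inp s).toNat 0 := rfl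
@[simp] theorem eval_bin (o : BinOp) :
    eval inp s (.bin o e f) = o.eval (e.eval inp s) (f.eval inp s) := rfl
@[simp] theorem eval_add : eval inp s (e + f) = e.eval inp s + f.eval inp s := rfl
@[simp] theorem eval_sub : eval inp s (e - f) = e.eval inp s - f.eval inp s := rfl
@[simp] theorem eval_mul : eval inp s (e * f) = e.eval inp s * f.eval inp s := rfl
@[simp] theorem eval_div : eval inp s (e / f) = e.eval inp s / f.eval inp s := rfl
@[simp] theorem eval_mod : eval inp s (e % f) = e.eval inp s % f.eval inp s := rfl

@[simp] theorem fits_zero : Fits inp Z s (0 : Expr) ↔ Small Z 0 := Iff.rfl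
@[simp] theorem fits_one : Fits inp Z s (1 : Expr) ↔ Small Z 1 := Iff.rfl
@[simp] theorem fits_var (x : ℕ) : Fits inp Z s (.var x) ↔ Small Z (s.var x) := Iff.rfl
@[simp] theorem fits_arr (a : Fin 4) : Fits inp Z s (.arr a e) ↔
    e.Fits inp Z s ∧ 0 ≤ e.eval inp s ∧ Small Z (s.arr a (e.eval inp s).toNat) := Iff.rfl
@[simp] theorem fits_inp : Fits inp Z s (.inp e) ↔
    e.Fits inp Z s ∧ Small Z (inp.getD (e.eval inp s).toNat 0) := Iff.rfl
@[simp] theorem fits_bin (o : BinOp) : Fits inp Z s (.bin o e f) ↔ e.Fits inp Z s ∧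
    f.Fits inp Z s ∧ Small Z (o.eval (e.eval inp s) (f.eval inp s)) := Iff.rfl
@[simp] theorem fits_add : Fits inp Z s (e + f) ↔ e.Fits inp Z s ∧
    f.Fits inp Z s ∧ Small Z (e.eval inp s + f.eval inp s) := Iff.rfl
@[simp] theorem fits_sub : Fits inp Z s (e - f) ↔ e.Fits inp Z s ∧
    f.Fits inp Z s ∧ Small Z (e.eval inp s - f.eval inp s) := Iff.rfl
@[simp] theorem fits_mul : Fits inp Z s (e * f) ↔ e.Fits inp Z s ∧
    f.Fits inp Z s ∧ Small Z (e.eval inp s * f.eval inp s) := Iff.rfl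
@[simp] theorem fits_div : Fits inp Z s (e / f) ↔ e.Fits inp Z s ∧
    f.Fits inp Z s ∧ Small Z (e.eval inp s / f.eval inp s) := Iff.rfl
@[simp] theorem fits_mod : Fits inp Z s (e % f) ↔ e.Fits inp Z s ∧
    f.Fits inp Z s ∧ Small Z (e.eval inp s % f.eval inp s) := Iff.rfl

@[simp] theorem size_zero : size (0 : Expr) = 1 := rfl
@[simp] theorem size_one : size (1 : Expr) = 1 := rfl
@[simp] theorem size_var (x : ℕ) : size (.var x) = 2 := rfl
@[simp] theorem size_arr (a : Fin 4) : size (.arr a e) = e.size + 5 := rfl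
@[simp] theorem size_inp : size (.inp e) = e.size + 1 := rfl
@[simp] theorem size_bin (o : BinOp) : size (.bin o e f) = e.size + f.size + 1 := rfl
@[simp] theorem size_add : size (e + f) = e.size + f.size + 1 := rfl
@[simp] theorem size_sub : size (e - f) = e.size + f.size + 1 := rfl
@[simp] theorem size_mul : size (e * f) = e.size + f.size + 1 := rfl
@[simp] theorem size_div : size (e / f) = e.size + f.size + 1 := rfl
@[simp] theorem size_mod : size (e % f) = e.size + f.size + 1 := rfl

end Expr

namespace BinOp
@[simp] theorem eval_gcd (x y : ℤ) : gcd.eval x y = Int.gcd x y := rfl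
@[simp] theorem eval_bezoutLeft (x y : ℤ) : bezoutLeft.eval x y = Int.gcdA x y := rfl
@[simp] theorem eval_bezoutRight (x y : ℤ) : bezoutRight.eval x y = Int.gcdB x y := rfl
end BinOp

namespace Store
variable (x y : ℕ) (a b : Fin 4) (i j : ℕ) (z : ℤ)
@[simp] theorem var_setVar : (s.setVar x z).var y = if y = x then z else s.var y := by
  simp [setVar, Function.update_apply]
@[simp] theorem arr_setVar : (s.setVar x z).arr = s.arr := rfl
@[simp] theorem out_setVar : (s.setVar x z).out = s.out := rfl
@[simp] theorem var_setArr : (s.setArr a i z).var = s.var := rfl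
@[simp] theorem out_setArr : (s.setArr a i z).out = s.out := rfl
theorem arr_setArr : (s.setArr a i z).arr b j =
    if b = a then if j = i then z else s.arr b j else s.arr b j := by
  unfold setArr
  by_cases h : b = a
  · subst h; simp [Function.update_apply]
  · simp [h]
@[simp] theorem arr_setArr_self : (s.setArr a i z).arr a j = if j = i then z else s.arr a j := by
  simp [arr_setArr]
@[simp] theorem arr_setArr_of_ne (h : b ≠ a) : (s.setArr a i z).arr b = s.arr b :=
  Function.update_of_ne h _ _
end Store

end

@[simp] theorem toNat_mul_add (a b c : ℕ) : ((a : ℤ) * b + c).toNat = a * b + c := by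
  rw [show (a : ℤ) * b + c = ((a * b + c : ℕ) : ℤ) by push_cast; rfl, Int.toNat_natCast]

theorem mul_add_nonneg (a b c : ℕ) : (0 : ℤ) ≤ (a : ℤ) * b + c := by positivity

namespace Cmd

/-- The variables that a command may change. -/
def vars : Cmd → List ℕ
  | .assign x _ => [x]
  | .store _ _ _ => []
  | .write _ => []
  | .seq b c => b.vars ++ c.vars
  | .loop x _ b => x :: b.vars

/-- The arrays that a command may change. -/
def arrs : Cmd → List (Fin 4)
  | .assign _ _ => []
  | .store a _ _ => [a]
  | .write _ => []
  | .seq b c => b.arrs ++ c.arrs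
  | .loop _ _ b => b.arrs

/-- The command writes no output. -/
def silent : Cmd → Bool
  | .assign _ _ => true
  | .store _ _ _ => true
  | .write _ => false
  | .seq b c => b.silent && c.silent
  | .loop _ _ b => b.silent

variable {inp : List ℤ}

/-- `s'` differs from `s` only by what `b` may change. -/
structure Frame (b : Cmd) (s s' : Store) : Prop where
  var : ∀ x, x ∉ b.vars → s'.var x = s.var x
  arr : ∀ a, a ∉ b.arrs → s'.arr a = s.arr a
  out : b.silent = true → s'.out = s.out

theorem frame_iter {x : ℕ} {e : Expr} {b : Cmd} {f : ℕ → Store → Store}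
    (hf : ∀ i s, Frame b (s.setVar x i) (f i s)) (s : Store) (n : ℕ) :
    Frame (.loop x e b) s (iter f s n) := by
  induction n with
  | zero => exact ⟨fun _ _ => rfl, fun _ _ => rfl, fun _ => rfl⟩
  | succ n ih =>
    have h := hf n (iter f s n)
    refine ⟨fun y hy => ?_, fun a ha => ?_, fun ho => ?_⟩
    · have h1 : y ≠ x := fun h => hy (by simp [vars, h])
      have h2 : y ∉ b.vars := fun h => hy (by simp [vars, h])
      rw [← ih.var y hy]
      simpa [iter, h1] using h.var y h2
    · rw [← ih.arr a ha]
      exact h.arr a ha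
    · rw [← ih.out ho]
      exact h.out ho

theorem frame_eval (b : Cmd) (s : Store) : Frame b s (b.eval inp s) := by
  induction b generalizing s with
  | assign x e =>
    refine ⟨fun y hy => ?_, fun _ _ => rfl, fun _ => rfl⟩
    have : y ≠ x := by simpa [vars] using hy
    simp [Cmd.eval, this]
  | store a e f =>
    refine ⟨fun _ _ => rfl, fun c hc => ?_, fun _ => rfl⟩
    have : c ≠ a := by simpa [arrs] using hc
    simp [Cmd.eval, this]
  | write e => exact ⟨fun _ _ => rfl, fun _ _ => rfl, fun h => by simp [silent] at h⟩
  | seq b c ihb ihc =>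
    refine ⟨fun y hy => ?_, fun a ha => ?_, fun h => ?_⟩
    · simp only [vars, List.mem_append, not_or] at hy
      exact ((ihc _).var y hy.2).trans ((ihb s).var y hy.1)
    · simp only [arrs, List.mem_append, not_or] at ha
      exact ((ihc _).arr a ha.2).trans ((ihb s).arr a ha.1)
    · simp only [silent, Bool.and_eq_true] at h
      exact ((ihc _).out h.2).trans ((ihb s).out h.1)
  | loop x e b ih => exact frame_iter (fun i s => ih _) s _

theorem Safe.mono {b : Cmd} {s : Store} {T T' : ℕ} (h : b.Safe inp s T) (hT : T ≤ T') :
    b.Safe inp s T' := by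
  cases b with
  | assign x e => obtain ⟨Z, h1, h2⟩ := h; exact ⟨Z, h1, h2.trans hT⟩
  | store a e f => obtain ⟨Z, h1, h2, h3, h4⟩ := h; exact ⟨Z, h1, h2, h3, h4.trans hT⟩
  | write e => obtain ⟨Z, h1, h2⟩ := h; exact ⟨Z, h1, h2.trans hT⟩
  | seq b c => obtain ⟨T₁, T₂, h1, h2, h3⟩ := h; exact ⟨T₁, T₂, h1, h2, h3.trans hT⟩
  | loop x e b => obtain ⟨Z, U, h1, h2, h3⟩ := h; exact ⟨Z, U, h1, h2, h3.trans hT⟩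

/-- From the store `s`, the command runs at a cost of at most `T` and ends in a store
satisfying `Q`. -/
def Spec (inp : List ℤ) (b : Cmd) (s : Store) (T : ℕ) (Q : Store → Prop) : Prop :=
  b.Safe inp s T ∧ Q (b.eval inp s)

/-- `Spec` with the cost measured in operations with numbers of size `Z`. -/
def Wp (inp : List ℤ) (Z : ℤ) (b : Cmd) (s : Store) (n : ℕ) (Q : Store → Prop) : Prop :=
  b.Spec inp s (n * unitCost Z) Q

theorem Spec.imp {b : Cmd} {s : Store} {T T' : ℕ} {Q Q' : Store → Prop}
    (h : b.Spec inp s T Q) (hT : T ≤ T') (hQ : ∀ s', Frame b s s' → Q s' → Q' s') :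
    b.Spec inp s T' Q' := ⟨h.1.mono hT, hQ _ (frame_eval b s) h.2⟩

theorem Spec.seq {b c : Cmd} {s : Store} {T U : ℕ} {Q : Store → Prop}
    (h : b.Spec inp s T fun s' => c.Spec inp s' U Q) : (Cmd.seq b c).Spec inp s (T + U) Q :=
  ⟨⟨T, U, h.1, h.2.1, le_rfl⟩, h.2.2⟩

variable {Z : ℤ} {s : Store} {Q : Store → Prop}

theorem Wp.imp {b : Cmd} {n n' : ℕ} {Q' : Store → Prop}
    (h : b.Wp inp Z s n Q) (hn : n ≤ n') (hQ : ∀ s', Frame b s s' → Q s' → Q' s') :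
    b.Wp inp Z s n' Q' := Spec.imp h (Nat.mul_le_mul_right _ hn) hQ

theorem wp_seq {b c : Cmd} {n m : ℕ}
    (h : b.Wp inp Z s n fun s' => c.Wp inp Z s' m Q) : (Cmd.seq b c).Wp inp Z s (n + m) Q := by
  unfold Wp at *
  rw [add_mul]
  exact Spec.seq h

theorem wp_assign {x : ℕ} {e : Expr} (v : ℤ) (h : e.Fits inp Z s ∧ e.eval inp s = v)
    (hQ : Q (s.setVar x v)) : (Cmd.assign x e).Wp inp Z s (e.size + 2) Q :=
  ⟨⟨Z, h.1, le_rfl⟩, by simpa [Cmd.eval, h.2] using hQ⟩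

theorem wp_store {a : Fin 4} {e f : Expr} (i : ℕ) (v : ℤ)
    (he : e.Fits inp Z s ∧ e.eval inp s = i) (hf : f.Fits inp Z s ∧ f.eval inp s = v)
    (hQ : Q (s.setArr a i v)) : (Cmd.store a e f).Wp inp Z s (e.size + f.size + 5) Q :=
  ⟨⟨Z, he.1, by rw [he.2]; positivity, hf.1, le_rfl⟩, by
    simpa [Cmd.eval, he.2, hf.2] using hQ⟩

theorem wp_write {e : Expr} (v : ℤ) (h : e.Fits inp Z s ∧ e.eval inp s = v)
    (hQ : Q ⟨s.var, s.arr, s.out ++ [v]⟩) : (Cmd.write e).Wp inp Z s (e.size + 1) Q :=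
  ⟨⟨Z, h.1, le_rfl⟩, by simpa [Cmd.eval, h.2] using hQ⟩

/-- The invariant rule. An invariant has to mention only what the body changes. Everything else
comes from the `Frame` hypothesis, which is decided from the syntax of the program. -/
theorem wp_loop {x : ℕ} {e : Expr} {b : Cmd} {n k : ℕ} (I : ℕ → Store → Prop)
    (he : e.Fits inp Z s ∧ e.eval inp s = n) (h0 : I 0 s)
    (hI : ∀ i < n, ∀ s', Frame (.loop x e b) s s' → I i s' →
      b.Wp inp Z (s'.setVar x i) k (I (i + 1)))
    (hQ : ∀ s', Frame (.loop x e b) s s' → I n s' → Q s') :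
    (Cmd.loop x e b).Wp inp Z s (e.size + 3 + n * (k + 8)) Q := by
  set f : ℕ → Store → Store := fun i s' => b.eval inp (s'.setVar x i) with hf
  have hfr : ∀ i, Frame (.loop x e b) s (iter f s i) := frame_iter (fun i s => frame_eval _ _) s
  have key : ∀ i ≤ n, I i (iter f s i) := by
    intro i
    induction i with
    | zero => exact fun _ => h0
    | succ i ih => exact fun hi => (hI i (by omega) _ (hfr i) (ih (by omega))).2
  have hn : (e.eval inp s).toNat = n := by rw [he.2]; simp
  refine ⟨⟨Z, k * unitCost Z, he.1, fun i hi => ?_, ?_⟩, ?_⟩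
  · rw [hn] at hi
    exact (hI i hi _ (hfr i) (key i hi.le)).1
  · rw [hn]
    exact le_of_eq (by ring)
  · simp only [Cmd.eval, hn]
    exact hQ _ (hfr n) (key n le_rfl)

end Cmd

end RAM

/-! ### Elimination modulo `g` -/

namespace RAM
-- For an array with at most `A` rows of length `w`, the number `A * w + A + w` dominates an index
-- and all values that occur while it is computed.
theorem small_index {Z : ℤ} {A w i k : ℕ} (hi : i < A) (hk : k < w)
    (hZ : ((A * w + A + w : ℕ) : ℤ) ≤ Z) : Small Z (i : ℤ) ∧ Small Z (w : ℤ) ∧ Small Z (k : ℤ) ∧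
      Small Z ((i : ℤ) * w) ∧ Small Z ((i : ℤ) * w + k) := by
  have h1 : (i + 1) * w ≤ A * w := Nat.mul_le_mul_right w hi
  rw [add_one_mul] at h1
  have key : ∀ x : ℕ, x ≤ A * w + A + w → Small Z (x : ℤ) := fun x hx =>
    small_of_nonneg (by positivity) (le_trans (by exact_mod_cast hx) hZ)
  refine ⟨key _ (by omega), key _ (by omega), key _ (by omega), ?_, ?_⟩
  · exact_mod_cast key (i * w) (by omega)
  · exact_mod_cast key (i * w + k) (by omega)

theorem add_one_le_of_sq_le {g Z : ℤ} (hg : 0 < g) (hZ : 4 * (g + 1) ^ 2 ≤ Z) : g + 1 ≤ Z := by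
  nlinarith

theorem small_entry_mul {g x u : ℤ} (hg : 0 < g) (hu : Small (g + 1) u) (hx : Small g x) : Small (2 * (g + 1) ^ 2) (u * x) :=
  (hu.mul hx).mono (by nlinarith)

namespace Cmd
open RAM.Expr RowLattice

variable {inp : List ℤ} {Z : ℤ} {s : Store}

/-- The row operations of an elimination step on the pivot row `x₁₁` of the array `1` and the row
`x₁₂` of the array `0`, for the coordinates below `x₁₁`. -/
def rowStep : Cmd :=
  .loop 20 (var 11) <|
  .seq (.assign 21 (arr 1 (var 11 * var 1 + var 20))) <|
  .seq (.assign 22 (arr 0 (var 12 * var 1 + var 20))) <|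
  .seq (.store 1 (var 11 * var 1 + var 20) ((var 16 * var 21 + var 17 * var 22) % var 2)) <|
  .store 0 (var 12 * var 1 + var 20) ((var 18 * var 22 - var 19 * var 21) % var 2)

/-- The array `A'` results from `A` by changing the first `k` entries of the row `i` to those
of `f`. -/
def RowChange (A A' : ℕ → ℤ) (w i k : ℕ) (f : ℕ → ℤ) : Prop :=
  (∀ t < k, A' (i * w + t) = f t) ∧ ∀ m, (∀ t < k, m ≠ i * w + t) → A' m = A m

theorem RowChange.zero (A : ℕ → ℤ) (w i : ℕ) (f : ℕ → ℤ) : RowChange A A w i 0 f :=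
  ⟨by simp, fun _ _ => rfl⟩

theorem RowChange.succ {A A' A'' : ℕ → ℤ} {w i k : ℕ} {f : ℕ → ℤ} (h : RowChange A A' w i k f)
    (h' : ∀ m, A'' m = if m = i * w + k then f k else A' m) :
    RowChange A A'' w i (k + 1) f := by
  refine ⟨fun t ht => ?_, fun m hm => ?_⟩
  · rw [h']
    split_ifs with he
    · rw [show t = k by omega]
    · exact h.1 t (by omega)
  · rw [h', if_neg (hm k (by omega)), h.2 m fun t ht => hm t (by omega)]

theorem RowChange.get {A A' : ℕ → ℤ} {w i k : ℕ} {f : ℕ → ℤ} (h : RowChange A A' w i k f) {t : ℕ}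
    (ht : k ≤ t) : A' (i * w + t) = A (i * w + t) := h.2 _ fun t' ht' => by omega

theorem RowChange.get_ne {A A' : ℕ → ℤ} {w i k : ℕ} {f : ℕ → ℤ} (h : RowChange A A' w i k f)
    (hk : k ≤ w) {j t : ℕ} (hj : j ≠ i) (ht : t < w) : A' (j * w + t) = A (j * w + t) :=
  h.2 _ fun t' ht' he => by
    rcases lt_or_gt_of_ne hj with h1 | h1
    · have : (j + 1) * w ≤ i * w := Nat.mul_le_mul_right w h1
      rw [add_one_mul] at this; omega
    · have : (i + 1) * w ≤ j * w := Nat.mul_le_mul_right w h1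
      rw [add_one_mul] at this; omega

/-- Both old entries are read into variables before either is overwritten, and later coordinates are
still the original ones, so the new rows are expressed in the old ones. Reduction modulo `g` after
each combination keeps all intermediate values below `4 * (g + 1) ^ 2`. -/
theorem wp_rowStep {c i w : ℕ} {g u v p q : ℤ} (hg : 0 < g)
    (h11 : s.var 11 = c) (h12 : s.var 12 = i) (h1 : s.var 1 = w) (h2 : s.var 2 = g)
    (h16 : s.var 16 = u) (h17 : s.var 17 = v) (h18 : s.var 18 = p) (h19 : s.var 19 = q)
    (hu : Small (g + 1) u) (hv : Small (g + 1) v) (hp : Small (g + 1) p) (hq : Small (g + 1) q)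
    (hR : ∀ t < c, Small g (s.arr 1 (c * w + t))) (hV : ∀ t < c, Small g (s.arr 0 (i * w + t)))
    {A : ℕ} (hcA : c < A) (hiA : i < A) (hgZ : 4 * (g + 1) ^ 2 ≤ Z)
    (hwZ : ((A * w + A + w : ℕ) : ℤ) ≤ Z) (hc : c ≤ w) :
    rowStep.Wp inp Z s (5 + c * 110) fun s' =>
      RowChange (s.arr 1) (s'.arr 1) w c c
        (fun t => (u * s.arr 1 (c * w + t) + v * s.arr 0 (i * w + t)) % g) ∧
      RowChange (s.arr 0) (s'.arr 0) w i c
        (fun t => (p * s.arr 0 (i * w + t) - q * s.arr 1 (c * w + t)) % g) := by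
  have hg1 := add_one_le_of_sq_le hg hgZ
  have hgZ' : g ≤ Z := by linarith
  have e6 : Small Z g := small_of_nonneg hg.le hgZ'
  have e2 : Small Z (c : ℤ) := small_of_nonneg (by positivity) (le_trans (by norm_cast; omega) hwZ)
  refine Wp.imp (wp_loop (n := c) (k := 102) (fun k s' =>
      RowChange (s.arr 1) (s'.arr 1) w c k
        (fun t => (u * s.arr 1 (c * w + t) + v * s.arr 0 (i * w + t)) % g) ∧
      RowChange (s.arr 0) (s'.arr 0) w i k
        (fun t => (p * s.arr 0 (i * w + t) - q * s.arr 1 (c * w + t)) % g)) ?_ ?_ ?_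
      (fun s' _ h => h)) (by simp) (fun _ _ h => h)
  · simp [h11, e2]
  · exact ⟨RowChange.zero _ _ _ _, RowChange.zero _ _ _ _⟩
  · rintro k hk s' hF ⟨hA, hB⟩
    have f11 := (hF.var 11 (by decide)).trans h11
    have f12 := (hF.var 12 (by decide)).trans h12
    have f1 := (hF.var 1 (by decide)).trans h1
    have f2 := (hF.var 2 (by decide)).trans h2
    have f16 := (hF.var 16 (by decide)).trans h16
    have f17 := (hF.var 17 (by decide)).trans h17
    have f18 := (hF.var 18 (by decide)).trans h18
    have f19 := (hF.var 19 (by decide)).trans h19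
    obtain ⟨e2, e1, d1, e4, d2⟩ := small_index hcA (hk.trans_le hc) hwZ
    obtain ⟨e3, -, -, e5, d3⟩ := small_index hiA (hk.trans_le hc) hwZ
    have a1 := hA.get (le_refl k)
    have a2 := hB.get (le_refl k)
    have r1 := hR k hk
    have r2 := hV k hk
    generalize hx : s.arr 1 (c * w + k) = x at *
    generalize hy : s.arr 0 (i * w + k) = y at *
    have n1 := mul_add_nonneg c w k
    have n2 := mul_add_nonneg i w k
    have b0 : 0 ≤ (g + 1) ^ 2 := sq_nonneg _
    have b1 := small_entry_mul hg hu r1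
    have b2 := small_entry_mul hg hv r2
    have b3 := small_entry_mul hg hp r2
    have b4 := small_entry_mul hg hq r1
    have b5 : Small Z (u * x + v * y) := (b1.add b2).mono (by linarith)
    have b6 : Small Z (p * y - q * x) := (b3.sub b4).mono (by linarith)
    replace b1 := b1.mono (show _ ≤ Z by linarith)
    replace b2 := b2.mono (show _ ≤ Z by linarith)
    replace b3 := b3.mono (show _ ≤ Z by linarith)
    replace b4 := b4.mono (show _ ≤ Z by linarith)
    have b7 := small_emod (Z := Z) (u * x + v * y) hg hgZ'
    have b8 := small_emod (Z := Z) (p * y - q * x) hg hgZ'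
    refine Wp.imp (wp_seq (wp_assign x ?_ (wp_seq (wp_assign y ?_
      (wp_seq (wp_store (c * w + k) ((u * x + v * y) % g) ?_ ?_
        (wp_store (i * w + k) ((p * y - q * x) % g) ?_ ?_ ?_))))))) (by simp) (fun _ _ h => h)
    · simp [f11, f1, a1, n1, d1, d2, e1, e2, e4, r1.mono hgZ']
    · simp [f12, f1, a2, n2, d1, d3, e1, e3, e5, r2.mono hgZ']
    · simp [f11, f1, d1, d2, e1, e2, e4]
    · simp [f16, f17, f2, b1, b2, b5, b7, e6, hu.mono hg1, hv.mono hg1, r1.mono hgZ',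
        r2.mono hgZ']
    · simp [f12, f1, d1, d3, e1, e3, e5]
    · simp [f18, f19, f2, b3, b4, b6, b8, e6, hp.mono hg1, hq.mono hg1, r1.mono hgZ',
        r2.mono hgZ']
    · constructor
      · refine hA.succ fun m => ?_
        simp [hx, hy]
      · refine hB.succ fun m => ?_
        simp [hx, hy]

end Cmd
end RAM

namespace RAM
namespace Cmd
open RAM.Expr RowLattice

variable {inp : List ℤ} {Z : ℤ} {s : Store}

theorem RowChange.congr {A A' : ℕ → ℤ} {w i k : ℕ} {f f' : ℕ → ℤ} (h : RowChange A A' w i k f)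
    (hf : ∀ t < k, f t = f' t) : RowChange A A' w i k f' :=
  ⟨fun t ht => (h.1 t ht).trans (hf t ht), h.2⟩

/-- Clear the entry in the column `x₁₁` of the generator `x₁₂` by means of the pivot row. -/
def colStep : Cmd :=
  .seq (.assign 13 (arr 1 (var 11 * var 1 + var 11))) <|
  .seq (.assign 14 (arr 0 (var 12 * var 1 + var 11))) <|
  .seq (.assign 15 (bin .gcd (var 13) (var 14))) <|
  .seq (.assign 16 (bin .bezoutLeft (var 13) (var 14))) <|
  .seq (.assign 17 (bin .bezoutRight (var 13) (var 14))) <|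
  .seq (.assign 18 (var 13 / var 15)) <|
  .seq (.assign 19 (var 14 / var 15)) <|
  .seq rowStep <|
  .seq (.store 1 (var 11 * var 1 + var 11) (var 15)) <|
  .store 0 (var 12 * var 1 + var 11) 0

/-- The column `c` itself is written exactly, not modulo `g`: the pivot becomes the gcd and the
entry of the generator becomes `0`. The gcd may be equal to `g`, and reduction would then destroy
the pivot. The Bézout coefficients are at most `g + 1` by the bounds for the Euclidean algorithm. -/
theorem wp_colStep {c i w : ℕ} {g a b : ℤ} (hg : 0 < g)
    (h11 : s.var 11 = c) (h12 : s.var 12 = i) (h1 : s.var 1 = w) (h2 : s.var 2 = g)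
    (ha : s.arr 1 (c * w + c) = a) (hb : s.arr 0 (i * w + c) = b)
    (ha0 : 0 < a) (hag : a ≤ g) (hb0 : 0 ≤ b) (hbg : b ≤ g)
    (hR : ∀ t < c, Small g (s.arr 1 (c * w + t))) (hV : ∀ t < c, Small g (s.arr 0 (i * w + t)))
    {A : ℕ} (hcA : c < A) (hiA : i < A) (hgZ : 4 * (g + 1) ^ 2 ≤ Z)
    (hwZ : ((A * w + A + w : ℕ) : ℤ) ≤ Z) (hc : c < w) :
    colStep.Wp inp Z s (150 + c * 110) fun s' =>
      RowChange (s.arr 1) (s'.arr 1) w c (c + 1) (fun t => if t = c then (Int.gcd a b : ℤ) else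
        (Int.gcdA a b * s.arr 1 (c * w + t) + Int.gcdB a b * s.arr 0 (i * w + t)) % g) ∧
      RowChange (s.arr 0) (s'.arr 0) w i (c + 1) (fun t => if t = c then 0 else
        (a / Int.gcd a b * s.arr 0 (i * w + t) - b / Int.gcd a b * s.arr 1 (c * w + t)) % g) := by
  have hg1 := add_one_le_of_sq_le hg hgZ
  have hgZ' : g ≤ Z := by linarith
  obtain ⟨e2, e1, -, e4, d2⟩ := small_index hcA hc hwZ
  obtain ⟨e3, -, -, e5, d3⟩ := small_index hiA hc hwZ
  have n1 := mul_add_nonneg c w c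
  have n2 := mul_add_nonneg i w c
  have sa : Small Z a := small_of_nonneg ha0.le (hag.trans hgZ')
  have sb : Small Z b := small_of_nonneg hb0 (hbg.trans hgZ')
  have hu : Small (g + 1) (Int.gcdA a b) := (Int.abs_gcdA_le ha0.le hb0).trans (by linarith)
  have hv : Small (g + 1) (Int.gcdB a b) := (Int.abs_gcdB_le ha0.le hb0).trans (by linarith)
  have hh0 : (0 : ℤ) < Int.gcd a b := by exact_mod_cast Int.gcd_pos_of_ne_zero_left b ha0.ne'
  have hha : (Int.gcd a b : ℤ) ≤ a := Int.le_of_dvd ha0 (Int.gcd_dvd_left _ _)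
  have hh : Small Z (Int.gcd a b : ℤ) := small_of_nonneg hh0.le (by linarith)
  have hp : Small (g + 1) (a / Int.gcd a b) :=
    small_of_nonneg (Int.ediv_nonneg ha0.le hh0.le) ((Int.ediv_le_self _ ha0.le).trans (by linarith))
  have hq : Small (g + 1) (b / Int.gcd a b) :=
    small_of_nonneg (Int.ediv_nonneg hb0 hh0.le) ((Int.ediv_le_self _ hb0).trans (by linarith))
  refine Wp.imp (wp_seq (wp_assign a ?_ (wp_seq (wp_assign b ?_
    (wp_seq (wp_assign (Int.gcd a b) ?_ (wp_seq (wp_assign (Int.gcdA a b) ?_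
    (wp_seq (wp_assign (Int.gcdB a b) ?_ (wp_seq (wp_assign (a / Int.gcd a b) ?_
    (wp_seq (wp_assign (b / Int.gcd a b) ?_
    (wp_seq (Wp.imp (n' := 5 + c * 110) (wp_rowStep (c := c) (i := i) (w := w) (g := g) hg ?_ ?_ ?_ ?_ ?_ ?_ ?_ ?_
      hu hv hp hq ?_ ?_ hcA hiA hgZ hwZ hc.le) le_rfl (fun s' hF hs' =>
    (wp_seq (wp_store (c * w + c) (Int.gcd a b) ?_ ?_
    (wp_store (i * w + c) 0 ?_ ?_ ?_)))))))))))))))))))) ?_ (fun _ _ h => h)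
  · simp [h11, h1, ha, e1, e2, e4, d2, n1, sa]
  · simp [h11, h12, h1, hb, e1, e2, e3, e5, d3, n2, sb]
  · simp [sa, sb, hh]
  · simp [sa, sb, hu.mono hg1]
  · simp [sa, sb, hv.mono hg1]
  · simp [sa, hh, hp.mono hg1]
  · simp [sb, hh, hq.mono hg1]
  all_goals try simp [h11, h12, h1, h2]
  · exact hR
  · exact hV
  · have f11 := hF.var 11 (by decide)
    have f1 := hF.var 1 (by decide)
    simp at f11 f1
    simp [f11, f1, h11, h1, e1, e2, e4, d2]
  · have f15 := hF.var 15 (by decide)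
    simp at f15
    simp [f15, hh]
  · have f11 := hF.var 11 (by decide)
    have f12 := hF.var 12 (by decide)
    have f1 := hF.var 1 (by decide)
    simp at f11 f12 f1
    simp [f11, f12, f1, h11, h12, h1, e1, e2, e3, e5, d3]
  · simp [small_of_nonneg le_rfl (show 0 ≤ Z by linarith)]
  · simp only [Store.arr_setVar] at hs'
    constructor
    · refine (hs'.1.congr fun t ht => ?_).succ fun m => ?_
      · rw [if_neg ht.ne]
      · simp
    · refine (hs'.2.congr fun t ht => ?_).succ fun m => ?_
      · rw [if_neg ht.ne]
      · simp
  · omega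

/-- The entries of `n` rows of length `w` are between `0` and `g`. -/
def Box (A : ℕ → ℤ) (w n : ℕ) (g : ℤ) : Prop :=
  ∀ i < n, ∀ t < w, 0 ≤ A (i * w + t) ∧ A (i * w + t) ≤ g

/-- The state of the arrays when the column `c` has been cleared in the first `i` generators. -/
structure ColInv (Λ : Submodule ℤ (ℕ → ℤ)) (R₀ R V : ℕ → ℤ) (w n c : ℕ) (g : ℤ) (i : ℕ) : Prop where
  lat : Submodule.span ℤ {rowVec R w c} ⊔ genLat V w n g c = Λ
  box : Box V w n g
  zero : ∀ j < n, ∀ t, c < t → t < w → V (j * w + t) = 0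
  cleared : ∀ j < i, V (j * w + c) = 0
  row : ∀ t < w, 0 ≤ R (c * w + t) ∧ R (c * w + t) ≤ g
  pos : 0 < R (c * w + c)
  upper : ∀ t, c < t → t < w → R (c * w + t) = 0
  other : ∀ j ≠ c, ∀ t < w, R (j * w + t) = R₀ (j * w + t)

/-- The lattice is preserved by `bezout_step`: the new rows differ from the unimodular combination
by multiples of `g` in coordinates below `c` only. In the coordinate `c` they agree by the Bézout
relation, and above `c` both rows are zero. -/
theorem ColInv.step {Λ : Submodule ℤ (ℕ → ℤ)} {R₀ R V R' V' : ℕ → ℤ} {w n c i : ℕ} {g a b : ℤ}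
    (hg : 0 < g) (h : ColInv Λ R₀ R V w n c g i) (hi : i < n) (hc : c < w)
    (ha : R (c * w + c) = a) (hb : V (i * w + c) = b)
    (hR : RowChange R R' w c (c + 1) (fun t => if t = c then (Int.gcd a b : ℤ) else
        (Int.gcdA a b * R (c * w + t) + Int.gcdB a b * V (i * w + t)) % g))
    (hV : RowChange V V' w i (c + 1) (fun t => if t = c then 0 else
        (a / Int.gcd a b * V (i * w + t) - b / Int.gcd a b * R (c * w + t)) % g)) :
    ColInv Λ R₀ R' V' w n c g (i + 1) := by
  have ha0 : 0 < a := ha ▸ h.pos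
  have hag : a ≤ g := ha ▸ (h.row c hc).2
  have hh0 : (0 : ℤ) < Int.gcd a b := by exact_mod_cast Int.gcd_pos_of_ne_zero_left b ha0.ne'
  have hha : (Int.gcd a b : ℤ) ≤ a := Int.le_of_dvd ha0 (Int.gcd_dvd_left _ _)
  have hpa : a / Int.gcd a b * Int.gcd a b = a := Int.ediv_mul_cancel (Int.gcd_dvd_left _ _)
  have hqb : b / Int.gcd a b * Int.gcd a b = b := Int.ediv_mul_cancel (Int.gcd_dvd_right _ _)
  have hbez := Int.gcd_eq_gcd_ab a b
  generalize (Int.gcd a b : ℤ) = d at *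
  generalize Int.gcdA a b = u at *
  generalize Int.gcdB a b = v at *
  generalize a / d = p at *
  generalize b / d = q at *
  have hdet : u * p + v * q = 1 := by
    have : d * (u * p + v * q) = d * 1 := by
      calc _ = u * (p * d) + v * (q * d) := by ring
        _ = d * 1 := by rw [hpa, hqb, hbez]; ring
    exact mul_left_cancel₀ hh0.ne' this
  have hRc := hR.1 c (by omega)
  have hVc := hV.1 c (by omega)
  simp only [if_true] at hRc hVc
  have hRt : ∀ t < c, R' (c * w + t) = (u * R (c * w + t) + v * V (i * w + t)) % g :=
    fun t ht => (hR.1 t (by omega)).trans (if_neg ht.ne)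
  have hVt : ∀ t < c, V' (i * w + t) = (p * V (i * w + t) - q * R (c * w + t)) % g :=
    fun t ht => (hV.1 t (by omega)).trans (if_neg ht.ne)
  refine ⟨?_, fun j hj t ht => ?_, fun j hj t ht ht' => ?_, fun j hj => ?_, fun t ht => ?_, ?_,
    fun t ht ht' => ?_, fun j hj t ht => ?_⟩
  · rw [← h.lat]
    refine bezout_step (u := u) (v := v) (p := p) (q := q) hi (fun j hj hji => ?_) hdet ?_ ?_
    · ext t
      unfold rowVec
      split_ifs with ht
      · exact hV.get_ne (by omega) hji ht
      · rfl
    · have key : ∀ t, c ≤ t → (rowVec R' w c - (u • rowVec R w c + v • rowVec V w i)) t = 0 := by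
        intro t ht
        simp only [Pi.sub_apply, Pi.add_apply, Pi.smul_apply, smul_eq_mul, rowVec]
        split_ifs with h2
        · rcases ht.eq_or_lt with rfl | ht
          · rw [hRc, ha, hb, hbez]; ring
          · rw [hR.get ht, h.upper t ht h2, h.zero i hi t ht h2]; ring
        · ring
      refine ⟨fun t => ?_, key⟩
      rcases lt_or_ge t c with ht | ht
      · simp only [Pi.sub_apply, Pi.add_apply, Pi.smul_apply, smul_eq_mul, rowVec,
          if_pos (ht.trans hc)]
        rw [hRt t ht, ← dvd_neg, neg_sub]
        exact Int.dvd_self_sub_emod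
      · rw [key t ht]; exact dvd_zero _
    · have key : ∀ t, c ≤ t → (rowVec V' w i - (p • rowVec V w i - q • rowVec R w c)) t = 0 := by
        intro t ht
        simp only [Pi.sub_apply, Pi.smul_apply, smul_eq_mul, rowVec]
        split_ifs with h2
        · rcases ht.eq_or_lt with rfl | ht
          · rw [hVc, ha, hb, ← hpa, ← hqb]; ring
          · rw [hV.get ht, h.upper t ht h2, h.zero i hi t ht h2]; ring
        · ring
      refine ⟨fun t => ?_, key⟩
      rcases lt_or_ge t c with ht | ht
      · simp only [Pi.sub_apply, Pi.smul_apply, smul_eq_mul, rowVec, if_pos (ht.trans hc)]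
        rw [hVt t ht, ← dvd_neg, neg_sub]
        exact Int.dvd_self_sub_emod
      · rw [key t ht]; exact dvd_zero _
  · by_cases hji : j = i
    · subst hji
      rcases lt_trichotomy t c with htc | rfl | htc
      · rw [hVt t htc]
        exact ⟨Int.emod_nonneg _ hg.ne', (Int.emod_lt_of_pos _ hg).le⟩
      · rw [hVc]; exact ⟨le_rfl, hg.le⟩
      · rw [hV.get htc]; exact h.box j hj t ht
    · rw [hV.get_ne (by omega) hji ht]; exact h.box j hj t ht
  · by_cases hji : j = i
    · subst hji
      rw [hV.get ht]; exact h.zero j hj t ht ht'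
    · rw [hV.get_ne (by omega) hji ht']; exact h.zero j hj t ht ht'
  · by_cases hji : j = i
    · subst hji; exact hVc
    · rw [hV.get_ne (by omega) hji hc]; exact h.cleared j (by omega)
  · rcases lt_trichotomy t c with htc | rfl | htc
    · rw [hRt t htc]
      exact ⟨Int.emod_nonneg _ hg.ne', (Int.emod_lt_of_pos _ hg).le⟩
    · rw [hRc]; exact ⟨hh0.le, hha.trans hag⟩
    · rw [hR.get htc]; exact h.row t ht
  · rw [hRc]; exact hh0
  · rw [hR.get ht]; exact h.upper t ht ht'
  · rw [hR.get_ne (by omega) hj ht]; exact h.other j hj t ht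

end Cmd
end RAM

namespace RAM
namespace Cmd
open RAM.Expr RowLattice

variable {inp : List ℤ} {Z : ℤ} {s : Store}

/-- Triangularize: the generators are in the rows of the array `0`, the basis is put into the
array `1`. -/
def elim : Cmd :=
  .loop 10 (var 1) <|
  -- Columns are cleared from the last to the first, which produces a lower triangular matrix and
  -- leaves the vectors supported on the first coordinates to the end. The pivot row of each column
  -- starts as `g` times the unit vector.
  .seq (.assign 11 (var 1 - 1 - var 10)) <|
  .seq (.loop 20 (var 1) (.store 1 (var 11 * var 1 + var 20) 0)) <|
  .seq (.store 1 (var 11 * var 1 + var 11) (var 2)) <|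
  .loop 12 (var 0) colStep

theorem wp_colLoop {c w n : ℕ} {g : ℤ} (hg : 0 < g)
    (h11 : s.var 11 = c) (h0 : s.var 0 = n) (h1 : s.var 1 = w) (h2 : s.var 2 = g)
    {Λ : Submodule ℤ (ℕ → ℤ)} (hI : ColInv Λ (s.arr 1) (s.arr 1) (s.arr 0) w n c g 0)
    {A : ℕ} (hcA : c < A) (hnA : n ≤ A) (hgZ : 4 * (g + 1) ^ 2 ≤ Z)
    (hwZ : ((A * w + A + w : ℕ) : ℤ) ≤ Z) (hc : c < w) :
    (Cmd.loop 12 (var 0) colStep).Wp inp Z s (5 + n * (158 + c * 110)) fun s' =>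
      ColInv Λ (s.arr 1) (s'.arr 1) (s'.arr 0) w n c g n := by
  refine Wp.imp (wp_loop (n := n) (k := 150 + c * 110)
    (fun i s' => ColInv Λ (s.arr 1) (s'.arr 1) (s'.arr 0) w n c g i) ?_ hI ?_
    (fun s' _ h => h)) (le_of_eq (by rw [Expr.size_var]; ring)) (fun _ _ h => h)
  · have : Small Z (n : ℤ) := small_of_nonneg (by positivity)
      (le_trans (by norm_cast; omega) hwZ)
    simp [h0, this]
  · intro i hi s' hF h
    have f11 := (hF.var 11 (by decide)).trans h11
    have f1 := (hF.var 1 (by decide)).trans h1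
    have f2 := (hF.var 2 (by decide)).trans h2
    refine Wp.imp (wp_colStep (c := c) (i := i) (w := w) (g := g) hg (by simp [f11]) (by simp)
      (by simp [f1]) (by simp [f2]) rfl rfl h.pos (h.row c hc).2 (h.box i hi c hc).1
      (h.box i hi c hc).2
      (fun t ht => small_of_nonneg (h.row t (by omega)).1 (h.row t (by omega)).2)
      (fun t ht => small_of_nonneg (h.box i hi t (by omega)).1 (h.box i hi t (by omega)).2)
      hcA (by omega) hgZ hwZ hc) le_rfl fun s'' _ h'' => ?_
    exact h.step hg hi hc rfl rfl h''.1 h''.2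

theorem wp_zeroRow {c w : ℕ} (h11 : s.var 11 = c) (h1 : s.var 1 = w)
    {A : ℕ} (hcA : c < A) (hwZ : ((A * w + A + w : ℕ) : ℤ) ≤ Z) :
    (Cmd.loop 20 (var 1) (.store 1 (var 11 * var 1 + var 20) 0)).Wp inp Z s (5 + w * 22)
      fun s' => RowChange (s.arr 1) (s'.arr 1) w c w (fun _ => 0) := by
  have hwZ' : Small Z (w : ℤ) := small_of_nonneg (by positivity)
    (le_trans (by norm_cast; omega) hwZ)
  refine Wp.imp (wp_loop (n := w) (k := 14)
    (fun i s' => RowChange (s.arr 1) (s'.arr 1) w c i (fun _ => 0)) ?_ (RowChange.zero _ _ _ _) ?_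
    (fun s' _ h => h)) (le_of_eq (by simp)) (fun _ _ h => h)
  · simp [h1, hwZ']
  · intro i hi s' hF h
    have f11 := (hF.var 11 (by decide)).trans h11
    have f1 := (hF.var 1 (by decide)).trans h1
    obtain ⟨e2, e1, d1, e4, d2⟩ := small_index hcA hi hwZ
    refine Wp.imp (wp_store (c * w + i) 0 ?_ ?_ ?_) (by simp) (fun _ _ h => h)
    · simp [f11, f1, e1, e2, e4, d1, d2]
    · simp [small_of_nonneg le_rfl ((abs_nonneg _).trans e1)]
    · exact h.succ fun m => by simp

/-- The state of the arrays when the columns from `c` on have been cleared. -/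
structure ElimInv (Λ : Submodule ℤ (ℕ → ℤ)) (R V : ℕ → ℤ) (w n : ℕ) (g : ℤ) (c : ℕ) : Prop where
  box : Box V w n g
  zero : ∀ j < n, ∀ t, c ≤ t → t < w → V (j * w + t) = 0
  lat : ∀ x, (x ∈ Λ ∧ ∀ t, c ≤ t → x t = 0) ↔ x ∈ genLat V w n g c
  piv : ∀ i, c ≤ i → i < w → IsPivotRow Λ R w i
  row : ∀ i, c ≤ i → i < w → ∀ t < w, 0 ≤ R (i * w + t) ∧ R (i * w + t) ≤ g

theorem ElimInv.init {V R : ℕ → ℤ} {w n : ℕ} {g : ℤ} (h : Box V w n g) :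
    ElimInv (genLat V w n g w) R V w n g w := by
  refine ⟨h, fun j hj t h1 h2 => absurd h1 (by omega), fun x => ⟨fun h => h.1, fun h => ⟨h, ?_⟩⟩,
    fun i h1 h2 => absurd h1 (by omega), fun i h1 h2 => absurd h1 (by omega)⟩
  intro t ht
  refine genLat_zero_of_le le_rfl (fun i _ t ht => ?_) h ht
  simp [rowVec, show ¬ t < w by omega]

theorem ElimInv.colInit {Λ : Submodule ℤ (ℕ → ℤ)} {R V R' : ℕ → ℤ} {w n c : ℕ} {g : ℤ}
    (hg : 0 < g) (h : ElimInv Λ R V w n g (c + 1)) (hc : c < w)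
    (hR : ∀ t < w, R' (c * w + t) = if t = c then g else 0) :
    ColInv (genLat V w n g (c + 1)) R' R' V w n c g 0 := by
  refine ⟨?_, h.box, fun j hj t h1 h2 => h.zero j hj t h1 h2, by simp, fun t ht => ?_, ?_,
    fun t h1 h2 => ?_, fun _ _ _ _ => rfl⟩
  · rw [← pivot_init]
    congr 3
    ext t
    unfold rowVec
    by_cases htc : t = c
    · subst htc; simp [hc, hR]
    · rw [Pi.single_eq_of_ne htc]
      split_ifs with ht
      · rw [hR t ht, if_neg htc]
      · rfl
  · rw [hR t ht]; split_ifs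
    · exact ⟨hg.le, le_rfl⟩
    · exact ⟨le_rfl, hg.le⟩
  · rw [hR c hc, if_pos rfl]; exact hg
  · rw [hR t h2, if_neg h1.ne']

/-- By `pivot_final`, once the generators vanish in the column `c`, the lattice splits into
multiples of the pivot row and vectors that vanish from `c` on. The first part supplies a row of the
triangular basis, the second is the lattice left for the remaining columns. -/
theorem ElimInv.step {Λ : Submodule ℤ (ℕ → ℤ)} {R V R₀ R' V' : ℕ → ℤ} {w n c : ℕ} {g : ℤ}
    (h : ElimInv Λ R V w n g (c + 1)) (hc : c < w)
    (hR₀ : ∀ i ≠ c, ∀ t < w, R₀ (i * w + t) = R (i * w + t))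
    (h' : ColInv (genLat V w n g (c + 1)) R₀ R' V' w n c g n) : ElimInv Λ R' V' w n g c := by
  have hother : ∀ i ≠ c, ∀ t < w, R' (i * w + t) = R (i * w + t) := fun i hi t ht =>
    (h'.other i hi t ht).trans (hR₀ i hi t ht)
  have hz : ∀ j < n, ∀ t, c ≤ t → t < w → V' (j * w + t) = 0 := by
    intro j hj t h1 h2
    rcases h1.eq_or_lt with rfl | h1
    · exact h'.cleared j hj
    · exact h'.zero j hj t h1 h2
  have hrc : rowVec R' w c c = R' (c * w + c) := by simp [rowVec, hc]
  have fin := pivot_final (P := rowVec R' w c) (V := V') (w := w) (n := n) (c := c) (g := g)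
    (by rw [hrc]; exact h'.pos) (fun i hi t ht => by
      unfold rowVec; split_ifs with h2
      · exact hz i hi t ht h2
      · rfl)
  rw [h'.lat] at fin
  have hpiv : IsPivotRow Λ R' w c := by
    refine ⟨?_, h'.upper, h'.pos, fun x hx h0 => ?_⟩
    · refine ((h.lat _).2 ?_).1
      rw [← h'.lat]
      exact Submodule.mem_sup_left (Submodule.mem_span_singleton_self _)
    · rw [← hrc]
      exact fin.1 x ((h.lat x).1 ⟨hx, fun t ht => h0 t ht⟩)
  refine ⟨h'.box, hz, fun x => ?_, fun i h1 h2 => ?_, fun i h1 h2 t ht => ?_⟩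
  · rw [← fin.2 x, ← h.lat x]
    exact ⟨fun ⟨h1, h2⟩ => ⟨⟨h1, fun t ht => h2 t (by omega)⟩, h2⟩, fun ⟨h1, h2⟩ => ⟨h1.1, h2⟩⟩
  · by_cases hi : i = c
    · subst hi; exact hpiv
    · exact (h.piv i (by omega) h2).congr h2 (hother i hi)
  · by_cases hi : i = c
    · subst hi; exact h'.row t ht
    · rw [hother i hi t ht]; exact h.row i (by omega) h2 t ht

/-- For each of `w` columns, all `n` generators are combined with the pivot row in up to `w`
coordinates. This gives the `n * w ^ 2` operations. -/
theorem wp_elim {w n : ℕ} {g : ℤ} (hg : 0 < g)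
    (h0 : s.var 0 = n) (h1 : s.var 1 = w) (h2 : s.var 2 = g) (hbox : Box (s.arr 0) w n g)
    {A : ℕ} (hwA : w ≤ A) (hnA : n ≤ A) (hgZ : 4 * (g + 1) ^ 2 ≤ Z)
    (hwZ : ((A * w + A + w : ℕ) : ℤ) ≤ Z) :
    elim.Wp inp Z s (5 + w * (60 + w * 22 + n * (158 + w * 110))) fun s' =>
      (∀ i < w, IsPivotRow (genLat (s.arr 0) w n g w) (s'.arr 1) w i) ∧
      Box (s'.arr 1) w w g := by
  have hg1 := add_one_le_of_sq_le hg hgZ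
  have hsw : Small Z (w : ℤ) := small_of_nonneg (by positivity)
    (le_trans (by norm_cast; omega) hwZ)
  have hs1 : Small Z 1 := small_of_nonneg (by norm_num) (by linarith)
  refine Wp.imp (wp_loop (n := w) (k := 52 + w * 22 + n * (158 + w * 110))
    (fun k s' => ElimInv (genLat (s.arr 0) w n g w) (s'.arr 1) (s'.arr 0) w n g (w - k))
    ?_ (ElimInv.init hbox) ?_
    (fun s' _ h => h)) (le_of_eq (by rw [Expr.size_var]; ring)) (fun s' _ h => ?_)
  · simp [h1, hsw]
  · intro k hk s' hF h
    have f0 := (hF.var 0 (by decide)).trans h0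
    have f1 := (hF.var 1 (by decide)).trans h1
    have f2 := (hF.var 2 (by decide)).trans h2
    obtain ⟨c, hc⟩ : ∃ c, w = c + 1 + k := ⟨w - 1 - k, by omega⟩
    have hcw : c < w := by omega
    rw [show w - k = c + 1 by omega] at h
    rw [show w - (k + 1) = c by omega]
    have hck : (w : ℤ) - 1 - k = c := by rw [hc]; push_cast; ring
    have hsk : Small Z (k : ℤ) := small_of_nonneg (by positivity)
      (le_trans (by norm_cast; omega) hwZ)
    have hsc : Small Z (c : ℤ) := small_of_nonneg (by positivity)
      (le_trans (by norm_cast; omega) hwZ)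
    have hsw1 : Small Z ((w : ℤ) - 1) := small_of_nonneg (by rw [hc]; push_cast; linarith)
      (le_trans (by push_cast; nlinarith) hwZ)
    obtain ⟨e2, e1, -, e4, d2⟩ := small_index (hcw.trans_le hwA) hcw hwZ
    refine Wp.imp (wp_seq (wp_assign (c : ℤ) ?_ (wp_seq (Wp.imp (wp_zeroRow (c := c) (w := w)
      ?_ ?_ (hcw.trans_le hwA) hwZ) le_rfl (fun s₁ hF₁ h₁ =>
      wp_seq (wp_store (c * w + c) g ?_ ?_
      (Wp.imp (wp_colLoop (c := c) (w := w) (n := n) (g := g)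
        (Λ := genLat (s'.arr 0) w n g (c + 1)) hg ?_ ?_ ?_ ?_ ?_ (hcw.trans_le hwA) hnA hgZ hwZ hcw)
        le_rfl (fun s₂ hF₂ h₂ => ?_)))))))) ?_ (fun _ _ h => h)
    · simp [f1, hsw, hs1, hsk, hsw1, hck, hsc]
    · simp
    · simp [f1]
    · have k11 := hF₁.var 11 (by decide)
      have k1 := hF₁.var 1 (by decide)
      simp at k11 k1
      simp [k11, k1, f1, e1, e2, e4, d2]
    · have k2 := hF₁.var 2 (by decide)
      simp at k2
      simp [k2, f2, small_of_nonneg hg.le (show g ≤ Z by linarith)]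
    · simpa using hF₁.var 11 (by decide)
    · simpa [f0] using hF₁.var 0 (by decide)
    · simpa [f1] using hF₁.var 1 (by decide)
    · simpa [f2] using hF₁.var 2 (by decide)
    · have a0 : s₁.arr 0 = s'.arr 0 := hF₁.arr 0 (by decide)
      simp only [Store.arr_setArr_of_ne _ _ _ _ _ (show (0 : Fin 4) ≠ 1 by decide), a0]
      refine h.colInit hg hcw fun t ht => ?_
      by_cases htc : t = c
      · simp [htc]
      · simp [htc, h₁.1 t ht]
    · refine h.step hcw (R₀ := (s₁.setArr 1 (c * w + c) g).arr 1) (fun i hi t ht => ?_) h₂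
      have := h₁.get_ne le_rfl hi ht
      have hne : i * w + t ≠ c * w + c := by
        intro he
        rcases lt_or_gt_of_ne hi with h3 | h3
        · have : (i + 1) * w ≤ c * w := Nat.mul_le_mul_right w h3
          rw [add_one_mul] at this; omega
        · have : (c + 1) * w ≤ i * w := Nat.mul_le_mul_right w h3
          rw [add_one_mul] at this; omega
      rw [Store.arr_setArr_self, if_neg hne, this]
      rfl
    · have : n * (158 + c * 110) ≤ n * (158 + w * 110) := by gcongr
      simp
      omega
  · rw [Nat.sub_self] at h
    exact ⟨fun i hi => h.piv i i.zero_le hi, fun i hi => h.row i i.zero_le hi⟩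

end Cmd
end RAM

/-! ### Reduction of the entries below the diagonal -/

namespace RAM
namespace Cmd
open RAM.Expr RowLattice

variable {inp : List ℤ} {Z : ℤ} {s : Store}

/-- Reduce the entry in the row `x₁₂` and the column `x₁₁` of the array `1`. -/
def reduceStep : Cmd :=
  .seq (.assign 19 (arr 1 (var 12 * var 1 + var 11) / arr 1 (var 11 * var 1 + var 11))) <|
  .loop 20 (var 11 + 1) <|
  .store 1 (var 12 * var 1 + var 20)
    ((arr 1 (var 12 * var 1 + var 20) - var 19 * arr 1 (var 11 * var 1 + var 20)) % var 2)

/-- Reduce the entries below the diagonal in the first `x₃` rows of the array `1`. -/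
def reduce : Cmd :=
  .loop 12 (var 3) <| .loop 10 (var 12) <|
  -- From the diagonal to the left: subtracting the row `j` changes only the columns up to `j`, so
  -- entries already reduced stay reduced.
  .seq (.assign 11 (var 12 - 1 - var 10)) reduceStep

theorem wp_reduceStep {i j w : ℕ} {g : ℤ} (hg : 0 < g)
    (h11 : s.var 11 = j) (h12 : s.var 12 = i) (h1 : s.var 1 = w) (h2 : s.var 2 = g)
    (hbi : ∀ t < w, 0 ≤ s.arr 1 (i * w + t) ∧ s.arr 1 (i * w + t) ≤ g)
    (hbj : ∀ t < w, 0 ≤ s.arr 1 (j * w + t) ∧ s.arr 1 (j * w + t) ≤ g)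
    (hpos : 0 < s.arr 1 (j * w + j))
    {A : ℕ} (hiA : i < A) (hji : j < i) (hiw : i < w) (hgZ : 4 * (g + 1) ^ 2 ≤ Z)
    (hwZ : ((A * w + A + w : ℕ) : ℤ) ≤ Z) :
    reduceStep.Wp inp Z s (50 + w * 60) fun s' =>
      RowChange (s.arr 1) (s'.arr 1) w i (j + 1) fun t =>
        (s.arr 1 (i * w + t) - s.arr 1 (i * w + j) / s.arr 1 (j * w + j) *
          s.arr 1 (j * w + t)) % g := by
  have hg1 := add_one_le_of_sq_le hg hgZ
  have hgZ' : g ≤ Z := by linarith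
  have hjw := hji.trans hiw
  obtain ⟨e2, e1, d0, e4, d2⟩ := small_index hiA hjw hwZ
  obtain ⟨-, -, -, e5, d3⟩ := small_index (hji.trans hiA) hjw hwZ
  have n1 := mul_add_nonneg i w j
  have n2 := mul_add_nonneg j w j
  have hq0 : 0 ≤ s.arr 1 (i * w + j) / s.arr 1 (j * w + j) :=
    Int.ediv_nonneg (hbi j hjw).1 hpos.le
  have hqg : s.arr 1 (i * w + j) / s.arr 1 (j * w + j) ≤ g :=
    (Int.ediv_le_self _ (hbi j hjw).1).trans (hbi j hjw).2
  have s1 : Small Z (s.arr 1 (i * w + j)) :=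
    small_of_nonneg (hbi j hjw).1 ((hbi j hjw).2.trans hgZ')
  have s2 : Small Z (s.arr 1 (j * w + j)) :=
    small_of_nonneg (hbj j hjw).1 ((hbj j hjw).2.trans hgZ')
  generalize hq : s.arr 1 (i * w + j) / s.arr 1 (j * w + j) = q at *
  have sq : Small (g + 1) q := small_of_nonneg hq0 (by linarith)
  have h1Z : Small Z 1 := small_of_nonneg (by norm_num) (by linarith)
  have d4 : Small Z ((j : ℤ) + 1) := small_of_nonneg (by positivity)
    (le_trans (by norm_cast; omega) hwZ)
  refine Wp.imp (wp_seq (wp_assign q ?_ (wp_loop (n := j + 1) (k := 50)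
    (fun k s' => RowChange (s.arr 1) (s'.arr 1) w i k fun t =>
        (s.arr 1 (i * w + t) - q * s.arr 1 (j * w + t)) % g) ?_ (RowChange.zero _ _ _ _) ?_
    (fun s' _ h => h)))) ?_ (fun _ _ h => h)
  · simp [h11, h12, h1, e1, e2, e4, e5, d0, d2, d3, n1, n2, s1, s2, hq, sq.mono hg1]
  · simp [h11, d0, h1Z, d4]
  · intro k hk s' hF h
    have f11 := hF.var 11 (by decide)
    have f12 := hF.var 12 (by decide)
    have f1 := hF.var 1 (by decide)
    have f2 := hF.var 2 (by decide)
    have f19 := hF.var 19 (by decide)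
    simp only [Store.var_setVar] at f11 f12 f1 f2 f19
    norm_num [h11, h12, h1, h2] at f11 f12 f1 f2 f19
    have hkw : k < w := by omega
    obtain ⟨-, -, d5, -, d6⟩ := small_index hiA hkw hwZ
    obtain ⟨-, -, -, -, d7⟩ := small_index (hji.trans hiA) hkw hwZ
    have a1 := h.get (le_refl k)
    have a2 := h.get_ne (by omega) hji.ne hkw
    have r1 : Small g (s.arr 1 (i * w + k)) := small_of_nonneg (hbi k hkw).1 (hbi k hkw).2
    have r2 : Small g (s.arr 1 (j * w + k)) := small_of_nonneg (hbj k hkw).1 (hbj k hkw).2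
    generalize hx : s.arr 1 (i * w + k) = x at *
    generalize hy : s.arr 1 (j * w + k) = y at *
    have b0 : g ≤ 2 * (g + 1) ^ 2 := by nlinarith
    have b1 := small_entry_mul hg sq r2
    have b2 : Small Z (x - q * y) := (r1.sub b1).mono (by linarith)
    replace b1 := b1.mono (show _ ≤ Z by linarith [sq_nonneg (g + 1)])
    have b3 := small_emod (Z := Z) (x - q * y) hg hgZ'
    have n3 := mul_add_nonneg i w k
    have n4 := mul_add_nonneg j w k
    refine Wp.imp (wp_store (i * w + k) ((x - q * y) % g) ?_ ?_ ?_) (by simp) (fun _ _ h => h)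
    · simp [f12, f1, e1, e2, e4, d5, d6]
    · simp [f11, f12, f1, f2, f19, a1, a2, n3, n4, e1, e2, e4, e5, d0, d5, d6, d7, r1.mono hgZ',
        r2.mono hgZ', sq.mono hg1, b1, b2, b3, small_of_nonneg hg.le hgZ']
    · refine h.succ fun m => ?_
      simp [hx, hy]
  · simp
    omega

/-- The state of the basis when, in the row `i`, the entries from `c` to the diagonal have been
reduced, as well as all rows above. -/
structure ReduceInv (Λ : Submodule ℤ (ℕ → ℤ)) (R : ℕ → ℤ) (w : ℕ) (g : ℤ) (i c : ℕ) : Prop where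
  piv : ∀ k < w, IsPivotRow Λ R w k
  box : Box R w w g
  above : ∀ k < i, ∀ j < k, R (k * w + j) < R (j * w + j)
  here : ∀ j, c ≤ j → j < i → R (i * w + j) < R (j * w + j)

/-- Subtracting a multiple of the row `j` and reducing modulo `g` stays in the lattice, which
contains the multiples of `g`. In the column `j` the result is a remainder modulo the diagonal
entry; it is smaller than that entry, hence smaller than `g`, and the reduction modulo `g` does not
affect it. -/
theorem ReduceInv.step {Λ : Submodule ℤ (ℕ → ℤ)} {R R' : ℕ → ℤ} {w i j : ℕ} {g : ℤ}
    (hg : 0 < g) (h : ReduceInv Λ R w g i (j + 1)) (hji : j < i) (hiw : i < w)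
    (hΛ : modLat g w ≤ Λ)
    (hR : RowChange R R' w i (j + 1) fun t =>
      (R (i * w + t) - R (i * w + j) / R (j * w + j) * R (j * w + t)) % g) :
    ReduceInv Λ R' w g i j := by
  have hjw := hji.trans hiw
  have hdiag : ∀ k < w, R' (k * w + k) = R (k * w + k) := fun k hk => by
    by_cases hki : k = i
    · subst hki; exact hR.get hji
    · exact hR.get_ne hjw hki hk
  have hpos := (h.piv j hjw).pos
  refine ⟨fun k hk => ?_, fun k hk t ht => ?_, fun k hk t ht => ?_, fun t h1 h2 => ?_⟩
  · by_cases hki : k = i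
    · subst hki
      refine (h.piv k hk).of_sub_mem hk (fun t h1 _ => hR.get (by omega)) ?_
      set q := R (k * w + j) / R (j * w + j) with hq
      have : rowVec R' w k - rowVec R w k + q • rowVec R w j ∈ modLat g w := by
        refine ⟨fun t => ?_, fun t ht => ?_⟩
        · simp only [Pi.sub_apply, Pi.add_apply, Pi.smul_apply, smul_eq_mul, rowVec]
          split_ifs with ht
          · rcases lt_or_ge j t with hjt | hjt
            · rw [hR.get hjt, (h.piv j hjw).upper t hjt ht]; simp
            · have e := hR.1 t (by omega)
              simp only at e
              rw [e, show (R (k * w + t) - q * R (j * w + t)) % g - R (k * w + t) +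
                q * R (j * w + t) = -(R (k * w + t) - q * R (j * w + t) -
                  (R (k * w + t) - q * R (j * w + t)) % g) by ring]
              exact (dvd_neg.2 Int.dvd_self_sub_emod)
          · simp
        · simp [rowVec, show ¬ t < w by omega]
      have := Λ.sub_mem (hΛ this) (Λ.smul_mem q (h.piv j hjw).mem)
      simpa using this
    · exact (h.piv k hk).congr hk fun t ht => hR.get_ne hjw hki ht
  · by_cases hki : k = i
    · subst hki
      rcases lt_or_ge j t with hjt | hjt
      · rw [hR.get hjt]; exact h.box k hk t ht
      · rw [hR.1 t (by omega)]
        exact ⟨Int.emod_nonneg _ hg.ne', (Int.emod_lt_of_pos _ hg).le⟩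
    · rw [hR.get_ne hjw hki ht]; exact h.box k hk t ht
  · rw [hdiag t (by omega), hR.get_ne hjw (by omega) (by omega)]
    exact h.above k hk t ht
  · rw [hdiag t (by omega)]
    rcases h1.eq_or_lt with rfl | h1
    · rw [hR.1 j (by omega)]
      simp only
      have e : R (i * w + j) - R (i * w + j) / R (j * w + j) * R (j * w + j) =
          R (i * w + j) % R (j * w + j) := by
        have := Int.ediv_mul_add_emod (R (i * w + j)) (R (j * w + j))
        linarith
      have h3 := Int.emod_lt_of_pos (R (i * w + j)) hpos
      have h4 := Int.emod_nonneg (R (i * w + j)) hpos.ne'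
      rw [e, Int.emod_eq_of_lt h4 (h3.trans_le (h.box j hjw j hjw).2)]
      exact h3
    · rw [hR.get h1]; exact h.here t h1 h2

theorem wp_reduce {d w : ℕ} {g : ℤ} (hg : 0 < g)
    (h3 : s.var 3 = d) (h1 : s.var 1 = w) (h2 : s.var 2 = g)
    {Λ : Submodule ℤ (ℕ → ℤ)} (hΛ : modLat g w ≤ Λ)
    (hpiv : ∀ i < w, IsPivotRow Λ (s.arr 1) w i) (hbox : Box (s.arr 1) w w g)
    {A : ℕ} (hwA : w ≤ A) (hdw : d ≤ w) (hgZ : 4 * (g + 1) ^ 2 ≤ Z)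
    (hwZ : ((A * w + A + w : ℕ) : ℤ) ≤ Z) :
    reduce.Wp inp Z s (5 + d * (13 + d * (70 + w * 60))) fun s' =>
      (∀ i < w, IsPivotRow Λ (s'.arr 1) w i) ∧ Box (s'.arr 1) w w g ∧
      ∀ k < d, ∀ j < k, s'.arr 1 (k * w + j) < s'.arr 1 (j * w + j) := by
  have hg1 := add_one_le_of_sq_le hg hgZ
  have hnat : ∀ x : ℕ, x ≤ w → Small Z (x : ℤ) := fun x hx =>
    small_of_nonneg (by positivity) (le_trans (by norm_cast; omega) hwZ)
  have hs1 : Small Z 1 := small_of_nonneg (by norm_num) (by linarith)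
  refine Wp.imp (wp_loop (n := d) (k := 5 + d * (70 + w * 60))
    (fun i s' => ReduceInv Λ (s'.arr 1) w g i i)
    ?_ ⟨hpiv, hbox, by simp, fun j h1 h2 => absurd h1 (by omega)⟩ ?_
    (fun s' _ h => h)) (le_of_eq (by rw [Expr.size_var]; ring)) (fun s' _ h => ?_)
  · simp [h3, hnat d hdw]
  · intro i hi s' hF h
    have f1 := (hF.var 1 (by decide)).trans h1
    have f2 := (hF.var 2 (by decide)).trans h2
    have hsi := hnat i (by omega)
    refine Wp.imp (wp_loop (n := i) (k := 62 + w * 60)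
      (fun c s'' => ReduceInv Λ (s''.arr 1) w g i (i - c))
      ?_ h ?_ (fun s' _ h => h)) ?_ (fun s' _ h => ?_)
    · simp [hsi]
    · intro c hc s₁ hF₁ h
      obtain ⟨j, hj⟩ : ∃ j, i = j + 1 + c := ⟨i - 1 - c, by omega⟩
      rw [show i - c = j + 1 by omega] at h
      rw [show i - (c + 1) = j by omega]
      have k12 := hF₁.var 12 (by decide)
      have k1 := hF₁.var 1 (by decide)
      have k2 := hF₁.var 2 (by decide)
      simp only [Store.var_setVar] at k12 k1 k2
      norm_num [f1, f2] at k12 k1 k2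
      have hck : (i : ℤ) - 1 - c = j := by rw [hj]; push_cast; ring
      have hi1 : Small Z ((i : ℤ) - 1) := by
        rw [show (i : ℤ) - 1 = ((i - 1 : ℕ) : ℤ) by omega]; exact hnat _ (by omega)
      refine Wp.imp (wp_seq (wp_assign (j : ℤ) ?_ (Wp.imp (wp_reduceStep (i := i) (j := j) (w := w)
        (g := g) hg ?_ ?_ ?_ ?_ (h.box i (by omega)) (h.box j (by omega)) (h.piv j (by omega)).pos
        (show i < A by omega) (by omega) (by omega) hgZ hwZ) le_rfl
        (fun s₂ hF₂ h₂ => ?_)))) ?_ (fun _ _ h => h)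
      · simp [k12, hsi, hs1, hi1, hck, hnat c (by omega), hnat j (by omega)]
      · simp
      · simp [k12]
      · simp [k1]
      · simp [k2]
      · exact h.step hg (by omega) (by omega) hΛ h₂
      · simp; omega
    · have : i * (70 + w * 60) ≤ d * (70 + w * 60) := by gcongr
      rw [Expr.size_var]
      linarith
    · rw [Nat.sub_self] at h
      refine ⟨h.piv, h.box, fun k hk j hj => ?_, fun j h1 h2 => absurd h1 (by omega)⟩
      rcases (Nat.lt_succ_iff.1 hk).eq_or_lt with rfl | hk
      · exact h.here j j.zero_le hj
      · exact h.above k hk j hj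
  · exact ⟨h.piv, h.box, h.above⟩

end Cmd
end RAM

/-! ### Content and output of the basis -/

namespace RAM
namespace Cmd
open RAM.Expr RowLattice

variable {inp : List ℤ} {Z : ℤ} {s : Store}

/-- Compute the greatest common divisor of the entries of the basis into `x₁₅`. -/
def content : Cmd :=
  .seq (.assign 15 0) <|
  .loop 12 (var 3) <| .loop 11 (var 3) <|
  .assign 15 (bin .gcd (var 15) (arr 1 (var 12 * var 1 + var 11)))

/-- The gcd is described by its divisors, so that the invariant for the entries visited so far
passes through a step by the universal property. Starting from `0` is consistent: everything divides
`0`, and the gcd with the first entries stays at most `g`. -/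
theorem wp_content {d w : ℕ} {g : ℤ} (hg : 0 < g)
    (h3 : s.var 3 = d) (h1 : s.var 1 = w) (hbox : Box (s.arr 1) w w g)
    {A : ℕ} (hwA : w ≤ A) (hdw : d ≤ w) (hgZ : g ≤ Z)
    (hwZ : ((A * w + A + w : ℕ) : ℤ) ≤ Z) :
    content.Wp inp Z s (8 + d * (13 + d * 28)) fun s' =>
      0 ≤ s'.var 15 ∧ s'.var 15 ≤ g ∧
      ∀ x : ℤ, x ∣ s'.var 15 ↔ ∀ i < d, ∀ j < d, x ∣ s.arr 1 (i * w + j) := by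
  have hnat : ∀ x : ℕ, x ≤ w → Small Z (x : ℤ) := fun x hx =>
    small_of_nonneg (by positivity) (le_trans (by norm_cast; omega) hwZ)
  have hs0 : Small Z 0 := small_of_nonneg le_rfl (by linarith)
  set I : ℕ → ℕ → Store → Prop := fun i j s' => 0 ≤ s'.var 15 ∧ s'.var 15 ≤ g ∧
    ∀ x : ℤ, x ∣ s'.var 15 ↔ ∀ i' < d, ∀ j' < d, (i' < i ∨ i' = i ∧ j' < j) →
      x ∣ s.arr 1 (i' * w + j') with hI
  refine Wp.imp (wp_seq (wp_assign 0 ?_ (wp_loop (n := d) (k := 5 + d * 28) (fun i s' => I i 0 s')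
    ?_ ?_ ?_ (fun s' _ h => h)))) (by simp; ring_nf; omega) (fun s' _ h => ?_)
  · simp [hs0]
  · simp [h3, hnat d hdw]
  · simp [hI, hg.le]
  · intro i hi s' hF h
    have f1 := hF.var 1 (by decide)
    have f3 := hF.var 3 (by decide)
    have a1 := hF.arr 1 (by decide)
    simp at f1 f3 a1
    refine Wp.imp (wp_loop (n := d) (k := 20) (fun j s' => I i j s')
      ?_ ?_ ?_ (fun s' _ h => h)) (by simp) (fun s' _ h => ?_)
    · simp [f3, h3, hnat d hdw]
    · simpa [hI] using h
    · intro j hj s₁ hF₁ h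
      have k1 := hF₁.var 1 (by decide)
      have k12 := hF₁.var 12 (by decide)
      have b1 := hF₁.arr 1 (by decide)
      simp [f1, h1] at k1 k12
      simp [a1] at b1
      obtain ⟨e2, e1, d0, e4, d2⟩ := small_index (show i < A by omega)
        (show j < w by omega) hwZ
      obtain ⟨p1, p2⟩ := hbox i (by omega) j (by omega)
      obtain ⟨h4, h5, h6⟩ := h
      have n1 := mul_add_nonneg i w j
      set γ := (Int.gcd (s₁.var 15) (s.arr 1 (i * w + j)) : ℤ) with hγ
      have hγ0 : 0 ≤ γ := by positivity
      have hγg : γ ≤ g := by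
        rcases h4.eq_or_lt with h0 | h0
        · rw [hγ, ← h0, Int.gcd_zero_left, Int.natAbs_of_nonneg p1]; exact p2
        · exact (Int.le_of_dvd h0 (Int.gcd_dvd_left _ _)).trans h5
      refine Wp.imp (wp_assign γ ?_ ⟨?_, ?_, fun x => ?_⟩) (by simp) (fun s' _ h => h)
      · simp [k1, k12, b1, e1, e2, e4, d0, d2, n1, ← hγ, small_of_nonneg p1 (p2.trans hgZ),
          small_of_nonneg hγ0 (hγg.trans hgZ), small_of_nonneg h4 (h5.trans hgZ)]
      · simpa using hγ0
      · simpa using hγg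
      · simp only [Store.var_setVar, if_true]
        rw [hγ, Int.dvd_coe_gcd_iff, h6]
        constructor
        · rintro ⟨h7, h8⟩ i' hi' j' hj' h
          by_cases he : i' = i ∧ j' = j
          · rw [he.1, he.2]; exact h8
          · exact h7 i' hi' j' hj' (by omega)
        · exact fun h => ⟨fun i' hi' j' hj' h' => h i' hi' j' hj' (by omega),
            h i hi j hj (by omega)⟩
    · refine ⟨h.1, h.2.1, fun x => (h.2.2 x).trans ?_⟩
      exact forall₄_congr fun i' hi' j' hj' => by
        rw [show (i' < i ∨ i' = i ∧ j' < d) ↔ (i' < i + 1 ∨ i' = i + 1 ∧ j' < 0) by omega]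
  · refine ⟨h.1, h.2.1, fun x => (h.2.2 x).trans ?_⟩
    exact forall₄_congr fun i' hi' j' hj' => by simp [hi']

/-- Write the representation of the lattice `(x₄ / x₅) Λ`, where the basis of `Λ` has the content
`x₁₅`. -/
def output : Cmd :=
  .seq (.assign 16 (var 4 * var 15)) <|
  .seq (.assign 17 (bin .gcd (var 16) (var 5))) <|
  .seq (.write (var 5 / var 17)) <|
  .seq (.assign 16 (var 16 / var 17)) <|
  .loop 12 (var 3) <| .loop 11 (var 3) <|
  .write (var 16 * (arr 1 (var 12 * var 1 + var 11) / var 15))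

/-- The basis is divided by its content and multiplied by the numerator of the reduced fraction.
Only here do `num` and `den` meet the matrix, and this takes `O(d ^ 2)` operations on numbers up to
`num * g * g` and `den`. -/
theorem wp_output {d w : ℕ} {g num den γ : ℤ} (hg : 0 < g) (hnum : 0 < num) (hden : 0 < den)
    (hγ : 0 < γ) (hγg : γ ≤ g)
    (h3 : s.var 3 = d) (h1 : s.var 1 = w) (h4 : s.var 4 = num) (h5 : s.var 5 = den)
    (h15 : s.var 15 = γ) (hbox : Box (s.arr 1) w w g)
    {A : ℕ} (hwA : w ≤ A) (hdw : d ≤ w) (hgZ : num * g * g ≤ Z) (hdZ : den ≤ Z)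
    (hwZ : ((A * w + A + w : ℕ) : ℤ) ≤ Z) :
    output.Wp inp Z s (40 + d * (13 + d * 28)) fun s' =>
      s'.out = s.out ++ den / Int.gcd (num * γ) den ::
        (List.range d).flatMap fun i => (List.range d).map fun j =>
          num * γ / Int.gcd (num * γ) den * (s.arr 1 (i * w + j) / γ) := by
  have hnat : ∀ x : ℕ, x ≤ w → Small Z (x : ℤ) := fun x hx =>
    small_of_nonneg (by positivity) (le_trans (by norm_cast; omega) hwZ)
  have hU0 : 0 < num * γ := mul_pos hnum hγ
  have hh0 : (0 : ℤ) < Int.gcd (num * γ) den := by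
    exact_mod_cast Int.gcd_pos_of_ne_zero_left den hU0.ne'
  have hhd : (Int.gcd (num * γ) den : ℤ) ≤ den := Int.le_of_dvd hden (Int.gcd_dvd_right _ _)
  have hnumg : num * g ≤ num * g * g := le_mul_of_one_le_right (by positivity) hg
  have hg2 : g ≤ num * g := le_mul_of_one_le_left hg.le hnum
  have hn2 : num ≤ num * g := le_mul_of_one_le_right hnum.le hg
  have hUg : num * γ ≤ num * g := mul_le_mul_of_nonneg_left hγg hnum.le
  have sU : Small Z (num * γ) := small_of_nonneg hU0.le (by linarith)
  have sγ : Small Z γ := small_of_nonneg hγ.le (by linarith)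
  have sn : Small Z num := small_of_nonneg hnum.le (by linarith)
  have sd : Small Z den := small_of_nonneg hden.le hdZ
  set h := (Int.gcd (num * γ) den : ℤ) with hh
  set U := num * γ with hU
  have sh : Small Z h := small_of_nonneg hh0.le (by linarith)
  have sdh : Small Z (den / h) := small_of_nonneg (Int.ediv_nonneg hden.le hh0.le)
    ((Int.ediv_le_self _ hden.le).trans hdZ)
  have hUh0 : 0 ≤ U / h := Int.ediv_nonneg hU0.le hh0.le
  have hUh1 : U / h ≤ num * g := (Int.ediv_le_self _ hU0.le).trans hUg
  have sUh : Small Z (U / h) := small_of_nonneg hUh0 (by linarith)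
  refine Wp.imp (wp_seq (wp_assign U ?_ (wp_seq (wp_assign h ?_
    (wp_seq (wp_write (den / h) ?_ (wp_seq (wp_assign (U / h) ?_
    (wp_loop (n := d) (k := 5 + d * 28) (fun i s' => s'.out = s.out ++ den / h ::
        (List.range i).flatMap fun i => (List.range d).map fun j =>
          U / h * (s.arr 1 (i * w + j) / γ))
    ?_ ?_ ?_ (fun s' _ h => h)))))))))) (by simp; ring_nf; omega) (fun s' _ h => h)
  · simp [h4, h15, sn, sγ, sU, ← hU]
  · simp [h5, sU, sd, sh, ← hh]
  · simp [h5, sd, sh, sdh]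
  · simp [sU, sh, sUh]
  · simp [h3, hnat d hdw]
  · simp
  · intro i hi s' hF ho
    have f1 := hF.var 1 (by decide)
    have f3 := hF.var 3 (by decide)
    have f15 := hF.var 15 (by decide)
    have f16 := hF.var 16 (by decide)
    have a1 := hF.arr 1 (by decide)
    simp [h1, h3, h15] at f1 f3 f15 f16 a1
    refine Wp.imp (wp_loop (n := d) (k := 20) (fun j s'' => s''.out = s'.out ++
        (List.range j).map fun j => U / h * (s.arr 1 (i * w + j) / γ))
      ?_ ?_ ?_ (fun s' _ h => h)) (by simp) (fun s'' _ ho' => ?_)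
    · simp [f3, hnat d hdw]
    · simp
    · intro j hj s₁ hF₁ ho'
      have k1 := hF₁.var 1 (by decide)
      have k12 := hF₁.var 12 (by decide)
      have k15 := hF₁.var 15 (by decide)
      have k16 := hF₁.var 16 (by decide)
      have b1 := hF₁.arr 1 (by decide)
      simp [f1, f15, f16] at k1 k12 k15 k16
      simp [a1] at b1
      obtain ⟨e2, e1, d0, e4, d2⟩ := small_index (show i < A by omega)
        (show j < w by omega) hwZ
      obtain ⟨p1, p2⟩ := hbox i (by omega) j (by omega)
      have n1 := mul_add_nonneg i w j
      have q0 : 0 ≤ s.arr 1 (i * w + j) / γ := Int.ediv_nonneg p1 hγ.le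
      have q1 : s.arr 1 (i * w + j) / γ ≤ g := (Int.ediv_le_self _ p1).trans p2
      have s1 : Small Z (s.arr 1 (i * w + j)) := small_of_nonneg p1 (by linarith)
      have s2 : Small Z (s.arr 1 (i * w + j) / γ) := small_of_nonneg q0 (by linarith)
      have s3 : Small Z (U / h * (s.arr 1 (i * w + j) / γ)) :=
        small_of_nonneg (mul_nonneg hUh0 q0)
          ((mul_le_mul hUh1 q1 q0 (by positivity)).trans hgZ)
      refine Wp.imp (wp_write (U / h * (s.arr 1 (i * w + j) / γ)) ?_ ?_) (by simp)
        (fun s' _ h => h)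
      · simp [k1, k12, k15, k16, b1, e1, e2, e4, d0, d2, n1, s1, s2, s3, sUh, sγ]
      · simp [List.range_succ, ho']
    · rw [ho', ho]
      simp [List.range_succ, List.flatMap_append]

end Cmd
end RAM

/-! ### The complete normal form computation -/

namespace RAM
namespace Cmd
open RAM.Expr RowLattice

variable {inp : List ℤ} {s : Store}

/-- Compute and write the normal form of the lattice given by the generators in the array `0`. -/
def normalize : Cmd := .seq elim <| .seq reduce <| .seq content output

/-- Two number sizes are separated. The cubic part, triangularization and reduction, sees only
numbers bounded in terms of `g` and the array indices, collected in `Z`. The factors `num` and `den`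
enter only the quadratic output phase, charged with `Z'`. -/
theorem spec_normalize {d w n : ℕ} {g num den Z Z' : ℤ} (hd : 0 < d) (hg : 0 < g)
    (hnum : 0 < num) (hden : 0 < den)
    (h0 : s.var 0 = n) (h1 : s.var 1 = w) (h2 : s.var 2 = g)
    (h3 : s.var 3 = d) (h4 : s.var 4 = num) (h5 : s.var 5 = den) (hout : s.out = [])
    (hbox : Box (s.arr 0) w n g)
    {A : ℕ} (hwA : w ≤ A) (hnA : n ≤ A) (hdw : d ≤ w) (hgZ : 4 * (g + 1) ^ 2 ≤ Z)
    (hwZ : ((A * w + A + w : ℕ) : ℤ) ≤ Z)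
    (hgZ' : num * g * g ≤ Z') (hdZ' : den ≤ Z') (hwZ' : ((A * w + A + w : ℕ) : ℤ) ≤ Z') :
    normalize.Spec inp s (300 * (n + w) * (w + 1) ^ 2 * unitCost Z + 81 * d ^ 2 * unitCost Z')
      fun s' => ∃ (H : Matrix (Fin d) (Fin d) ℤ) (γ : ℤ), IsHNF H ∧ 0 < γ ∧
        (∀ x, x ∣ γ ↔ ∀ i j, x ∣ H i j) ∧
        (∀ x : ℕ → ℤ, (x ∈ genLat (s.arr 0) w n g w ∧ ∀ t, d ≤ t → x t = 0) ↔
          x ∈ Submodule.span ℤ (Set.range fun i : Fin d =>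
            (fun t => if h : t < d then H i ⟨t, h⟩ else 0 : ℕ → ℤ))) ∧
        s'.out = encodeIdeal (den / Int.gcd (num * γ) den).toNat
          (Matrix.of fun i j => num * γ / Int.gcd (num * γ) den * (H i j / γ)) := by
  have hg1 := add_one_le_of_sq_le hg hgZ
  have hlast : ∀ (s₃ : Store) (R : ℕ → ℤ) (γ : ℤ), s₃.arr 1 = R → s₃.var 15 = γ →
      s₃.out = [] → s₃.var 1 = w → s₃.var 3 = d → s₃.var 4 = num → s₃.var 5 = den →
      (∀ i < w, IsPivotRow (genLat (s.arr 0) w n g w) R w i) → Box R w w g →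
      (∀ k < d, ∀ j < k, R (k * w + j) < R (j * w + j)) →
      0 ≤ γ → γ ≤ g → (∀ x : ℤ, x ∣ γ ↔ ∀ i < d, ∀ j < d, x ∣ R (i * w + j)) →
      output.Spec inp s₃ (81 * d ^ 2 * unitCost Z')
      fun s' => ∃ (H : Matrix (Fin d) (Fin d) ℤ) (γ : ℤ), IsHNF H ∧ 0 < γ ∧
        (∀ x, x ∣ γ ↔ ∀ i j, x ∣ H i j) ∧
        (∀ x : ℕ → ℤ, (x ∈ genLat (s.arr 0) w n g w ∧ ∀ t, d ≤ t → x t = 0) ↔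
          x ∈ Submodule.span ℤ (Set.range fun i : Fin d =>
            (fun t => if h : t < d then H i ⟨t, h⟩ else 0 : ℕ → ℤ))) ∧
        s'.out = encodeIdeal (den / Int.gcd (num * γ) den).toNat
          (Matrix.of fun i j => num * γ / Int.gcd (num * γ) den * (H i j / γ)) := by
    intro s₃ R γ hR hγ hout h1 h3 h4 h5 hpiv hbox hred hγ0 hγg hγdvd
    -- A vanishing content would make the first diagonal entry zero.
    have hγpos : 0 < γ := by
      refine hγ0.lt_of_ne fun h => ?_
      have h2 := (hγdvd 0).1 (by rw [← h]) 0 hd 0 hd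
      have := (hpiv 0 (by omega)).pos
      rw [zero_dvd_iff.1 h2] at this
      exact lt_irrefl _ this
    refine Spec.imp (wp_output (Z := Z') (d := d) (w := w) hg hnum hden hγpos hγg h3 h1 h4 h5 hγ
      (hR ▸ hbox) hwA hdw hgZ' hdZ' hwZ') ?_ fun s' _ ho => ?_
    · gcongr
      nlinarith
    · refine ⟨Matrix.of fun i j => R (i * w + j), γ, ⟨fun i j hij => ?_, fun i => ?_,
        fun i j hij => ⟨?_, ?_⟩⟩, hγpos, fun x => ?_, fun x => ?_, ?_⟩
      · exact (hpiv i (by omega)).upper j hij (by omega)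
      · exact (hpiv i (by omega)).pos
      · exact (hbox i (by omega) j (by omega)).1
      · exact hred i i.2 j hij
      · rw [hγdvd]
        exact ⟨fun h i j => h i i.2 j j.2, fun h i hi j hj => h ⟨i, hi⟩ ⟨j, hj⟩⟩
      -- Only the first `d` of the `w` rows are written. They form a basis of the sublattice of
      -- vectors supported on the first `d` coordinates.
      · rw [mem_span_rows hdw (fun i hi => hpiv i (by omega))]
        have hrow : ∀ i < d, rowVec R w i =
            fun t => if h : t < d then R (i * w + t) else 0 := by
          intro i hi
          ext t
          unfold rowVec
          split_ifs with ha hb hb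
          · rfl
          · exact (hpiv i (by omega)).upper t (by omega) ha
          · omega
          · rfl
        suffices {x | ∃ i < d, rowVec R w i = x} = Set.range fun i : Fin d =>
            (fun t => if h : t < d then Matrix.of (fun i j : Fin d => R (i * w + j)) i ⟨t, h⟩
              else 0 : ℕ → ℤ) by rw [this]
        ext y
        constructor
        · rintro ⟨i, hi, rfl⟩
          exact ⟨⟨i, hi⟩, (hrow i hi).symm⟩
        · rintro ⟨i, rfl⟩
          exact ⟨i, i.2, hrow i i.2⟩
      · rw [ho, hout, hR]
        have hh0 : (0 : ℤ) < Int.gcd (num * γ) den := by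
          exact_mod_cast Int.gcd_pos_of_ne_zero_right _ hden.ne'
        simp only [List.nil_append, encodeIdeal, matrixEntries,
          Int.toNat_of_nonneg (Int.ediv_nonneg hden.le hh0.le), List.cons.injEq, true_and]
        simp only [← List.map_coe_finRange_eq_range, List.flatMap_map, List.map_map]
        rfl
  have e : normalize.Spec inp s ((5 + w * (60 + w * 22 + n * (158 + w * 110))) * unitCost Z +
      ((5 + d * (13 + d * (70 + w * 60))) * unitCost Z + ((8 + d * (13 + d * 28)) * unitCost Z +
        81 * d ^ 2 * unitCost Z'))) _ :=
    Spec.seq (Spec.imp (wp_elim hg h0 h1 h2 hbox hwA hnA hgZ hwZ) le_rfl fun s₁ hF₁ H₁ =>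
      Spec.seq (Spec.imp (wp_reduce (d := d) hg ((hF₁.var 3 (by decide)).trans h3)
        ((hF₁.var 1 (by decide)).trans h1) ((hF₁.var 2 (by decide)).trans h2)
        modLat_le_genLat H₁.1 H₁.2 hwA hdw hgZ hwZ) le_rfl fun s₂ hF₂ H₂ =>
      Spec.seq (Spec.imp (wp_content (d := d) hg
        ((hF₂.var 3 (by decide)).trans ((hF₁.var 3 (by decide)).trans h3))
        ((hF₂.var 1 (by decide)).trans ((hF₁.var 1 (by decide)).trans h1))
        H₂.2.1 hwA hdw (by linarith) hwZ) le_rfl fun s₃ hF₃ H₃ =>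
      hlast s₃ (s₂.arr 1) _ (hF₃.arr 1 (by decide)) rfl
        ((hF₃.out rfl).trans ((hF₂.out rfl).trans ((hF₁.out rfl).trans hout)))
        ((hF₃.var 1 (by decide)).trans
          ((hF₂.var 1 (by decide)).trans ((hF₁.var 1 (by decide)).trans h1)))
        ((hF₃.var 3 (by decide)).trans
          ((hF₂.var 3 (by decide)).trans ((hF₁.var 3 (by decide)).trans h3)))
        ((hF₃.var 4 (by decide)).trans
          ((hF₂.var 4 (by decide)).trans ((hF₁.var 4 (by decide)).trans h4)))
        ((hF₃.var 5 (by decide)).trans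
          ((hF₂.var 5 (by decide)).trans ((hF₁.var 5 (by decide)).trans h5)))
        H₂.1 H₂.2.1 H₂.2.2 H₃.1 H₃.2.1 H₃.2.2)))
  refine Spec.imp e ?_ fun _ _ h => h
  have key : 5 + w * (60 + w * 22 + n * (158 + w * 110)) + (5 + d * (13 + d * (70 + w * 60))) +
      (8 + d * (13 + d * 28)) ≤ 300 * (n + w) * (w + 1) ^ 2 := by
    have hd2 : d * d ≤ w * w := Nat.mul_le_mul hdw hdw
    have hd3 : d * d * w ≤ w * w * w := Nat.mul_le_mul_right w hd2
    have hw : 1 ≤ w := by omega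
    have hw2 : w ≤ w * w := Nat.le_mul_of_pos_left _ hw
    nlinarith [Nat.zero_le (n * w), Nat.zero_le (n * w * w), Nat.zero_le (w * w * w)]
  have := Nat.mul_le_mul_right (unitCost Z) key
  linarith

end Cmd
end RAM

/-! ### Normal forms of fractional ideals -/

section Ideals

variable {K : Type*} [Field K] {d : ℕ} (ω : Module.Basis (Fin d) ℤ (𝓞 K))

/-- The content of a scaled family is the scaled content. After division by `gcd q m`, the cofactor
of `q` is coprime to that of `m`, so it divides every `a i` and therefore `γ`. -/
theorem Int.dvd_mul_of_forall_dvd {ι : Type*} {a : ι → ℤ} {γ : ℤ}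
    (hγ : ∀ x, (∀ i, x ∣ a i) → x ∣ γ) {q m : ℤ} (hq : q ≠ 0) (h : ∀ i, q ∣ m * a i) :
    q ∣ m * γ := by
  have he : 0 < Int.gcd q m := Int.gcd_pos_of_ne_zero_left m hq
  obtain ⟨q', m', h1, h2, h3⟩ := Int.exists_gcd_one he
  have he' : (Int.gcd q m : ℤ) ≠ 0 := by exact_mod_cast he.ne'
  generalize (Int.gcd q m : ℤ) = e at *
  subst h2 h3
  have : q' ∣ γ := hγ q' fun i => by
    have h4 : q' * e ∣ m' * a i * e := by convert h i using 1; ring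
    exact Int.dvd_of_dvd_mul_right_of_gcd_one (Int.dvd_of_mul_dvd_mul_right he' h4) h1
  obtain ⟨r, rfl⟩ := this
  exact ⟨m' * r, by ring⟩

/-- The element with the given coordinates. -/
noncomputable def ofCoords : (ℕ → ℤ) →ₗ[ℤ] K where
  toFun x := ∑ j : Fin d, (x j : K) * (ω j : K)
  map_add' x y := by simp [add_mul, Finset.sum_add_distrib]
  map_smul' c x := by simp [Finset.mul_sum, mul_assoc]

theorem ofCoords_apply (x : ℕ → ℤ) : ofCoords ω x = ∑ j : Fin d, (x j : K) * (ω j : K) := rfl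

theorem ofCoords_sum_smul (c : Fin d → ℤ) :
    ((∑ j, c j • ω j : 𝓞 K) : K) = ∑ j, (c j : K) * (ω j : K) := by
  simp only [RingOfIntegers.coe_eq_algebraMap, map_sum, zsmul_eq_mul, map_mul, map_intCast]

theorem sum_repr_coe (y : 𝓞 K) : ∑ j, ((ω.repr y j : ℤ) : K) * (ω j : K) = y := by
  rw [← ofCoords_sum_smul ω, ω.sum_repr]

theorem mul_repr_eq {q : ℤ} {y : 𝓞 K} {c : Fin d → ℤ}
    (h : (q : K) * (y : K) = ∑ j, (c j : K) * (ω j : K)) (j : Fin d) : q * ω.repr y j = c j := by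
  have h1 : q • y = ∑ j, c j • ω j := by
    apply RingOfIntegers.ext
    rw [ofCoords_sum_smul, ← h]
    simp
  have := congrArg (fun z => ω.repr z j) h1
  simpa only [map_smul, Finsupp.smul_apply, smul_eq_mul, Module.Basis.repr_sum_self] using this

variable {𝔞 : FractionalIdeal (𝓞 K)⁰ K}

theorem forall_mem_of_span {ι : Type*} {f : ι → K}
    (h : (𝔞 : Submodule (𝓞 K) K).restrictScalars ℤ = Submodule.span ℤ (Set.range f))
    (N : Submodule ℤ K) (hN : ∀ i, f i ∈ N) {x : K} (hx : x ∈ 𝔞) : x ∈ N := by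
  have h1 : x ∈ (𝔞 : Submodule (𝓞 K) K).restrictScalars ℤ := hx
  rw [h] at h1
  exact Submodule.span_le.2 (by rintro _ ⟨i, rfl⟩; exact hN i) h1

theorem apply_mem_of_span {ι : Type*} {f : ι → K}
    (h : (𝔞 : Submodule (𝓞 K) K).restrictScalars ℤ = Submodule.span ℤ (Set.range f))
    (i : ι) : f i ∈ 𝔞 := by
  have h1 : f i ∈ (𝔞 : Submodule (𝓞 K) K).restrictScalars ℤ := by
    rw [h]; exact Submodule.subset_span ⟨i, rfl⟩
  exact h1

variable {k : ℕ} {M : Matrix (Fin d) (Fin d) ℤ}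

theorem IsHNFRep.pos {ω : Module.Basis (Fin d) ℤ (𝓞 K)} (h : IsHNFRep ω 𝔞 k M) : 0 < k := h.1.1.1

variable [NumberField K]

/-- The normal form of `(num / den) Λ`, where `H` is the normal form of the lattice `Λ` with
content `γ`. -/
theorem isHNFRep_of_span {H : Matrix (Fin d) (Fin d) ℤ} {num den γ : ℤ} (hnum : 0 < num)
    (hden : 0 < den) (hγ : 0 < γ) (hH : IsHNF H) (hγH : ∀ x, x ∣ γ ↔ ∀ i j, x ∣ H i j)
    (h : (𝔞 : Submodule (𝓞 K) K).restrictScalars ℤ = Submodule.span ℤ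
      (Set.range fun i => (num / den : K) * ∑ j, (H i j : K) * (ω j : K))) :
    IsHNFRep ω 𝔞 (den / Int.gcd (num * γ) den).toNat
      (Matrix.of fun i j => num * γ / Int.gcd (num * γ) den * (H i j / γ)) := by
  have hU : 0 < num * γ := mul_pos hnum hγ
  have he : 0 < Int.gcd (num * γ) den := Int.gcd_pos_of_ne_zero_right _ hden.ne'
  -- The fraction `num * γ / den` in lowest terms is `u / k`. As `H i j / γ` has content `1`, the
  -- number `k` is the denominator.
  obtain ⟨u, k, h1, h2, h3⟩ := Int.exists_gcd_one he
  have he' : (0 : ℤ) < Int.gcd (num * γ) den := by exact_mod_cast he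
  rw [Int.ediv_eq_of_eq_mul_left he'.ne' h2, Int.ediv_eq_of_eq_mul_left he'.ne' h3]
  generalize (Int.gcd (num * γ) den : ℤ) = e at *
  have hu : 0 < u := by rw [h2] at hU; exact pos_of_mul_pos_left hU he'.le
  have hk : 0 < k := by rw [h3] at hden; exact pos_of_mul_pos_left hden he'.le
  have hγd : ∀ i j, γ ∣ H i j := (hγH γ).1 dvd_rfl
  have hdvd : ∀ i j, H i j / γ * γ = H i j := fun i j => Int.ediv_mul_cancel (hγd i j)
  have hkK : ((k.toNat : ℕ) : K) = (k : K) := by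
    have : ((k.toNat : ℤ) : K) = (k : K) := by rw [Int.toNat_of_nonneg hk.le]
    exact_mod_cast this
  have hk0 : (k : K) ≠ 0 := by exact_mod_cast hk.ne'
  have he0 : (e : K) ≠ 0 := by exact_mod_cast he'.ne'
  have hγ0 : (γ : K) ≠ 0 := by exact_mod_cast hγ.ne'
  have hentry : ∀ i j, (num / den : K) * (H i j : K) =
      (k : K)⁻¹ * ((u * (H i j / γ) : ℤ) : K) := by
    intro i j
    have e1 : (num : K) * γ = u * e := by exact_mod_cast h2
    have e2 : (den : K) = k * e := by exact_mod_cast h3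
    have e3 : ((H i j / γ : ℤ) : K) * γ = H i j := by exact_mod_cast hdvd i j
    rw [e2, ← e3]
    push_cast
    field_simp
    linear_combination ((H i j / γ : ℤ) : K) * e1
  have hrow : ∀ i, (num / den : K) * ∑ j, (H i j : K) * (ω j : K) =
      (k : K)⁻¹ * ∑ j, ((u * (H i j / γ) : ℤ) : K) * (ω j : K) := by
    intro i
    rw [Finset.mul_sum, Finset.mul_sum]
    exact Finset.sum_congr rfl fun j _ => by rw [← mul_assoc, hentry, mul_assoc]
  refine ⟨⟨⟨by omega, fun x hx => ?_⟩, fun t ht => ?_⟩, ⟨fun i j hij => ?_, fun i => ?_,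
    fun i j hij => ?_⟩, ?_⟩
  · let N : Submodule ℤ K :=
      { carrier := {x | ∃ y : 𝓞 K, (k : K) * x = (y : K)}
        zero_mem' := ⟨0, by simp⟩
        add_mem' := fun {a b} ⟨y, hy⟩ ⟨z, hz⟩ => ⟨y + z, by rw [mul_add, hy, hz]; simp⟩
        smul_mem' := fun c a ⟨y, hy⟩ => ⟨c • y, by simp [← hy]; ring⟩ }
    rw [hkK]
    refine forall_mem_of_span h N (fun i => ⟨∑ j, (u * (H i j / γ)) • ω j, ?_⟩) hx
    rw [hrow, mul_inv_cancel_left₀ hk0, ofCoords_sum_smul]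
  -- Minimality: if `t 𝔞` is integral, then `den` divides `t * num * H i j` for all entries, hence
  -- `t * num * γ`. Cancelling the gcd gives `k ∣ t * u` with `u` and `k` coprime, so `k ∣ t`.
  · obtain ⟨ht0, ht⟩ := ht
    have key : ∀ p : Fin d × Fin d, den ∣ (t * num : ℤ) * H p.1 p.2 := by
      rintro ⟨i, j⟩
      obtain ⟨y, hy⟩ := ht _ (apply_mem_of_span h i)
      have hd0 : (den : K) ≠ 0 := by exact_mod_cast hden.ne'
      refine ⟨ω.repr y j, (mul_repr_eq ω (q := den) (c := fun j => t * num * H i j) ?_ j).symm⟩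
      rw [← hy]
      push_cast
      simp_rw [mul_assoc, ← Finset.mul_sum]
      field_simp
    have h4 : den ∣ t * num * γ :=
      Int.dvd_mul_of_forall_dvd (fun x hx => (hγH x).2 fun i j => hx (i, j)) hden.ne' key
    rw [mul_assoc, h2, h3, ← mul_assoc] at h4
    have h5 := Int.dvd_of_dvd_mul_left_of_gcd_one (Int.dvd_of_mul_dvd_mul_right he'.ne' h4)
      (by rw [Int.gcd_comm]; exact h1)
    have := Int.le_of_dvd (by exact_mod_cast ht0) h5
    omega
  · simp [hH.1 i j hij]
  · exact mul_pos hu (Int.ediv_pos_of_pos_of_dvd (hH.2.1 i) hγ.le (hγd i i))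
  · have h4 := hH.2.2 i j hij
    have h5 : H i j / γ < H j j / γ := by
      have := h4.2
      rw [← hdvd i j, ← hdvd j j] at this
      exact lt_of_mul_lt_mul_right this hγ.le
    exact ⟨mul_nonneg hu.le (Int.ediv_nonneg h4.1 hγ.le), mul_lt_mul_of_pos_left h5 hu⟩
  · rw [h]
    congr 2
    funext i
    rw [hrow, hkK]
    simp

theorem IsHNF.det (h : IsHNF M) : M.det = ∏ i, M i i :=
  Matrix.det_of_isLowerTriangular _ fun i j hij => h.1 i j hij

theorem IsHNF.det_pos (h : IsHNF M) : 0 < M.det := by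
  rw [h.det]; exact Finset.prod_pos fun i _ => h.2.1 i

theorem IsHNF.diag_le (h : IsHNF M) (i : Fin d) : M i i ≤ M.det := by
  rw [h.det]
  exact Int.le_of_dvd (Finset.prod_pos fun i _ => h.2.1 i)
    (Finset.dvd_prod_of_mem _ (Finset.mem_univ i))

theorem IsHNF.nonneg (h : IsHNF M) (i j : Fin d) : 0 ≤ M i j := by
  rcases lt_trichotomy i j with hij | rfl | hij
  · exact (h.1 i j hij).ge
  · exact (h.2.1 i).le
  · exact (h.2.2 i j hij).1

/-- An entry is at most the diagonal entry of its column, and a diagonal entry is a factor of the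
determinant. So one determinant bounds the whole matrix. -/
theorem IsHNF.le_det (h : IsHNF M) (i j : Fin d) : M i j ≤ M.det := by
  rcases lt_trichotomy i j with hij | rfl | hij
  · rw [h.1 i j hij]; exact h.det_pos.le
  · exact h.diag_le i
  · exact (h.2.2 i j hij).2.le.trans (h.diag_le j)

/-- The multiples of the determinant are in the lattice spanned by the rows. -/
theorem det_mul_mem {ω : Module.Basis (Fin d) ℤ (𝓞 K)} (h : IsHNFRep ω 𝔞 k M) (j : Fin d) :
    (k : K)⁻¹ * ((M.det : K) * (ω j : K)) ∈ 𝔞 := by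
  -- Multiplication by the adjugate expresses the determinant times a basis element as an integral
  -- combination of the rows.
  have e : (k : K)⁻¹ * ((M.det : K) * (ω j : K)) =
      ∑ i, M.adjugate j i • ((k : K)⁻¹ * ∑ l, (M i l : K) * (ω l : K)) := by
    have h1 : ∀ l, ((M.det * if j = l then 1 else 0 : ℤ) : K) =
        ∑ i, (M.adjugate j i : K) * (M i l : K) := by
      intro l
      have := congrFun (congrFun (Matrix.adjugate_mul M) j) l
      rw [Matrix.mul_apply, Matrix.smul_apply, Matrix.one_apply, smul_eq_mul] at this
      rw [← this]
      push_cast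
      rfl
    calc _ = (k : K)⁻¹ * ∑ l, ((M.det * if j = l then 1 else 0 : ℤ) : K) * (ω l : K) := by
          congr 1
          rw [Finset.sum_eq_single j]
          · simp
          · intro l _ hl
            simp [Ne.symm hl]
          · simp
      _ = _ := by
          simp_rw [h1, Finset.sum_mul, Finset.mul_sum]
          rw [Finset.sum_comm]
          refine Finset.sum_congr rfl fun i _ => ?_
          rw [zsmul_eq_mul, Finset.mul_sum]
          refine Finset.sum_congr rfl fun l _ => by ring
  rw [e]
  have : ∀ i, M.adjugate j i • ((k : K)⁻¹ * ∑ l, (M i l : K) * (ω l : K)) ∈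
      (𝔞 : Submodule (𝓞 K) K).restrictScalars ℤ := fun i =>
    Submodule.smul_mem _ _ (apply_mem_of_span h.2.2 i)
  exact Submodule.sum_mem ((𝔞 : Submodule (𝓞 K) K).restrictScalars ℤ) fun i _ => this i

end Ideals

section Ideals

variable {K : Type*} [Field K] {d : ℕ} {ω : Module.Basis (Fin d) ℤ (𝓞 K)}
  {𝔞 : FractionalIdeal (𝓞 K)⁰ K} {k : ℕ} {M : Matrix (Fin d) (Fin d) ℤ}

theorem IsHNFRep.idealDen_eq (h : IsHNFRep ω 𝔞 k M) : idealDen 𝔞 = k :=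
  h.1.csInf_eq

variable [NumberField K]

theorem IsHNFRep.mem_idealNum (h : IsHNFRep ω 𝔞 k M) (x : 𝓞 K) :
    x ∈ idealNum 𝔞 ↔ x ∈ Submodule.span ℤ (Set.range fun i => ∑ j, M i j • ω j) := by
  have hk : (k : K) ≠ 0 := by exact_mod_cast h.pos.ne'
  have h1 : x ∈ idealNum 𝔞 ↔ (k : K)⁻¹ * (x : K) ∈ 𝔞 := by
    unfold idealNum
    rw [h.idealDen_eq, Submodule.mem_comap, FractionalIdeal.mem_coe,
      FractionalIdeal.mem_singleton_mul]
    constructor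
    · rintro ⟨y, hy, e⟩
      have : (x : K) = k * y := e
      rw [this, inv_mul_cancel_left₀ hk]; exact hy
    · intro hx
      exact ⟨_, hx, by rw [mul_inv_cancel_left₀ hk]; rfl⟩
  rw [h1]
  have h2 : (k : K)⁻¹ * (x : K) ∈ 𝔞 ↔
      (k : K)⁻¹ * (x : K) ∈ (𝔞 : Submodule (𝓞 K) K).restrictScalars ℤ := Iff.rfl
  let f : 𝓞 K →ₗ[ℤ] K := (LinearMap.mulLeft ℤ (k : K)⁻¹).comp
    ((Algebra.linearMap (𝓞 K) K).restrictScalars ℤ)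
  have hf : Function.Injective f := by
    intro a b hab
    have : (k : K)⁻¹ * (a : K) = (k : K)⁻¹ * (b : K) := hab
    exact RingOfIntegers.ext (mul_left_cancel₀ (inv_ne_zero hk) this)
  have h3 : Submodule.span ℤ (Set.range fun i => (k : K)⁻¹ * ∑ j, (M i j : K) * (ω j : K)) =
      (Submodule.span ℤ (Set.range fun i => ∑ j, M i j • ω j)).map f := by
    rw [Submodule.map_span, ← Set.range_comp]
    congr 2
    funext i
    change _ = (k : K)⁻¹ * ((∑ j, M i j • ω j : 𝓞 K) : K)
    rw [ofCoords_sum_smul]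
  rw [h2, h.2.2, h3]
  constructor
  · rintro ⟨y, hy, e⟩
    rwa [← hf e]
  · intro hx
    exact ⟨x, hx, rfl⟩

/-- The rows are a basis of the integral ideal, and its index is the absolute determinant of the
base change. This turns a bound on the size of the ideal into a bound on the matrix. -/
theorem IsHNFRep.absNorm_eq (h : IsHNFRep ω 𝔞 k M) :
    (Ideal.absNorm (idealNum 𝔞) : ℤ) = M.det := by
  have hdet := h.2.1.det_pos
  let v : Fin d → 𝓞 K := fun i => ∑ j, M i j • ω j
  have hli : LinearIndependent ℤ v := by
    have := (Matrix.linearIndependent_rows_of_det_ne_zero hdet.ne').map'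
      (ω.equivFun.symm : (Fin d → ℤ) →ₗ[ℤ] 𝓞 K) (LinearEquiv.ker _)
    have e : v = ω.equivFun.symm ∘ M.row := funext fun i =>
      (Module.Basis.equivFun_symm_apply ω (M i)).symm
    rw [e]
    exact this
  have hspan : (idealNum 𝔞).restrictScalars ℤ = Submodule.span ℤ (Set.range v) := by
    ext x; exact h.mem_idealNum x
  let b₀ := Module.Basis.span hli
  let b : Module.Basis (Fin d) ℤ (idealNum 𝔞) := b₀.map (LinearEquiv.ofEq _ _ hspan.symm)
  have hb : ∀ i, ((b i : idealNum 𝔞) : 𝓞 K) = v i := fun i =>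
    congrArg Subtype.val (Module.Basis.span_apply hli i)
  have := Ideal.natAbs_det_basis_change ω (idealNum 𝔞) b
  rw [← this, show ((↑) ∘ b : Fin d → 𝓞 K) = v from funext hb]
  have e : ω.det v = M.det := by
    rw [Module.Basis.det_apply, ← Matrix.det_transpose M]
    congr 1
    ext i j
    rw [Module.Basis.toMatrix_apply, Matrix.transpose_apply]
    simp only [v, Module.Basis.repr_sum_self]
  rw [e, Int.natAbs_of_nonneg hdet.le]

theorem IsHNFRep.logb_den_le (h : IsHNFRep ω 𝔞 k M) {B : ℝ} (hB : idealSize 𝔞 ≤ B) :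
    Real.logb 2 k ≤ B := by
  unfold idealSize at hB
  rw [h.idealDen_eq] at hB
  have : 0 ≤ Real.logb 2 (Ideal.absNorm (idealNum 𝔞)) := by
    refine Real.logb_nonneg (by norm_num) ?_
    have := h.absNorm_eq
    have h2 := h.2.1.det_pos
    exact_mod_cast (by omega : 1 ≤ Ideal.absNorm (idealNum 𝔞))
  nlinarith [sq_nonneg (Module.finrank ℚ K : ℝ)]

/-- The weight `d ^ 2` pays off here: the moduli of the computations have only about `B / d ^ 2`
bits, although the denominators may have `B`. -/
theorem IsHNFRep.logb_det_le (h : IsHNFRep ω 𝔞 k M) (hd : Module.finrank ℚ K = d) {B : ℝ}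
    (hB : idealSize 𝔞 ≤ B) : (d : ℝ) ^ 2 * Real.logb 2 M.det ≤ B := by
  unfold idealSize at hB
  rw [h.idealDen_eq, hd] at hB
  have h1 : ((M.det : ℤ) : ℝ) = (Ideal.absNorm (idealNum 𝔞) : ℝ) := by
    rw [← h.absNorm_eq]; simp
  have h2 : 0 ≤ Real.logb 2 k :=
    Real.logb_nonneg (by norm_num) (by exact_mod_cast h.pos)
  rw [h1]
  linarith

end Ideals

namespace RowLattice

/-- When the modulus acts in all coordinates, membership means being congruent modulo `g` to an
integral combination of the rows. The coefficients become available for explicit computations. -/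
theorem mem_genLat_iff {V : ℕ → ℤ} {w n : ℕ} {g : ℤ} {x : ℕ → ℤ} :
    x ∈ genLat V w n g w ↔ (∀ t, w ≤ t → x t = 0) ∧
      ∃ c : ℕ → ℤ, ∀ t < w, g ∣ x t - ∑ i ∈ Finset.range n, c i * V (i * w + t) := by
  constructor
  · intro hx
    let N : Submodule ℤ (ℕ → ℤ) :=
      { carrier := {x | (∀ t, w ≤ t → x t = 0) ∧
          ∃ c : ℕ → ℤ, ∀ t < w, g ∣ x t - ∑ i ∈ Finset.range n, c i * V (i * w + t)}
        zero_mem' := ⟨fun _ _ => rfl, 0, by simp⟩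
        add_mem' := by
          rintro x y ⟨hx, c, hc⟩ ⟨hy, b, hb⟩
          refine ⟨fun t ht => by simp [hx t ht, hy t ht], c + b, fun t ht => ?_⟩
          have := dvd_add (hc t ht) (hb t ht)
          rwa [sub_add_sub_comm, ← Finset.sum_add_distrib,
            ← Finset.sum_congr rfl fun i _ => add_mul (c i) (b i) (V (i * w + t))] at this
        smul_mem' := by
          rintro r x ⟨hx, c, hc⟩
          refine ⟨fun t ht => by simp [hx t ht], r • c, fun t ht => ?_⟩
          have := (hc t ht).mul_left r
          rwa [mul_sub, Finset.mul_sum,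
            ← Finset.sum_congr rfl fun i _ => mul_assoc r (c i) (V (i * w + t))] at this }
    refine (genLat_le (N := N)).2 ⟨fun i hi => ⟨fun t ht => ?_, Pi.single i 1, fun t ht => ?_⟩,
      fun y hy => ⟨hy.2, 0, fun t _ => by simpa using hy.1 t⟩⟩ hx
    · simp [rowVec, not_lt.2 ht]
    · rw [Finset.sum_eq_single i (fun j _ hj => by simp [hj]) (fun h => by simp [hi] at h)]
      simp [rowVec, ht]
  · rintro ⟨hx, c, hc⟩
    have h1 : ∑ i ∈ Finset.range n, c i • rowVec V w i ∈ genLat V w n g w :=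
      Submodule.sum_mem _ fun i hi =>
        Submodule.smul_mem _ _ (rowVec_mem_genLat (Finset.mem_range.1 hi))
    have h2 : x - ∑ i ∈ Finset.range n, c i • rowVec V w i ∈ modLat g w := by
      refine ⟨fun t => ?_, fun t ht => ?_⟩
      · rcases lt_or_ge t w with ht | ht
        · simpa [rowVec, ht] using hc t ht
        · simp [rowVec, not_lt.2 ht, hx t ht]
      · simp [rowVec, not_lt.2 ht, hx t ht]
    have := Submodule.add_mem _ h1 (modLat_le_genLat h2)
    rwa [add_sub_cancel] at this

end RowLattice

/-! ### Sums, products and inverses as lattices with generators modulo an integer -/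

section Ideals
open RowLattice

variable {K : Type*} [Field K] {d : ℕ} {ω : Module.Basis (Fin d) ℤ (𝓞 K)}

theorem span_rows_eq {C : Submodule ℤ K} {q : K} {Λ : Set (ℕ → ℤ)}
    {H : Matrix (Fin d) (Fin d) ℤ} (hC : ∀ y, y ∈ C ↔ ∃ x ∈ Λ, y = q * ofCoords ω x)
    (hΛ : ∀ x, x ∈ Λ ↔ x ∈ Submodule.span ℤ (Set.range fun i : Fin d =>
      (fun t => if h : t < d then H i ⟨t, h⟩ else 0 : ℕ → ℤ))) :
    C = Submodule.span ℤ (Set.range fun i => q * ∑ j, (H i j : K) * (ω j : K)) := by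
  have e : (Set.range fun i => q * ∑ j, (H i j : K) * (ω j : K)) =
      (LinearMap.mulLeft ℤ q ∘ₗ ofCoords ω) '' (Set.range fun i : Fin d =>
        (fun t => if h : t < d then H i ⟨t, h⟩ else 0 : ℕ → ℤ)) := by
    rw [← Set.range_comp]
    congr 1
    funext i
    simp [ofCoords_apply, Finset.mul_sum]
  rw [e, Submodule.span_image]
  ext y
  rw [hC, Submodule.mem_map]
  exact exists_congr fun x => and_congr (hΛ x) eq_comm

/-- The fractional lattice spanned by elements `u i` whose coordinates, up to the factor `q`, are
given modulo `g`. -/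
theorem mem_iff_exists_genLat {C : Submodule ℤ K} {n : ℕ} {g : ℤ} {q : K} {V : ℕ → ℤ}
    {U : ℕ → ℕ → ℤ} {u : ℕ → K} (hV : ∀ i < n, ∀ t < d, V (i * d + t) = U i t % g)
    (hu : ∀ i < n, u i = q * ofCoords ω (U i)) (hg : ∀ j : Fin d, q * (g * (ω j : K)) ∈ C)
    (hC : C = Submodule.span ℤ {y | ∃ i < n, u i = y}) (y : K) :
    y ∈ C ↔ ∃ x, (x ∈ genLat V d n g d ∧ ∀ t, d ≤ t → x t = 0) ∧ y = q * ofCoords ω x := by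
  have hcoords : ∀ c : ℕ → ℤ, ∑ i ∈ Finset.range n, (c i : K) * u i =
      q * ofCoords ω (fun t => ∑ i ∈ Finset.range n, c i * U i t) := by
    intro c
    have e : (fun t => ∑ i ∈ Finset.range n, c i * U i t) = ∑ i ∈ Finset.range n, c i • U i := by
      ext t; simp
    rw [e, map_sum, Finset.mul_sum]
    refine Finset.sum_congr rfl fun i hi => ?_
    rw [hu i (Finset.mem_range.1 hi), map_smul, zsmul_eq_mul]
    ring
  constructor
  · intro hy
    have key : ∃ c : ℕ → ℤ, y = ∑ i ∈ Finset.range n, (c i : K) * u i := by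
      rw [hC] at hy
      induction hy using Submodule.span_induction with
      | mem y hy =>
        obtain ⟨i, hi, rfl⟩ := hy
        refine ⟨Pi.single i 1, ?_⟩
        rw [Finset.sum_eq_single i (fun j _ hj => by simp [hj]) (fun h => by simp [hi] at h)]
        simp
      | zero => exact ⟨0, by simp⟩
      | add y z _ _ hy hz =>
        obtain ⟨c, rfl⟩ := hy
        obtain ⟨b, rfl⟩ := hz
        exact ⟨c + b, by simp [add_mul, Finset.sum_add_distrib]⟩
      | smul r y _ hy =>
        obtain ⟨c, rfl⟩ := hy
        exact ⟨r • c, by simp [Finset.mul_sum, mul_assoc]⟩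
    obtain ⟨c, rfl⟩ := key
    refine ⟨fun t => if t < d then ∑ i ∈ Finset.range n, c i * U i t else 0,
      ⟨mem_genLat_iff.2 ⟨fun t ht => if_neg (not_lt.2 ht), c, fun t ht => ?_⟩,
        fun t ht => if_neg (not_lt.2 ht)⟩, ?_⟩
    · simp only [ht, if_true]
      rw [← Finset.sum_sub_distrib]
      refine Finset.dvd_sum fun i hi => ?_
      rw [hV i (Finset.mem_range.1 hi) t ht, ← mul_sub]
      exact (Int.dvd_self_sub_emod).mul_left _
    · rw [hcoords, ofCoords_apply, ofCoords_apply]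
      simp
  · rintro ⟨x, ⟨hx, -⟩, rfl⟩
    obtain ⟨hx0, c, hc⟩ := mem_genLat_iff.1 hx
    have hd : ∀ t : Fin d, ∃ z : ℤ, x t - ∑ i ∈ Finset.range n, c i * U i t = g * z := by
      intro t
      have h1 : g ∣ ∑ i ∈ Finset.range n, c i * V (i * d + t) -
          ∑ i ∈ Finset.range n, c i * U i t := by
        rw [← Finset.sum_sub_distrib]
        refine Finset.dvd_sum fun i hi => ?_
        rw [hV i (Finset.mem_range.1 hi) t t.2, ← mul_sub]
        exact ((dvd_sub_comm).1 Int.dvd_self_sub_emod).mul_left _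
      have := dvd_add (hc t t.2) h1
      rwa [sub_add_sub_cancel] at this
    choose z hz using hd
    -- The coordinates of `x` and of the combination differ by multiples `g * z j`. These contribute
    -- elements of `C` because `C` contains the scaled multiples of `g`; so replacing generators by
    -- their residues changes nothing.
    have e : q * ofCoords ω x = ∑ i ∈ Finset.range n, (c i : K) * u i +
        ∑ j, z j • (q * (g * (ω j : K))) := by
      rw [hcoords, ofCoords_apply, ofCoords_apply, Finset.mul_sum, Finset.mul_sum,
        ← Finset.sum_add_distrib]
      refine Finset.sum_congr rfl fun j _ => ?_
      have : (x j : K) = ((∑ i ∈ Finset.range n, c i * U i j : ℤ) : K) + g * z j := by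
        have := congrArg (Int.cast : ℤ → K) (hz j)
        push_cast at this ⊢
        linear_combination this
      rw [this, zsmul_eq_mul]
      ring
    rw [e]
    refine C.add_mem (Submodule.sum_mem _ fun i hi => ?_)
      (Submodule.sum_mem _ fun j _ => C.smul_mem _ (hg j))
    rw [← zsmul_eq_mul]
    refine C.smul_mem _ ?_
    rw [hC]
    exact Submodule.subset_span ⟨i, Finset.mem_range.1 hi, rfl⟩

/-- The coordinates of the product of two elements given by their coordinates. -/
theorem mul_eq_ofCoords (a b : Fin d → ℤ) :
    (∑ p, (a p : K) * (ω p : K)) * ∑ q, (b q : K) * (ω q : K) =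
      ∑ t : Fin d, ((∑ p, ∑ q, a p * b q * ω.repr (ω p * ω q) t : ℤ) : K) * (ω t : K) := by
  have h1 : ∀ p q, (ω p : K) * (ω q : K) = ∑ t, ((ω.repr (ω p * ω q) t : ℤ) : K) * (ω t : K) := by
    intro p q
    rw [sum_repr_coe]
    simp
  rw [Finset.sum_mul_sum]
  push_cast
  simp_rw [Finset.sum_mul]
  rw [Finset.sum_comm' (t' := Finset.univ) (s' := fun _ => Finset.univ) (by simp)]
  rw [Finset.sum_comm]
  symm
  rw [Finset.sum_comm]
  refine Finset.sum_congr rfl fun p _ => ?_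
  rw [Finset.sum_comm]
  refine Finset.sum_congr rfl fun q _ => ?_
  rw [mul_mul_mul_comm, h1, Finset.mul_sum]
  exact Finset.sum_congr rfl fun t _ => by ring

variable [NumberField K] {𝔞 𝔟 : FractionalIdeal (𝓞 K)⁰ K} {k l : ℕ}
  {M N : Matrix (Fin d) (Fin d) ℤ}

/-- The lattice of a sum of fractional ideals. -/
theorem mem_add_iff_exists_genLat (ha : IsHNFRep ω 𝔞 k M) (hb : IsHNFRep ω 𝔟 l N) {k₁ l₁ g : ℤ}
    (hkl : k * k₁ = l * l₁) (hk₁ : k₁ ≠ 0) (hg : ∃ a b : ℤ, g = k₁ * M.det * a + l₁ * N.det * b)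
    {V : ℕ → ℤ} (hV : ∀ i j : Fin d, V (i * d + j) = k₁ * M i j % g)
    (hV' : ∀ i j : Fin d, V ((d + i) * d + j) = l₁ * N i j % g) (y : K) :
    y ∈ 𝔞 + 𝔟 ↔ ∃ x, (x ∈ genLat V d (d + d) g d ∧ ∀ t, d ≤ t → x t = 0) ∧
      y = (((1 : ℤ) : K) / ((k * k₁ : ℤ) : K)) * ofCoords ω x := by
  have hk0 : (k : K) ≠ 0 := by exact_mod_cast ha.pos.ne'
  have hl0 : (l : K) ≠ 0 := by exact_mod_cast hb.pos.ne'
  have hk₁0 : (k₁ : K) ≠ 0 := by exact_mod_cast hk₁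
  have hl₁0 : (l₁ : K) ≠ 0 := by
    have : l₁ ≠ 0 := by
      rintro rfl
      rw [mul_zero] at hkl
      exact mul_ne_zero (by exact_mod_cast ha.pos.ne') hk₁ hkl
    exact_mod_cast this
  have hkl' : (k * k₁ : K) = l * l₁ := by exact_mod_cast hkl
  have hy : y ∈ 𝔞 + 𝔟 ↔ y ∈ ((𝔞 + 𝔟 : FractionalIdeal (𝓞 K)⁰ K) :
    Submodule (𝓞 K) K).restrictScalars ℤ := Iff.rfl
  rw [hy]
  have hsup : ((𝔞 + 𝔟 : FractionalIdeal (𝓞 K)⁰ K) : Submodule (𝓞 K) K).restrictScalars ℤ =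
      (𝔞 : Submodule (𝓞 K) K).restrictScalars ℤ ⊔ (𝔟 : Submodule (𝓞 K) K).restrictScalars ℤ := by
    rw [FractionalIdeal.coe_add]
    ext z
    simp only [Submodule.restrictScalars_mem, Submodule.mem_sup, Submodule.add_eq_sup]
  have hleft : ∀ z ∈ 𝔞, z ∈ ((𝔞 + 𝔟 : FractionalIdeal (𝓞 K)⁰ K) :
      Submodule (𝓞 K) K).restrictScalars ℤ := fun z hz => by
    rw [hsup]; exact Submodule.mem_sup_left hz
  have hright : ∀ z ∈ 𝔟, z ∈ ((𝔞 + 𝔟 : FractionalIdeal (𝓞 K)⁰ K) :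
      Submodule (𝓞 K) K).restrictScalars ℤ := fun z hz => by
    rw [hsup]; exact Submodule.mem_sup_right hz
  -- The rows of both matrices over the common denominator `k * k₁ = l * l₁`, before reduction
  -- modulo `g`.
  let U : ℕ → ℕ → ℤ := fun i t => if h : t < d then
    if hi : i < d then k₁ * M ⟨i, hi⟩ ⟨t, h⟩ else
      if hi' : i - d < d then l₁ * N ⟨i - d, hi'⟩ ⟨t, h⟩ else 0 else 0
  refine mem_iff_exists_genLat (U := U) (u := fun i => (((1 : ℤ) : K) / ((k * k₁ : ℤ) : K)) *
    ofCoords ω (U i)) (fun i hi t ht => ?_) (fun i _ => rfl) (fun j => ?_) ?_ y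
  · by_cases hid : i < d
    · simpa [U, ht, hid] using hV ⟨i, hid⟩ ⟨t, ht⟩
    · have h1 : i - d < d := by omega
      have := hV' ⟨i - d, h1⟩ ⟨t, ht⟩
      simp only [show d + (i - d) = i by omega] at this
      simpa [U, ht, hid, h1] using this
  · obtain ⟨a, b, rfl⟩ := hg
    -- Over the common denominator, `k₁ * M.det` becomes `M.det / k` and `l₁ * N.det` becomes `N.det
    -- / l`. Multiples of the former lie in `𝔞` and of the latter in `𝔟`, so any integral
    -- combination `g` of the two is a valid modulus for the sum.
    have e : (((1 : ℤ) : K) / ((k * k₁ : ℤ) : K)) *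
        (((k₁ * M.det * a + l₁ * N.det * b : ℤ) : K) * (ω j : K)) =
        a • ((k : K)⁻¹ * ((M.det : K) * (ω j : K))) +
          b • ((l : K)⁻¹ * ((N.det : K) * (ω j : K))) := by
      simp only [zsmul_eq_mul]
      push_cast
      rw [hkl']
      have : (k : K)⁻¹ = k₁ * (l * l₁ : K)⁻¹ := by rw [← hkl']; field_simp
      rw [this]
      field_simp
    rw [e]
    exact Submodule.add_mem _ (Submodule.smul_mem _ _ (hleft _ (det_mul_mem ha j)))
      (Submodule.smul_mem _ _ (hright _ (det_mul_mem hb j)))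
  · rw [hsup, ha.2.2, hb.2.2, ← Submodule.span_union]
    congr 1
    have h1 : ∀ i : Fin d, (((1 : ℤ) : K) / ((k * k₁ : ℤ) : K)) * ofCoords ω (U i) =
        (k : K)⁻¹ * ∑ j, (M i j : K) * (ω j : K) := by
      intro i
      rw [ofCoords_apply, Finset.mul_sum, Finset.mul_sum]
      refine Finset.sum_congr rfl fun j _ => ?_
      simp only [U, Fin.is_lt, dif_pos]
      push_cast
      field_simp
    have h2 : ∀ i : Fin d, (((1 : ℤ) : K) / ((k * k₁ : ℤ) : K)) * ofCoords ω (U (d + i)) =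
        (l : K)⁻¹ * ∑ j, (N i j : K) * (ω j : K) := by
      intro i
      rw [ofCoords_apply, Finset.mul_sum, Finset.mul_sum]
      refine Finset.sum_congr rfl fun j _ => ?_
      simp only [U, Fin.is_lt, dif_pos, show ¬ (d + (i : ℕ) < d) by omega, dif_neg,
        Nat.add_sub_cancel_left, not_false_eq_true]
      push_cast
      rw [hkl']
      field_simp
    ext z
    constructor
    · rintro (⟨i, rfl⟩ | ⟨i, rfl⟩)
      · exact ⟨i, by omega, h1 i⟩
      · exact ⟨d + i, by omega, h2 i⟩
    · rintro ⟨i, hi, rfl⟩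
      by_cases hid : i < d
      · exact Or.inl ⟨⟨i, hid⟩, (h1 ⟨i, hid⟩).symm⟩
      · have := h2 ⟨i - d, by omega⟩
        simp only [show d + (i - d) = i by omega] at this
        exact Or.inr ⟨⟨i - d, by omega⟩, this.symm⟩

end Ideals

section Ideals
open RowLattice

variable {K : Type*} [Field K] {d : ℕ} {ω : Module.Basis (Fin d) ℤ (𝓞 K)}
  {𝔞 𝔟 : FractionalIdeal (𝓞 K)⁰ K} {k l : ℕ} {M N : Matrix (Fin d) (Fin d) ℤ}

theorem restrictScalars_mul_eq_span {ι κ : Type*} {a : ι → K} {b : κ → K}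
    (ha : (𝔞 : Submodule (𝓞 K) K).restrictScalars ℤ = Submodule.span ℤ (Set.range a))
    (hb : (𝔟 : Submodule (𝓞 K) K).restrictScalars ℤ = Submodule.span ℤ (Set.range b)) :
    ((𝔞 * 𝔟 : FractionalIdeal (𝓞 K)⁰ K) : Submodule (𝓞 K) K).restrictScalars ℤ =
      Submodule.span ℤ {y | ∃ i j, a i * b j = y} := by
  rw [FractionalIdeal.coe_mul, Submodule.restrictScalars_mul, ha, hb, Submodule.span_mul_span]
  congr 1
  ext y
  simp [Set.mem_mul]

variable [NumberField K]

/-- The lattice of a product of fractional ideals. -/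
theorem mem_mul_iff_exists_genLat (ha : IsHNFRep ω 𝔞 k M) (hb : IsHNFRep ω 𝔟 l N)
    (hω : ∀ i : Fin d, (i : ℕ) = 0 → ω i = 1) {V : ℕ → ℤ}
    (hV : ∀ i j t : Fin d, V ((i * d + j) * d + t) =
      (∑ p, ∑ q, M i p * N j q * ω.repr (ω p * ω q) t) % (M.det * N.det)) (y : K) :
    y ∈ 𝔞 * 𝔟 ↔ ∃ x, (x ∈ genLat V d (d * d) (M.det * N.det) d ∧ ∀ t, d ≤ t → x t = 0) ∧
      y = (((1 : ℤ) : K) / ((k * l : ℤ) : K)) * ofCoords ω x := by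
  have hk0 : (k : K) ≠ 0 := by exact_mod_cast ha.pos.ne'
  have hl0 : (l : K) ≠ 0 := by exact_mod_cast hb.pos.ne'
  have hy : y ∈ 𝔞 * 𝔟 ↔ y ∈ ((𝔞 * 𝔟 : FractionalIdeal (𝓞 K)⁰ K) :
    Submodule (𝓞 K) K).restrictScalars ℤ := Iff.rfl
  rw [hy]
  -- The generator number `r = i * d + j` is the product of the row `i` of `M` and the row `j` of
  -- `N`.
  let U : ℕ → ℕ → ℤ := fun r t => if h : t < d then
    if hr : r < d * d then ∑ p, ∑ q, M ⟨r / d, Nat.div_lt_of_lt_mul hr⟩ p *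
      N ⟨r % d, Nat.mod_lt _ (by omega)⟩ q * ω.repr (ω p * ω q) ⟨t, h⟩ else 0 else 0
  have hdiv : ∀ i j : Fin d, ((i : ℕ) * d + j) / d = i ∧ ((i : ℕ) * d + j) % d = j := fun i j => by
    rw [mul_comm, Nat.mul_add_div i.pos, Nat.div_eq_of_lt j.2, Nat.mul_add_mod,
      Nat.mod_eq_of_lt j.2]
    exact ⟨rfl, rfl⟩
  have hlt : ∀ i j : Fin d, (i : ℕ) * d + j < d * d := fun i j => by
    have := i.2
    have := j.2
    nlinarith
  have hU : ∀ i j t : Fin d, U (i * d + j) t =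
      ∑ p, ∑ q, M i p * N j q * ω.repr (ω p * ω q) t := by
    intro i j t
    simp only [U, Fin.is_lt, dif_pos, hlt, (hdiv i j).1, (hdiv i j).2]
  have hu : ∀ i j : Fin d, (((1 : ℤ) : K) / ((k * l : ℤ) : K)) * ofCoords ω (U (i * d + j)) =
      ((k : K)⁻¹ * ∑ p, (M i p : K) * (ω p : K)) *
        ((l : K)⁻¹ * ∑ q, (N j q : K) * (ω q : K)) := by
    intro i j
    rw [mul_mul_mul_comm, mul_eq_ofCoords, ofCoords_apply]
    simp_rw [hU]
    push_cast
    field_simp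
  refine mem_iff_exists_genLat (U := U) (u := fun i => (((1 : ℤ) : K) / ((k * l : ℤ) : K)) *
    ofCoords ω (U i)) (fun r hr t ht => ?_) (fun i _ => rfl) (fun j => ?_) ?_ y
  · have hd : 0 < d := by omega
    have := hV ⟨r / d, Nat.div_lt_of_lt_mul hr⟩ ⟨r % d, Nat.mod_lt _ hd⟩ ⟨t, ht⟩
    rw [← hU] at this
    simpa only [Nat.div_add_mod' r d] using this
  · have hd : 0 < d := j.pos
    have h1 := det_mul_mem ha j
    have h2 := det_mul_mem hb ⟨0, hd⟩
    -- Since the first basis element is `1`, the determinant of `N` itself, divided by `l`, lies in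
    -- `𝔟`. Multiplying it by `M.det / k` times a basis element shows that the product of the
    -- determinants is a valid modulus.
    rw [hω ⟨0, hd⟩ rfl] at h2
    have h3 := FractionalIdeal.mul_mem_mul h1 h2
    have e : (((1 : ℤ) : K) / ((k * l : ℤ) : K)) * (((M.det * N.det : ℤ) : K) * (ω j : K)) =
        (k : K)⁻¹ * ((M.det : K) * (ω j : K)) *
          ((l : K)⁻¹ * ((N.det : K) * ((1 : 𝓞 K) : K))) := by
      rw [show ((1 : 𝓞 K) : K) = 1 from map_one (algebraMap (𝓞 K) K)]
      simp only [Int.cast_mul, Int.cast_one, Int.cast_natCast]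
      field_simp
    rw [e]
    exact h3
  · rw [restrictScalars_mul_eq_span ha.2.2 hb.2.2]
    congr 1
    ext z
    constructor
    · rintro ⟨i, j, rfl⟩
      exact ⟨i * d + j, hlt i j, hu i j⟩
    · rintro ⟨r, hr, rfl⟩
      have hd : 0 < d := by
        rcases Nat.eq_zero_or_pos d with rfl | h
        · simp at hr
        · exact h
      have := hu ⟨r / d, Nat.div_lt_of_lt_mul hr⟩ ⟨r % d, Nat.mod_lt _ hd⟩
      simp only [Nat.div_add_mod' r d] at this
      exact ⟨_, _, this.symm⟩

theorem exists_coe_eq_iff_dvd {g : ℤ} (hg : g ≠ 0) (e : Fin d → ℤ) :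
    (∃ y : 𝓞 K, (y : K) = (g : K)⁻¹ * ∑ t, (e t : K) * (ω t : K)) ↔ ∀ t, g ∣ e t := by
  have hg0 : (g : K) ≠ 0 := by exact_mod_cast hg
  constructor
  · rintro ⟨y, hy⟩ t
    exact ⟨_, (mul_repr_eq ω (q := g) (y := y) (c := e)
      (by rw [hy, mul_inv_cancel_left₀ hg0]) t).symm⟩
  · intro h
    choose f hf using h
    refine ⟨∑ t, f t • ω t, ?_⟩
    rw [ofCoords_sum_smul, Finset.mul_sum]
    refine Finset.sum_congr rfl fun t _ => ?_
    rw [hf]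
    push_cast
    field_simp

/-- The lattice of the inverse of a fractional ideal. -/
theorem mem_inv_iff_exists_genLat (ha : IsHNFRep ω 𝔞 k M) (h𝔞 : 𝔞 ≠ 0)
    (hω : ∀ i : Fin d, (i : ℕ) = 0 → ω i = 1) {V : ℕ → ℤ} (hd : 0 < d)
    (hV : ∀ i t : Fin d, V (i * (d + d * d) + t) = if i = t then 1 else 0)
    (hV' : ∀ i j t : Fin d, V (i * (d + d * d) + (d + (j * d + t))) =
      (∑ p, M j p * ω.repr (ω i * ω p) t) % M.det) (y : K) :
    y ∈ 𝔞⁻¹ ↔ ∃ x, (x ∈ genLat V (d + d * d) d M.det (d + d * d) ∧ ∀ t, d ≤ t → x t = 0) ∧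
      y = ((k : ℤ) : K) / (M.det : K) * ofCoords ω x := by
  have hk0 : (k : K) ≠ 0 := by exact_mod_cast ha.pos.ne'
  have hg := ha.2.1.det_pos.ne'
  have hg0 : (M.det : K) ≠ 0 := by exact_mod_cast hg
  have hlt : ∀ i j : Fin d, d + ((i : ℕ) * d + j) < d + d * d := fun i j => by
    have := i.2
    have := j.2
    nlinarith
  have hrow : ∀ (x : ℕ → ℤ) (j : Fin d), ((k : ℤ) : K) / (M.det : K) * ofCoords ω x *
      ((k : K)⁻¹ * ∑ p, (M j p : K) * (ω p : K)) = (M.det : K)⁻¹ *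
        ∑ t : Fin d, ((∑ i : Fin d, ∑ p, x i * M j p * ω.repr (ω i * ω p) t : ℤ) : K) *
          (ω t : K) := by
    intro x j
    rw [← mul_eq_ofCoords (fun i => x i) (M j), ofCoords_apply]
    push_cast
    field_simp
  -- It suffices to test multiplication on the rows that generate `𝔞`. The factors `k` cancel, and
  -- integrality means that `M.det` divides all coordinates of the products.
  have hinv : ∀ x : ℕ → ℤ, ((k : ℤ) : K) / (M.det : K) * ofCoords ω x ∈ 𝔞⁻¹ ↔
      ∀ j t : Fin d, M.det ∣ ∑ i : Fin d, ∑ p, x i * M j p * ω.repr (ω i * ω p) t := by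
    intro x
    rw [FractionalIdeal.mem_inv_iff h𝔞]
    constructor
    · intro h j
      have := h _ (apply_mem_of_span ha.2.2 j)
      rw [hrow, FractionalIdeal.mem_one_iff] at this
      exact (exists_coe_eq_iff_dvd hg _).1 this
    · intro h z hz
      let S : Submodule ℤ K := (((1 : FractionalIdeal (𝓞 K)⁰ K) :
        Submodule (𝓞 K) K).restrictScalars ℤ).comap
          (LinearMap.mulLeft ℤ (((k : ℤ) : K) / (M.det : K) * ofCoords ω x))
      refine forall_mem_of_span ha.2.2 S (fun j => ?_) hz
      change _ * _ ∈ (1 : FractionalIdeal (𝓞 K)⁰ K)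
      rw [hrow, FractionalIdeal.mem_one_iff]
      exact (exists_coe_eq_iff_dvd hg _).2 (h j)
  have hsum : ∀ (c : ℕ → ℤ) (j t : Fin d),
      M.det ∣ ∑ i ∈ Finset.range d, c i * V (i * (d + d * d) + (d + (j * d + t))) ↔
        M.det ∣ ∑ i : Fin d, ∑ p, c i * M j p * ω.repr (ω i * ω p) t := by
    intro c j t
    rw [Finset.sum_range]
    refine (dvd_iff_dvd_of_dvd_sub ?_)
    rw [← Finset.sum_sub_distrib]
    refine Finset.dvd_sum fun i _ => ?_
    rw [hV']
    simp_rw [mul_assoc]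
    rw [← Finset.mul_sum, ← mul_sub]
    exact ((dvd_sub_comm).1 Int.dvd_self_sub_emod).mul_left _
  constructor
  · intro hy
    -- As `M.det / k` lies in `𝔞`, an element `y` of the inverse times `M.det / k` is integral. This
    -- is why `y` has the form `(k / M.det) x` with integral coordinates.
    have h1 := det_mul_mem ha ⟨0, hd⟩
    rw [hω ⟨0, hd⟩ rfl] at h1
    obtain ⟨z, hz⟩ := (FractionalIdeal.mem_one_iff _).1
      ((FractionalIdeal.mem_inv_iff h𝔞).1 hy _ h1)
    let x : ℕ → ℤ := fun t => if h : t < d then ω.repr z ⟨t, h⟩ else 0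
    have hxz : ofCoords ω x = z := by
      rw [ofCoords_apply, ← sum_repr_coe ω z]
      simp [x]
    have hyx : y = ((k : ℤ) : K) / (M.det : K) * ofCoords ω x := by
      rw [hxz]
      rw [show ((1 : 𝓞 K) : K) = 1 from map_one (algebraMap (𝓞 K) K)] at hz
      rw [RingOfIntegers.coe_eq_algebraMap, hz, Int.cast_natCast]
      field_simp
    have hx0 : ∀ t, d ≤ t → x t = 0 := fun t ht => dif_neg (not_lt.2 ht)
    refine ⟨x, ⟨mem_genLat_iff.2 ⟨fun t ht => hx0 t (by omega), x, fun t ht => ?_⟩, hx0⟩, hyx⟩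
    rcases lt_or_ge t d with htd | htd
    · rw [Finset.sum_range, Finset.sum_eq_single ⟨t, htd⟩]
      · rw [hV _ ⟨t, htd⟩]; simp
      · intro i _ hi
        rw [hV i ⟨t, htd⟩, if_neg hi, mul_zero]
      · simp
    · obtain ⟨r, rfl⟩ := Nat.exists_eq_add_of_le htd
      have hr : r < d * d := by omega
      rw [hx0 _ htd, zero_sub, dvd_neg]
      have := (hsum x ⟨r / d, Nat.div_lt_of_lt_mul hr⟩ ⟨r % d, Nat.mod_lt _ hd⟩).2
        ((hinv x).1 (hyx ▸ hy) _ _)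
      simpa only [Nat.div_add_mod' r d] using this
  · rintro ⟨x, ⟨hx, hx0⟩, rfl⟩
    obtain ⟨-, c, hc⟩ := mem_genLat_iff.1 hx
    -- The identity block reveals the coefficients modulo `M.det`. So the congruences satisfied by
    -- `c` in the additional columns hold for the first `d` coordinates of `x` as well.
    have hcx : ∀ i : Fin d, M.det ∣ x i - c i := by
      intro i
      have := hc i (by omega)
      rwa [Finset.sum_range, Finset.sum_eq_single i, hV, if_pos rfl, mul_one] at this
      · intro i' _ hi
        rw [hV, if_neg hi, mul_zero]
      · simp
    rw [hinv]
    intro j t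
    have h1 := hc _ (hlt j t)
    rw [hx0 _ (by omega), zero_sub, dvd_neg, hsum] at h1
    refine (dvd_iff_dvd_of_dvd_sub ?_).2 h1
    rw [← Finset.sum_sub_distrib]
    refine Finset.dvd_sum fun i _ => ?_
    rw [← Finset.sum_sub_distrib]
    refine Finset.dvd_sum fun p _ => ?_
    rw [mul_assoc, mul_assoc, ← sub_mul]
    exact (hcx i).mul_right _

end Ideals

namespace RAM.Cmd
open RowLattice

variable {K : Type*} [Field K] [NumberField K] {inp : List ℤ} {s : Store}

theorem spec_normalize_ideal {d w n : ℕ} {ω : Module.Basis (Fin d) ℤ (𝓞 K)}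
    {𝔠 : FractionalIdeal (𝓞 K)⁰ K} {g num den Z Z' : ℤ} (hd : 0 < d) (hg : 0 < g)
    (hnum : 0 < num) (hden : 0 < den)
    (h0 : s.var 0 = n) (h1 : s.var 1 = w) (h2 : s.var 2 = g)
    (h3 : s.var 3 = d) (h4 : s.var 4 = num) (h5 : s.var 5 = den) (hout : s.out = [])
    (hbox : Box (s.arr 0) w n g)
    {A : ℕ} (hwA : w ≤ A) (hnA : n ≤ A) (hdw : d ≤ w) (hgZ : 4 * (g + 1) ^ 2 ≤ Z)
    (hwZ : ((A * w + A + w : ℕ) : ℤ) ≤ Z)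
    (hgZ' : num * g * g ≤ Z') (hdZ' : den ≤ Z') (hwZ' : ((A * w + A + w : ℕ) : ℤ) ≤ Z')
    (h𝔠 : ∀ y, y ∈ 𝔠 ↔ ∃ x, (x ∈ genLat (s.arr 0) w n g w ∧ ∀ t, d ≤ t → x t = 0) ∧
      y = (num / den : K) * ofCoords ω x) :
    normalize.Spec inp s (300 * (n + w) * (w + 1) ^ 2 * unitCost Z + 81 * d ^ 2 * unitCost Z')
      fun s' => ∃ m R, IsHNFRep ω 𝔠 m R ∧ s'.out = encodeIdeal m R := by
  refine (spec_normalize hd hg hnum hden h0 h1 h2 h3 h4 h5 hout hbox hwA hnA hdw hgZ hwZ hgZ' hdZ'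
    hwZ').imp le_rfl ?_
  rintro s' - ⟨H, γ, hH, hγ, hγH, hspan, ho⟩
  exact ⟨_, _, isHNFRep_of_span ω hnum hden hγ hH hγH (span_rows_eq h𝔠 hspan), ho⟩

end RAM.Cmd

namespace RAM
namespace Cmd
open RAM.Expr RowLattice

variable {inp : List ℤ} {Z : ℤ} {s : Store}

/-! ### Programs for the generators -/

/-- Read the degree and the denominators and compute the positions of the input data. -/
def prologue : Cmd :=
  .seq (.assign 3 (.inp 0)) <|
  .seq (.assign 30 (var 3 * var 3)) <|
  -- The input consists of `d`, the `d ^ 3` entries of the table, and for each ideal its denominator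
  -- and `d ^ 2` entries. So the first denominator is at `d ^ 3 + 1`, the second at `d ^ 3 + d ^ 2 +
  -- 2`, each followed by its matrix.
  .seq (.assign 31 (var 30 * var 3 + 1)) <|
  .seq (.assign 32 (.inp (var 31))) <|
  .seq (.assign 33 (var 31 + 1)) <|
  .seq (.assign 34 (var 33 + var 30)) <|
  .seq (.assign 35 (.inp (var 34))) <|
  .assign 36 (var 34 + 1)

/-- The values of the variables after the prologue. -/
structure Prologue (d : ℕ) (k l : ℤ) (s : Store) : Prop where
  var3 : s.var 3 = d
  var30 : s.var 30 = (d * d : ℕ)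
  var32 : s.var 32 = k
  var33 : s.var 33 = (d * d * d + 2 : ℕ)
  var35 : s.var 35 = l
  var36 : s.var 36 = (d * d * d + d * d + 3 : ℕ)
  out : s.out = []
  arr : s.arr = fun _ _ => 0

theorem Prologue.mono {d : ℕ} {k l : ℤ} {s s' : Store} {b : Cmd} (h : Prologue d k l s)
    (hF : Frame b s s') (hb : ∀ x ∈ [3, 30, 32, 33, 35, 36], x ∉ b.vars)
    (ha : b.arrs = []) (ho : b.silent = true) : Prologue d k l s' where
  var3 := (hF.var 3 (hb 3 (by decide))).trans h.var3
  var30 := (hF.var 30 (hb 30 (by decide))).trans h.var30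
  var32 := (hF.var 32 (hb 32 (by decide))).trans h.var32
  var33 := (hF.var 33 (hb 33 (by decide))).trans h.var33
  var35 := (hF.var 35 (hb 35 (by decide))).trans h.var35
  var36 := (hF.var 36 (hb 36 (by decide))).trans h.var36
  out := (hF.out ho).trans h.out
  arr := (funext fun a => hF.arr a (by simp [ha])).trans h.arr

theorem wp_prologue {d : ℕ} {k l : ℤ} (hd : inp.getD 0 0 = d)
    (hk : inp.getD (d * d * d + 1) 0 = k) (hl : inp.getD (d * d * d + d * d + 2) 0 = l)
    (hdZ : ((d * d * d + 3 * (d * d) + 3 : ℕ) : ℤ) ≤ Z) (hkZ : Small Z k) (hlZ : Small Z l) :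
    prologue.Wp inp Z Store.init 80 (Prologue d k l) := by
  have key : ∀ x : ℕ, x ≤ d * d * d + 3 * (d * d) + 3 → Small Z (x : ℤ) := fun x hx =>
    small_of_nonneg (by positivity) (le_trans (by exact_mod_cast hx) hdZ)
  have s0 : Small Z 0 := key 0 (by omega)
  have s1 : Small Z 1 := key 1 (by omega)
  have hdd : d ≤ d * d := Nat.le_mul_self d
  have s2 := key d (by omega)
  have s3 := key (d * d) (by omega)
  have s4 := key (d * d * d) (by omega)
  have s5 := key (d * d * d + 1) (by omega)
  have s6 := key (d * d * d + 2) (by omega)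
  have s7 := key (d * d * d + d * d + 2) (by omega)
  have s8 := key (d * d * d + d * d + 3) (by omega)
  refine Wp.imp (wp_seq (wp_assign (d : ℤ) ?_ (wp_seq (wp_assign ((d * d : ℕ) : ℤ) ?_
    (wp_seq (wp_assign ((d * d * d + 1 : ℕ) : ℤ) ?_ (wp_seq (wp_assign k ?_
    (wp_seq (wp_assign ((d * d * d + 2 : ℕ) : ℤ) ?_
    (wp_seq (wp_assign ((d * d * d + d * d + 2 : ℕ) : ℤ) ?_ (wp_seq (wp_assign l ?_
    (wp_assign ((d * d * d + d * d + 3 : ℕ) : ℤ) ?_ ?_))))))))))))))) (by simp) (fun _ _ h => h)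
  · refine ⟨⟨s0, ?_⟩, hd⟩
    change Small Z (inp.getD 0 0)
    rw [hd]
    exact s2
  · simpa [s2] using s3
  · simp only [fits_add, fits_mul, fits_var, fits_one, eval_add, eval_mul, eval_var, eval_one,
      Store.var_setVar]
    norm_num
    exact ⟨⟨by exact_mod_cast s3, s2, by exact_mod_cast s4⟩, s1, by exact_mod_cast s5⟩
  · simp only [fits_inp, fits_var, eval_inp, eval_var, Store.var_setVar, if_true, Int.toNat_natCast]
    rw [hk]
    exact ⟨⟨s5, hkZ⟩, rfl⟩
  · simp only [fits_add, fits_var, fits_one, eval_add, eval_var, eval_one, Store.var_setVar]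
    norm_num
    refine ⟨⟨by exact_mod_cast s5, s1, ?_⟩, by ring⟩
    rw [add_assoc]
    exact_mod_cast s6
  · simp only [fits_add, fits_var, eval_add, eval_var, Store.var_setVar]
    norm_num
    refine ⟨⟨by exact_mod_cast s6, by exact_mod_cast s3, ?_⟩, by ring⟩
    convert s7 using 1
    push_cast
    ring
  · simp only [fits_inp, fits_var, eval_inp, eval_var, Store.var_setVar, if_true, Int.toNat_natCast]
    rw [hl]
    exact ⟨⟨s7, hlZ⟩, rfl⟩
  · simp only [fits_add, fits_var, fits_one, eval_add, eval_var, eval_one, Store.var_setVar]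
    norm_num
    refine ⟨⟨by exact_mod_cast s7, s1, ?_⟩, by ring⟩
    convert s8 using 1
    push_cast
    ring
  · constructor <;> simp [Store.init]

/-- Compute the product of the diagonal entries of the matrix at the position `x_p`. -/
def diagProd (x p : ℕ) : Cmd :=
  .seq (.assign x 1) <| .loop 20 (var 3) <|
  .assign x (var x * .inp (var p + (var 20 * var 3 + var 20)))

/-- A partial product of positive diagonal entries divides the complete one, so no intermediate
value exceeds the determinant. -/
theorem wp_diagProd {x p d P : ℕ} {a : ℤ} (h3 : s.var 3 = d) (hp : s.var p = P)
    (hx3 : x ≠ 3) (hx20 : x ≠ 20) (hxp : x ≠ p) (hp20 : p ≠ 20)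
    (hpos : ∀ i < d, 0 < inp.getD (P + (i * d + i)) 0)
    (ha : ∏ i ∈ Finset.range d, inp.getD (P + (i * d + i)) 0 = a)
    (haZ : a ≤ Z) (hPZ : ((P + d * d + d : ℕ) : ℤ) ≤ Z) :
    (diagProd x p).Wp inp Z s (8 + d * 25) fun s' => s'.var x = a := by
  have hprod : ∀ i ≤ d, 0 < ∏ j ∈ Finset.range i, inp.getD (P + (j * d + j)) 0 := fun i hi =>
    Finset.prod_pos fun j hj => hpos j (by have := Finset.mem_range.1 hj; omega)
  have ha0 : 0 < a := ha ▸ hprod d le_rfl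
  have hle : ∀ i ≤ d, ∏ j ∈ Finset.range i, inp.getD (P + (j * d + j)) 0 ≤ Z := fun i hi =>
    le_trans (Int.le_of_dvd ha0 (ha ▸ Finset.prod_dvd_prod_of_subset _ _ _
      (Finset.range_subset_range.2 hi))) haZ
  have key : ∀ t : ℕ, t ≤ P + d * d + d → Small Z (t : ℤ) := fun t ht =>
    small_of_nonneg (by positivity) (le_trans (by exact_mod_cast ht) hPZ)
  refine Wp.imp (wp_seq (wp_assign 1 ?_ (wp_loop (n := d) (k := 17)
    (fun i s' => s'.var x = ∏ j ∈ Finset.range i, inp.getD (P + (j * d + j)) 0) ?_ ?_ ?_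
    (fun s' _ h => ?_)))) (by simp; omega) (fun _ _ h => h)
  · simpa using small_of_nonneg zero_le_one (hle 0 (Nat.zero_le _))
  · simp [hx3.symm, h3, key d (by omega)]
  · simp
  · intro i hi s' hF h
    have f3 : s'.var 3 = d := (hF.var 3 (by simp [vars, hx3.symm])).trans (by simp [hx3.symm, h3])
    have fp : s'.var p = P :=
      (hF.var p (by simp [vars, hp20, hxp.symm])).trans (by simp [hxp.symm, hp])
    have hidx : i * d + i ≤ d * d + d := by nlinarith
    have hid : i * d ≤ d * d := Nat.mul_le_mul_right d hi.le
    have hin : ((P : ℤ) + (i * d + i)).toNat = P + (i * d + i) := by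
      rw [show (P : ℤ) + (i * d + i) = ((P + (i * d + i) : ℕ) : ℤ) by push_cast; ring,
        Int.toNat_natCast]
    have hval := hle (i + 1) hi
    have hval0 := hprod (i + 1) hi
    have hle1 := hle i hi.le
    have hpr := hprod i hi.le
    have hdz : inp.getD (P + (i * d + i)) 0 ≤ Z := by
      refine le_trans (Int.le_of_dvd hval0 ?_) hval
      rw [Finset.prod_range_succ]
      exact Dvd.intro_left _ rfl
    rw [Finset.prod_range_succ] at hval hval0
    refine Wp.imp (wp_assign (∏ j ∈ Finset.range (i + 1), inp.getD (P + (j * d + j)) 0) ?_ ?_)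
      (by simp) (fun _ _ h => h)
    · rw [Finset.prod_range_succ]
      simp only [fits_mul, fits_var, fits_inp, fits_add, eval_add, eval_mul, eval_var, eval_inp,
        Store.var_setVar, hx20, hp20, if_false, if_true, f3, fp, h, hin, and_true,
        show (3 : ℕ) ≠ 20 by decide]
      have e1 := key P (by omega)
      have e2 := key i (by nlinarith)
      have e3 := key d (by omega)
      have e4 := key (i * d) (by omega)
      have e5 := key (i * d + i) (by omega)
      have e6 := key (P + (i * d + i)) (by omega)
      push_cast at e4 e5 e6
      exact ⟨small_of_nonneg hpr.le hle1, ⟨⟨e1, ⟨⟨e2, e3, e4⟩, e2, e5⟩, e6⟩,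
        small_of_nonneg (hpos i hi).le hdz⟩, small_of_nonneg hval0.le hval⟩
    · simp
  · rw [h, ha]

end Cmd
end RAM

namespace RAM
namespace Cmd
open RAM.Expr RowLattice

variable {inp : List ℤ} {Z : ℤ} {s : Store}

/-- Read the degree and the denominators and compute the determinants. -/
def readIdeals : Cmd := .seq prologue <| .seq (diagProd 40 33) (diagProd 41 36)

theorem wp_readIdeals {d : ℕ} {k l a b : ℤ} (hd : inp.getD 0 0 = d)
    (hk : inp.getD (d * d * d + 1) 0 = k) (hl : inp.getD (d * d * d + d * d + 2) 0 = l)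
    (hM' : ∀ i < d, 0 < inp.getD (d * d * d + 2 + (i * d + i)) 0)
    (hN' : ∀ i < d, 0 < inp.getD (d * d * d + d * d + 3 + (i * d + i)) 0)
    (ha : ∏ i ∈ Finset.range d, inp.getD (d * d * d + 2 + (i * d + i)) 0 = a)
    (hb : ∏ i ∈ Finset.range d, inp.getD (d * d * d + d * d + 3 + (i * d + i)) 0 = b)
    (hkZ : Small Z k) (hlZ : Small Z l) (haZ : a ≤ Z) (hbZ : b ≤ Z)
    (hdZ : ((2 * (d * d * d) + 4 * (d * d) + 2 * d + 5 : ℕ) : ℤ) ≤ Z) :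
    readIdeals.Wp inp Z Store.init (96 + d * 50) fun s =>
      Prologue d k l s ∧ s.var 40 = a ∧ s.var 41 = b := by
  refine Wp.imp (wp_seq (Wp.imp (n' := 80) (wp_prologue hd hk hl
    (le_trans (by norm_cast; omega) hdZ) hkZ hlZ) le_rfl fun s₁ _ H₁ =>
    wp_seq (Wp.imp (n' := 8 + d * 25) (wp_diagProd H₁.var3 H₁.var33 (by decide) (by decide)
      (by decide) (by decide) hM' ha haZ (le_trans (by norm_cast; nlinarith) hdZ))
      le_rfl fun s₂ hF₂ h₂ => ?_)))
    (n := 80 + (8 + d * 25 + (8 + d * 25))) (by linarith) (fun _ _ h => h)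
  have H₂ := H₁.mono hF₂ (by decide) rfl rfl
  refine Wp.imp (wp_diagProd H₂.var3 H₂.var36 (by decide) (by decide) (by decide) (by decide)
    hN' hb hbZ (le_trans (by norm_cast; nlinarith) hdZ)) le_rfl fun s₃ hF₃ h₃ => ?_
  exact ⟨H₂.mono hF₃ (by decide) rfl rfl, (hF₃.var 40 (by decide)).trans h₂, h₃⟩

/-- The multiples of the rows of both matrices. -/
def fillSum : Cmd :=
  .loop 50 (var 30) <|
  .seq (.store 0 (var 50) ((var 43 * .inp (var 33 + var 50)) % var 2)) <|
  .store 0 (var 30 + var 50) ((var 44 * .inp (var 36 + var 50)) % var 2)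

theorem wp_fillSum {D P P' : ℕ} {a b k₁ l₁ g : ℤ} (h30 : s.var 30 = D) (h33 : s.var 33 = P)
    (h36 : s.var 36 = P') (h43 : s.var 43 = k₁) (h44 : s.var 44 = l₁) (h2 : s.var 2 = g)
    (hg : 0 < g) (hgZ : g ≤ Z) (hk : 0 < k₁) (hl : 0 < l₁)
    (hM : ∀ t < D, 0 ≤ inp.getD (P + t) 0 ∧ inp.getD (P + t) 0 ≤ a)
    (hN : ∀ t < D, 0 ≤ inp.getD (P' + t) 0 ∧ inp.getD (P' + t) 0 ≤ b)
    (haZ : k₁ * a ≤ Z) (hbZ : l₁ * b ≤ Z) (hkZ : k₁ ≤ Z) (hlZ : l₁ ≤ Z)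
    (hPZ : ((P + P' + D + D : ℕ) : ℤ) ≤ Z) :
    fillSum.Wp inp Z s (5 + D * 49) fun s' => ∀ t < D,
      s'.arr 0 t = k₁ * inp.getD (P + t) 0 % g ∧
      s'.arr 0 (D + t) = l₁ * inp.getD (P' + t) 0 % g := by
  have key : ∀ t : ℕ, t ≤ P + P' + D + D → Small Z (t : ℤ) := fun t ht =>
    small_of_nonneg (by positivity) (le_trans (by exact_mod_cast ht) hPZ)
  refine Wp.imp (wp_loop (n := D) (k := 41) (fun i s' => ∀ t < i,
      s'.arr 0 t = k₁ * inp.getD (P + t) 0 % g ∧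
      s'.arr 0 (D + t) = l₁ * inp.getD (P' + t) 0 % g) ?_ (by simp) ?_ (fun s' _ h => h))
    (by simp) (fun _ _ h => h)
  · simp only [fits_var, eval_var, h30, and_true]
    exact key D (by omega)
  · intro i hi s' hF h
    have f30 := (hF.var 30 (by decide)).trans h30
    have f33 := (hF.var 33 (by decide)).trans h33
    have f36 := (hF.var 36 (by decide)).trans h36
    have f43 := (hF.var 43 (by decide)).trans h43
    have f44 := (hF.var 44 (by decide)).trans h44
    have f2 := (hF.var 2 (by decide)).trans h2
    have t1 : ((P : ℤ) + i).toNat = P + i := by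
      rw [show (P : ℤ) + i = ((P + i : ℕ) : ℤ) by push_cast; rfl, Int.toNat_natCast]
    have t2 : ((P' : ℤ) + i).toNat = P' + i := by
      rw [show (P' : ℤ) + i = ((P' + i : ℕ) : ℤ) by push_cast; rfl, Int.toNat_natCast]
    have e1 := key (P + i) (by omega)
    have e2 := key (P' + i) (by omega)
    have e3 := key (D + i) (by omega)
    push_cast at e1 e2 e3
    have e4 := key P (by omega)
    have e5 := key P' (by omega)
    have e6 := key D (by omega)
    have e7 := key i (by omega)
    have m1 : Small Z (inp.getD (P + i) 0) := small_of_nonneg (hM i hi).1 (by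
      have := hM i hi; nlinarith)
    have m2 : Small Z (inp.getD (P' + i) 0) := small_of_nonneg (hN i hi).1 (by
      have := hN i hi; nlinarith)
    have m3 : Small Z (k₁ * inp.getD (P + i) 0) :=
      small_of_nonneg (mul_nonneg hk.le (hM i hi).1)
        ((mul_le_mul_of_nonneg_left (hM i hi).2 hk.le).trans haZ)
    have m4 : Small Z (l₁ * inp.getD (P' + i) 0) :=
      small_of_nonneg (mul_nonneg hl.le (hN i hi).1)
        ((mul_le_mul_of_nonneg_left (hN i hi).2 hl.le).trans hbZ)
    have m5 := small_emod (Z := Z) (k₁ * inp.getD (P + i) 0) hg hgZ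
    have m6 := small_emod (Z := Z) (l₁ * inp.getD (P' + i) 0) hg hgZ
    have m7 : Small Z k₁ := small_of_nonneg hk.le hkZ
    have m8 : Small Z l₁ := small_of_nonneg hl.le hlZ
    have m9 : Small Z g := small_of_nonneg hg.le hgZ
    refine Wp.imp (wp_seq (wp_store i (k₁ * inp.getD (P + i) 0 % g) ?_ ?_
      (wp_store (D + i) (l₁ * inp.getD (P' + i) 0 % g) ?_ ?_ ?_))) (by simp) (fun _ _ h => h)
    · simpa using e7
    · simp only [fits_mod, fits_mul, fits_var, fits_inp, fits_add, eval_mod, eval_add, eval_mul,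
        eval_var, eval_inp, Store.var_setVar]
      norm_num [f2, f33, f43, t1]
      exact ⟨⟨m7, ⟨⟨e4, e7, e1⟩, m1⟩, m3⟩, m9, m5⟩
    · simp [f30, e3, e6, e7]
    · simp only [fits_mod, fits_mul, fits_var, fits_inp, fits_add, eval_mod, eval_add, eval_mul,
        eval_var, eval_inp, Store.var_setVar, Store.var_setArr]
      norm_num [f2, f36, f44, t2]
      exact ⟨⟨m8, ⟨⟨e5, e7, e2⟩, m2⟩, m4⟩, m9, m6⟩
    · intro t ht
      rw [Store.arr_setArr_self, Store.arr_setArr_self, Store.arr_setArr_self,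
        Store.arr_setArr_self, if_neg (show t ≠ D + i by omega)]
      rcases (Nat.lt_succ_iff.1 ht).eq_or_lt with rfl | hti
      · simp
      · rw [if_neg hti.ne, if_neg (by omega), if_neg (by omega)]
        exact h t hti

/-- The generators of a sum. -/
def prepareSum : Cmd :=
  .seq readIdeals <|
  .seq (.assign 42 (bin .gcd (var 32) (var 35))) <|
  .seq (.assign 43 (var 35 / var 42)) <|
  .seq (.assign 44 (var 32 / var 42)) <|
  -- Both arguments are valid moduli, hence so is their gcd. As the factors in `x₄₃` and `x₄₄` are
  -- coprime, the gcd divides the product of the two determinants: the modulus is small even if the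
  -- denominators are large.
  .seq (.assign 2 (bin .gcd (var 43 * var 40) (var 44 * var 41))) <|
  .seq (.assign 0 (var 3 + var 3)) <|
  .seq (.assign 1 (var 3)) <|
  .seq (.assign 4 1) <|
  .seq (.assign 5 (var 32 * var 43)) fillSum

theorem wp_prepareSum {d : ℕ} {k l a b : ℤ} (hd : inp.getD 0 0 = d)
    (hk : inp.getD (d * d * d + 1) 0 = k) (hl : inp.getD (d * d * d + d * d + 2) 0 = l)
    (hk0 : 0 < k) (hl0 : 0 < l)
    (hM : ∀ t < d * d, 0 ≤ inp.getD (d * d * d + 2 + t) 0 ∧ inp.getD (d * d * d + 2 + t) 0 ≤ a)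
    (hN : ∀ t < d * d, 0 ≤ inp.getD (d * d * d + d * d + 3 + t) 0 ∧
      inp.getD (d * d * d + d * d + 3 + t) 0 ≤ b)
    (hM' : ∀ i < d, 0 < inp.getD (d * d * d + 2 + (i * d + i)) 0)
    (hN' : ∀ i < d, 0 < inp.getD (d * d * d + d * d + 3 + (i * d + i)) 0)
    (ha : ∏ i ∈ Finset.range d, inp.getD (d * d * d + 2 + (i * d + i)) 0 = a)
    (hb : ∏ i ∈ Finset.range d, inp.getD (d * d * d + d * d + 3 + (i * d + i)) 0 = b)
    (hZ : k * l * (a * b) ≤ Z) (hdZ : ((2 * (d * d * d) + 4 * (d * d) + 2 * d + 5 : ℕ) : ℤ) ≤ Z) :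
    prepareSum.Wp inp Z Store.init (200 + d * 50 + d * d * 49) fun s' =>
      s'.var 0 = (d + d : ℕ) ∧ s'.var 1 = d ∧ s'.var 2 = Int.gcd (l / Int.gcd k l * a)
        (k / Int.gcd k l * b) ∧ s'.var 3 = d ∧ s'.var 4 = 1 ∧
      s'.var 5 = k * (l / Int.gcd k l) ∧ s'.out = [] ∧ ∀ t < d * d,
      s'.arr 0 t = l / Int.gcd k l * inp.getD (d * d * d + 2 + t) 0 %
        Int.gcd (l / Int.gcd k l * a) (k / Int.gcd k l * b) ∧
      s'.arr 0 (d * d + t) = k / Int.gcd k l * inp.getD (d * d * d + d * d + 3 + t) 0 %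
        Int.gcd (l / Int.gcd k l * a) (k / Int.gcd k l * b) := by
  have key : ∀ t : ℕ, t ≤ 2 * (d * d * d) + 4 * (d * d) + 2 * d + 5 → Small Z (t : ℤ) :=
    fun t ht => small_of_nonneg (by positivity) (le_trans (by exact_mod_cast ht) hdZ)
  have ha0 : 0 < a := ha ▸ Finset.prod_pos fun i hi => hM' i (Finset.mem_range.1 hi)
  have hb0 : 0 < b := hb ▸ Finset.prod_pos fun i hi => hN' i (Finset.mem_range.1 hi)
  have hgg : (0 : ℤ) < Int.gcd k l := by exact_mod_cast Int.gcd_pos_of_ne_zero_left l hk0.ne'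
  have hggk : (Int.gcd k l : ℤ) ≤ k := Int.le_of_dvd hk0 (Int.gcd_dvd_left _ _)
  have hk₁ : 0 < l / Int.gcd k l := Int.ediv_pos_of_pos_of_dvd hl0 hgg.le (Int.gcd_dvd_right _ _)
  have hl₁ : 0 < k / Int.gcd k l := Int.ediv_pos_of_pos_of_dvd hk0 hgg.le (Int.gcd_dvd_left _ _)
  have hk₁' : l / Int.gcd k l ≤ l := Int.ediv_le_self _ hl0.le
  have hl₁' : k / Int.gcd k l ≤ k := Int.ediv_le_self _ hk0.le
  have hggZ : (Int.gcd k l : ℤ) ≤ k := hggk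
  have hgE : BinOp.gcd.eval k l = Int.gcd k l := rfl
  generalize (Int.gcd k l : ℤ) = e at *
  generalize hk₁e : l / e = k₁ at *
  generalize hl₁e : k / e = l₁ at *
  have hab : 1 ≤ a * b := Int.add_one_le_of_lt (mul_pos ha0 hb0)
  have hkl : 1 ≤ k * l := Int.add_one_le_of_lt (mul_pos hk0 hl0)
  have haab : a ≤ a * b := le_mul_of_one_le_right ha0.le hb0
  have hbab : b ≤ a * b := le_mul_of_one_le_left hb0.le ha0
  have hkkl : k ≤ k * l := le_mul_of_one_le_right hk0.le hl0
  have hlkl : l ≤ k * l := le_mul_of_one_le_left hl0.le hk0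
  have hklZ : k * l ≤ Z := (le_mul_of_one_le_right (by linarith) hab).trans hZ
  have habZ : a * b ≤ Z := (le_mul_of_one_le_left (by linarith) hkl).trans hZ
  have hk₁a : k₁ * a ≤ Z :=
    (mul_le_mul (hk₁'.trans hlkl) haab ha0.le (by linarith)).trans hZ
  have hl₁b : l₁ * b ≤ Z :=
    (mul_le_mul (hl₁'.trans hkkl) hbab hb0.le (by linarith)).trans hZ
  have hg0 : (0 : ℤ) < Int.gcd (k₁ * a) (l₁ * b) := by
    exact_mod_cast Int.gcd_pos_of_ne_zero_left _ (mul_pos hk₁ ha0).ne'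
  have hgle : (Int.gcd (k₁ * a) (l₁ * b) : ℤ) ≤ k₁ * a :=
    Int.le_of_dvd (mul_pos hk₁ ha0) (Int.gcd_dvd_left _ _)
  have hkk₁ : k * k₁ ≤ Z := (mul_le_mul_of_nonneg_left hk₁' hk0.le).trans hklZ
  have pos : ∀ {x : ℤ}, 0 < x → x ≤ Z → Small Z x := fun h h' => small_of_nonneg h.le h'
  have mk := pos hk0 (by linarith)
  have ml := pos hl0 (by linarith)
  have ma := pos ha0 (by linarith)
  have mb := pos hb0 (by linarith)
  have me := pos hgg (by linarith)
  have mk₁ := pos hk₁ (by linarith)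
  have ml₁ := pos hl₁ (by linarith)
  have mk₁a := pos (mul_pos hk₁ ha0) hk₁a
  have ml₁b := pos (mul_pos hl₁ hb0) hl₁b
  have mkk₁ := pos (mul_pos hk0 hk₁) hkk₁
  have mg := pos hg0 (by linarith)
  refine Wp.imp (n := 96 + d * 50 + (60 + d * d * 49)) (wp_seq (Wp.imp (wp_readIdeals hd hk hl
    hM' hN' ha hb mk ml (by linarith) (by linarith) hdZ) le_rfl fun s₃ _ H₃ => ?_))
    (by linarith) (fun _ _ h => h)
  obtain ⟨⟨v3, v30, v32, v33, v35, v36, ho, -⟩, h40, h₃⟩ := H₃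
  refine Wp.imp (wp_seq (wp_assign e ?_ (wp_seq (wp_assign k₁ ?_ (wp_seq (wp_assign l₁ ?_
    (wp_seq (wp_assign (Int.gcd (k₁ * a) (l₁ * b)) ?_ (wp_seq (wp_assign ((d + d : ℕ) : ℤ) ?_
    (wp_seq (wp_assign (d : ℤ) ?_ (wp_seq (wp_assign 1 ?_ (wp_seq (wp_assign (k * k₁) ?_
    (Wp.imp (n' := 5 + d * d * 49) (wp_fillSum (D := d * d) (P := d * d * d + 2)
      (P' := d * d * d + d * d + 3) (a := a) (b := b) (k₁ := k₁) (l₁ := l₁)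
      (g := Int.gcd (k₁ * a) (l₁ * b)) ?_ ?_ ?_ ?_ ?_ ?_ hg0 (hgle.trans hk₁a) hk₁ hl₁ hM hN
      hk₁a hl₁b (by linarith) (by linarith) (le_trans (by norm_cast; omega) hdZ)) le_rfl
      fun s' hF h => ?_)))))))))))))))))
    (by simp; omega) (fun _ _ h => h)
  · simp [v32, v35, mk, ml, me, hgE]
  · simp [v35, ml, me, mk₁, hk₁e]
  · simp [v32, mk, me, ml₁, hl₁e]
  · simp [h40, h₃, ma, mb, mk₁, ml₁, mk₁a, ml₁b, mg]
  · have := key (d + d) (by omega)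
    push_cast at this
    simp [v3, key d (by omega), this]
  · simp [v3, key d (by omega)]
  · simpa using key 1 (by omega)
  · simp [v32, mk, mk₁, mkk₁]
  all_goals try simp [v30, v33, v36]
  refine ⟨(hF.var 0 (by decide)).trans ?_, (hF.var 1 (by decide)).trans ?_,
    (hF.var 2 (by decide)).trans ?_, (hF.var 3 (by decide)).trans ?_,
    (hF.var 4 (by decide)).trans ?_, (hF.var 5 (by decide)).trans ?_, (hF.out rfl).trans ?_, h⟩
  all_goals simp [v3, ho]

end Cmd
end RAM

/-! ### Generators of a product -/

namespace RAM
namespace Cmd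
open RAM.Expr RowLattice

variable {inp : List ℤ} {Z : ℤ} {s : Store}

/-- Compute the sum of the values of `f`, for `x₅₃` below the value of `e`, modulo `x₂`. -/
def modSum (e f : Expr) : Cmd :=
  .seq (.assign 52 0) <| .loop 53 e <| .assign 52 ((var 52 + f) % var 2)

/-- Reducing after each summand keeps the accumulator below `g`, so the length of the sum does not
enter the size bound `g + X`. The conditions on `e` and `f` are imposed on all stores that the loop
can reach, which makes the lemma applicable to any summand. -/
theorem wp_modSum {e f : Expr} {n : ℕ} {F : ℕ → ℤ} {g X : ℤ} (h2 : s.var 2 = g) (hg : 0 < g)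
    (hX : g + X ≤ Z) (hF : ∀ q < n, Small X (F q))
    (he : ∀ s', Frame (modSum e f) s s' → e.Fits inp Z s' ∧ e.eval inp s' = n)
    (hf : ∀ q < n, ∀ s', Frame (modSum e f) s s' → s'.var 53 = q →
      f.Fits inp Z s' ∧ f.eval inp s' = F q) (hX0 : 0 ≤ X) :
    (modSum e f).Wp inp Z s (e.size + 6 + n * (f.size + 16)) fun s' =>
      s'.var 52 = (∑ q ∈ Finset.range n, F q) % g := by
  have hgZ : g ≤ Z := by linarith
  refine Wp.imp (wp_seq (wp_assign 0 ?_ (wp_loop (n := n) (k := f.size + 8)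
    (fun i s' => s'.var 52 = (∑ q ∈ Finset.range i, F q) % g) ?_ ?_ ?_ (fun _ _ h => h))))
    (le_of_eq (by simp; ring)) (fun _ _ h => h)
  · simpa using small_of_nonneg le_rfl (hg.le.trans hgZ)
  · refine he _ ⟨fun x hx => ?_, fun _ _ => rfl, fun _ => rfl⟩
    have : x ≠ 52 := fun h => hx (by simp [modSum, vars, h])
    simp [this]
  · simp
  · intro q hq s' hFr h
    have hfr : Frame (modSum e f) s (s'.setVar 53 q) := by
      refine ⟨fun x hx => ?_, fun a ha => ?_, fun ho => ?_⟩
      · have h1 : x ≠ 52 := fun h => hx (by simp [modSum, vars, h])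
        have h3 : x ≠ 53 := fun h => hx (by simp [modSum, vars, h])
        have := hFr.var x (by simp [vars, h1, h3])
        simpa [h1, h3] using this
      · simpa using hFr.arr a (by simp [arrs])
      · simpa using hFr.out rfl
    obtain ⟨h4, h5⟩ := hf q hq _ hfr (by simp)
    have f2 : (s'.setVar 53 q).var 2 = g := (hfr.var 2 (show 2 ∉ [52, 53, 52] by decide)).trans h2
    have f52 : (s'.setVar 53 q).var 52 = (∑ q ∈ Finset.range q, F q) % g := by simp [h]
    have h6 : Small g ((∑ q ∈ Finset.range q, F q) % g) := small_emod _ hg le_rfl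
    have h7 := (h6.add (hF q hq)).mono hX
    have h8 := small_emod (Z := Z) ((∑ q ∈ Finset.range q, F q) % g + F q) hg hgZ
    refine Wp.imp (wp_assign (((∑ q ∈ Finset.range q, F q) % g + F q) % g) ?_ ?_)
      (le_of_eq (by simp; ring)) (fun _ _ h => h)
    · simp only [fits_mod, fits_add, fits_var, eval_mod, eval_add, eval_var, f2, f52, h5, and_true]
      exact ⟨⟨h6.mono hgZ, h4, h7⟩, small_of_nonneg hg.le hgZ, h8⟩
    · simp [Finset.sum_range_succ]

/-- The product of the determinants as the modulus, and the coordinates of the products of the rows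
of both matrices. -/
def fillProd : Cmd :=
  .loop 50 (var 30 * var 3) <|
  .seq (modSum (var 30)
    (.inp (var 33 + ((var 50 / var 30) * var 3 + var 53 / var 3)) *
      .inp (var 36 + ((var 50 / var 3) % var 3 * var 3 + var 53 % var 3)) *
      .inp (1 + (var 53 * var 3 + var 50 % var 3)))) <|
  .store 0 (var 50) (var 52)

theorem div_mul_add_lt {d D A x y : ℕ} (hx : x < A) (hy : y < d) (h : A * d ≤ D) :
    x * d + y < D := by
  nlinarith

/-- A single counter `m = (i * d + j) * d + t` runs through the coordinates `t` of the products of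
the rows `i` and `j`, and the summation index `q` encodes a pair of basis elements. The `d ^ 5`
passes through the inner loop dominate the cost of a multiplication of ideals. -/
theorem wp_fillProd {d P P' : ℕ} {a b τ g : ℤ} (h3 : s.var 3 = d) (h30 : s.var 30 = (d * d : ℕ))
    (h33 : s.var 33 = P) (h36 : s.var 36 = P') (h2 : s.var 2 = g) (hg : 0 < g)
    (hM : ∀ t < d * d, 0 ≤ inp.getD (P + t) 0 ∧ inp.getD (P + t) 0 ≤ a)
    (hN : ∀ t < d * d, 0 ≤ inp.getD (P' + t) 0 ∧ inp.getD (P' + t) 0 ≤ b)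
    (hT : ∀ t < d * d * d, Small τ (inp.getD (1 + t) 0)) (hτ : 1 ≤ τ) (ha : 1 ≤ a) (hb : 1 ≤ b)
    (hZ : g + a * b * τ ≤ Z) (hPZ : ((P + P' + d * d * d + d * d + d + 1 : ℕ) : ℤ) ≤ Z) :
    fillProd.Wp inp Z s (8 + d * d * d * (25 + d * d * 71)) fun s' => ∀ m < d * d * d,
      s'.arr 0 m = (∑ q ∈ Finset.range (d * d), inp.getD (P + (m / (d * d) * d + q / d)) 0 *
        inp.getD (P' + (m / d % d * d + q % d)) 0 * inp.getD (1 + (q * d + m % d)) 0) % g := by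
  have key : ∀ t : ℕ, t ≤ P + P' + d * d * d + d * d + d + 1 → Small Z (t : ℤ) := fun t ht =>
    small_of_nonneg (by positivity) (le_trans (by exact_mod_cast ht) hPZ)
  have hab : 1 ≤ a * b := one_le_mul_of_one_le_of_one_le ha hb
  have habτ : a * b ≤ a * b * τ := le_mul_of_one_le_right (by linarith) hτ
  have hτab : τ ≤ a * b * τ := le_mul_of_one_le_left (by linarith) hab
  have haab : a ≤ a * b := le_mul_of_one_le_right (by linarith) hb
  have hbab : b ≤ a * b := le_mul_of_one_le_left (by linarith) ha
  refine Wp.imp (wp_loop (n := d * d * d) (k := 17 + d * d * 71) (fun i s' => ∀ m < i,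
      s'.arr 0 m = (∑ q ∈ Finset.range (d * d), inp.getD (P + (m / (d * d) * d + q / d)) 0 *
        inp.getD (P' + (m / d % d * d + q % d)) 0 * inp.getD (1 + (q * d + m % d)) 0) % g)
      ?_ (by simp) ?_ (fun s' _ h => h)) (le_of_eq (by simp only [size_mul, size_var]; ring))
      (fun _ _ h => h)
  · have e1 := key (d * d) (by omega)
    have e2 := key (d * d * d) (by omega)
    push_cast at e1 e2
    simp [h3, h30, key d (by omega), e1, e2]
  · intro m hm s' hF h
    have hd : 0 < d := by
      rcases Nat.eq_zero_or_pos d with rfl | h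
      · simp at hm
      · exact h
    have f3 := (hF.var 3 (by decide)).trans h3
    have f30 := (hF.var 30 (by decide)).trans h30
    have f33 := (hF.var 33 (by decide)).trans h33
    have f36 := (hF.var 36 (by decide)).trans h36
    have f2 := (hF.var 2 (by decide)).trans h2
    have hi : m / (d * d) < d := Nat.div_lt_of_lt_mul hm
    have hj : m / d % d < d := Nat.mod_lt _ hd
    have hl : m % d < d := Nat.mod_lt _ hd
    have hmd : m / d ≤ m := Nat.div_le_self _ _
    refine Wp.imp (wp_seq (Wp.imp (wp_modSum (n := d * d) (g := g) (X := a * b * τ)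
      (F := fun q => inp.getD (P + (m / (d * d) * d + q / d)) 0 *
        inp.getD (P' + (m / d % d * d + q % d)) 0 * inp.getD (1 + (q * d + m % d)) 0)
      (by simpa using f2) hg hZ ?_ ?_ ?_ (by linarith)) le_rfl
      (fun s₁ hF₁ h₁ => wp_store m _ ?_ ⟨?_, rfl⟩ ?_))) (le_of_eq (by simp; ring))
      (fun _ _ h => h)
    · intro q hq
      have hq1 : q / d < d := Nat.div_lt_of_lt_mul hq
      have hq2 : q % d < d := Nat.mod_lt _ hd
      have m1 := hM _ (div_mul_add_lt hi hq1 le_rfl)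
      have m2 := hN _ (div_mul_add_lt hj hq2 le_rfl)
      have m3 := hT _ (div_mul_add_lt hq hl le_rfl)
      exact ((small_of_nonneg m1.1 m1.2).mul (small_of_nonneg m2.1 m2.2)).mul m3
    · intro s₁ hF₁
      have g30 := hF₁.var 30 (by decide)
      simp only [Store.var_setVar] at g30
      norm_num [f30] at g30
      have := key (d * d) (by omega)
      push_cast at this
      simp [g30, this]
    · intro q hq s₁ hF₁ g53
      have hq1 : q / d < d := Nat.div_lt_of_lt_mul hq
      have hq2 : q % d < d := Nat.mod_lt _ hd
      have i1 := div_mul_add_lt hi hq1 le_rfl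
      have i2 := div_mul_add_lt hj hq2 le_rfl
      have i3 := div_mul_add_lt hq hl le_rfl
      have m1 := hM _ i1
      have m2 := hN _ i2
      have m3 := hT _ i3
      have g3 := (hF₁.var 3 (by decide))
      have g30 := (hF₁.var 30 (by decide))
      have g33 := (hF₁.var 33 (by decide))
      have g36 := (hF₁.var 36 (by decide))
      have g50 := (hF₁.var 50 (by decide))
      simp only [Store.var_setVar] at g3 g30 g33 g36 g50
      rw [if_neg (by decide)] at g3 g30 g33 g36
      rw [if_pos trivial] at g50
      rw [f3] at g3
      rw [f30] at g30
      rw [f33] at g33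
      rw [f36] at g36
      have c1 : ((m : ℤ) / (d * d : ℕ)) = (m / (d * d) : ℕ) := by norm_cast
      have c2 : ((q : ℤ) / d) = (q / d : ℕ) := by norm_cast
      have c3 : ((m : ℤ) / d) = (m / d : ℕ) := by norm_cast
      have c4 : (((m / d : ℕ) : ℤ) % d) = (m / d % d : ℕ) := by norm_cast
      have c5 : ((q : ℤ) % d) = (q % d : ℕ) := by norm_cast
      have c6 : ((m : ℤ) % d) = (m % d : ℕ) := by norm_cast
      simp only [fits_mul, fits_inp, fits_add, fits_div, fits_mod, fits_var, fits_one, eval_mul,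
        eval_inp, eval_add, eval_div, eval_mod, eval_var, eval_one, g3, g30, g33, g36, g50, g53,
        c1, c2, c3, c4, c5, c6]
      generalize m / (d * d) = x₁ at *
      generalize m / d % d = x₂ at *
      generalize m / d = x₃ at *
      generalize m % d = x₄ at *
      generalize q / d = y₁ at *
      generalize q % d = y₂ at *
      have t1 : ((P : ℤ) + ((x₁ : ℤ) * d + y₁)).toNat = P + (x₁ * d + y₁) := by
        rw [show (P : ℤ) + ((x₁ : ℤ) * d + y₁) = ((P + (x₁ * d + y₁) : ℕ) : ℤ) by push_cast; rfl,
          Int.toNat_natCast]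
      have t2 : ((P' : ℤ) + ((x₂ : ℤ) * d + y₂)).toNat = P' + (x₂ * d + y₂) := by
        rw [show (P' : ℤ) + ((x₂ : ℤ) * d + y₂) = ((P' + (x₂ * d + y₂) : ℕ) : ℤ) by push_cast; rfl,
          Int.toNat_natCast]
      have t3 : ((1 : ℤ) + ((q : ℤ) * d + x₄)).toNat = 1 + (q * d + x₄) := by
        rw [show (1 : ℤ) + ((q : ℤ) * d + x₄) = ((1 + (q * d + x₄) : ℕ) : ℤ) by push_cast; rfl,
          Int.toNat_natCast]
      rw [t1, t2, t3]
      have k1 := key P (by omega)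
      have k2 := key P' (by omega)
      have k3 := key m (by omega)
      have k4 := key (d * d) (by omega)
      have k5 := key x₁ (by omega)
      have k6 := key d (by omega)
      have k7 := key (x₁ * d) (by omega)
      have k8 := key q (by omega)
      have k9 := key y₁ (by omega)
      have k10 := key (x₁ * d + y₁) (by omega)
      have k11 := key (P + (x₁ * d + y₁)) (by omega)
      have k12 := key x₃ (by omega)
      have k13 := key x₂ (by omega)
      have k14 := key (x₂ * d) (by omega)
      have k15 := key y₂ (by omega)
      have k16 := key (x₂ * d + y₂) (by omega)
      have k17 := key (P' + (x₂ * d + y₂)) (by omega)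
      have k18 := key (q * d) (by omega)
      have k19 := key x₄ (by omega)
      have k20 := key (q * d + x₄) (by omega)
      have k21 := key (1 + (q * d + x₄)) (by omega)
      have k22 := key 1 (by omega)
      push_cast at k7 k10 k11 k14 k16 k17 k18 k20 k21 k22
      have z1 := small_of_nonneg m1.1 m1.2
      have z2 := small_of_nonneg m2.1 m2.2
      have w1 := z1.mono (show a ≤ Z by linarith)
      have w2 := z2.mono (show b ≤ Z by linarith)
      have w3 := m3.mono (show τ ≤ Z by linarith)
      have w4 := (z1.mul z2).mono (show a * b ≤ Z by linarith)
      have w5 := ((z1.mul z2).mul m3).mono (show a * b * τ ≤ Z by linarith)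
      simp only [k1, k2, k3, k4, k5, k6, k7, k8, k9, k10, k11, k12, k13, k14, k15, k16, k17, k18,
        k19, k20, k21, k22, w1, w2, w3, w4, w5, and_self]
    · have := hF₁.var 50 (by decide)
      simp only [Store.var_setVar, if_true] at this
      simp only [fits_var, eval_var, this, and_true]
      exact key m (by omega)
    · simp only [fits_var, h₁]
      exact small_emod _ hg (by linarith)
    · intro m' hm'
      rw [Store.arr_setArr_self]
      have harr : s₁.arr 0 = s'.arr 0 := (hF₁.arr 0 (by decide)).trans (by simp)
      rcases (Nat.lt_succ_iff.1 hm').eq_or_lt with rfl | hlt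
      · rw [if_pos rfl]; exact h₁
      · rw [if_neg hlt.ne, harr]
        exact h m' hlt

end Cmd
end RAM

/-! ### Generators for an inverse -/

namespace RAM
namespace Cmd
open RAM.Expr RowLattice

variable {inp : List ℤ} {Z : ℤ} {s : Store}

theorem index_inj {w i j t u : ℕ} (ht : t < w) (hu : u < w) (h : i * w + t = j * w + u) :
    i = j ∧ t = u := by
  have hw : 0 < w := by omega
  have h1 : (i * w + t) / w = i := by
    rw [mul_comm, Nat.mul_add_div hw, Nat.div_eq_of_lt ht, add_zero]
  have h2 : (j * w + u) / w = j := by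
    rw [mul_comm, Nat.mul_add_div hw, Nat.div_eq_of_lt hu, add_zero]
  have h3 : i = j := by rw [← h1, h, h2]
  subst h3
  exact ⟨rfl, by omega⟩

/-- The coordinate `x₅₀ mod d` of the product of a basis element with a row of a matrix. -/
def invEntry : Cmd :=
  modSum (var 3)
    (.inp (var 33 + ((var 50 % var 30) / var 3 * var 3 + var 53)) *
      .inp (1 + ((var 50 / var 30 * var 3 + var 53) * var 3 + var 50 % var 3)))

theorem wp_invEntry {d P m : ℕ} {a τ g : ℤ} (h3 : s.var 3 = d) (h30 : s.var 30 = (d * d : ℕ))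
    (h33 : s.var 33 = P) (h50 : s.var 50 = m) (h2 : s.var 2 = g) (hg : 0 < g)
    (hM : ∀ t < d * d, 0 ≤ inp.getD (P + t) 0 ∧ inp.getD (P + t) 0 ≤ a)
    (hT : ∀ t < d * d * d, Small τ (inp.getD (1 + t) 0)) (hτ : 1 ≤ τ) (ha : 1 ≤ a)
    (hZ : g + a * τ ≤ Z) (hm : m < d * d * d)
    (hPZ : ((P + 2 * (d * d * d) + 2 * (d * d) + d + 1 : ℕ) : ℤ) ≤ Z) :
    invEntry.Wp inp Z s (8 + d * 58) fun s' => s'.var 52 =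
      (∑ p ∈ Finset.range d, inp.getD (P + (m % (d * d) / d * d + p)) 0 *
        inp.getD (1 + ((m / (d * d) * d + p) * d + m % d)) 0) % g := by
  have key : ∀ t : ℕ, t ≤ P + 2 * (d * d * d) + 2 * (d * d) + d + 1 → Small Z (t : ℤ) :=
    fun t ht => small_of_nonneg (by positivity) (le_trans (by exact_mod_cast ht) hPZ)
  have haτ : a ≤ a * τ := le_mul_of_one_le_right (by linarith) hτ
  have hτa : τ ≤ a * τ := le_mul_of_one_le_left (by linarith) ha
  have hd : 0 < d := by
    rcases Nat.eq_zero_or_pos d with rfl | h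
    · simp at hm
    · exact h
  have hi : m / (d * d) < d := Nat.div_lt_of_lt_mul hm
  have hc : m % (d * d) < d * d := Nat.mod_lt _ (Nat.mul_pos hd hd)
  have hj : m % (d * d) / d < d := Nat.div_lt_of_lt_mul hc
  have hl : m % d < d := Nat.mod_lt _ hd
  have c1 : ((m : ℤ) / (d * d : ℕ)) = (m / (d * d) : ℕ) := by norm_cast
  have c2 : ((m : ℤ) % (d * d : ℕ)) = (m % (d * d) : ℕ) := by norm_cast
  have c3 : (((m % (d * d) : ℕ) : ℤ) / d) = (m % (d * d) / d : ℕ) := by norm_cast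
  have c4 : ((m : ℤ) % d) = (m % d : ℕ) := by norm_cast
  have hF0 : ∀ q < d, Small (a * τ) (inp.getD (P + (m % (d * d) / d * d + q)) 0 *
        inp.getD (1 + ((m / (d * d) * d + q) * d + m % d)) 0) := fun q hq => by
    have m1 := hM _ (div_mul_add_lt hj hq le_rfl)
    exact (small_of_nonneg m1.1 m1.2).mul
      (hT _ (div_mul_add_lt (div_mul_add_lt hi hq le_rfl) hl le_rfl))
  refine Wp.imp (wp_modSum (n := d) (g := g) (X := a * τ)
    (F := fun q => inp.getD (P + (m % (d * d) / d * d + q)) 0 *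
        inp.getD (1 + ((m / (d * d) * d + q) * d + m % d)) 0)
    h2 hg hZ hF0 ?_ ?_ (by linarith)) (le_of_eq (by
        simp only [size_mul, size_var, size_inp, size_add, size_div, size_mod, size_one]))
    (fun _ _ h => h)
  · intro s₁ hF₁
    have g3 := (hF₁.var 3 (by decide)).trans h3
    simp [g3, key d (by omega)]
  · intro q hq s₁ hF₁ g53
    have g3 := (hF₁.var 3 (by decide)).trans h3
    have g30 := (hF₁.var 30 (by decide)).trans h30
    have g33 := (hF₁.var 33 (by decide)).trans h33
    have g50 := (hF₁.var 50 (by decide)).trans h50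
    have i1 := div_mul_add_lt hj hq le_rfl
    have i2 := div_mul_add_lt (div_mul_add_lt hi hq le_rfl) hl le_rfl
    have m1 := hM _ i1
    have m3 := hT _ i2
    have m4 := hF0 q hq
    simp only [fits_mul, fits_inp, fits_add, fits_div, fits_mod, fits_var, fits_one, eval_mul,
      eval_inp, eval_add, eval_div, eval_mod, eval_var, eval_one, g3, g30, g33, g50, g53,
      c1, c2, c3, c4]
    generalize m / (d * d) = x₁ at *
    generalize m % (d * d) / d = x₂ at *
    generalize m % (d * d) = x₃ at *
    generalize m % d = x₄ at *
    have t1 : ((P : ℤ) + ((x₂ : ℤ) * d + q)).toNat = P + (x₂ * d + q) := by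
      rw [show (P : ℤ) + ((x₂ : ℤ) * d + q) = ((P + (x₂ * d + q) : ℕ) : ℤ) by push_cast; rfl,
        Int.toNat_natCast]
    have t2 : ((1 : ℤ) + (((x₁ : ℤ) * d + q) * d + x₄)).toNat = 1 + ((x₁ * d + q) * d + x₄) := by
      rw [show (1 : ℤ) + (((x₁ : ℤ) * d + q) * d + x₄) = ((1 + ((x₁ * d + q) * d + x₄) : ℕ) : ℤ)
        by push_cast; rfl, Int.toNat_natCast]
    rw [t1, t2]
    have i3 := div_mul_add_lt hi hq le_rfl
    have k1 := key P (by omega)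
    have k2 := key m (by nlinarith)
    have k3 := key (d * d) (by omega)
    have k4 := key x₃ (by omega)
    have k5 := key d (by omega)
    have k6 := key x₂ (by omega)
    have k7 := key (x₂ * d) (by omega)
    have k8 := key q (by omega)
    have k9 := key (x₂ * d + q) (by omega)
    have k10 := key (P + (x₂ * d + q)) (by omega)
    have k11 := key 1 (by omega)
    have k12 := key x₁ (by omega)
    have k13 := key (x₁ * d) (by omega)
    have k14 := key (x₁ * d + q) (by omega)
    have k15 := key ((x₁ * d + q) * d) (by omega)
    have k16 := key x₄ (by omega)
    have k17 := key ((x₁ * d + q) * d + x₄) (by omega)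
    have k18 := key (1 + ((x₁ * d + q) * d + x₄)) (by omega)
    push_cast at k7 k9 k10 k11 k13 k14 k15 k17 k18
    have w1 := (small_of_nonneg m1.1 m1.2).mono (show a ≤ Z by linarith)
    have w3 := m3.mono (show τ ≤ Z by linarith)
    have w4 := m4.mono (show a * τ ≤ Z by linarith)
    simp only [k1, k2, k3, k4, k5, k6, k7, k8, k9, k10, k11, k12, k13, k14, k15, k16, k17, k18,
      w1, w3, w4, and_self]

/-- The coordinates of the products of the basis with the rows of a matrix, one row for each basis
element. -/
def fillTable : Cmd :=
  .loop 50 (var 3 * var 30) <| .seq invEntry <|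
    .store 0 (var 50 / var 30 * var 1 + (var 3 + var 50 % var 30)) (var 52)

theorem mul_add_le_cube {d i t : ℕ} (hi : i < d) (ht : t < d + d * d) :
    i * (d + d * d) + t ≤ d * d * d + d * d := by
  have : (i + 1) * (d + d * d) ≤ d * (d + d * d) := Nat.mul_le_mul_right _ hi
  rw [add_one_mul] at this
  nlinarith

/-- The stores go to columns from `d` on only, so the first `d` columns keep their initial zeros.
This is recorded because the identity block is completed later by setting only its diagonal. -/
theorem wp_fillTable {d P : ℕ} {a τ g : ℤ} (h3 : s.var 3 = d) (h30 : s.var 30 = (d * d : ℕ))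
    (h33 : s.var 33 = P) (h1 : s.var 1 = (d + d * d : ℕ)) (h2 : s.var 2 = g) (hg : 0 < g)
    (hA : s.arr 0 = fun _ => 0)
    (hM : ∀ t < d * d, 0 ≤ inp.getD (P + t) 0 ∧ inp.getD (P + t) 0 ≤ a)
    (hT : ∀ t < d * d * d, Small τ (inp.getD (1 + t) 0)) (hτ : 1 ≤ τ) (ha : 1 ≤ a)
    (hZ : g + a * τ ≤ Z)
    (hPZ : ((P + 2 * (d * d * d) + 2 * (d * d) + d + 1 : ℕ) : ℤ) ≤ Z) :
    fillTable.Wp inp Z s (8 + d * d * d * (50 + d * 58)) fun s' =>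
      (∀ m < d * (d * d), s'.arr 0 (m / (d * d) * (d + d * d) + (d + m % (d * d))) =
        (∑ p ∈ Finset.range d, inp.getD (P + (m % (d * d) / d * d + p)) 0 *
          inp.getD (1 + ((m / (d * d) * d + p) * d + m % d)) 0) % g) ∧
      ∀ i < d, ∀ t < d, s'.arr 0 (i * (d + d * d) + t) = 0 := by
  have key : ∀ t : ℕ, t ≤ P + 2 * (d * d * d) + 2 * (d * d) + d + 1 → Small Z (t : ℤ) :=
    fun t ht => small_of_nonneg (by positivity) (le_trans (by exact_mod_cast ht) hPZ)
  refine Wp.imp (wp_loop (n := d * d * d) (k := 40 + d * 58)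
    (fun i s' => (∀ m < i, s'.arr 0 (m / (d * d) * (d + d * d) + (d + m % (d * d))) =
        (∑ p ∈ Finset.range d, inp.getD (P + (m % (d * d) / d * d + p)) 0 *
          inp.getD (1 + ((m / (d * d) * d + p) * d + m % d)) 0) % g) ∧
      ∀ i < d, ∀ t < d, s'.arr 0 (i * (d + d * d) + t) = 0)
    ?_ ?_ ?_ (fun s' _ h => by rwa [← mul_assoc]))
    (by simp only [size_mul, size_var]; nlinarith) (fun _ _ h => h)
  · have e1 := key (d * d) (by omega)
    have e2 := key (d * d * d) (by omega)
    push_cast at e1 e2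
    simp only [fits_mul, fits_var, eval_mul, eval_var, h3, h30]
    push_cast
    rw [mul_assoc] at e2 ⊢
    exact ⟨⟨key d (by omega), e1, e2⟩, rfl⟩
  · simp [hA]
  · rintro m hm s' hF ⟨h, h'⟩
    have hd : 0 < d := by
      rcases Nat.eq_zero_or_pos d with rfl | h
      · simp at hm
      · exact h
    have f3 := (hF.var 3 (by decide)).trans h3
    have f30 := (hF.var 30 (by decide)).trans h30
    have f33 := (hF.var 33 (by decide)).trans h33
    have f1 := (hF.var 1 (by decide)).trans h1
    have f2 := (hF.var 2 (by decide)).trans h2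
    have hi : m / (d * d) < d := Nat.div_lt_of_lt_mul hm
    have hc : m % (d * d) < d * d := Nat.mod_lt _ (Nat.mul_pos hd hd)
    have c1 : ((m : ℤ) / (d * d : ℕ)) = (m / (d * d) : ℕ) := by norm_cast
    have c2 : ((m : ℤ) % (d * d : ℕ)) = (m % (d * d) : ℕ) := by norm_cast
    refine Wp.imp (wp_seq (Wp.imp (wp_invEntry (s := s'.setVar 50 m) (m := m) (by simpa using f3)
      (by simpa using f30) (by simpa using f33) (by simp) (by simpa using f2) hg hM hT hτ ha hZ
      hm hPZ) le_rfl
      (fun s₁ hF₁ h₁ => wp_store (m / (d * d) * (d + d * d) + (d + m % (d * d))) _ ?_ ⟨?_, rfl⟩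
        ?_))) (by simp only [size_mul, size_var, size_add, size_div, size_mod]; omega)
      (fun _ _ h => h)
    · have g1 := (hF₁.var 1 (by decide))
      have g3 := (hF₁.var 3 (by decide))
      have g30 := (hF₁.var 30 (by decide))
      have g50 := (hF₁.var 50 (by decide))
      simp only [Store.var_setVar] at g1 g3 g30 g50
      rw [if_neg (by decide)] at g1 g3 g30
      rw [if_pos trivial] at g50
      rw [f1] at g1
      rw [f3] at g3
      rw [f30] at g30
      simp only [fits_mul, fits_add, fits_div, fits_mod, fits_var, eval_mul,
        eval_add, eval_div, eval_mod, eval_var, g1, g3, g30, g50, c1, c2]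
      have h5 := mul_add_le_cube hi (show d + m % (d * d) < d + d * d by omega)
      have k1 := key m (by nlinarith)
      have k2 := key (d * d) (by omega)
      have k3 := key (m / (d * d)) (by omega)
      have k4 := key (d + d * d) (by omega)
      have k5 := key (m / (d * d) * (d + d * d)) (by omega)
      have k6 := key d (by omega)
      have k7 := key (m % (d * d)) (by omega)
      have k8 := key (d + m % (d * d)) (by omega)
      have k9 := key (m / (d * d) * (d + d * d) + (d + m % (d * d))) (by omega)
      generalize m / (d * d) = x₁ at *
      generalize m % (d * d) = x₃ at *
      simp only [← Nat.cast_add, ← Nat.cast_mul]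
      simp only [k1, k2, k3, k4, k5, k6, k7, k8, k9, and_self]
    · simp only [fits_var, h₁]
      exact small_emod _ hg (by nlinarith)
    · have harr : s₁.arr 0 = s'.arr 0 := (hF₁.arr 0 (by decide)).trans (by simp)
      refine ⟨fun m' hm' => ?_, fun i hi' t ht => ?_⟩
      · rw [Store.arr_setArr_self]
        rcases (Nat.lt_succ_iff.1 hm').eq_or_lt with rfl | hlt
        · rw [if_pos rfl]; exact h₁
        · rw [if_neg, harr]
          · exact h m' hlt
          · intro he
            have hc' : m' % (d * d) < d * d := Nat.mod_lt _ (Nat.mul_pos hd hd)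
            obtain ⟨e1, e2⟩ := index_inj (by omega) (by omega) he
            have := Nat.div_add_mod m (d * d)
            rw [← e1, show m % (d * d) = m' % (d * d) by omega, Nat.div_add_mod] at this
            omega
      · rw [Store.arr_setArr_self, if_neg, harr]
        · exact h' i hi' t ht
        · intro he
          have := (index_inj (by omega) (by omega) he).2
          omega
/-- Store the identity matrix in the first `x₃` columns. -/
def fillIdentity : Cmd := .loop 50 (var 3) <| .store 0 (var 50 * var 1 + var 50) 1

theorem wp_fillIdentity {d : ℕ} {F : ℕ → ℤ} (h3 : s.var 3 = d) (h1 : s.var 1 = (d + d * d : ℕ))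
    (hA : ∀ m < d * (d * d), s.arr 0 (m / (d * d) * (d + d * d) + (d + m % (d * d))) = F m)
    (hA' : ∀ i < d, ∀ t < d, s.arr 0 (i * (d + d * d) + t) = 0)
    (hPZ : ((d * d * d + 2 * (d * d) + d + 1 : ℕ) : ℤ) ≤ Z) :
    fillIdentity.Wp inp Z s (5 + d * 23) fun s' =>
      (∀ m < d * (d * d), s'.arr 0 (m / (d * d) * (d + d * d) + (d + m % (d * d))) = F m) ∧
      ∀ i < d, ∀ t < d, s'.arr 0 (i * (d + d * d) + t) = if i = t then 1 else 0 := by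
  have key : ∀ t : ℕ, t ≤ d * d * d + 2 * (d * d) + d + 1 → Small Z (t : ℤ) :=
    fun t ht => small_of_nonneg (by positivity) (le_trans (by exact_mod_cast ht) hPZ)
  refine Wp.imp (wp_loop (n := d) (k := 15)
    (fun i s' => (∀ m < d * (d * d), s'.arr 0 (m / (d * d) * (d + d * d) + (d + m % (d * d))) =
        F m) ∧
      ∀ j < d, ∀ t < d, s'.arr 0 (j * (d + d * d) + t) = if j < i ∧ j = t then 1 else 0)
      ?_ ?_ ?_ (fun s' _ h => ⟨h.1, fun i hi t ht => ?_⟩)) (by simp) (fun _ _ h => h)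
  · simp [h3, key d (by omega)]
  · refine ⟨hA, fun i hi t ht => ?_⟩
    rw [hA' i hi t ht]; simp
  · rintro i hi s' hF ⟨h, h'⟩
    have f1 := (hF.var 1 (by decide)).trans h1
    have h5 := mul_add_le_cube hi (show i < d + d * d by omega)
    have k1 := key i (by omega)
    have k2 := key (d + d * d) (by omega)
    have k3 := key (i * (d + d * d)) (by omega)
    have k4 := key (i * (d + d * d) + i) (by omega)
    refine Wp.imp (wp_store (i * (d + d * d) + i) 1 ?_ ⟨?_, rfl⟩ ?_) (by simp) (fun _ _ h => h)
    · simp only [fits_mul, fits_add, fits_var, eval_mul, eval_add, eval_var, Store.var_setVar,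
        if_true, f1, show (1 : ℕ) ≠ 50 by decide, if_false]
      simp only [← Nat.cast_add, ← Nat.cast_mul]
      simp only [k1, k2, k3, k4, and_self]
    · simpa using key 1 (by omega)
    · refine ⟨fun m hm => ?_, fun j hj t ht => ?_⟩
      · rw [Store.arr_setArr_self, if_neg, Store.arr_setVar]
        · exact h m hm
        · intro he
          have hc' : m % (d * d) < d * d := Nat.mod_lt _ (Nat.mul_pos (by omega) (by omega))
          have := (index_inj (by omega) (by omega) he).2
          omega
      · rw [Store.arr_setArr_self, Store.arr_setVar, h' j hj t ht]
        by_cases he : j * (d + d * d) + t = i * (d + d * d) + i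
        · obtain ⟨rfl, rfl⟩ := index_inj (by omega) (by omega) he
          simp
        · rw [if_neg he]
          by_cases hjt : j = t
          · subst hjt
            have : j ≠ i := fun h => he (by rw [h])
            simp only [and_true, show (j < i ↔ j < i + 1) by omega]
          · simp [hjt]
  · rw [h.2 i hi t ht]
    simp [hi]

end Cmd
end RAM

/-! ### Positions of the data in the input -/

section Encoding

variable {K : Type*} [Field K] {d : ℕ} (ω : Module.Basis (Fin d) ℤ (𝓞 K))

theorem encodeField_length : (encodeField ω).length = d * d * d + 1 := by
  simp [encodeField, mul_assoc]

theorem encodeField_getD (L : List ℤ) (i j t : Fin d) :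
    (encodeField ω ++ L).getD (1 + ((i * d + j) * d + t)) 0 = ω.repr (ω i * ω j) t := by
  rw [add_comm 1, encodeField, List.cons_append, List.getD_cons_succ]
  have e : ((i : ℕ) * d + j) * d + t = i * (d * d) + (j * d + t) := by ring
  have hj : (j : ℕ) * d + t < d * d := by
    have := j.2
    have := t.2
    nlinarith
  rw [e, flatMap_finRange_getD d (d * d) _ (by simp) 0 i hj]
  have := flatMap_finRange_getD d d (fun j => (List.finRange d).map fun l =>
    ω.repr (ω i * ω j) l) (by simp) 0 j t.2 []
  rw [List.append_nil] at this
  rw [this]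
  simp [List.getD_eq_getElem?_getD]

variable (k l : ℕ) (M N : Matrix (Fin d) (Fin d) ℤ)

theorem encodeIdeal_length : (encodeIdeal k M).length = d * d + 1 := by
  simp [encodeIdeal, matrixEntries_length]

theorem encodeIdeal_getD (L : List ℤ) (i j : Fin d) :
    (encodeIdeal k M ++ L).getD (1 + (i * d + j)) 0 = M i j := by
  rw [add_comm 1, encodeIdeal, List.cons_append, List.getD_cons_succ, matrixEntries_getD]

theorem input_getD_den (L : List ℤ) :
    (encodeField ω ++ encodeIdeal k M ++ L).getD (d * d * d + 1) 0 = k := by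
  rw [List.append_assoc, List.getD_append_right _ _ _ _ (encodeField_length ω).le,
    encodeField_length, Nat.sub_self]
  rfl

theorem input_getD_num (L : List ℤ) (i j : Fin d) :
    (encodeField ω ++ encodeIdeal k M ++ L).getD (d * d * d + 2 + (i * d + j)) 0 = M i j := by
  rw [List.append_assoc, List.getD_append_right _ _ _ _ (by rw [encodeField_length]; omega),
    encodeField_length, show d * d * d + 2 + ((i : ℕ) * d + j) - (d * d * d + 1) =
      1 + (i * d + j) by omega, encodeIdeal_getD]

theorem input_getD_den' :
    (encodeField ω ++ encodeIdeal k M ++ encodeIdeal l N).getD (d * d * d + d * d + 2) 0 = l := by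
  have h : (encodeField ω ++ encodeIdeal k M).length = d * d * d + d * d + 2 := by
    rw [List.length_append, encodeField_length, encodeIdeal_length]; omega
  rw [List.getD_append_right _ _ _ _ h.le, h, Nat.sub_self]
  rfl

theorem input_getD_num' (i j : Fin d) :
    (encodeField ω ++ encodeIdeal k M ++ encodeIdeal l N).getD
      (d * d * d + d * d + 3 + (i * d + j)) 0 = N i j := by
  have h : (encodeField ω ++ encodeIdeal k M).length = d * d * d + d * d + 2 := by
    rw [List.length_append, encodeField_length, encodeIdeal_length]; omega
  rw [List.getD_append_right _ _ _ _ (by omega), h,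
    show d * d * d + d * d + 3 + ((i : ℕ) * d + j) - (d * d * d + d * d + 2) =
      1 + (i * d + j) by omega]
  have := encodeIdeal_getD l N [] i j
  rwa [List.append_nil] at this

theorem forall_lt_sq {p : ℕ → Prop} (h : ∀ i j : Fin d, p (i * d + j)) : ∀ t < d * d, p t := by
  intro t ht
  have hd : 0 < d := by
    rcases Nat.eq_zero_or_pos d with rfl | h
    · simp at ht
    · exact h
  have := h ⟨t / d, Nat.div_lt_of_lt_mul ht⟩ ⟨t % d, Nat.mod_lt _ hd⟩
  simpa only [Nat.div_add_mod' t d] using this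

theorem forall_lt_cube {p : ℕ → Prop} (h : ∀ i j t : Fin d, p ((i * d + j) * d + t)) :
    ∀ m < d * d * d, p m := by
  intro m hm
  have hd : 0 < d := by
    rcases Nat.eq_zero_or_pos d with rfl | h
    · simp at hm
    · exact h
  have h1 : ∀ r < d * d, ∀ t : Fin d, p (r * d + t) :=
    forall_lt_sq (p := fun r => ∀ t : Fin d, p (r * d + t)) fun i j t => h i j t
  have := h1 (m / d) (Nat.div_lt_of_lt_mul (by linarith)) ⟨m % d, Nat.mod_lt _ hd⟩
  simpa only [Nat.div_add_mod' m d] using this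

theorem sum_range_sq (F : ℕ → ℤ) :
    ∑ q ∈ Finset.range (d * d), F q = ∑ i : Fin d, ∑ j : Fin d, F (i * d + j) := by
  have key : ∀ m, ∑ q ∈ Finset.range (m * d), F q =
      ∑ i ∈ Finset.range m, ∑ j : Fin d, F (i * d + j) := by
    intro m
    induction m with
    | zero => simp
    | succ m ih =>
      rw [add_one_mul, Finset.sum_range_add, ih, Finset.sum_range_succ,
        Finset.sum_range fun x => F (m * d + x)]
  rw [key, Finset.sum_range]

end Encoding

/-! ### Parameters of the product and inverse programs -/

namespace RAM
namespace Cmd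
open RAM.Expr RowLattice

variable {inp : List ℤ} {Z : ℤ} {s : Store}

/-- The parameters of the generators of a product. -/
def setupProd : Cmd :=
  .seq readIdeals <|
  .seq (.assign 2 (var 40 * var 41)) <|
  .seq (.assign 0 (var 30)) <|
  .seq (.assign 1 (var 3)) <|
  .seq (.assign 4 1) <|
  .assign 5 (var 32 * var 35)

theorem wp_setupProd {d : ℕ} {k l a b : ℤ} (hd : inp.getD 0 0 = d)
    (hk : inp.getD (d * d * d + 1) 0 = k) (hl : inp.getD (d * d * d + d * d + 2) 0 = l)
    (hk0 : 0 < k) (hl0 : 0 < l)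
    (hM' : ∀ i < d, 0 < inp.getD (d * d * d + 2 + (i * d + i)) 0)
    (hN' : ∀ i < d, 0 < inp.getD (d * d * d + d * d + 3 + (i * d + i)) 0)
    (ha : ∏ i ∈ Finset.range d, inp.getD (d * d * d + 2 + (i * d + i)) 0 = a)
    (hb : ∏ i ∈ Finset.range d, inp.getD (d * d * d + d * d + 3 + (i * d + i)) 0 = b)
    (hZ : k * l * (a * b) ≤ Z) (hdZ : ((2 * (d * d * d) + 4 * (d * d) + 2 * d + 5 : ℕ) : ℤ) ≤ Z) :
    setupProd.Wp inp Z Store.init (130 + d * 50) fun s' =>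
      Prologue d k l s' ∧ s'.var 0 = (d * d : ℕ) ∧ s'.var 1 = d ∧ s'.var 2 = a * b ∧
      s'.var 4 = 1 ∧ s'.var 5 = k * l := by
  have key : ∀ t : ℕ, t ≤ 2 * (d * d * d) + 4 * (d * d) + 2 * d + 5 → Small Z (t : ℤ) :=
    fun t ht => small_of_nonneg (by positivity) (le_trans (by exact_mod_cast ht) hdZ)
  have ha0 : 0 < a := ha ▸ Finset.prod_pos fun i hi => hM' i (Finset.mem_range.1 hi)
  have hb0 : 0 < b := hb ▸ Finset.prod_pos fun i hi => hN' i (Finset.mem_range.1 hi)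
  have hab : 1 ≤ a * b := Int.add_one_le_of_lt (mul_pos ha0 hb0)
  have hkl : 1 ≤ k * l := Int.add_one_le_of_lt (mul_pos hk0 hl0)
  have haab : a ≤ a * b := le_mul_of_one_le_right ha0.le hb0
  have hbab : b ≤ a * b := le_mul_of_one_le_left hb0.le ha0
  have hkkl : k ≤ k * l := le_mul_of_one_le_right hk0.le hl0
  have hlkl : l ≤ k * l := le_mul_of_one_le_left hl0.le hk0
  have hklZ : k * l ≤ Z := (le_mul_of_one_le_right (by linarith) hab).trans hZ
  have habZ : a * b ≤ Z := (le_mul_of_one_le_left (by linarith) hkl).trans hZ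
  have pos : ∀ {x : ℤ}, 0 < x → x ≤ Z → Small Z x := fun h h' => small_of_nonneg h.le h'
  have mk := pos hk0 (by linarith)
  have ml := pos hl0 (by linarith)
  have ma := pos ha0 (by linarith)
  have mb := pos hb0 (by linarith)
  have mab := pos (mul_pos ha0 hb0) habZ
  have mkl := pos (mul_pos hk0 hl0) hklZ
  refine Wp.imp (n := 96 + d * 50 + 34) (wp_seq (Wp.imp (wp_readIdeals hd hk hl
    hM' hN' ha hb mk ml (by linarith) (by linarith) hdZ) le_rfl fun s₃ _ H₃ => ?_))
    (by linarith) (fun _ _ h => h)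
  obtain ⟨⟨v3, v30, v32, v33, v35, v36, ho, hA⟩, h40, h₃⟩ := H₃
  have k1 := key (d * d) (by omega)
  push_cast at k1
  refine Wp.imp (wp_seq (wp_assign (a * b) ?_ (wp_seq (wp_assign ((d * d : ℕ) : ℤ) ?_
    (wp_seq (wp_assign (d : ℤ) ?_ (wp_seq (wp_assign 1 ?_ (wp_assign (k * l) ?_ ?_)))))))))
    (by simp) (fun _ _ h => h)
  · simp [h40, h₃, ma, mb, mab]
  · simp [v30, k1]
  · simp [v3, key d (by omega)]
  · simpa using key 1 (by omega)
  · simp [v32, v35, mk, ml, mkl]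
  · refine ⟨⟨?_, ?_, ?_, ?_, ?_, ?_, ?_, ?_⟩, ?_⟩
    all_goals simp [v3, v30, v32, v33, v35, v36, ho, hA]

/-- The parameters of the generators for an inverse. -/
def setupInv : Cmd :=
  .seq prologue <|
  .seq (diagProd 40 33) <|
  .seq (.assign 2 (var 40)) <|
  .seq (.assign 0 (var 3)) <|
  .seq (.assign 1 (var 3 + var 30)) <|
  .seq (.assign 4 (var 32)) <|
  .assign 5 (var 40)

theorem wp_setupInv {d : ℕ} {k l a : ℤ} (hd : inp.getD 0 0 = d)
    (hk : inp.getD (d * d * d + 1) 0 = k) (hl : inp.getD (d * d * d + d * d + 2) 0 = l)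
    (hkZ : Small Z k) (hlZ : Small Z l)
    (hM' : ∀ i < d, 0 < inp.getD (d * d * d + 2 + (i * d + i)) 0)
    (ha : ∏ i ∈ Finset.range d, inp.getD (d * d * d + 2 + (i * d + i)) 0 = a)
    (haZ : a ≤ Z) (hdZ : ((2 * (d * d * d) + 4 * (d * d) + 2 * d + 5 : ℕ) : ℤ) ≤ Z) :
    setupInv.Wp inp Z Store.init (130 + d * 25) fun s' =>
      Prologue d k l s' ∧ s'.var 0 = d ∧ s'.var 1 = (d + d * d : ℕ) ∧ s'.var 2 = a ∧
      s'.var 4 = k ∧ s'.var 5 = a := by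
  have key : ∀ t : ℕ, t ≤ 2 * (d * d * d) + 4 * (d * d) + 2 * d + 5 → Small Z (t : ℤ) :=
    fun t ht => small_of_nonneg (by positivity) (le_trans (by exact_mod_cast ht) hdZ)
  have ha0 : 0 < a := ha ▸ Finset.prod_pos fun i hi => hM' i (Finset.mem_range.1 hi)
  have ma : Small Z a := small_of_nonneg ha0.le haZ
  refine Wp.imp (wp_seq (Wp.imp (n' := 80) (wp_prologue hd hk hl
    (le_trans (by norm_cast; omega) hdZ) hkZ hlZ) le_rfl fun s₁ _ H₁ =>
    wp_seq (Wp.imp (n' := 8 + d * 25) (wp_diagProd H₁.var3 H₁.var33 (by decide) (by decide)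
      (by decide) (by decide) hM' ha haZ (le_trans (by norm_cast; nlinarith) hdZ))
      le_rfl fun s₂ hF₂ h₂ => ?_)))
    (n := 80 + (8 + d * 25 + 40)) (by linarith) (fun _ _ h => h)
  obtain ⟨v3, v30, v32, v33, v35, v36, ho, hA⟩ := H₁.mono hF₂ (by decide) rfl rfl
  have k1 := key (d * d) (by omega)
  have k2 := key (d + d * d) (by nlinarith)
  push_cast at k1 k2
  refine Wp.imp (wp_seq (wp_assign a ?_ (wp_seq (wp_assign (d : ℤ) ?_
    (wp_seq (wp_assign ((d + d * d : ℕ) : ℤ) ?_ (wp_seq (wp_assign k ?_ (wp_assign a ?_ ?_)))))))))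
    (by simp) (fun _ _ h => h)
  · simp [h₂, ma]
  · simp [v3, key d (by omega)]
  · simp [v3, v30, key d (by omega), k1, k2]
  · simp [v32, hkZ]
  · simp [h₂, ma]
  · refine ⟨⟨?_, ?_, ?_, ?_, ?_, ?_, ?_, ?_⟩, ?_⟩
    all_goals simp [v3, v30, v32, v33, v35, v36, ho, hA]

end Cmd
end RAM

theorem IsHNF.input_facts {d P : ℕ} {M : Matrix (Fin d) (Fin d) ℤ} {inp : List ℤ} (h : IsHNF M)
    (hP : ∀ i j : Fin d, inp.getD (P + (i * d + j)) 0 = M i j) :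
    (∀ t < d * d, 0 ≤ inp.getD (P + t) 0 ∧ inp.getD (P + t) 0 ≤ M.det) ∧
    (∀ i < d, 0 < inp.getD (P + (i * d + i)) 0) ∧
    ∏ i ∈ Finset.range d, inp.getD (P + (i * d + i)) 0 = M.det := by
  refine ⟨forall_lt_sq fun i j => ?_, fun i hi => ?_, ?_⟩
  · rw [hP]
    exact ⟨h.nonneg i j, h.le_det i j⟩
  · rw [show inp.getD (P + (i * d + i)) 0 = M ⟨i, hi⟩ ⟨i, hi⟩ from hP ⟨i, hi⟩ ⟨i, hi⟩]
    exact h.2.1 _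
  · rw [h.det, Finset.prod_range]
    exact Finset.prod_congr rfl fun i _ => hP i i

section Index

variable {d : ℕ}

theorem Fin.mul_add_lt (i j : Fin d) : (i : ℕ) * d + j < d * d := by
  have := Nat.mul_le_mul_right d i.2
  have := j.2
  rw [Nat.succ_mul] at *
  omega

theorem Fin.mul_add_div (i : ℕ) (j : Fin d) : (i * d + j) / d = i := by
  rw [mul_comm, Nat.mul_add_div j.pos, Nat.div_eq_of_lt j.2, add_zero]

theorem Fin.mul_add_mod (i : ℕ) (j : Fin d) : (i * d + j) % d = j := by
  rw [mul_comm, Nat.mul_add_mod, Nat.mod_eq_of_lt j.2]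

theorem Fin.mul_add_lt_cube (i j t : Fin d) : ((i : ℕ) * d + j) * d + t < d * d * d := by
  have := Nat.mul_le_mul_right d (Fin.mul_add_lt i j)
  have := t.2
  rw [Nat.succ_mul] at *
  omega

end Index

/-! ### The three programs: correctness and operation counts -/

namespace RAM
namespace Cmd
open RAM.Expr RowLattice

theorem box_of_forall_lt {A : ℕ → ℤ} {w n : ℕ} {g : ℤ}
    (h : ∀ m < n * w, 0 ≤ A m ∧ A m ≤ g) : Box A w n g := fun i hi t ht =>
  h _ (by nlinarith)

/-- The program for the sum of two ideals. -/
def addIdeals : Cmd := .seq prepareSum normalize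

/-- The program for the product of two ideals. -/
def mulIdeals : Cmd := .seq setupProd (.seq fillProd normalize)

/-- The program for the inverse of an ideal. -/
def invIdeal : Cmd := .seq setupInv (.seq fillTable (.seq fillIdentity normalize))

variable {K : Type*} [Field K] [NumberField K] {d : ℕ} {ω : Module.Basis (Fin d) ℤ (𝓞 K)}
  {𝔞 𝔟 : FractionalIdeal (𝓞 K)⁰ K} {k l : ℕ} {M N : Matrix (Fin d) (Fin d) ℤ} {Z Z' : ℤ}

/-- Elimination of `2 d` generators with `d` columns gives `O(d ^ 3)` operations with numbers
bounded by the determinants. The denominators and the unreduced generators require the larger bound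
`Z'`, but only for `O(d ^ 2)` operations. -/
theorem spec_addIdeals (hd : 0 < d) (ha : IsHNFRep ω 𝔞 k M) (hb : IsHNFRep ω 𝔟 l N)
    (hZ : 4 * (M.det * N.det + 1) ^ 2 ≤ Z)
    (hdZ : ((2 * (d * d * d) + 4 * (d * d) + 2 * d + 5 : ℕ) : ℤ) ≤ Z)
    (hZZ : Z ≤ Z') (hZ' : k * l * (M.det * N.det) ≤ Z') :
    addIdeals.Spec (encodeField ω ++ encodeIdeal k M ++ encodeIdeal l N) Store.init
      ((200 + d * 50 + d * d * 49) * unitCost Z' +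
        (300 * (d + d + d) * (d + 1) ^ 2 * unitCost Z + 81 * d ^ 2 * unitCost Z'))
      fun s' => ∃ m R, IsHNFRep ω (𝔞 + 𝔟) m R ∧ s'.out = encodeIdeal m R := by
  obtain ⟨hM, hM', hMa⟩ := ha.2.1.input_facts (input_getD_num ω k M (encodeIdeal l N))
  obtain ⟨hN, hN', hNb⟩ := hb.2.1.input_facts (input_getD_num' ω k l M N)
  have hk0 : (0 : ℤ) < k := by exact_mod_cast ha.pos
  have hl0 : (0 : ℤ) < l := by exact_mod_cast hb.pos
  have ha0 := ha.2.1.det_pos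
  have hb0 := hb.2.1.det_pos
  have hd0 : (encodeField ω ++ encodeIdeal k M ++ encodeIdeal l N).getD 0 0 = d := rfl
  refine Spec.seq (Spec.imp (wp_prepareSum hd0 (input_getD_den ω k M _)
    (input_getD_den' ω k l M N) hk0 hl0 hM hN hM' hN' hMa hNb hZ' (hdZ.trans hZZ)) le_rfl ?_)
  rintro s' - ⟨h0, h1, h2, h3, h4, h5, ho, hA⟩
  have hgg : (0 : ℤ) < Int.gcd k l :=
    Int.natCast_pos.2 (Int.gcd_pos_of_ne_zero_left _ hk0.ne')
  have hk₁ : (0 : ℤ) < l / Int.gcd k l :=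
    Int.ediv_pos_of_pos_of_dvd hl0 hgg.le (Int.gcd_dvd_right _ _)
  have hl₁ : (0 : ℤ) < k / Int.gcd k l :=
    Int.ediv_pos_of_pos_of_dvd hk0 hgg.le (Int.gcd_dvd_left _ _)
  have hcop : IsCoprime ((l : ℤ) / Int.gcd k l) (k / Int.gcd k l) := by
    rw [Int.isCoprime_iff_gcd_eq_one, Int.gcd_comm]
    exact Int.gcd_ediv_gcd_ediv_gcd (Int.gcd_pos_of_ne_zero_left _ hk0.ne')
  have hkl : (k : ℤ) * (l / Int.gcd k l) = l * (k / Int.gcd k l) := by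
    rw [← Int.mul_ediv_assoc _ (Int.gcd_dvd_right _ _), ← Int.mul_ediv_assoc _ (Int.gcd_dvd_left _ _),
      mul_comm]
  have hk₁l : (l : ℤ) / Int.gcd k l ≤ l := Int.ediv_le_self _ hl0.le
  generalize (l : ℤ) / Int.gcd k l = k₁ at *
  generalize (k : ℤ) / Int.gcd k l = l₁ at *
  have hg0 : (0 : ℤ) < Int.gcd (k₁ * M.det) (l₁ * N.det) :=
    Int.natCast_pos.2 (Int.gcd_pos_of_ne_zero_left _ (mul_pos hk₁ ha0).ne')
  have hbez : ∃ a b : ℤ, (Int.gcd (k₁ * M.det) (l₁ * N.det) : ℤ) =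
      k₁ * M.det * a + l₁ * N.det * b := ⟨_, _, Int.gcd_eq_gcd_ab _ _⟩
  -- A Bézout relation between `k₁` and `l₁`, multiplied by both determinants, writes their product
  -- as a combination of the two arguments of the gcd.
  have hgle : (Int.gcd (k₁ * M.det) (l₁ * N.det) : ℤ) ≤ M.det * N.det := by
    refine Int.le_of_dvd (mul_pos ha0 hb0) ?_
    obtain ⟨x, y, hxy⟩ := hcop
    have e : M.det * N.det = x * N.det * (k₁ * M.det) + y * M.det * (l₁ * N.det) := by
      linear_combination (-(M.det * N.det)) * hxy
    rw [e]
    exact dvd_add ((Int.gcd_dvd_left _ _).mul_left _) ((Int.gcd_dvd_right _ _).mul_left _)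
  generalize (Int.gcd (k₁ * M.det) (l₁ * N.det) : ℤ) = g at *
  have hab := mul_pos ha0 hb0
  have hden : k * k₁ ≤ Z' := le_trans ((mul_le_mul_of_nonneg_left hk₁l hk0.le).trans
    (le_mul_of_one_le_right (by positivity) hab)) hZ'
  have hg4 : 4 * (g + 1) ^ 2 ≤ Z := le_trans (by gcongr) hZ
  have hpos : (((d + d) * d + (d + d) + d : ℕ) : ℤ) ≤ Z :=
    le_trans (by norm_cast; rw [add_mul]; have := Nat.le_mul_self d; omega) hdZ
  have hg2 : 1 * g * g ≤ Z := le_trans (by nlinarith) hg4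
  refine Spec.imp (spec_normalize_ideal hd hg0 one_pos (mul_pos hk0 hk₁) h0 h1 h2 h3 h4 h5 ho
    (box_of_forall_lt fun m hm => ?_) (A := d + d) (by omega) le_rfl le_rfl hg4 hpos
    (hg2.trans hZZ) hden (hpos.trans hZZ)
    (mem_add_iff_exists_genLat ha hb hkl hk₁.ne' hbez (fun i j => ?_) (fun i j => ?_)))
    le_rfl fun _ _ h => h
  · rcases lt_or_ge m (d * d) with h | h
    · rw [(hA m h).1]
      exact ⟨Int.emod_nonneg _ hg0.ne', (Int.emod_lt_of_pos _ hg0).le⟩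
    · obtain ⟨r, rfl⟩ := Nat.exists_eq_add_of_le h
      rw [(hA r (by rw [add_mul] at hm; omega)).2]
      exact ⟨Int.emod_nonneg _ hg0.ne', (Int.emod_lt_of_pos _ hg0).le⟩
  · rw [(hA (i * d + j) (Fin.mul_add_lt i j)).1, input_getD_num]
  · rw [add_mul, add_assoc, (hA (i * d + j) (Fin.mul_add_lt i j)).2, input_getD_num']

theorem spec_mulIdeals (hd : 0 < d) (hω : ∀ i : Fin d, (i : ℕ) = 0 → ω i = 1)
    (ha : IsHNFRep ω 𝔞 k M) (hb : IsHNFRep ω 𝔟 l N) {τ : ℤ} (hτ : 1 ≤ τ)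
    (hT : ∀ i j t, |ω.repr (ω i * ω j) t| ≤ τ)
    (hZ : 4 * (M.det * N.det + 1) ^ 2 * τ ≤ Z)
    (hdZ : ((3 * (d * d * d) + 4 * (d * d) + 2 * d + 6 : ℕ) : ℤ) ≤ Z)
    (hZZ : Z ≤ Z') (hZ' : k * l * (M.det * N.det) ≤ Z') :
    mulIdeals.Spec (encodeField ω ++ encodeIdeal k M ++ encodeIdeal l N) Store.init
      ((130 + d * 50) * unitCost Z' + ((8 + d * d * d * (25 + d * d * 71)) * unitCost Z +
        (300 * (d * d + d) * (d + 1) ^ 2 * unitCost Z + 81 * d ^ 2 * unitCost Z')))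
      fun s' => ∃ m R, IsHNFRep ω (𝔞 * 𝔟) m R ∧ s'.out = encodeIdeal m R := by
  obtain ⟨hM, hM', hMa⟩ := ha.2.1.input_facts (input_getD_num ω k M (encodeIdeal l N))
  obtain ⟨hN, hN', hNb⟩ := hb.2.1.input_facts (input_getD_num' ω k l M N)
  have hk0 : (0 : ℤ) < k := by exact_mod_cast ha.pos
  have hl0 : (0 : ℤ) < l := by exact_mod_cast hb.pos
  have ha0 := ha.2.1.det_pos
  have hb0 := hb.2.1.det_pos
  have hab := mul_pos ha0 hb0
  have hd0 : (encodeField ω ++ encodeIdeal k M ++ encodeIdeal l N).getD 0 0 = d := rfl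
  have hin : ∀ i j t : Fin d, (encodeField ω ++ encodeIdeal k M ++ encodeIdeal l N).getD
      (1 + ((i * d + j) * d + t)) 0 = ω.repr (ω i * ω j) t := fun i j t => by
    rw [List.append_assoc, encodeField_getD]
  have hg4 : 4 * (M.det * N.det + 1) ^ 2 ≤ Z := (le_mul_of_one_le_right (by positivity) hτ).trans hZ
  have hgZ : M.det * N.det + M.det * N.det * τ ≤ Z := by
    refine le_trans ?_ hZ
    nlinarith [mul_pos hab (by linarith : 0 < τ), mul_nonneg (sq_nonneg (M.det * N.det))
      (by linarith : 0 ≤ τ)]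
  refine Spec.seq (Spec.imp (wp_setupProd hd0 (input_getD_den ω k M _)
    (input_getD_den' ω k l M N) hk0 hl0 hM' hN' hMa hNb hZ'
    (le_trans (by norm_cast; omega) (hdZ.trans hZZ))) le_rfl ?_)
  rintro s₁ - ⟨hp, h0, h1, h2, h4, h5⟩
  refine Spec.seq (Spec.imp (wp_fillProd (τ := τ) hp.var3 hp.var30 hp.var33 hp.var36 h2 hab hM hN
    (forall_lt_cube fun i j t => by rw [hin]; exact hT i j t) hτ ha0 hb0
    hgZ (le_trans (by norm_cast; omega) hdZ)) le_rfl ?_)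
  intro s₂ hF hA
  have f0 := (hF.var 0 (by decide)).trans h0
  have f1 := (hF.var 1 (by decide)).trans h1
  have f2 := (hF.var 2 (by decide)).trans h2
  have f3 := (hF.var 3 (by decide)).trans hp.var3
  have f4 := (hF.var 4 (by decide)).trans h4
  have f5 := (hF.var 5 (by decide)).trans h5
  have fo := (hF.out rfl).trans hp.out
  have hpos : ((d * d * d + d * d + d : ℕ) : ℤ) ≤ Z := le_trans (by norm_cast; omega) hdZ
  have hg2 : 1 * (M.det * N.det) * (M.det * N.det) ≤ Z := le_trans (by nlinarith) hg4
  have hkl1 : (1 : ℤ) ≤ k * l := mul_pos hk0 hl0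
  refine Spec.imp (spec_normalize_ideal hd hab one_pos (mul_pos hk0 hl0) f0 f1 f2 f3 f4 f5 fo
    (box_of_forall_lt fun m hm => ?_) (A := d * d) (Nat.le_mul_self d) le_rfl le_rfl hg4 hpos
    (hg2.trans hZZ) ((le_mul_of_one_le_right (by linarith) hab).trans hZ') (hpos.trans hZZ)
    (mem_mul_iff_exists_genLat ha hb hω fun i j t => ?_))
    le_rfl fun _ _ h => h
  · rw [hA m hm]
    exact ⟨Int.emod_nonneg _ hab.ne', (Int.emod_lt_of_pos _ hab).le⟩
  · rw [hA _ (Fin.mul_add_lt_cube i j t), ← Nat.div_div_eq_div_mul, Fin.mul_add_div,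
      Fin.mul_add_mod, Fin.mul_add_div, Fin.mul_add_mod, sum_range_sq]
    simp only [Fin.mul_add_div, Fin.mul_add_mod, hin, input_getD_num, input_getD_num']

/-- The matrix has `d` rows and `d + d ^ 2` columns. Elimination also builds a pivot row for each
additional column, and reduction and output are restricted to the first `d` rows. The total is `O(d
^ 6)` operations modulo the determinant. -/
theorem spec_invIdeal (hd : 0 < d) (hω : ∀ i : Fin d, (i : ℕ) = 0 → ω i = 1) (h𝔞 : 𝔞 ≠ 0)
    (ha : IsHNFRep ω 𝔞 k M) {τ : ℤ} (hτ : 1 ≤ τ) (hT : ∀ i j t, |ω.repr (ω i * ω j) t| ≤ τ)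
    (hZ : 4 * (M.det + 1) ^ 2 * τ ≤ Z)
    (hdZ : ((d * d * (d * d) + 5 * (d * d * d) + 4 * (d * d) + 2 * d + 6 : ℕ) : ℤ) ≤ Z)
    (hZZ : Z ≤ Z') (hZ' : k * (M.det * M.det) ≤ Z') :
    invIdeal.Spec (encodeField ω ++ encodeIdeal k M) Store.init
      ((130 + d * 25) * unitCost Z' + ((8 + d * d * d * (50 + d * 58)) * unitCost Z +
        ((5 + d * 23) * unitCost Z +
        (300 * (d + (d + d * d)) * (d + d * d + 1) ^ 2 * unitCost Z + 81 * d ^ 2 * unitCost Z'))))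
      fun s' => ∃ m R, IsHNFRep ω 𝔞⁻¹ m R ∧ s'.out = encodeIdeal m R := by
  have hnum : ∀ i j : Fin d, (encodeField ω ++ encodeIdeal k M).getD
      (d * d * d + 2 + (i * d + j)) 0 = M i j := fun i j => by
    simpa using input_getD_num ω k M [] i j
  have hden : (encodeField ω ++ encodeIdeal k M).getD (d * d * d + 1) 0 = k := by
    simpa using input_getD_den ω k M []
  -- The prologue is shared with the other programs and also reads a second denominator. There is
  -- none here, and beyond its end the input reads as `0`.
  have hend : (encodeField ω ++ encodeIdeal k M).getD (d * d * d + d * d + 2) 0 = 0 :=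
    List.getD_eq_default _ _ (by
      rw [List.length_append, encodeField_length, encodeIdeal_length]; omega)
  have hin : ∀ i j t : Fin d, (encodeField ω ++ encodeIdeal k M).getD
      (1 + ((i * d + j) * d + t)) 0 = ω.repr (ω i * ω j) t := encodeField_getD ω _
  obtain ⟨hM, hM', hMa⟩ := ha.2.1.input_facts hnum
  have hk0 : (0 : ℤ) < k := by exact_mod_cast ha.pos
  have ha0 := ha.2.1.det_pos
  have haa : M.det ≤ M.det * M.det := le_mul_of_one_le_right ha0.le ha0
  have hkaa : (k : ℤ) ≤ k * (M.det * M.det) := le_mul_of_one_le_right hk0.le (by nlinarith)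
  have hg4 : 4 * (M.det + 1) ^ 2 ≤ Z := (le_mul_of_one_le_right (by positivity) hτ).trans hZ
  have hdet : M.det ≤ Z := le_trans (by nlinarith) hg4
  have hgZ : M.det + M.det * τ ≤ Z := by
    refine le_trans ?_ hZ
    nlinarith [mul_pos ha0 (by linarith : 0 < τ), mul_nonneg (sq_nonneg M.det)
      (by linarith : 0 ≤ τ)]
  have hZ0 : 0 ≤ Z' := by linarith
  have hd0 : (encodeField ω ++ encodeIdeal k M).getD 0 0 = d := rfl
  refine Spec.seq (Spec.imp (wp_setupInv hd0 hden hend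
    (small_of_nonneg hk0.le (hkaa.trans hZ')) (small_of_nonneg le_rfl hZ0) hM' hMa
    (hdet.trans hZZ) (le_trans (by norm_cast; omega) (hdZ.trans hZZ))) le_rfl ?_)
  rintro s₁ - ⟨hp, h0, h1, h2, h4, h5⟩
  refine Spec.seq (Spec.imp (wp_fillTable (τ := τ) hp.var3 hp.var30 hp.var33 h1 h2 ha0
    (by rw [hp.arr]) hM (forall_lt_cube fun i j t => by rw [hin]; exact hT i j t) hτ ha0
    hgZ (le_trans (by norm_cast; omega) hdZ)) le_rfl ?_)
  rintro s₂ hF ⟨hA, hA'⟩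
  have f0 := (hF.var 0 (by decide)).trans h0
  have f1 := (hF.var 1 (by decide)).trans h1
  have f2 := (hF.var 2 (by decide)).trans h2
  have f3 := (hF.var 3 (by decide)).trans hp.var3
  have f4 := (hF.var 4 (by decide)).trans h4
  have f5 := (hF.var 5 (by decide)).trans h5
  have fo := (hF.out rfl).trans hp.out
  refine Spec.seq (Spec.imp (wp_fillIdentity f3 f1 hA hA'
    (le_trans (by norm_cast; omega) hdZ)) le_rfl ?_)
  rintro s₃ hF ⟨hA, hA'⟩
  replace f0 := (hF.var 0 (by decide)).trans f0
  replace f1 := (hF.var 1 (by decide)).trans f1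
  replace f2 := (hF.var 2 (by decide)).trans f2
  replace f3 := (hF.var 3 (by decide)).trans f3
  replace f4 := (hF.var 4 (by decide)).trans f4
  replace f5 := (hF.var 5 (by decide)).trans f5
  replace fo := (hF.out rfl).trans fo
  have hpos : (((d + d * d) * (d + d * d) + (d + d * d) + (d + d * d) : ℕ) : ℤ) ≤ Z :=
    le_trans (by norm_cast; ring_nf; omega) hdZ
  have hidx : ∀ i j t : Fin d, s₃.arr 0 (i * (d + d * d) + (d + (j * d + t))) =
      (∑ p, M j p * ω.repr (ω i * ω p) t) % M.det := fun i j t => by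
    have hr := Fin.mul_add_lt j t
    have e1 : ((i : ℕ) * (d * d) + (j * d + t)) / (d * d) = i := by
      rw [mul_comm (i : ℕ), Nat.mul_add_div (by positivity), Nat.div_eq_of_lt hr, add_zero]
    have e2 : ((i : ℕ) * (d * d) + (j * d + t)) % (d * d) = j * d + t := by
      rw [mul_comm (i : ℕ), Nat.mul_add_mod, Nat.mod_eq_of_lt hr]
    have e3 : (i : ℕ) * (d * d) + (j * d + t) = (i * d + j) * d + t := by ring
    have := hA (i * (d * d) + (j * d + t)) (by
      rw [e3, ← mul_assoc]; exact Fin.mul_add_lt_cube i j t)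
    rw [e1, e2, e3, Fin.mul_add_div, Fin.mul_add_mod, Finset.sum_range] at this
    simpa only [hnum, hin] using this
  refine Spec.imp (spec_normalize_ideal hd ha0 hk0 ha0 f0 f1 f2 f3 f4 f5 fo
    ?_ (A := d + d * d) le_rfl (by omega) (by omega) hg4 hpos
    (by rwa [mul_assoc]) (hdet.trans hZZ) (hpos.trans hZZ)
    (mem_inv_iff_exists_genLat ha h𝔞 hω hd (fun i t => ?_) hidx))
    le_rfl fun _ _ h => h
  · intro i hi t ht
    rcases lt_or_ge t d with h | h
    · rw [hA' i hi t h]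
      split_ifs <;> constructor <;> linarith
    · obtain ⟨r, rfl⟩ := Nat.exists_eq_add_of_le h
      have hr : r < d * d := by omega
      have := hidx ⟨i, hi⟩ ⟨r / d, Nat.div_lt_of_lt_mul hr⟩ ⟨r % d, Nat.mod_lt _ hd⟩
      simp only [Nat.div_add_mod'] at this
      rw [this]
      exact ⟨Int.emod_nonneg _ ha0.ne', (Int.emod_lt_of_pos _ ha0).le⟩
  · rw [hA' i i.2 t t.2]
    simp only [Fin.val_inj]

end Cmd
end RAM

/-! ### From operation counts to bit costs -/

namespace RAM

theorem lg_le_logb {h : ℕ} (hh : 0 < h) : (lg h : ℝ) ≤ Real.logb 2 h + 1 := by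
  unfold lg
  push_cast
  have : ((2 ^ Nat.log 2 h : ℕ) : ℝ) ≤ h := by exact_mod_cast Nat.pow_log_le_self 2 hh.ne'
  gcongr
  rw [Real.le_logb_iff_rpow_le (by norm_num) (by exact_mod_cast hh)]
  simpa using this

theorem one_le_logb_two_add {X : ℝ} (hX : 0 ≤ X) : 1 ≤ Real.logb 2 (2 + X) := by
  rw [Real.le_logb_iff_rpow_le (by norm_num) (by linarith)]
  simpa using hX

theorem bits_le_of_le_rpow {Z : ℤ} {L : ℝ} (hZ : 0 ≤ Z) (hL : 1 ≤ L) (h : (Z : ℝ) ≤ 2 ^ L) :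
    (bits (32 * Z + 32) : ℝ) ≤ 10 * L := by
  have h1 : (32 * Z + 32).natAbs < 2 ^ (⌊L⌋₊ + 8) := by
    have h2 : ((32 * Z + 32).natAbs : ℝ) < 2 ^ (⌊L⌋₊ + 8) := by
      have h3 : (((32 * Z + 32).natAbs : ℤ) : ℝ) = 32 * Z + 32 := by
        rw [Int.natAbs_of_nonneg (by linarith)]
        push_cast
        rfl
      rw [Int.cast_natCast] at h3
      rw [h3]
      have h4 : (2 : ℝ) ^ L ≤ 2 ^ (⌊L⌋₊ + 1) := by
        rw [← Real.rpow_natCast]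
        apply Real.rpow_le_rpow_of_exponent_le (by norm_num)
        push_cast
        exact (Nat.lt_floor_add_one L).le
      have h5 : (1 : ℝ) ≤ 2 ^ (⌊L⌋₊ + 1) := one_le_pow₀ (by norm_num)
      have h6 : (2 : ℝ) ^ (⌊L⌋₊ + 8) = 128 * 2 ^ (⌊L⌋₊ + 1) := by ring
      linarith
    exact_mod_cast h2
  have h2 : (bits (32 * Z + 32) : ℝ) ≤ ⌊L⌋₊ + 9 := by
    have := Nat.size_le.2 h1
    unfold bits
    norm_cast
    omega
  linarith [Nat.floor_le (by linarith : 0 ≤ L)]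

theorem unitCost_le_of_le_rpow {Z : ℤ} {L : ℝ} (hZ : 0 ≤ Z) (hL : 1 ≤ L) (h : (Z : ℝ) ≤ 2 ^ L) :
    (unitCost Z : ℝ) ≤ 4320 * L * Real.logb 2 (2 + L) ^ 3 := by
  have h1 := bits_le_of_le_rpow hZ hL h
  have h0 : 0 < bits (32 * Z + 32) := Nat.succ_pos _
  unfold unitCost mulCost
  generalize bits (32 * Z + 32) = b at *
  have hb : (0 : ℝ) < b := by exact_mod_cast h0
  have hℓ := one_le_logb_two_add (by linarith : 0 ≤ L)
  -- Since `b ≤ 10 * L ≤ 2 ^ 4 * (2 + L)`, the logarithm of `b` exceeds that of `2 + L` by at most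
  -- `4`; the latter is at least `1`, so the constants are absorbed into the factor `6`.
  have h2 : (lg b : ℝ) ≤ 6 * Real.logb 2 (2 + L) := by
    have h3 : Real.logb 2 b ≤ 4 + Real.logb 2 (2 + L) := by
      calc Real.logb 2 b ≤ Real.logb 2 (2 ^ (4 : ℕ) * (2 + L)) :=
            Real.logb_le_logb_of_le (by norm_num) hb (by linarith)
        _ = 4 + Real.logb 2 (2 + L) := by
            rw [Real.logb_mul (by positivity) (by linarith), Real.logb_pow,
              Real.logb_self_eq_one (by norm_num)]
            norm_num
    linarith [lg_le_logb h0]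
  have h3 : (lg (lg b) : ℝ) ≤ lg b := by
    unfold lg
    exact_mod_cast Nat.succ_le_of_lt (Nat.log_lt_self 2 (Nat.succ_ne_zero _))
  push_cast
  calc 2 * ((lg b : ℝ) * (b * lg b * lg (lg b)))
      ≤ 2 * ((6 * Real.logb 2 (2 + L)) * (10 * L * (6 * Real.logb 2 (2 + L)) *
        (6 * Real.logb 2 (2 + L)))) := by gcongr; exact h3.trans h2
    _ = _ := by ring

/-- If `n` operations on numbers of `L` bits satisfy `n * L = O(X log X)`, then `L` is at most
quadratic in `X`, so `log L = O(log X)`. The three logarithms in the cost of an operation and the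
one allowed in the hypothesis make up the exponent `4`. -/
theorem exists_mul_unitCost_le {A : ℝ} (hA : 0 ≤ A) :
    ∃ C : ℝ, ∀ (n : ℕ) (Z : ℤ) (L X : ℝ), 1 ≤ n → 0 ≤ Z → (Z : ℝ) ≤ 2 ^ L → 1 ≤ L → 1 ≤ X →
      n * L ≤ A * (X * Real.logb 2 (2 + X)) → (n * unitCost Z : ℝ) ≤ C * softO 4 X := by
  refine ⟨4320 * A * (2 + Real.logb 2 (2 + A)) ^ 3, fun n Z L X hn hZ hZL hL hX h => ?_⟩
  have hℓ := one_le_logb_two_add (by linarith : 0 ≤ X)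
  have hℓA := one_le_logb_two_add hA
  have hn' : (1 : ℝ) ≤ n := by exact_mod_cast hn
  have hlog : Real.logb 2 (2 + X) ≤ 2 + X := by
    rw [Real.logb_le_iff_le_rpow (by norm_num) (by linarith)]
    have := one_add_mul_self_le_rpow_one_add (s := 1) (by norm_num) (p := 2 + X) (by linarith)
    rw [show (1 : ℝ) + 1 = 2 by norm_num] at this
    linarith
  have hLX : L ≤ A * (2 + X) ^ 2 := by
    calc L ≤ n * L := le_mul_of_one_le_left (by linarith) hn'
      _ ≤ _ := h
      _ ≤ A * ((2 + X) * (2 + X)) := by gcongr; linarith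
      _ = _ := by ring
  have hlogL : Real.logb 2 (2 + L) ≤ (2 + Real.logb 2 (2 + A)) * Real.logb 2 (2 + X) := by
    calc Real.logb 2 (2 + L) ≤ Real.logb 2 ((2 + A) * (2 + X) ^ 2) :=
          Real.logb_le_logb_of_le (by norm_num) (by linarith) (by nlinarith)
      _ = Real.logb 2 (2 + A) + 2 * Real.logb 2 (2 + X) := by
          rw [Real.logb_mul (by positivity) (by positivity), Real.logb_pow]
          norm_num
      _ ≤ _ := by nlinarith
  have hℓL := one_le_logb_two_add (by linarith : 0 ≤ L)
  calc (n * unitCost Z : ℝ) ≤ n * (4320 * L * Real.logb 2 (2 + L) ^ 3) := by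
        gcongr
        exact unitCost_le_of_le_rpow hZ hL hZL
    _ = 4320 * (n * L) * Real.logb 2 (2 + L) ^ 3 := by ring
    _ ≤ 4320 * (A * (X * Real.logb 2 (2 + X))) *
        ((2 + Real.logb 2 (2 + A)) * Real.logb 2 (2 + X)) ^ 3 := by gcongr
    _ = _ := by unfold softO; ring

/-- A bound for the numbers in a computation modulo `a` in degree `d`. -/
def workSize (d : ℕ) (a τ : ℤ) : ℤ := 4 * (a + 1) ^ 2 * τ * (32 * d ^ 4)

section WorkSize

variable {d : ℕ} {a τ κ : ℤ}

theorem le_workSize (hd : 0 < d) (hτ : 1 ≤ τ) : 4 * (a + 1) ^ 2 * τ ≤ workSize d a τ := by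
  have : (1 : ℤ) ≤ 32 * d ^ 4 := by
    have : (0 : ℤ) < d := by exact_mod_cast hd
    have := pow_pos this 4
    linarith
  exact le_mul_of_one_le_right (by positivity) this

theorem natCast_le_workSize (hd : 0 < d) (ha : 1 ≤ a) (hτ : 1 ≤ τ) :
    ((d * d * (d * d) + 5 * (d * d * d) + 4 * (d * d) + 2 * d + 6 : ℕ) : ℤ) ≤ workSize d a τ := by
  have h1 : d * d * (d * d) + 5 * (d * d * d) + 4 * (d * d) + 2 * d + 6 ≤ 32 * d ^ 4 := by
    have e1 : d ≤ d * d := Nat.le_mul_self d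
    have e2 : d * d ≤ d * d * d := Nat.le_mul_of_pos_right _ hd
    have e3 : d * d * d ≤ d * d * d * d := Nat.le_mul_of_pos_right _ hd
    have e4 : d * d * (d * d) = d * d * d * d := by ring
    have e5 : d ^ 4 = d * d * d * d := by ring
    omega
  have h2 : (1 : ℤ) ≤ 4 * (a + 1) ^ 2 * τ := by nlinarith
  refine le_trans (by exact_mod_cast h1) (le_mul_of_one_le_left (b := (32 * d ^ 4 : ℤ)) ?_ h2)
  positivity

theorem workSize_mul_le (hd : 0 < d) (ha : 1 ≤ a) (hτ : 1 ≤ τ) (hκ : 1 ≤ κ) :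
    ((workSize d a τ * κ : ℤ) : ℝ) ≤ 2 ^ (9 + 2 * Real.logb 2 a + Real.logb 2 τ +
      4 * Real.logb 2 d + Real.logb 2 κ) := by
  have hd' : (0 : ℝ) < d := by exact_mod_cast hd
  have ha' : (1 : ℝ) ≤ a := by exact_mod_cast ha
  have hτ' : (1 : ℝ) ≤ τ := by exact_mod_cast hτ
  have hκ' : (1 : ℝ) ≤ κ := by exact_mod_cast hκ
  have e : ∀ x : ℝ, 0 < x → (2 : ℝ) ^ Real.logb 2 x = x := fun x hx =>
    Real.rpow_logb (by norm_num) (by norm_num) hx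
  have e' : ∀ (x : ℝ) (n : ℕ), 0 < x → (2 : ℝ) ^ ((n : ℝ) * Real.logb 2 x) = x ^ n :=
    fun x n hx => by rw [mul_comm, Real.rpow_mul (by norm_num), e x hx, Real.rpow_natCast]
  have e2 := e' a 2 (by linarith)
  have e4 := e' d 4 hd'
  rw [Real.rpow_add (by norm_num), Real.rpow_add (by norm_num), Real.rpow_add (by norm_num),
    Real.rpow_add (by norm_num), e _ (by linarith), e _ (by linarith)]
  push_cast at e2 e4
  rw [e2, e4]
  unfold workSize
  push_cast
  -- As `a + 1 ≤ 2 * a`, the constant is `4 * 4 * 32 = 2 ^ 9`.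
  calc 4 * ((a : ℝ) + 1) ^ 2 * τ * (32 * d ^ 4) * κ
      ≤ 4 * ((a : ℝ) + a) ^ 2 * τ * (32 * d ^ 4) * κ := by
        gcongr
    _ = (2 : ℝ) ^ 9 * (a : ℝ) ^ 2 * τ * d ^ 4 * κ := by ring
    _ = _ := by rw [show (2 : ℝ) ^ (9 : ℝ) = 2 ^ 9 from mod_cast Real.rpow_natCast 2 9]

end WorkSize

end RAM

namespace RAM

/-- The cost of two parts of a computation with numbers of different sizes. -/
theorem exists_cost_add_le {A : ℝ} (hA : 0 ≤ A) :
    ∃ C : ℝ, ∀ (d : ℕ) (a τ κ : ℤ) (n n' T : ℕ) (X : ℝ), 0 < d → 1 ≤ a → 1 ≤ τ → 1 ≤ κ →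
      1 ≤ X → 1 ≤ n → 1 ≤ n' →
      n * (9 + 2 * Real.logb 2 a + Real.logb 2 τ + 4 * Real.logb 2 d) ≤
        A * (X * Real.logb 2 (2 + X)) →
      n' * (9 + 2 * Real.logb 2 a + Real.logb 2 τ + 4 * Real.logb 2 d + Real.logb 2 κ) ≤
        A * (X * Real.logb 2 (2 + X)) →
      T ≤ n * unitCost (workSize d a τ) + n' * unitCost (workSize d a τ * κ) →
      (T : ℝ) ≤ C * softO 4 X := by
  obtain ⟨C, hC⟩ := exists_mul_unitCost_le hA
  refine ⟨C + C, fun d a τ κ n n' T X hd ha hτ hκ hX hn hn' h h' hT => ?_⟩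
  have la : 0 ≤ Real.logb 2 a := Real.logb_nonneg (by norm_num) (by exact_mod_cast ha)
  have lτ : 0 ≤ Real.logb 2 τ := Real.logb_nonneg (by norm_num) (by exact_mod_cast hτ)
  have lκ : 0 ≤ Real.logb 2 κ := Real.logb_nonneg (by norm_num) (by exact_mod_cast hκ)
  have ld : 0 ≤ Real.logb 2 d := Real.logb_nonneg (by norm_num) (by exact_mod_cast hd)
  have hW : 0 ≤ workSize d a τ := le_trans (by positivity) (le_workSize hd hτ)
  have e := workSize_mul_le hd ha hτ le_rfl
  rw [mul_one, Int.cast_one, Real.logb_one, add_zero] at e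
  have h1 := hC n _ _ X hn hW e (by linarith) hX h
  have h2 := hC n' _ _ X hn' (by positivity) (workSize_mul_le hd ha hτ hκ) (by linarith) hX h'
  have h3 : (T : ℝ) ≤ n * unitCost (workSize d a τ) + n' * unitCost (workSize d a τ * κ) := by
    exact_mod_cast hT
  linarith

end RAM

theorem Real.logb_two_natCast_le (d : ℕ) : Real.logb 2 d ≤ d := by
  rcases Nat.eq_zero_or_pos d with rfl | hd
  · simp
  rw [Real.logb_le_iff_le_rpow (by norm_num) (by exact_mod_cast hd), Real.rpow_natCast]
  exact_mod_cast (Nat.lt_two_pow_self (n := d)).le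

section Reps

variable {K : Type*} [Field K] [NumberField K] {d : ℕ} {ω : Module.Basis (Fin d) ℤ (𝓞 K)}

/-- The real bound for the table is rounded down; the entries are integers, so they stay below the
floor. -/
theorem IsLLLReduced.exists_table_bound (h : IsLLLReduced ω) (hd : Module.finrank ℚ K = d)
    (hω : ∀ i : Fin d, (i : ℕ) = 0 → ω i = 1) :
    ∃ τ : ℤ, 1 ≤ τ ∧ (∀ i j t, |ω.repr (ω i * ω j) t| ≤ τ) ∧
      Real.logb 2 τ ≤ 7 * (d : ℝ) ^ 2 + 2 * Real.logb 2 |(discr K : ℝ)| := by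
  have hΔ : 0 ≤ Real.logb 2 |(discr K : ℝ)| :=
    Real.logb_nonneg (by norm_num) one_le_abs_discr
  have h1 : (1 : ℝ) ≤ 2 ^ (7 * (d : ℝ) ^ 2 + 2 * Real.logb 2 |(discr K : ℝ)|) :=
    Real.one_le_rpow (by norm_num) (by positivity)
  have hτ : 1 ≤ ⌊(2 : ℝ) ^ (7 * (d : ℝ) ^ 2 + 2 * Real.logb 2 |(discr K : ℝ)|)⌋ :=
    Int.le_floor.2 (by simpa using h1)
  refine ⟨_, hτ, fun i j t => Int.le_floor.2 ?_, ?_⟩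
  · simpa using h.abs_repr_mul_le_two_rpow hd hω i j t
  · rw [Real.logb_le_iff_le_rpow (by norm_num) (by exact_mod_cast hτ)]
    exact Int.floor_le _

end Reps

/-! ### The time bounds -/

namespace RAM

theorem le_workSize_of_nonneg {d : ℕ} {a τ : ℤ} (hd : 0 < d) (ha : 0 ≤ a) (hτ : 1 ≤ τ) :
    a * a ≤ workSize d a τ := by
  refine le_trans ?_ (le_workSize hd hτ)
  refine le_trans ?_ (le_mul_of_one_le_right (by positivity) hτ)
  nlinarith

open Cmd

theorem one_le_cast_pow {d : ℕ} (hd : 0 < d) (n : ℕ) : (1 : ℝ) ≤ (d : ℝ) ^ n :=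
  one_le_pow₀ (by exact_mod_cast hd)

/-- The `O(d ^ 3)` operations on numbers of `O(B / d ^ 2 + log d)` bits and the `O(d ^ 2)`
operations on numbers of `O(B + log d)` bits both fit into `d ^ 3 * B` up to logarithms. The size
can be zero, for instance for the unit ideal, so `B ≥ 1` is what pays for the constant part of the
cost. -/
theorem exists_computesWithin_addIdeals :
    ∃ C : ℝ, ∀ (K : Type u) [Field K] [NumberField K] (d : ℕ) (_ : Module.finrank ℚ K = d)
      (ω : Module.Basis (Fin d) ℤ (𝓞 K)) (𝔞 𝔟 : FractionalIdeal (𝓞 K)⁰ K)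
      (B : ℝ) (_ : 1 ≤ B) (_ : idealSize 𝔞 ≤ B) (_ : idealSize 𝔟 ≤ B)
      (k l : ℕ) (M N : Matrix (Fin d) (Fin d) ℤ) (_ : IsHNFRep ω 𝔞 k M) (_ : IsHNFRep ω 𝔟 l N),
      ∃ (m : ℕ) (R : Matrix (Fin d) (Fin d) ℤ), IsHNFRep ω (𝔞 + 𝔟) m R ∧
        ComputesWithin (addIdeals.compile 0 0) (encodeField ω ++ encodeIdeal k M ++ encodeIdeal l N)
          (encodeIdeal m R) (C * softO 4 ((d : ℝ) ^ (matMulExponent + 1) * B)) := by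
  obtain ⟨C, hC⟩ := exists_cost_add_le (A := 200000) (by norm_num)
  refine ⟨C, fun K _ _ d hdK ω 𝔞 𝔟 B hB hSa hSb k l M N ha hb => ?_⟩
  have hd : 0 < d := hdK ▸ Module.finrank_pos
  have ha0 := ha.2.1.det_pos
  have hb0 := hb.2.1.det_pos
  have hab : 1 ≤ M.det * N.det := mul_pos ha0 hb0
  have hk0 : (0 : ℤ) < k := by exact_mod_cast ha.pos
  have hl0 : (0 : ℤ) < l := by exact_mod_cast hb.pos
  have hkl : (1 : ℤ) ≤ k * l := mul_pos hk0 hl0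
  have hZ0 := le_workSize (a := M.det * N.det) hd le_rfl
  rw [mul_one] at hZ0
  have hW : 0 ≤ workSize d (M.det * N.det) 1 := le_trans (by positivity) hZ0
  have hdZ := natCast_le_workSize hd hab le_rfl
  obtain ⟨hs, m, R, hR, ho⟩ := spec_addIdeals hd ha hb hZ0
    (le_trans (by norm_cast; nlinarith) hdZ) (le_mul_of_one_le_right hW hkl)
    (by rw [mul_comm]; gcongr; nlinarith)
  refine ⟨m, R, hR, ho ▸ computesWithin _ hs ?_⟩
  have hd1 : (1 : ℝ) ≤ d := by exact_mod_cast hd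
  set X := (d : ℝ) ^ (matMulExponent + 1) * B with hXdef
  have hX3 : (d : ℝ) ^ 3 * B ≤ X := by
    have : (d : ℝ) ^ 3 ≤ (d : ℝ) ^ (matMulExponent + 1) := by
      rw [← Real.rpow_natCast]
      exact Real.rpow_le_rpow_of_exponent_le hd1 (by norm_num; linarith [two_le_matMulExponent])
    rw [hXdef]
    gcongr
  have hX1 : 1 ≤ X := le_trans (one_le_mul_of_one_le_of_one_le (one_le_cast_pow hd 3) hB) hX3
  have hdX : (d : ℝ) ≤ X := by
    refine le_trans ?_ hX3
    calc (d : ℝ) = d ^ 1 * 1 := by ring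
      _ ≤ d ^ 3 * B := by gcongr; norm_num [hd1]
  have hℓ := one_le_logb_two_add (by linarith : 0 ≤ X)
  -- The bits of array indices are absorbed by the logarithmic factor on the right of the cost
  -- criterion.
  have hld : Real.logb 2 d ≤ Real.logb 2 (2 + X) :=
    Real.logb_le_logb_of_le (by norm_num) (by linarith) (by linarith)
  have hld' := Real.logb_two_natCast_le d
  have lM := ha.logb_det_le hdK hSa
  have lN := hb.logb_det_le hdK hSb
  have lk := ha.logb_den_le hSa
  have ll := hb.logb_den_le hSb
  have ea : Real.logb 2 ((M.det * N.det : ℤ) : ℝ) = Real.logb 2 M.det + Real.logb 2 N.det := by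
    rw [Int.cast_mul]
    exact Real.logb_mul (by exact_mod_cast ha0.ne') (by exact_mod_cast hb0.ne')
  have ek : Real.logb 2 ((k * l : ℤ) : ℝ) = Real.logb 2 k + Real.logb 2 l := by
    rw [Int.cast_mul]
    exact Real.logb_mul (by exact_mod_cast hk0.ne') (by exact_mod_cast hl0.ne')
  have lM0 : 0 ≤ Real.logb 2 M.det := Real.logb_nonneg (by norm_num) (by exact_mod_cast ha0)
  have lN0 : 0 ≤ Real.logb 2 N.det := Real.logb_nonneg (by norm_num) (by exact_mod_cast hb0)
  -- No elements of the field are multiplied for a sum, so the bound for the table is taken to be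
  -- `1`. The factor `k * l` separates the two number sizes.
  refine hC d _ 1 (k * l) (3600 * d ^ 3) (380 * d ^ 2) _ X hd hab le_rfl hkl hX1
    (Nat.mul_pos (by norm_num) (pow_pos hd 3)) (Nat.mul_pos (by norm_num) (pow_pos hd 2)) ?_ ?_ ?_
  · rw [ea, Int.cast_one, Real.logb_one]
    simp only [Nat.cast_mul, Nat.cast_pow, Nat.cast_ofNat]
    have h1 : (d : ℝ) ≤ d ^ 3 := le_self_pow₀ hd1 (by norm_num)
    -- Two of the three factors `d` are spent on the determinants, through `d ^ 2 * log det ≤ B`.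
    calc _ = 3600 * (9 * d ^ 3 + 2 * d * (d ^ 2 * Real.logb 2 M.det + d ^ 2 * Real.logb 2 N.det) +
          4 * (d ^ 3 * Real.logb 2 d)) := by ring
      _ ≤ 3600 * (9 * d ^ 3 + 2 * d * (B + B) + 4 * (d ^ 3 * Real.logb 2 (2 + X))) := by gcongr
      _ ≤ 3600 * (9 * (d ^ 3 * B) + 4 * (d ^ 3 * B) + 4 * (d ^ 3 * B * Real.logb 2 (2 + X))) := by
        have h2 : (d : ℝ) ^ 3 ≤ d ^ 3 * B := le_mul_of_one_le_right (by positivity) hB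
        have h3 : (d : ℝ) * B ≤ d ^ 3 * B := by gcongr
        have h4 : (d : ℝ) ^ 3 * Real.logb 2 (2 + X) ≤ d ^ 3 * B * Real.logb 2 (2 + X) := by gcongr
        linarith
      _ ≤ 3600 * (17 * (d ^ 3 * B * Real.logb 2 (2 + X))) := by
        have h2 : (d : ℝ) ^ 3 * B ≤ d ^ 3 * B * Real.logb 2 (2 + X) :=
          le_mul_of_one_le_right (by positivity) hℓ
        linarith
      _ ≤ 3600 * (17 * (X * Real.logb 2 (2 + X))) := by gcongr
      _ ≤ _ := by nlinarith
  · rw [ea, ek, Int.cast_one, Real.logb_one]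
    simp only [Nat.cast_mul, Nat.cast_pow, Nat.cast_ofNat]
    have h1 : Real.logb 2 M.det ≤ B :=
      (le_mul_of_one_le_left lM0 (one_le_cast_pow hd 2)).trans lM
    have h2 : Real.logb 2 N.det ≤ B :=
      (le_mul_of_one_le_left lN0 (one_le_cast_pow hd 2)).trans lN
    have h3 : (d : ℝ) ≤ d * B := le_mul_of_one_le_right (by positivity) hB
    have h4 : B ≤ d * B := le_mul_of_one_le_left (by positivity) hd1
    calc _ ≤ 380 * (d : ℝ) ^ 2 * (19 * (d * B)) := by gcongr; linarith
      _ = 7220 * (d ^ 3 * B) := by ring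
      _ ≤ 7220 * (X * Real.logb 2 (2 + X)) := by
        have := le_mul_of_one_le_right (by linarith : 0 ≤ X) hℓ
        exact mul_le_mul_of_nonneg_left (hX3.trans this) (by norm_num)
      _ ≤ _ := by nlinarith
  · have e1 : 200 + d * 50 + d * d * 49 + 81 * d ^ 2 ≤ 380 * d ^ 2 := by nlinarith
    have e2 : 300 * (d + d + d) * (d + 1) ^ 2 ≤ 3600 * d ^ 3 := by
      calc 300 * (d + d + d) * (d + 1) ^ 2 ≤ 300 * (d + d + d) * (d + d) ^ 2 := by gcongr; omega
        _ = 3600 * d ^ 3 := by ring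
    have := Nat.mul_le_mul_right (unitCost (workSize d (M.det * N.det) 1 * (k * l))) e1
    have := Nat.mul_le_mul_right (unitCost (workSize d (M.det * N.det) 1)) e2
    linarith

/-- The quantity in the bounds for products and inverses, and what it dominates. -/
theorem le_main_term {d : ℕ} (hd : 0 < d) {δ B b τ x : ℝ} (hδ : 0 ≤ δ) (hB : 0 ≤ B)
    (hb : (d : ℝ) ^ 2 * b ≤ 2 * B) (hτ : τ ≤ 7 * (d : ℝ) ^ 2 + 2 * δ) (hx : x ≤ d) :
    (d : ℝ) ^ 2 * (9 + 2 * b + τ + 4 * x) ≤ 20 * ((d : ℝ) ^ 4 + (d : ℝ) ^ 2 * δ + B) ∧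
    9 + 2 * b + τ + 4 * x + 2 * B ≤ 22 * ((d : ℝ) ^ 4 + (d : ℝ) ^ 2 * δ + B) := by
  have hd1 : (1 : ℝ) ≤ d := by exact_mod_cast hd
  have p2 := one_le_cast_pow hd 2
  have h1 : (d : ℝ) ^ 2 ≤ d ^ 4 := pow_le_pow_right₀ hd1 (by norm_num)
  have h2 : (d : ℝ) ^ 3 ≤ d ^ 4 := pow_le_pow_right₀ hd1 (by norm_num)
  have h0 : (d : ℝ) ^ 2 * (9 + 2 * b + τ + 4 * x) ≤ 20 * ((d : ℝ) ^ 4 + (d : ℝ) ^ 2 * δ + B) := by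
    calc (d : ℝ) ^ 2 * (9 + 2 * b + τ + 4 * x)
        ≤ (d : ℝ) ^ 2 * (9 + 2 * b + (7 * (d : ℝ) ^ 2 + 2 * δ) + 4 * d) := by gcongr
      _ = 9 * d ^ 2 + 2 * (d ^ 2 * b) + 7 * d ^ 4 + 2 * (d ^ 2 * δ) + 4 * d ^ 3 := by ring
      _ ≤ _ := by nlinarith
  refine ⟨h0, ?_⟩
  have hY : 0 ≤ (d : ℝ) ^ 4 + (d : ℝ) ^ 2 * δ := by positivity
  rcases le_total 0 (9 + 2 * b + τ + 4 * x) with h | h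
  · have := le_mul_of_one_le_left h p2
    linarith
  · linarith

/-- There are `O(d ^ 5)` operations on numbers whose bit size, multiplied by `d ^ 2`, is bounded by
the main term according to `le_main_term`. This leaves the factor `d ^ 3`. The term `d ^ 4` keeps
the bound at least `1` even for `B = 0`. -/
theorem exists_computesWithin_mulIdeals :
    ∃ C : ℝ, ∀ (K : Type u) [Field K] [NumberField K] (d : ℕ) (_ : Module.finrank ℚ K = d)
      (ω : Module.Basis (Fin d) ℤ (𝓞 K)) (_ : IsLLLReduced ω)
      (_ : ∀ i : Fin d, (i : ℕ) = 0 → ω i = 1) (𝔞 𝔟 : FractionalIdeal (𝓞 K)⁰ K)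
      (B : ℝ) (_ : idealSize 𝔞 ≤ B) (_ : idealSize 𝔟 ≤ B)
      (k l : ℕ) (M N : Matrix (Fin d) (Fin d) ℤ) (_ : IsHNFRep ω 𝔞 k M) (_ : IsHNFRep ω 𝔟 l N),
      ∃ (m : ℕ) (R : Matrix (Fin d) (Fin d) ℤ), IsHNFRep ω (𝔞 * 𝔟) m R ∧
        ComputesWithin (mulIdeals.compile 0 0) (encodeField ω ++ encodeIdeal k M ++ encodeIdeal l N)
          (encodeIdeal m R) (C * softO 4 ((d : ℝ) ^ 3 *
            ((d : ℝ) ^ 4 + (d : ℝ) ^ 2 * Real.logb 2 |(discr K : ℝ)| + B))) := by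
  obtain ⟨C, hC⟩ := exists_cost_add_le (A := 200000) (by norm_num)
  refine ⟨C, fun K _ _ d hdK ω hLLL hω 𝔞 𝔟 B hSa hSb k l M N ha hb => ?_⟩
  obtain ⟨τ, hτ, hT, lτ⟩ := hLLL.exists_table_bound hdK hω
  have hd : 0 < d := hdK ▸ Module.finrank_pos
  have ha0 := ha.2.1.det_pos
  have hb0 := hb.2.1.det_pos
  have hab : 1 ≤ M.det * N.det := mul_pos ha0 hb0
  have hk0 : (0 : ℤ) < k := by exact_mod_cast ha.pos
  have hl0 : (0 : ℤ) < l := by exact_mod_cast hb.pos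
  have hkl : (1 : ℤ) ≤ k * l := mul_pos hk0 hl0
  have hZ0 := le_workSize (a := M.det * N.det) hd hτ
  have hW : 0 ≤ workSize d (M.det * N.det) τ := le_trans (by positivity) hZ0
  have hdZ := natCast_le_workSize hd hab hτ
  have haW := le_workSize_of_nonneg hd (by linarith : 0 ≤ M.det * N.det) hτ
  obtain ⟨hs, m, R, hR, ho⟩ := spec_mulIdeals hd hω ha hb hτ hT hZ0
    (le_trans (by norm_cast; nlinarith) hdZ) (le_mul_of_one_le_right hW hkl)
    (by rw [mul_comm]; gcongr; nlinarith)
  refine ⟨m, R, hR, ho ▸ computesWithin _ hs ?_⟩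
  have hd1 : (1 : ℝ) ≤ d := by exact_mod_cast hd
  have hδ : 0 ≤ Real.logb 2 |(discr K : ℝ)| := Real.logb_nonneg (by norm_num) one_le_abs_discr
  have lk := ha.logb_den_le hSa
  have ll := hb.logb_den_le hSb
  have lk0 : 0 ≤ Real.logb 2 k := Real.logb_nonneg (by norm_num) (by exact_mod_cast hk0)
  have ea : Real.logb 2 ((M.det * N.det : ℤ) : ℝ) = Real.logb 2 M.det + Real.logb 2 N.det := by
    rw [Int.cast_mul]
    exact Real.logb_mul (by exact_mod_cast ha0.ne') (by exact_mod_cast hb0.ne')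
  have ek : Real.logb 2 ((k * l : ℤ) : ℝ) = Real.logb 2 k + Real.logb 2 l := by
    rw [Int.cast_mul]
    exact Real.logb_mul (by exact_mod_cast hk0.ne') (by exact_mod_cast hl0.ne')
  obtain ⟨b1, b2⟩ := le_main_term (b := Real.logb 2 (M.det * N.det : ℤ)) hd hδ (lk0.trans lk)
    (by rw [ea]; linarith [ha.logb_det_le hdK hSa, hb.logb_det_le hdK hSb]) lτ
    (Real.logb_two_natCast_le d)
  have hY0 : 1 ≤ (d : ℝ) ^ 4 + (d : ℝ) ^ 2 * Real.logb 2 |(discr K : ℝ)| + B := by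
    have := one_le_cast_pow hd 4
    have : 0 ≤ (d : ℝ) ^ 2 * Real.logb 2 |(discr K : ℝ)| := by positivity
    linarith
  generalize (d : ℝ) ^ 4 + (d : ℝ) ^ 2 * Real.logb 2 |(discr K : ℝ)| + B = Y at *
  have hX1 : 1 ≤ (d : ℝ) ^ 3 * Y := one_le_mul_of_one_le_of_one_le (one_le_cast_pow hd 3) hY0
  have hℓ := one_le_logb_two_add (by linarith : 0 ≤ (d : ℝ) ^ 3 * Y)
  have hXℓ := le_mul_of_one_le_right (by linarith : 0 ≤ (d : ℝ) ^ 3 * Y) hℓ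
  refine hC d _ τ (k * l) (2504 * d ^ 5) (261 * d ^ 2) _ _ hd hab hτ hkl hX1
    (Nat.mul_pos (by norm_num) (pow_pos hd 5)) (Nat.mul_pos (by norm_num) (pow_pos hd 2)) ?_ ?_ ?_
  · refine le_trans ?_ (mul_le_mul_of_nonneg_left hXℓ (by norm_num))
    simp only [Nat.cast_mul, Nat.cast_pow, Nat.cast_ofNat]
    calc _ = 2504 * (d : ℝ) ^ 3 * ((d : ℝ) ^ 2 * (9 + 2 * Real.logb 2 ((M.det * N.det : ℤ) : ℝ) +
          Real.logb 2 τ + 4 * Real.logb 2 d)) := by ring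
      _ ≤ 2504 * (d : ℝ) ^ 3 * (20 * Y) := by gcongr
      _ ≤ _ := by nlinarith
  · refine le_trans ?_ (mul_le_mul_of_nonneg_left hXℓ (by norm_num))
    rw [ek]
    calc _ ≤ ((261 * d ^ 2 : ℕ) : ℝ) * (22 * Y) := by gcongr; linarith
      _ = 5742 * ((d : ℝ) ^ 2 * Y) := by push_cast; ring
      _ ≤ 5742 * ((d : ℝ) ^ 3 * Y) := by gcongr; norm_num [hd1]
      _ ≤ _ := by nlinarith
  · have e1 : 130 + d * 50 + 81 * d ^ 2 ≤ 261 * d ^ 2 := by nlinarith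
    have e2 : 8 + d * d * d * (25 + d * d * 71) + 300 * (d * d + d) * (d + 1) ^ 2 ≤
        2504 * d ^ 5 := by
      have p3 : d ^ 3 ≤ d ^ 5 := Nat.pow_le_pow_right hd (by norm_num)
      have p4 : d ^ 4 ≤ d ^ 5 := Nat.pow_le_pow_right hd (by norm_num)
      have p0 : 1 ≤ d ^ 5 := Nat.one_le_pow _ _ hd
      calc 8 + d * d * d * (25 + d * d * 71) + 300 * (d * d + d) * (d + 1) ^ 2
          ≤ 8 + d * d * d * (25 + d * d * 71) + 300 * (d * d + d * d) * (d + d) ^ 2 := by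
            gcongr
            · exact Nat.le_mul_self d
            · omega
        _ = 8 + 25 * d ^ 3 + 71 * d ^ 5 + 2400 * d ^ 4 := by ring
        _ ≤ _ := by omega
    have := Nat.mul_le_mul_right (unitCost (workSize d (M.det * N.det) τ * (k * l))) e1
    have := Nat.mul_le_mul_right (unitCost (workSize d (M.det * N.det) τ)) e2
    linarith

/-- As for products, but with `O(d ^ 6)` operations, which leaves the factor `d ^ 4` and hence
requires the exponent of matrix multiplication to be at least `2`. -/
theorem exists_computesWithin_invIdeal :
    ∃ C : ℝ, ∀ (K : Type u) [Field K] [NumberField K] (d : ℕ) (_ : Module.finrank ℚ K = d)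
      (ω : Module.Basis (Fin d) ℤ (𝓞 K)) (_ : IsLLLReduced ω)
      (_ : ∀ i : Fin d, (i : ℕ) = 0 → ω i = 1) (𝔞 : FractionalIdeal (𝓞 K)⁰ K) (_ : 𝔞 ≠ 0)
      (B : ℝ) (_ : idealSize 𝔞 ≤ B)
      (k : ℕ) (M : Matrix (Fin d) (Fin d) ℤ) (_ : IsHNFRep ω 𝔞 k M),
      ∃ (m : ℕ) (R : Matrix (Fin d) (Fin d) ℤ), IsHNFRep ω 𝔞⁻¹ m R ∧
        ComputesWithin (invIdeal.compile 0 0) (encodeField ω ++ encodeIdeal k M)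
          (encodeIdeal m R) (C * softO 4 ((d : ℝ) ^ (2 * matMulExponent) *
            ((d : ℝ) ^ 4 + (d : ℝ) ^ 2 * Real.logb 2 |(discr K : ℝ)| + B))) := by
  obtain ⟨C, hC⟩ := exists_cost_add_le (A := 200000) (by norm_num)
  refine ⟨C, fun K _ _ d hdK ω hLLL hω 𝔞 h𝔞 B hSa k M ha => ?_⟩
  obtain ⟨τ, hτ, hT, lτ⟩ := hLLL.exists_table_bound hdK hω
  have hd : 0 < d := hdK ▸ Module.finrank_pos
  have ha0 := ha.2.1.det_pos
  have hk0 : (1 : ℤ) ≤ k := by exact_mod_cast ha.pos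
  have hZ0 := le_workSize (a := M.det) hd hτ
  have hW : 0 ≤ workSize d M.det τ := le_trans (by positivity) hZ0
  have hdZ := natCast_le_workSize hd ha0 hτ
  have haW := le_workSize_of_nonneg hd ha0.le hτ
  obtain ⟨hs, m, R, hR, ho⟩ := spec_invIdeal hd hω h𝔞 ha hτ hT hZ0 hdZ
    (le_mul_of_one_le_right hW hk0) (by rw [mul_comm]; gcongr)
  refine ⟨m, R, hR, ho ▸ computesWithin _ hs ?_⟩
  have hd1 : (1 : ℝ) ≤ d := by exact_mod_cast hd
  have hδ : 0 ≤ Real.logb 2 |(discr K : ℝ)| := Real.logb_nonneg (by norm_num) one_le_abs_discr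
  have lk := ha.logb_den_le hSa
  have lk0 : 0 ≤ Real.logb 2 k := Real.logb_nonneg (by norm_num) (by exact_mod_cast hk0)
  have hB := lk0.trans lk
  obtain ⟨b1, b2⟩ := le_main_term (b := Real.logb 2 M.det) hd hδ hB
    (by linarith [ha.logb_det_le hdK hSa]) lτ (Real.logb_two_natCast_le d)
  have hY0 : 1 ≤ (d : ℝ) ^ 4 + (d : ℝ) ^ 2 * Real.logb 2 |(discr K : ℝ)| + B := by
    have := one_le_cast_pow hd 4
    have : 0 ≤ (d : ℝ) ^ 2 * Real.logb 2 |(discr K : ℝ)| := by positivity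
    linarith
  generalize (d : ℝ) ^ 4 + (d : ℝ) ^ 2 * Real.logb 2 |(discr K : ℝ)| + B = Y at *
  set X := (d : ℝ) ^ (2 * matMulExponent) * Y with hXdef
  have hX4 : (d : ℝ) ^ 4 * Y ≤ X := by
    have : (d : ℝ) ^ 4 ≤ (d : ℝ) ^ (2 * matMulExponent) := by
      rw [← Real.rpow_natCast]
      exact Real.rpow_le_rpow_of_exponent_le hd1 (by norm_num; linarith [two_le_matMulExponent])
    rw [hXdef]
    gcongr
  have hX1 : 1 ≤ X := le_trans (one_le_mul_of_one_le_of_one_le (one_le_cast_pow hd 4) hY0) hX4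
  have hℓ := one_le_logb_two_add (by linarith : 0 ≤ X)
  have hXℓ := hX4.trans (le_mul_of_one_le_right (by linarith : 0 ≤ X) hℓ)
  refine hC d _ τ k (8244 * d ^ 6) (236 * d ^ 2) _ _ hd ha0 hτ hk0 hX1
    (Nat.mul_pos (by norm_num) (pow_pos hd 6)) (Nat.mul_pos (by norm_num) (pow_pos hd 2)) ?_ ?_ ?_
  · refine le_trans ?_ (mul_le_mul_of_nonneg_left hXℓ (by norm_num))
    simp only [Nat.cast_mul, Nat.cast_pow, Nat.cast_ofNat]
    calc _ = 8244 * (d : ℝ) ^ 4 * ((d : ℝ) ^ 2 * (9 + 2 * Real.logb 2 M.det +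
          Real.logb 2 τ + 4 * Real.logb 2 d)) := by ring
      _ ≤ 8244 * (d : ℝ) ^ 4 * (20 * Y) := by gcongr
      _ ≤ _ := by nlinarith [one_le_mul_of_one_le_of_one_le (one_le_cast_pow hd 4) hY0]
  · refine le_trans ?_ (mul_le_mul_of_nonneg_left hXℓ (by norm_num))
    rw [Int.cast_natCast]
    calc _ ≤ ((236 * d ^ 2 : ℕ) : ℝ) * (22 * Y) := by gcongr; linarith
      _ = 5192 * ((d : ℝ) ^ 2 * Y) := by push_cast; ring
      _ ≤ 5192 * ((d : ℝ) ^ 4 * Y) := by gcongr; norm_num [hd1]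
      _ ≤ _ := by nlinarith [one_le_mul_of_one_le_of_one_le (one_le_cast_pow hd 4) hY0]
  · have e1 : 130 + d * 25 + 81 * d ^ 2 ≤ 236 * d ^ 2 := by nlinarith
    have e2 : 8 + d * d * d * (50 + d * 58) + (5 + d * 23) +
        300 * (d + (d + d * d)) * (d + d * d + 1) ^ 2 ≤ 8244 * d ^ 6 := by
      have p0 : 1 ≤ d ^ 6 := Nat.one_le_pow _ _ hd
      have p1 : d ≤ d ^ 6 := Nat.le_self_pow (by norm_num) d
      have p3 : d ^ 3 ≤ d ^ 6 := Nat.pow_le_pow_right hd (by norm_num)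
      have p4 : d ^ 4 ≤ d ^ 6 := Nat.pow_le_pow_right hd (by norm_num)
      have hdd : d ≤ d * d := Nat.le_mul_self d
      calc 8 + d * d * d * (50 + d * 58) + (5 + d * 23) +
            300 * (d + (d + d * d)) * (d + d * d + 1) ^ 2
          ≤ 8 + d * d * d * (50 + d * 58) + (5 + d * 23) +
            300 * (d * d + (d * d + d * d)) * (d * d + d * d + d * d) ^ 2 := by
            gcongr
            omega
        _ = 13 + 23 * d + 50 * d ^ 3 + 58 * d ^ 4 + 8100 * d ^ 6 := by ring
        _ ≤ _ := by omega
    have := Nat.mul_le_mul_right (unitCost (workSize d M.det τ * k)) e1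
    have := Nat.mul_le_mul_right (unitCost (workSize d M.det τ)) e2
    linarith

end RAM

theorem proposition3 :
    -- addition
    (∃ (P : RAM.Program) (C : ℝ) (c : ℕ),
      ∀ (K : Type u) [Field K] [NumberField K] (d : ℕ) (_ : Module.finrank ℚ K = d)
        (ω : Module.Basis (Fin d) ℤ (𝓞 K)) (_ : IsLLLReduced ω)
        (_ : ∀ i : Fin d, (i : ℕ) = 0 → ω i = 1)
        (𝔞 𝔟 : FractionalIdeal (𝓞 K)⁰ K) (_ : 𝔞 ≠ 0) (_ : 𝔟 ≠ 0)
        (B : ℝ) (_ : 1 ≤ B) (_ : idealSize 𝔞 ≤ B) (_ : idealSize 𝔟 ≤ B)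
        (k l : ℕ) (M N : Matrix (Fin d) (Fin d) ℤ) (_ : IsHNFRep ω 𝔞 k M) (_ : IsHNFRep ω 𝔟 l N),
        ∃ (m : ℕ) (R : Matrix (Fin d) (Fin d) ℤ), IsHNFRep ω (𝔞 + 𝔟) m R ∧
          RAM.ComputesWithin P (encodeField ω ++ encodeIdeal k M ++ encodeIdeal l N)
            (encodeIdeal m R) (C * softO c ((d : ℝ) ^ (matMulExponent + 1) * B))) ∧
    -- multiplication
    (∃ (P : RAM.Program) (C : ℝ) (c : ℕ),
      ∀ (K : Type u) [Field K] [NumberField K] (d : ℕ) (_ : Module.finrank ℚ K = d)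
        (ω : Module.Basis (Fin d) ℤ (𝓞 K)) (_ : IsLLLReduced ω)
        (_ : ∀ i : Fin d, (i : ℕ) = 0 → ω i = 1)
        (𝔞 𝔟 : FractionalIdeal (𝓞 K)⁰ K) (_ : 𝔞 ≠ 0) (_ : 𝔟 ≠ 0)
        (B : ℝ) (_ : idealSize 𝔞 ≤ B) (_ : idealSize 𝔟 ≤ B)
        (k l : ℕ) (M N : Matrix (Fin d) (Fin d) ℤ) (_ : IsHNFRep ω 𝔞 k M) (_ : IsHNFRep ω 𝔟 l N),
        ∃ (m : ℕ) (R : Matrix (Fin d) (Fin d) ℤ), IsHNFRep ω (𝔞 * 𝔟) m R ∧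
          RAM.ComputesWithin P (encodeField ω ++ encodeIdeal k M ++ encodeIdeal l N)
            (encodeIdeal m R)
            (C * softO c ((d : ℝ) ^ 3 *
              ((d : ℝ) ^ 4 + (d : ℝ) ^ 2 * Real.logb 2 |(discr K : ℝ)| + B)))) ∧
    -- inversion
    (∃ (P : RAM.Program) (C : ℝ) (c : ℕ),
      ∀ (K : Type u) [Field K] [NumberField K] (d : ℕ) (_ : Module.finrank ℚ K = d)
        (ω : Module.Basis (Fin d) ℤ (𝓞 K)) (_ : IsLLLReduced ω)
        (_ : ∀ i : Fin d, (i : ℕ) = 0 → ω i = 1)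
        (𝔞 : FractionalIdeal (𝓞 K)⁰ K) (_ : 𝔞 ≠ 0) (B : ℝ) (_ : idealSize 𝔞 ≤ B)
        (k : ℕ) (M : Matrix (Fin d) (Fin d) ℤ) (_ : IsHNFRep ω 𝔞 k M),
        ∃ (m : ℕ) (R : Matrix (Fin d) (Fin d) ℤ), IsHNFRep ω 𝔞⁻¹ m R ∧
          RAM.ComputesWithin P (encodeField ω ++ encodeIdeal k M) (encodeIdeal m R)
            (C * softO c ((d : ℝ) ^ (2 * matMulExponent) *
              ((d : ℝ) ^ 4 + (d : ℝ) ^ 2 * Real.logb 2 |(discr K : ℝ)| + B)))) := by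
  obtain ⟨C₁, h₁⟩ := RAM.exists_computesWithin_addIdeals.{u}
  obtain ⟨C₂, h₂⟩ := RAM.exists_computesWithin_mulIdeals.{u}
  obtain ⟨C₃, h₃⟩ := RAM.exists_computesWithin_invIdeal.{u}
  refine ⟨⟨RAM.Cmd.addIdeals.compile 0 0, C₁, 4, ?_⟩, ⟨RAM.Cmd.mulIdeals.compile 0 0, C₂, 4, ?_⟩,
    ⟨RAM.Cmd.invIdeal.compile 0 0, C₃, 4, ?_⟩⟩
  · intro K _ _ d hd ω _ _ 𝔞 𝔟 _ _ B hB hSa hSb k l M N ha hb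
    exact h₁ K d hd ω 𝔞 𝔟 B hB hSa hSb k l M N ha hb
  · intro K _ _ d hd ω hLLL hω 𝔞 𝔟 _ _ B hSa hSb k l M N ha hb
    exact h₂ K d hd ω hLLL hω 𝔞 𝔟 B hSa hSb k l M N ha hb
  · intro K _ _ d hd ω hLLL hω 𝔞 h𝔞 B hSa k M ha
    exact h₃ K d hd ω hLLL hω 𝔞 h𝔞 B hSa k M ha
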